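/- **Setting.** Let $d\ge 2$, $\beta\in\mathbb R^d$, $\eta\in\mathbb R$ (fixed), $\rho>0$, and let $\Omega\in\mathbb R^{d-1}$ be Diophantine: for some $\kappa,\tau>0$, $|k\cdot\Omega-m|\ge\kappa|k|^{-\tau}$ for all $k\in\mathbb Z^{d-1}\setminus\{0\}$, $m\in\mathbb Z$ (with $|k|=\sum_j|k_j|$). Let $\mathscr A_\rho$ be the space of $\mathbb Z^{d-1}$-periodic functions continuous on $\{|\mathrm{Im}\,\psi_j|\le\rho\}$, analytic in the interior and real for real arguments, with the supremum norm $\|\cdot\|_\rho$; $\mathscr A_\rho^{\mathbb C}$ is the same space without the reality condition. Write $\langle f\rangle=\int_{\mathbb T^{d-1}}f\,d\psi$, $f_\pm(\psi)=f(\psi\pm\Omega)$, $\partial_\beta=\beta\cdot\nabla$. For a potential $W$ put $W_v(\psi)=W((\psi,\eta)+\beta v(\psi))$, similarly $(\partial_\beta W)_v$, $(\partial_\beta\partial_\beta W)_v$, and $$\mathscr E[v,\sigma,\lambda]=v_++v_--2v+W_v+\sigma v+\lambda,\qquad \mathscr F[v,\sigma,c]=\bigl(-c+2-(\partial_\beta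 W)_v-\sigma\bigr)c_+-1 .$$ **Hypotheses.** (A0) $W^\mu(x)$ is a family of potentials, $\mathbb Z^d$-periodic in $x$ and jointly analytic in $(\mu,x)$ on an open set $\mathscr D\subset\mathbb C\times\mathbb C^d$ which is invariant under $x\mapsto x+m$, $m\in\mathbb Z^d$. (A1) At $\mu_0\in\mathbb C$ there are $v^0\in\mathscr A_\rho$, $\sigma^0,\lambda^0\in\mathbb R$ with $(\mu_0,(\psi,\eta)+\beta v^0(\psi))\in\mathscr D$ for $|\mathrm{Im}\,\psi_j|\le\rho$ and $\mathscr E_{\mu_0}[v^0,\sigma^0,\lambda^0]=0$. (A2) The linearization $\mathscr L=T_\Omega+T_{-\Omega}-2+(\partial_\beta W^{\mu_0})_{v^0}+\sigma^0$ factorizes as $\mathscr L=(a\,T_\Omega-b)(\tilde c-\tilde d\,T_{-\Omega})$ with $a,b,\tilde c,\tilde d\in\mathscr A_\rho$. Put $c^0=b\,\tilde c$ (so that $\mathscr F_{\mu_0}[v^0,\sigma^0,c^0]=0$). (N) (Non-degeneracy: the counterterm direction is transversal to the factorization manifold.) For no $0<\rho'<\rho$ are there $B,q\in\mathscr A^{\mathbb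 C}_{\rho'}$ and $D\in\mathbb C$ with $\langle B\rangle=0$, $\langle q/c^0\rangle=0$ and $$\mathscr L B+v^0+D=0,\qquad -c^0_+q+\bigl(-c^0+2-(\partial_\beta W^{\mu_0})_{v^0}-\sigma^0\bigr)q_+-c^0_+-(\partial_\beta\partial_\beta W^{\mu_0})_{v^0}\,c^0_+B=0 .$$ **Normalized expansions.** A normalized expansion around $(v^0,\sigma^0,\lambda^0,c^0)$ is a quadruple of formal power series $v=\sum_{k\ge0} v^k(\mu-\mu_0)^k$, $\sigma=\sum\sigma^k(\mu-\mu_0)^k$, $\lambda=\sum\lambda^k(\mu-\mu_0)^k$, $c=\sum c^k(\mu-\mu_0)^k$ with these zeroth order terms, $v^k,c^k\in\mathscr A^{\mathbb C}_{\rho'}$ for every $0<\rho'<\rho$ and $\sigma^k,\lambda^k\in\mathbb C$, such that * for all $N\ge0$ and $0<\rho'<\rho$, the partial sums up to order $N$ satisfy $\|\mathscr E_\mu[\cdot]\|_{\rho'}\le C_{N,\rho'}|\mu-\mu_0|^{N+1}$ and $\|\mathscr F_\mu[\cdot]\|_{\rho'}\le C_{N,\rho'}|\mu-\mu_0|^{N+1}$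 for $\mu$ close to $\mu_0$; * $\langle v^k\rangle=0$ for $k\ge1$, and $\langle\log c\rangle$ is constant to all orders, i.e. all coefficients of the formal power series $(\partial_\mu c)/c$ have zero average. **Theorem.** Assume (A0), (A1), (A2), (N). Then there is exactly one normalized expansion, and it converges: for every $0<\rho'<\rho$ there is $r>0$ such that $\sum\|v^k\|_{\rho'}r^k$, $\sum|\sigma^k|r^k$, $\sum|\lambda^k|r^k$, $\sum\|c^k\|_{\rho'}r^k$ are finite, and for $|\mu-\mu_0|<r$ the sums satisfy $(\mu,(\psi,\eta)+\beta v^\mu(\psi))\in\mathscr D$, $\mathscr E_\mu[v^\mu,\sigma^\mu,\lambda^\mu]=0$ and $\mathscr F_\mu[v^\mu,\sigma^\mu,c^\mu]=0$ on $\{|\mathrm{Im}\,\psi_j|\le\rho'\}$. If $\mu_0$ is real and $W^\mu(x)$ is real for real $(\mu,x)\in\mathscr D$, then all $v^k,c^k$ are real for real arguments and all $\sigma^k,\lambda^k$ are real. If $\sigma^k=0$ for all $k$ (the potentials stay on the factorization manifold), then the series $v,\lambda$ are the unique formal solution, with $\langle v^k\rangle=0$ for $k\ge1$, of the equilibrium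 equation without counterterm ($\sigma=0$) around $(v^0,\lambda^0)$, so that this expansion converges. In particular (Lindstedt series), let $W$ be a $\mathbb Z^d$-periodic potential analytic on an open $\mathbb Z^d$-invariant set containing $(\psi,\eta)$ for all $|\mathrm{Im}\,\psi_j|\le\rho$. Then all these conclusions hold for $W^\mu=\mu W$, $\mu_0=0$, $(v^0,\sigma^0,\lambda^0,c^0)=(0,0,0,1)$, without assuming (A2) or (N). -/

import Mathlib

noncomputable section

namespace FKRes

/-- The closed complex strip `|Im ψ_j| ≤ ρ` in `ℂⁿ` (lift of the closure of `D_ρ`). -/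
def closedStrip (n : ℕ) (ρ : ℝ) : Set (Fin n → ℂ) := {ψ | ∀ j, |(ψ j).im| ≤ ρ}

/-- The open complex strip `|Im ψ_j| < ρ` in `ℂⁿ` (lift of `D_ρ`). -/
def openStrip (n : ℕ) (ρ : ℝ) : Set (Fin n → ℂ) := {ψ | ∀ j, |(ψ j).im| < ρ}

/-- A real point seen as a complex point. -/
def toC {n : ℕ} (x : Fin n → ℝ) : Fin n → ℂ := fun j => (x j : ℂ)

/-- An integer point seen as a complex point. -/
def intPt {n : ℕ} (m : Fin n → ℤ) : Fin n → ℂ := fun j => (m j : ℂ)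

/-- Functions `ℤⁿ`-periodic and continuous on the closed strip of width `ρ`, and analytic in its
interior; complex values are allowed on the real torus. -/
structure HolA (n : ℕ) (ρ : ℝ) (f : (Fin n → ℂ) → ℂ) : Prop where
  analytic : AnalyticOnNhd ℂ f (openStrip n ρ)
  continuousOn : ContinuousOn f (closedStrip n ρ)
  periodic : ∀ ψ ∈ closedStrip n ρ, ∀ m : Fin n → ℤ, f (ψ + intPt m) = f ψ

/-- The space `𝒜_ρ`: functions as in `HolA` which are real for real arguments. -/
structure InA (n : ℕ) (ρ : ℝ) (f : (Fin n → ℂ) → ℂ) : Prop extends HolA n ρ f where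
  real_of_real : ∀ x : Fin n → ℝ, (f (toC x)).im = 0

/-- The supremum norm of `𝒜_ρ`. -/
def stripNorm (n : ℕ) (ρ : ℝ) (f : (Fin n → ℂ) → ℂ) : ℝ := ⨆ ψ : closedStrip n ρ, ‖f ψ‖

/-- The average over the real torus, computed on the fundamental domain `[0,1]ⁿ`. -/
def avg {n : ℕ} (f : (Fin n → ℂ) → ℂ) : ℂ :=
  ∫ x in Set.Icc (0 : Fin n → ℝ) 1, f (toC x)

/-- The Diophantine condition `|k·Ω - m| ≥ κ |k|^{-τ}` for `k ≠ 0`, with `|k| = ∑ |k_j|`. -/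
def IsDiophantine {n : ℕ} (κ τ : ℝ) (Ω : Fin n → ℝ) : Prop :=
  ∀ k : Fin n → ℤ, k ≠ 0 → ∀ m : ℤ,
    κ * (∑ j, |(k j : ℝ)|) ^ (-τ) ≤ |∑ j, (k j : ℝ) * Ω j - (m : ℝ)|

/-- The point `(ψ, η) + β s` of `ℂ^{n+1}`. -/
def hull {n : ℕ} (β : Fin (n + 1) → ℝ) (η : ℝ) (ψ : Fin n → ℂ) (s : ℂ) : Fin (n + 1) → ℂ :=
  (Fin.snoc ψ (η : ℂ) : Fin (n + 1) → ℂ) + s • toC β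

/-- The derivative `∂_β U = β · ∇U`. -/
def dBeta {n : ℕ} (β : Fin (n + 1) → ℝ) (U : (Fin (n + 1) → ℂ) → ℂ) :
    (Fin (n + 1) → ℂ) → ℂ := fun x => lineDeriv ℂ U x (toC β)

/-- The equilibrium functional `ℰ[v, σ, λ]` for the potential `U`. -/
def equil {n : ℕ} (Ω : Fin n → ℝ) (β : Fin (n + 1) → ℝ) (η : ℝ) (U : (Fin (n + 1) → ℂ) → ℂ)
    (v : (Fin n → ℂ) → ℂ) (σ lam : ℂ) (ψ : Fin n → ℂ) : ℂ :=
  v (ψ + toC Ω) + v (ψ - toC Ω) - 2 * v ψ + U (hull β η ψ (v ψ)) + v ψ * σ + lam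

/-- The factorization functional `ℱ[v, σ, c]` for the potential `U`. -/
def factorEq {n : ℕ} (Ω : Fin n → ℝ) (β : Fin (n + 1) → ℝ) (η : ℝ)
    (U : (Fin (n + 1) → ℂ) → ℂ) (v : (Fin n → ℂ) → ℂ) (σ : ℂ) (c : (Fin n → ℂ) → ℂ)
    (ψ : Fin n → ℂ) : ℂ :=
  (-c ψ + 2 - dBeta β U (hull β η ψ (v ψ)) - σ) * c (ψ + toC Ω) - 1

/-- The linearization `ℒ = T_Ω + T_{-Ω} - 2 + ∂_β U((ψ,η) + βv) + σ` of the equilibrium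
equation in the direction of `v`, applied to `u`. -/
def linEquil {n : ℕ} (Ω : Fin n → ℝ) (β : Fin (n + 1) → ℝ) (η : ℝ)
    (U : (Fin (n + 1) → ℂ) → ℂ) (v : (Fin n → ℂ) → ℂ) (σ : ℂ) (u : (Fin n → ℂ) → ℂ)
    (ψ : Fin n → ℂ) : ℂ :=
  u (ψ + toC Ω) + u (ψ - toC Ω) - 2 * u ψ + dBeta β U (hull β η ψ (v ψ)) * u ψ + σ * u ψ

/-- The derivative of `ℱ` at `(v, σ, c)` in the direction `(u, s, q)`. -/
def linFactor {n : ℕ} (Ω : Fin n → ℝ) (β : Fin (n + 1) → ℝ) (η : ℝ)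
    (U : (Fin (n + 1) → ℂ) → ℂ) (v : (Fin n → ℂ) → ℂ) (σ : ℂ) (c : (Fin n → ℂ) → ℂ)
    (u : (Fin n → ℂ) → ℂ) (s : ℂ) (q : (Fin n → ℂ) → ℂ) (ψ : Fin n → ℂ) : ℂ :=
  -(c (ψ + toC Ω) * q ψ)
    + (-c ψ + 2 - dBeta β U (hull β η ψ (v ψ)) - σ) * q (ψ + toC Ω)
    - c (ψ + toC Ω) * s
    - dBeta β (dBeta β U) (hull β η ψ (v ψ)) * c (ψ + toC Ω) * u ψ

/-- The first order operator `a T_Ω - b`. -/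
def opPlus {n : ℕ} (Ω : Fin n → ℝ) (a b u : (Fin n → ℂ) → ℂ) (ψ : Fin n → ℂ) : ℂ :=
  a ψ * u (ψ + toC Ω) - b ψ * u ψ

/-- The first order operator `c - d T_{-Ω}`. -/
def opMinus {n : ℕ} (Ω : Fin n → ℝ) (c d u : (Fin n → ℂ) → ℂ) (ψ : Fin n → ℂ) : ℂ :=
  c ψ * u ψ - d ψ * u (ψ - toC Ω)

/-- The linearization factorizes: `ℒ = (a T_Ω - b) (c - d T_{-Ω})` with `a, b, c, d ∈ 𝒜_ρ`. -/
structure Factorizes {n : ℕ} (Ω : Fin n → ℝ) (β : Fin (n + 1) → ℝ) (η : ℝ)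
    (U : (Fin (n + 1) → ℂ) → ℂ) (ρ : ℝ) (v : (Fin n → ℂ) → ℂ) (σ : ℂ)
    (a b c d : (Fin n → ℂ) → ℂ) : Prop where
  mem_a : InA n ρ a
  mem_b : InA n ρ b
  mem_c : InA n ρ c
  mem_d : InA n ρ d
  eq : ∀ u, InA n ρ u → ∀ ψ ∈ closedStrip n ρ,
    linEquil Ω β η U v σ u ψ = opPlus Ω a b (opMinus Ω c d u) ψ

/-- An analytic family of potentials `W^μ` on the torus `ℂ^d/ℤ^d`, defined for `(μ, x)` in the
open `ℤ^d`-invariant set `𝒟`. -/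
structure AnalyticFamily {d : ℕ} (𝒟 : Set (ℂ × (Fin d → ℂ))) (W : ℂ → (Fin d → ℂ) → ℂ) :
    Prop where
  isOpen : IsOpen 𝒟
  analytic : AnalyticOnNhd ℂ (fun p : ℂ × (Fin d → ℂ) => W p.1 p.2) 𝒟
  periodic : ∀ μ x, (μ, x) ∈ 𝒟 → ∀ m : Fin d → ℤ,
    (μ, x + intPt m) ∈ 𝒟 ∧ W μ (x + intPt m) = W μ x

/-- The non-degeneracy condition: the direction of the counterterm `σ` is transversal to the
factorization manifold. There is no infinitesimal solution `(B, 1, D, q)` of the two linearized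
equations with `⟨B⟩ = 0` and `⟨q / c⟩ = 0`. -/
def Transversal {n : ℕ} (Ω : Fin n → ℝ) (β : Fin (n + 1) → ℝ) (η : ℝ)
    (U : (Fin (n + 1) → ℂ) → ℂ) (ρ : ℝ) (v : (Fin n → ℂ) → ℂ) (σ : ℂ)
    (c : (Fin n → ℂ) → ℂ) : Prop :=
  ∀ (ρ' : ℝ) (B q : (Fin n → ℂ) → ℂ) (D : ℂ), 0 < ρ' → ρ' < ρ → HolA n ρ' B → HolA n ρ' q →
    avg B = 0 →
    (∀ ψ ∈ closedStrip n ρ', linEquil Ω β η U v σ B ψ + v ψ + D = 0) →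
    (∀ ψ ∈ closedStrip n ρ', linFactor Ω β η U v σ c B 1 q ψ = 0) →
    avg (fun ψ => q ψ / c ψ) ≠ 0

/-- Partial sum `∑_{k ≤ N} z^k s_k`. -/
def psum (s : ℕ → ℂ) (N : ℕ) (z : ℂ) : ℂ := ∑ k ∈ Finset.range (N + 1), z ^ k * s k

/-- Partial sum of a series of functions. -/
def fpsum {n : ℕ} (v : ℕ → (Fin n → ℂ) → ℂ) (N : ℕ) (z : ℂ) : (Fin n → ℂ) → ℂ :=
  fun ψ => psum (fun k => v k ψ) N z

/-- The `k`-th coefficient (a function of `ψ`) of the formal logarithmic derivative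
`(d/dz c) / c` of the formal power series `c = ∑ c_k z^k`. -/
def logDerivCoeff {n : ℕ} (c : ℕ → (Fin n → ℂ) → ℂ) (k : ℕ) : (Fin n → ℂ) → ℂ :=
  fun ψ => PowerSeries.coeff k
    (PowerSeries.derivative ℂ (PowerSeries.mk fun j => c j ψ) *
      (PowerSeries.mk fun j => c j ψ)⁻¹)

/-- `∑ v_k (μ-μ₀)^k`, `∑ σ_k (μ-μ₀)^k`, `∑ λ_k (μ-μ₀)^k` is a formal solution of the equilibrium
equation for the family `W^μ`: all residuals of partial sums have the expected order. -/
def FormalEquil {n : ℕ} (Ω : Fin n → ℝ) (β : Fin (n + 1) → ℝ) (η : ℝ)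
    (W : ℂ → (Fin (n + 1) → ℂ) → ℂ) (μ₀ : ℂ) (ρ : ℝ)
    (v : ℕ → (Fin n → ℂ) → ℂ) (σ lam : ℕ → ℂ) : Prop :=
  ∀ (N : ℕ) (ρ' : ℝ), 0 < ρ' → ρ' < ρ → ∃ C r : ℝ, 0 < r ∧ ∀ μ : ℂ, ‖μ - μ₀‖ < r →
    ∀ ψ ∈ closedStrip n ρ',
      ‖equil Ω β η (W μ) (fpsum v N (μ - μ₀)) (psum σ N (μ - μ₀)) (psum lam N (μ - μ₀)) ψ‖
        ≤ C * ‖μ - μ₀‖ ^ (N + 1)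

/-- The analogous notion for the factorization equation. -/
def FormalFactor {n : ℕ} (Ω : Fin n → ℝ) (β : Fin (n + 1) → ℝ) (η : ℝ)
    (W : ℂ → (Fin (n + 1) → ℂ) → ℂ) (μ₀ : ℂ) (ρ : ℝ)
    (v : ℕ → (Fin n → ℂ) → ℂ) (σ : ℕ → ℂ) (c : ℕ → (Fin n → ℂ) → ℂ) : Prop :=
  ∀ (N : ℕ) (ρ' : ℝ), 0 < ρ' → ρ' < ρ → ∃ C r : ℝ, 0 < r ∧ ∀ μ : ℂ, ‖μ - μ₀‖ < r →
    ∀ ψ ∈ closedStrip n ρ',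
      ‖factorEq Ω β η (W μ) (fpsum v N (μ - μ₀)) (psum σ N (μ - μ₀)) (fpsum c N (μ - μ₀)) ψ‖
        ≤ C * ‖μ - μ₀‖ ^ (N + 1)

/-- The normalized perturbative expansion of both equations around `(v0, σ0, λ0, c0)`:
`⟨v_k⟩ = 0` for `k ≥ 1`, and the average `⟨log c⟩` (the logarithm of the average coefficient of
the first order factors) is constant to all orders. -/
structure NormalizedExpansion {n : ℕ} (Ω : Fin n → ℝ) (β : Fin (n + 1) → ℝ) (η : ℝ)
    (W : ℂ → (Fin (n + 1) → ℂ) → ℂ) (μ₀ : ℂ) (ρ : ℝ)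
    (v0 : (Fin n → ℂ) → ℂ) (σ0 lam0 : ℝ) (c0 : (Fin n → ℂ) → ℂ)
    (v : ℕ → (Fin n → ℂ) → ℂ) (σ lam : ℕ → ℂ) (c : ℕ → (Fin n → ℂ) → ℂ) : Prop where
  v_zero : v 0 = v0
  σ_zero : σ 0 = σ0
  lam_zero : lam 0 = lam0
  c_zero : c 0 = c0
  v_mem : ∀ k, ∀ ρ', 0 < ρ' → ρ' < ρ → HolA n ρ' (v k)
  c_mem : ∀ k, ∀ ρ', 0 < ρ' → ρ' < ρ → HolA n ρ' (c k)
  equil : FormalEquil Ω β η W μ₀ ρ v σ lam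
  factor : FormalFactor Ω β η W μ₀ ρ v σ c
  v_avg : ∀ k, 1 ≤ k → avg (v k) = 0
  c_avg : ∀ k, avg (logDerivCoeff c k) = 0

/-- The classical normalized perturbative expansion of the equilibrium equation without
counterterm (`σ = 0`) around `(v0, λ0)`. -/
structure ClassicalExpansion {n : ℕ} (Ω : Fin n → ℝ) (β : Fin (n + 1) → ℝ) (η : ℝ)
    (W : ℂ → (Fin (n + 1) → ℂ) → ℂ) (μ₀ : ℂ) (ρ : ℝ)
    (v0 : (Fin n → ℂ) → ℂ) (lam0 : ℝ)
    (v : ℕ → (Fin n → ℂ) → ℂ) (lam : ℕ → ℂ) : Prop where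
  v_zero : v 0 = v0
  lam_zero : lam 0 = lam0
  v_mem : ∀ k, ∀ ρ', 0 < ρ' → ρ' < ρ → HolA n ρ' (v k)
  equil : FormalEquil Ω β η W μ₀ ρ v (fun _ => 0) lam
  v_avg : ∀ k, 1 ≤ k → avg (v k) = 0

/-- The four power series converge: in each `𝒜_ρ'`, `0 < ρ' < ρ`, with a positive radius, and
their sums solve the equilibrium and the factorization equation. -/
def Converges {n : ℕ} (Ω : Fin n → ℝ) (β : Fin (n + 1) → ℝ) (η : ℝ)
    (𝒟 : Set (ℂ × (Fin (n + 1) → ℂ))) (W : ℂ → (Fin (n + 1) → ℂ) → ℂ) (μ₀ : ℂ) (ρ : ℝ)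
    (v : ℕ → (Fin n → ℂ) → ℂ) (σ lam : ℕ → ℂ) (c : ℕ → (Fin n → ℂ) → ℂ) : Prop :=
  ∀ ρ' : ℝ, 0 < ρ' → ρ' < ρ → ∃ r : ℝ, 0 < r ∧
    Summable (fun k => stripNorm n ρ' (v k) * r ^ k) ∧
    Summable (fun k => ‖σ k‖ * r ^ k) ∧
    Summable (fun k => ‖lam k‖ * r ^ k) ∧
    Summable (fun k => stripNorm n ρ' (c k) * r ^ k) ∧
    ∀ μ : ℂ, ‖μ - μ₀‖ < r → ∀ ψ ∈ closedStrip n ρ',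
      (μ, hull β η ψ (∑' k, (μ - μ₀) ^ k * v k ψ)) ∈ 𝒟 ∧
      equil Ω β η (W μ) (fun ζ => ∑' k, (μ - μ₀) ^ k * v k ζ)
        (∑' k, (μ - μ₀) ^ k * σ k) (∑' k, (μ - μ₀) ^ k * lam k) ψ = 0 ∧
      factorEq Ω β η (W μ) (fun ζ => ∑' k, (μ - μ₀) ^ k * v k ζ)
        (∑' k, (μ - μ₀) ^ k * σ k) (fun ζ => ∑' k, (μ - μ₀) ^ k * c k ζ) ψ = 0

/-- The normalized expansion exists, is unique, and converges; it is real if the family is real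
for real parameters; and if its counterterm `σ` vanishes to all orders, then it contains the
classical expansion (without counterterm), which therefore converges as well. -/
def ExpansionConverges {n : ℕ} (Ω : Fin n → ℝ) (β : Fin (n + 1) → ℝ) (η : ℝ)
    (𝒟 : Set (ℂ × (Fin (n + 1) → ℂ))) (W : ℂ → (Fin (n + 1) → ℂ) → ℂ) (μ₀ : ℂ) (ρ : ℝ)
    (v0 : (Fin n → ℂ) → ℂ) (σ0 lam0 : ℝ) (c0 : (Fin n → ℂ) → ℂ) : Prop :=
  ∃ (v : ℕ → (Fin n → ℂ) → ℂ) (σ lam : ℕ → ℂ) (c : ℕ → (Fin n → ℂ) → ℂ),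
    NormalizedExpansion Ω β η W μ₀ ρ v0 σ0 lam0 c0 v σ lam c ∧
    (∀ v' σ' lam' c', NormalizedExpansion Ω β η W μ₀ ρ v0 σ0 lam0 c0 v' σ' lam' c' →
      ∀ k, Set.EqOn (v' k) (v k) (openStrip n ρ) ∧ σ' k = σ k ∧ lam' k = lam k ∧
        Set.EqOn (c' k) (c k) (openStrip n ρ)) ∧
    Converges Ω β η 𝒟 W μ₀ ρ v σ lam c ∧
    ((μ₀.im = 0 ∧ ∀ (t : ℝ) (x : Fin (n + 1) → ℝ), ((t : ℂ), toC x) ∈ 𝒟 →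
        (W t (toC x)).im = 0) →
      ∀ k, (∀ x : Fin n → ℝ, (v k (toC x)).im = 0) ∧ (σ k).im = 0 ∧ (lam k).im = 0 ∧
        ∀ x : Fin n → ℝ, (c k (toC x)).im = 0) ∧
    ((∀ k, σ k = 0) →
      ClassicalExpansion Ω β η W μ₀ ρ v0 lam0 v lam ∧
      ∀ v' lam', ClassicalExpansion Ω β η W μ₀ ρ v0 lam0 v' lam' →
        ∀ k, Set.EqOn (v' k) (v k) (openStrip n ρ) ∧ lam' k = lam k)

end FKRes

end

noncomputable section

open scoped ENNReal Real
open Filter Topology ComplexConjugate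
open ENNReal (ofReal tsum_le_tsum mul_ne_top ofReal_mul one_ne_top add_ne_top ofReal_ne_top ofReal_le_ofReal pow_ne_top)

namespace FKRes

/-- The Banach space `ℓ¹(ι)`, with convolution as its product. -/
def Wien (ι : Type*) : Type _ := lp (fun _ : ι => ℂ) 1

namespace Wien

variable {ι : Type*}

instance : NormedAddCommGroup (Wien ι) := inferInstanceAs (NormedAddCommGroup (lp (fun _ : ι => ℂ) 1))
instance : NormedSpace ℂ (Wien ι) := inferInstanceAs (NormedSpace ℂ (lp (fun _ : ι => ℂ) 1))
instance : CompleteSpace (Wien ι) := inferInstanceAs (CompleteSpace (lp (fun _ : ι => ℂ) 1))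

/-- The coefficients of an element. -/
def coeffs (f : Wien ι) : ι → ℂ := (f : lp (fun _ : ι => ℂ) 1).1

instance : CoeFun (Wien ι) (fun _ => ι → ℂ) := ⟨coeffs⟩

@[ext] theorem ext {f g : Wien ι} (h : ∀ i, f i = g i) : f = g := lp.ext (funext h)

@[simp] theorem add_apply (f g : Wien ι) (i : ι) : (f + g) i = f i + g i := rfl
@[simp] theorem sub_apply (f g : Wien ι) (i : ι) : (f - g) i = f i - g i := rfl
@[simp] theorem neg_apply (f : Wien ι) (i : ι) : (-f) i = -f i := rfl
@[simp] theorem smul_apply (c : ℂ) (f : Wien ι) (i : ι) : (c • f) i = c * f i := rfl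
@[simp] theorem zero_apply (i : ι) : (0 : Wien ι) i = 0 := rfl

theorem summable_norm (f : Wien ι) : Summable fun i => ‖f i‖ := by
  have : Summable fun i => ‖f i‖ ^ (1 : ℝ≥0∞).toReal := (memℓp_gen_iff (p := 1) (by simp)).1 f.2
  simpa using this

theorem norm_eq (f : Wien ι) : ‖f‖ = ∑' i, ‖f i‖ := by
  have := lp.norm_eq_tsum_rpow (p := 1) (by simp) f
  simp only [ENNReal.toReal_one, Real.rpow_one, div_one] at this
  exact this

theorem enorm_eq (f : Wien ι) : ‖f‖ₑ = ∑' i, ‖f i‖ₑ := by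
  have h := summable_norm f
  rw [← ofReal_norm, norm_eq, ENNReal.ofReal_tsum_of_nonneg (fun _ => norm_nonneg _) h]
  simp only [ofReal_norm]

/-- The element with summable coefficients `f`. -/
def mk (f : ι → ℂ) (h : Summable fun i => ‖f i‖) : Wien ι :=
  ⟨f, (memℓp_gen_iff (p := 1) (by simp)).2 (by simpa using h)⟩

@[simp] theorem mk_apply (f : ι → ℂ) (h) (i : ι) : mk f h i = f i := rfl

/-- The coefficient functional. -/
def coeff (i : ι) : Wien ι →L[ℂ] ℂ := lp.evalCLM ℂ (fun _ : ι => ℂ) 1 i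

theorem tsum_apply {α : Type*} {F : α → Wien ι} (h : Summable F) (i : ι) : (∑' a, F a) i = ∑' a, F a i := (coeff i).map_tsum h

section weights

variable (w : ι → ℝ≥0∞)

/-- The weighted `ℓ¹` norm, with values in `[0, ∞]`. -/
def N (f : Wien ι) : ℝ≥0∞ := ∑' i, ‖f i‖ₑ * w i

variable {w}

theorem N_zero : N w (0 : Wien ι) = 0 := by simp [N]

theorem N_add_le (f g : Wien ι) : N w (f + g) ≤ N w f + N w g := by
  rw [N, N, N, ← ENNReal.tsum_add]
  refine tsum_le_tsum fun i => ?_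
  rw [← add_mul]
  exact mul_le_mul_left (enorm_add_le _ _) _

theorem N_neg (f : Wien ι) : N w (-f) = N w f := by simp [N]

theorem N_sub_le (f g : Wien ι) : N w (f - g) ≤ N w f + N w g := by
  rw [sub_eq_add_neg, ← N_neg g]; exact N_add_le _ _

theorem N_smul (c : ℂ) (f : Wien ι) : N w (c • f) = ‖c‖ₑ * N w f := by
  simp [N, mul_assoc, ENNReal.tsum_mul_left, enorm_mul]

theorem N_mono {w' : ι → ℝ≥0∞} (h : w' ≤ w) (f : Wien ι) : N w' f ≤ N w f :=
  tsum_le_tsum fun i => mul_le_mul_right (h i) _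

theorem enorm_le_N (h : 1 ≤ w) (f : Wien ι) : ‖f‖ₑ ≤ N w f := by
  rw [enorm_eq]
  exact tsum_le_tsum fun i => le_mul_of_one_le_right zero_le (h i)

theorem summable_of_N (h : 1 ≤ w) {α : Type*} {F : α → Wien ι} (hF : ∑' a, N w (F a) ≠ ∞) : Summable F := by
  refine Summable.of_norm (tsum_enorm_ne_top_iff_summable_norm.1 (ne_top_of_le_ne_top hF ?_))
  exact tsum_le_tsum fun i => enorm_le_N h _

theorem N_tsum_le {α : Type*} {F : α → Wien ι} (h : Summable F) : N w (∑' a, F a) ≤ ∑' a, N w (F a) := by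
  simp only [N]
  rw [ENNReal.tsum_comm]
  refine tsum_le_tsum fun i => ?_
  rw [tsum_apply h, ENNReal.tsum_mul_right]
  exact mul_le_mul_left enorm_tsum_le_tsum_enorm _

end weights

section single

/-- The basis vector at `i`. -/
def single [DecidableEq ι] (i : ι) : Wien ι := lp.single 1 i (1 : ℂ)

variable [DecidableEq ι]

theorem single_apply (i j : ι) : single i j = if j = i then (1 : ℂ) else 0 := by
  have h : (single i : Wien ι) j = (Pi.single i (1 : ℂ) : ι → ℂ) j :=
    lp.single_apply (E := fun _ : ι => ℂ) 1 i (1 : ℂ) j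
  rw [h, Pi.single_apply]

theorem norm_single (i : ι) : ‖single i‖ = 1 := by
  have := lp.norm_single (E := fun _ : ι => ℂ) (p := 1) (by simp) i (1 : ℂ)
  rw [norm_one] at this
  exact this

theorem hasSum_single (f : Wien ι) : HasSum (fun i => f i • single i) f := by
  have := lp.hasSum_single (E := fun _ : ι => ℂ) (p := 1) (by simp) f
  refine (congrArg (fun F => HasSum F f) (funext fun i => ?_)).mpr this
  apply Wien.ext
  intro j
  have h1 : (f i • single i : Wien ι) j = f i * single i j := rfl
  have h2 : (show Wien ι from lp.single 1 i (f i)) j = (Pi.single i (f i) : ι → ℂ) j :=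
    lp.single_apply (E := fun _ : ι => ℂ) 1 i (f i) j
  rw [h1, single_apply]
  refine Eq.trans ?_ h2.symm
  by_cases hj : j = i
  · subst hj; simp
  · simp [hj]

theorem clm_ext {E : Type*} [NormedAddCommGroup E] [NormedSpace ℂ E] {L L' : Wien ι →L[ℂ] E}
    (h : ∀ i, L (single i) = L' (single i)) : L = L' := by
  refine ContinuousLinearMap.ext fun f => ?_
  have h1 := (hasSum_single f).mapL L
  have h2 := (hasSum_single f).mapL L'
  simp only [map_smul, h] at h1 h2
  exact h1.unique h2

theorem N_single (w : ι → ℝ≥0∞) (i : ι) : N w (single i) = w i := by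
  rw [N, tsum_eq_single i]
  · simp [single_apply]
  · intro j hj; simp [single_apply, hj]

end single

section mul

variable [AddCommMonoid ι] [DecidableEq ι]

/-- The terms of the convolution product. -/
def mulTerm (f g : Wien ι) (p : ι × ι) : Wien ι := (f p.1 * g p.2) • single (p.1 + p.2)

theorem norm_mulTerm (f g : Wien ι) (p : ι × ι) : ‖mulTerm f g p‖ = ‖f p.1‖ * ‖g p.2‖ := by
  rw [mulTerm, norm_smul, norm_single, mul_one, norm_mul]

theorem summable_norm_mulTerm (f g : Wien ι) : Summable fun p => ‖mulTerm f g p‖ := by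
  simp only [norm_mulTerm]
  exact f.summable_norm.mul_of_nonneg g.summable_norm (fun _ => norm_nonneg _) (fun _ => norm_nonneg _)

theorem summable_mulTerm (f g : Wien ι) : Summable (mulTerm f g) := (summable_norm_mulTerm f g).of_norm

instance : Mul (Wien ι) := ⟨fun f g => ∑' p, mulTerm f g p⟩
instance : One (Wien ι) := ⟨single 0⟩

theorem mul_def (f g : Wien ι) : f * g = ∑' p, mulTerm f g p := rfl
theorem one_def : (1 : Wien ι) = single 0 := rfl

theorem mul_apply (f g : Wien ι) (m : ι) : (f * g) m = ∑' p : ι × ι,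
    (if p.1 + p.2 = m then f p.1 * g p.2 else 0) := by
  rw [mul_def, tsum_apply (summable_mulTerm f g)]
  congr 1; ext p
  simp [mulTerm, single_apply, eq_comm]

theorem norm_mul_le' (f g : Wien ι) : ‖f * g‖ ≤ ‖f‖ * ‖g‖ := by
  rw [mul_def, norm_eq f, norm_eq g,
    f.summable_norm.tsum_mul_tsum g.summable_norm
      (by simpa only [norm_mulTerm] using summable_norm_mulTerm f g)]
  simpa only [norm_mulTerm] using norm_tsum_le_tsum_norm (summable_norm_mulTerm f g)

/-- The convolution product as a bilinear map. -/
def mulL : Wien ι →L[ℂ] Wien ι →L[ℂ] Wien ι :=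
  LinearMap.mkContinuous₂ (LinearMap.mk₂ ℂ (fun f g : Wien ι => f * g) (fun f f' g => by
      simp only [mul_def]; rw [← (summable_mulTerm f g).tsum_add (summable_mulTerm f' g)]
      congr 1; ext1 p; simp [mulTerm, add_mul, add_smul])
    (fun c f g => by
      simp only [mul_def]; rw [← (summable_mulTerm f g).tsum_const_smul]
      congr 1; ext1 p; simp [mulTerm, mul_smul, mul_assoc])
    (fun f g g' => by
      simp only [mul_def]; rw [← (summable_mulTerm f g).tsum_add (summable_mulTerm f g')]
      congr 1; ext1 p; simp [mulTerm, mul_add, add_smul])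
    (fun c f g => by
      simp only [mul_def]; rw [← (summable_mulTerm f g).tsum_const_smul]
      congr 1; ext1 p; simp only [mulTerm, smul_apply, ← mul_smul]; congr 1; ring)) 1
    (fun f g => by simpa using norm_mul_le' f g)

theorem mulL_apply (f g : Wien ι) : mulL f g = f * g := rfl

theorem single_mul_single (i j : ι) : single i * single j = (single (i + j) : Wien ι) := by
  rw [mul_def, tsum_eq_single (i, j)]
  · simp [mulTerm, single_apply]
  · rintro ⟨a, b⟩ h
    have : ¬ (a = i ∧ b = j) := fun h' => h (by rw [h'.1, h'.2])
    simp only [mulTerm, single_apply]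
    by_cases ha : a = i
    · have hb : b ≠ j := fun hb => this ⟨ha, hb⟩
      simp [hb]
    · simp [ha]

theorem mul_comm' (f g : Wien ι) : f * g = g * f := by
  rw [mul_def, mul_def, ← (Equiv.prodComm ι ι).tsum_eq]
  congr 1; ext1 p; simp [mulTerm, mul_comm, add_comm]

theorem mul_assoc' (f g h : Wien ι) : f * g * h = f * (g * h) := by
  have key : ∀ i j (h : Wien ι), single i * single j * h = single i * (single j * h) := by
    intro i j h
    have : mulL (single i * single j : Wien ι) = (mulL (single i)).comp (mulL (single j)) := by
      refine clm_ext fun k => ?_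
      simp only [ContinuousLinearMap.comp_apply, mulL_apply, single_mul_single, add_assoc]
    exact congrArg (fun L => L h) this
  have key2 : ∀ i (g h : Wien ι), single i * g * h = single i * (g * h) := by
    intro i g h
    have : (mulL.flip h).comp (mulL (single i)) = (mulL (single i)).comp (mulL.flip h) := by
      refine clm_ext fun k => ?_
      simp only [ContinuousLinearMap.comp_apply, ContinuousLinearMap.flip_apply, mulL_apply, key]
    exact congrArg (fun L => L g) this
  have : (mulL.flip h).comp (mulL.flip g) = mulL.flip (g * h) := by
    refine clm_ext fun k => ?_
    simp only [ContinuousLinearMap.comp_apply, ContinuousLinearMap.flip_apply, mulL_apply, key2]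
  exact congrArg (fun L => L f) this

theorem one_mul' (f : Wien ι) : 1 * f = f := by
  have : mulL (1 : Wien ι) = ContinuousLinearMap.id ℂ _ := by
    refine clm_ext fun k => ?_
    simp only [mulL_apply, one_def, single_mul_single, zero_add, ContinuousLinearMap.id_apply]
  exact congrArg (fun L => L f) this

instance : NormedCommRing (Wien ι) :=
  { (inferInstance : NormedAddCommGroup (Wien ι)) with
    mul := (· * ·)
    one := 1
    left_distrib := fun f g h => (mulL f).map_add g h
    right_distrib := fun f g h => congrArg (fun L => L h) (mulL.map_add f g)
    zero_mul := fun f => congrArg (fun L => L f) (mulL.map_zero)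
    mul_zero := fun f => (mulL f).map_zero
    mul_assoc := mul_assoc'
    one_mul := one_mul'
    mul_one := fun f => by rw [mul_comm' f 1]; exact one_mul' f
    mul_comm := mul_comm'
    norm_mul_le := norm_mul_le' }

instance : NormedAlgebra ℂ (Wien ι) :=
  { Algebra.ofModule (R := ℂ) (A := Wien ι) (fun c f g => congrArg (fun L => L g) (mulL.map_smul c f))
      (fun c f g => (mulL f).map_smul c g) with
    norm_smul_le := fun c f => (norm_smul c f).le }

theorem N_mul_le {w : ι → ℝ≥0∞} (hw : ∀ i j, w (i + j) ≤ w i * w j) (f g : Wien ι) : N w (f * g) ≤ N w f * N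
    w g := by
  rw [mul_def]
  refine (N_tsum_le (summable_mulTerm f g)).trans ?_
  simp only [mulTerm, N_smul, N_single]
  rw [ENNReal.tsum_prod (f := fun a b => ‖f a * g b‖ₑ * w (a + b)), N, ← ENNReal.tsum_mul_right]
  refine tsum_le_tsum fun i => ?_
  rw [N, ← ENNReal.tsum_mul_left]
  refine tsum_le_tsum fun j => ?_
  calc ‖f i * g j‖ₑ * w (i + j) ≤ ‖f i * g j‖ₑ * (w i * w j) := by gcongr; exact hw i j
    _ = ‖f i‖ₑ * w i * (‖g j‖ₑ * w j) := by rw [enorm_mul]; ring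

theorem N_one {w : ι → ℝ≥0∞} (hw : w 0 = 1) : N w (1 : Wien ι) = 1 := by
  rw [one_def, N_single, hw]

theorem one_apply (i : ι) : (1 : Wien ι) i = if i = 0 then (1 : ℂ) else 0 := single_apply 0 i

/-- The sum of the coefficients. -/
def total (f : Wien ι) : ℂ := ∑' i, f i

theorem total_add (f g : Wien ι) : total (f + g) = total f + total g :=
  f.summable_norm.of_norm.tsum_add g.summable_norm.of_norm

theorem total_mul (f g : Wien ι) : total (f * g) = total f * total g := by
  let L : Wien ι →L[ℂ] ℂ := LinearMap.mkContinuous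
    { toFun := total, map_add' := total_add,
      map_smul' := fun c f => by simp only [total, smul_apply, RingHom.id_apply, smul_eq_mul, tsum_mul_left] } 1
    (fun f => by
      rw [norm_eq, one_mul]; exact norm_tsum_le_tsum_norm f.summable_norm)
  have hL : ∀ f, L f = total f := fun _ => rfl
  rw [← hL, mul_def, L.map_tsum (summable_mulTerm f g), total, total,
    tsum_mul_tsum_of_summable_norm f.summable_norm g.summable_norm]
  congr 1; ext p
  have : total (single (p.1 + p.2)) = 1 := by
    simp only [total, single_apply]; rw [tsum_ite_eq]
  rw [mulTerm, map_smul, hL, this]; simp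

end mul

section diag

/-- The diagonal multiplier with symbol `c` (zero if it does not map `f` to `ℓ¹`). -/
def diag (c : ι → ℂ) (f : Wien ι) : Wien ι :=
  open Classical in if h : Summable fun i => ‖c i * f i‖ then mk _ h else 0

/-- The domain of `diag c`. -/
def DiagDom (c : ι → ℂ) (f : Wien ι) : Prop := Summable fun i => ‖c i * f i‖

variable {c : ι → ℂ}

theorem diag_apply {f : Wien ι} (h : DiagDom c f) (i : ι) : diag c f i = c i * f i := by
  rw [diag, dif_pos (show Summable fun i => ‖c i * f i‖ from h), mk_apply]

theorem diag_of_not {f : Wien ι} (h : ¬ DiagDom c f) : diag c f = 0 := dif_neg h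

theorem diagDom_of_eq {f g : Wien ι} (h : ∀ i, g i = c i * f i) : DiagDom c f := by
  unfold DiagDom; simp only [← h]; exact g.summable_norm

theorem diag_eq {f g : Wien ι} (h : ∀ i, g i = c i * f i) : diag c f = g :=
  Wien.ext fun i => by rw [diag_apply (diagDom_of_eq h), h]

theorem diagDom_of_tsum {f : Wien ι} (h : ∑' i, ‖c i‖ₑ * ‖f i‖ₑ ≠ ∞) : DiagDom c f := by
  refine tsum_enorm_ne_top_iff_summable_norm.1 ?_
  simpa only [enorm_mul] using h

theorem diagDom_of_N {w : ι → ℝ≥0∞} {C : ℝ≥0∞} (hC : C ≠ ∞) (hc : ∀ i, ‖c i‖ₑ ≤ C * w i) {f : Wien ι}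
    (hf : N w f ≠ ∞) : DiagDom c f := by
  refine diagDom_of_tsum (ne_top_of_le_ne_top (mul_ne_top hC hf) ?_)
  rw [N, ← ENNReal.tsum_mul_left]
  refine tsum_le_tsum fun i => ?_
  calc ‖c i‖ₑ * ‖f i‖ₑ ≤ C * w i * ‖f i‖ₑ := by gcongr; exact hc i
    _ = _ := by ring

theorem diagDom_of_bound {C : ℝ≥0∞} (hC : C ≠ ∞) (hc : ∀ i, ‖c i‖ₑ ≤ C) (f : Wien ι) : DiagDom c f := by
  refine diagDom_of_N (w := 1) hC (by simpa using hc) ?_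
  simp only [N, Pi.one_apply, mul_one]
  rw [← enorm_eq]; exact enorm_ne_top

theorem N_diag_le {w w' : ι → ℝ≥0∞} {C : ℝ≥0∞} (hc : ∀ i, ‖c i‖ₑ * w' i ≤ C * w i) (f : Wien ι) : N w'
    (diag c f) ≤ C * N w f := by
  by_cases h : DiagDom c f
  · simp only [N, diag_apply h]
    rw [← ENNReal.tsum_mul_left]
    refine tsum_le_tsum fun i => ?_
    calc ‖c i * f i‖ₑ * w' i = ‖c i‖ₑ * w' i * ‖f i‖ₑ := by rw [enorm_mul]; ring
      _ ≤ C * w i * ‖f i‖ₑ := mul_le_mul_left (hc i) _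
      _ = _ := by ring
  · rw [diag_of_not h, N_zero]; exact zero_le

theorem diag_mul [AddCommMonoid ι] [DecidableEq ι] (hc : ∀ i j, c (i + j) = c i * c j) {f g : Wien ι}
    (hf : DiagDom c f) (hg : DiagDom c g) : diag c (f * g) = diag c f * diag c g := by
  refine diag_eq fun m => ?_
  rw [mul_apply, mul_apply, ← tsum_mul_left]
  congr 1; ext p
  rw [diag_apply hf, diag_apply hg]
  split_ifs with h
  · rw [← h, hc]; ring
  · simp

end diag

end Wien

section logDeriv

variable {X : Type*}

open PowerSeries in
theorem coeff_logDeriv_mem (S : Subring (X → ℂ)) {c : ℕ → X → ℂ} (hc : ∀ j, c j ∈ S)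
    (h0 : (fun x => (c 0 x)⁻¹) ∈ S) (k : ℕ) : (fun x => coeff k (derivative ℂ (mk fun j => c j x) *
    (mk fun j => c j x)⁻¹)) ∈ S := by
  have hinv : ∀ k, (fun x => coeff k (mk fun j => c j x)⁻¹) ∈ S := fun k => by
    induction k using Nat.strong_induction_on with
    | _ k ih =>
      rw [funext fun x => PowerSeries.coeff_inv k (mk fun j => c j x)]
      by_cases hk : k = 0
      · simpa only [hk, if_true, ← coeff_zero_eq_constantCoeff_apply, coeff_mk] using h0
      · have h1 : (∑ p ∈ Finset.HasAntidiagonal.antidiagonal k, fun x => if p.2 < k then coeff p.1 (mk fun j => c j x)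
            * coeff p.2 (mk fun j => c j x)⁻¹ else 0) ∈ S := by
          refine S.sum_mem fun p _ => ?_
          split_ifs with hp
          · have := S.mul_mem (hc p.1) (ih p.2 hp)
            simpa [coeff_mk, Pi.mul_def] using this
          · exact S.zero_mem
        have h2 := S.mul_mem (S.neg_mem h0) h1
        convert h2 using 1
        funext x
        simp only [if_neg hk, ← coeff_zero_eq_constantCoeff_apply, coeff_mk, Pi.mul_apply, Pi.neg_apply,
          Finset.sum_apply]
  simp only [coeff_mul, coeff_derivative, coeff_mk]
  have h1 : (∑ p ∈ Finset.HasAntidiagonal.antidiagonal k, (c (p.1 + 1) * ((p.1 : X → ℂ) + 1))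
      * fun x => coeff p.2 (mk fun j => c j x)⁻¹) ∈ S :=
    S.sum_mem fun p _ => S.mul_mem (S.mul_mem (hc _) (S.add_mem (natCast_mem S _) S.one_mem)) (hinv _)
  convert h1 using 1
  funext x
  simp [Finset.sum_apply]

open PowerSeries in
theorem coeff_logDeriv_sub {c c' : ℕ → ℂ} {N : ℕ} (h : ∀ k < N + 1, c k = c' k) (h0 : c 0 ≠ 0) : coeff N
    (derivative ℂ (mk c) * (mk c)⁻¹) - coeff N (derivative ℂ (mk c') * (mk c')⁻¹) = (N + 1) *
    ((c (N + 1) - c' (N + 1)) / c 0) := by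
  have h0' : c' 0 ≠ 0 := by rwa [← h 0 N.succ_pos]
  obtain ⟨E, hE⟩ : (PowerSeries.X : ℂ⟦X⟧) ^ (N + 1) ∣ mk c - mk c' :=
    X_pow_dvd_iff.2 fun m hm => by simp [h m hm]
  have hA : mk c = mk c' + PowerSeries.X ^ (N + 1) * E := by rw [← hE]; ring
  have hc : constantCoeff E = c (N + 1) - c' (N + 1) := by
    have := congrArg (coeff (N + 1)) hE
    rw [map_sub, coeff_mk, coeff_mk] at this
    rw [this, ← coeff_zero_eq_constantCoeff_apply]
    have := coeff_X_pow_mul E (N + 1) 0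
    rwa [zero_add, eq_comm] at this
  have hD : derivative ℂ (mk c) = derivative ℂ (mk c') + (PowerSeries.X ^ (N + 1) * derivative ℂ E
      + E * (((N + 1 : ℕ) : ℂ⟦X⟧) * PowerSeries.X ^ N)) := by
    rw [hA, map_add, Derivation.leibniz, Derivation.leibniz_pow, derivative_X]
    simp only [smul_eq_mul, mul_one, nsmul_eq_mul, Nat.add_sub_cancel]
  have h1 : mk c * (mk c)⁻¹ = 1 := PowerSeries.mul_inv_cancel _ (by simpa using h0)
  have h1' : mk c' * (mk c')⁻¹ = 1 := PowerSeries.mul_inv_cancel _ (by simpa using h0')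
  have key : derivative ℂ (mk c) * (mk c)⁻¹ - derivative ℂ (mk c') * (mk c')⁻¹
      = PowerSeries.X ^ N * (((PowerSeries.X * derivative ℂ E + ((N + 1 : ℕ) : ℂ⟦X⟧) * E) * mk c'
        - PowerSeries.X * derivative ℂ (mk c') * E) * (mk c)⁻¹ * (mk c')⁻¹) := by
    linear_combination -(derivative ℂ (mk c) * (mk c)⁻¹) * h1' + derivative ℂ (mk c') * (mk c')⁻¹ * h1
      + (mk c)⁻¹ * (mk c')⁻¹ * mk c' * hD - (mk c)⁻¹ * (mk c')⁻¹ * derivative ℂ (mk c') * hA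
  have h2 := congrArg (coeff N) key
  rw [map_sub] at h2
  have h3 := fun f : ℂ⟦X⟧ => coeff_X_pow_mul f N 0
  simp only [zero_add] at h3
  rw [h2, h3, coeff_zero_eq_constantCoeff_apply]
  have e0 : c' 0 = c 0 := (h 0 N.succ_pos).symm
  have m0 : ∀ d : ℕ → ℂ, constantCoeff (mk d) = d 0 := fun d => by
    rw [← coeff_zero_eq_constantCoeff_apply, coeff_mk]
  simp only [map_mul, map_sub, map_add, constantCoeff_X, zero_mul, constantCoeff_inv, zero_add, sub_zero,
    map_natCast, hc, m0, e0]
  push_cast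
  field_simp

end logDeriv

open Wien

/-- Multi-indices of Fourier-Taylor monomials `e^{2πi k·ψ} ζ^j`. -/
abbrev Idx (n : ℕ) := (Fin n → ℤ) × ℕ

/-- Fourier-Taylor series. -/
abbrev Ser (n : ℕ) := Wien (Idx n)

/-- Real vectors. -/
abbrev Vec (n : ℕ) := Fin n → ℝ

/-- Complex vectors. -/
abbrev CVec (n : ℕ) := Fin n → ℂ

/-- Functions of complex vectors. -/
abbrev Fn (n : ℕ) := CVec n → ℂ

variable {n : ℕ}

variable {f g X u Y φ σ lam v : Ser n} {ρ R ρ' R' C χ δ η M r : ℝ} {p : ℕ} {ψ : CVec n}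
  {Ω : Vec n} {β : Vec (n + 1)} {ζ z μ₀ σ₀ lam₀ μ : ℂ} {I : Fin 8 → Ser n} {v₀ c₀ : Fn n}
  {𝒟 : Set (ℂ × CVec (n + 1))} {W : ℂ → Fn (n + 1)} {U : Fn (n + 1)} {a : ℕ → Ser n}
  {B Λ ε e : ℝ≥0∞} {x : CVec (n + 1)}

/-- The `ℓ¹` length of an integer vector. -/
def len (k : Fin n → ℤ) : ℝ := ∑ j, |(k j : ℝ)|

theorem len_nonneg (k : Fin n → ℤ) : 0 ≤ len k := Finset.sum_nonneg fun _ _ => abs_nonneg _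

theorem len_add_le (k l : Fin n → ℤ) : len (k + l) ≤ len k + len l := by
  rw [len, len, len, ← Finset.sum_add_distrib]
  refine Finset.sum_le_sum fun j _ => ?_
  simp only [Pi.add_apply, Int.cast_add]
  exact abs_add_le _ _

theorem one_le_len {k : Fin n → ℤ} (hk : k ≠ 0) : 1 ≤ len k := by
  obtain ⟨j, hj⟩ := Function.ne_iff.1 hk
  calc (1 : ℝ) ≤ |(k j : ℝ)| := by exact_mod_cast Int.one_le_abs hj
    _ ≤ len k := Finset.single_le_sum (f := fun j => |(k j : ℝ)|) (fun _ _ => abs_nonneg _)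
        (Finset.mem_univ j)

/-- The exponential weight `e^{2πρ|k|}`. -/
def wt (n : ℕ) (ρ : ℝ) (i : Idx n) : ℝ≥0∞ := ofReal (Real.exp (2 * π * ρ * len i.1))

/-- The weighted norm of a Fourier-Taylor series on the strip of width `ρ`. -/
abbrev nrm (ρ : ℝ) (f : Ser n) : ℝ≥0∞ := N (wt n ρ) f

section weights

theorem wt_add_le (hρ : 0 ≤ ρ) (i j : Idx n) : wt n ρ (i + j) ≤ wt n ρ i * wt n ρ j := by
  rw [wt, wt, wt, ← ofReal_mul (Real.exp_pos _).le, ← Real.exp_add]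
  refine ofReal_le_ofReal (Real.exp_le_exp.2 ?_)
  rw [← mul_add]
  exact mul_le_mul_of_nonneg_left (len_add_le _ _) (by positivity)

theorem wt_zero_idx (ρ : ℝ) : wt n ρ 0 = 1 := by simp [wt, len]

theorem wt_of_zero (ρ : ℝ) {i : Idx n} (hi : i.1 = 0) : wt n ρ i = 1 := by simp [wt, len, hi]

theorem wt_mono (h : ρ ≤ ρ') : wt n ρ ≤ wt n ρ' := fun i => by
  refine ofReal_le_ofReal (Real.exp_le_exp.2 ?_)
  exact mul_le_mul_of_nonneg_right (by gcongr) (len_nonneg _)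

theorem one_le_wt (hρ : 0 ≤ ρ) : 1 ≤ wt n ρ := fun i => by
  rw [Pi.one_apply, ← wt_zero_idx (n := n) ρ]
  refine ofReal_le_ofReal (Real.exp_le_exp.2 ?_)
  have := len_nonneg i.1
  simp only [Prod.fst_zero]
  rw [show len (0 : Fin n → ℤ) = 0 by simp [len], mul_zero]
  positivity

theorem nrm_mono (h : ρ ≤ ρ') (f : Ser n) : nrm ρ f ≤ nrm ρ' f := N_mono (wt_mono h) f

theorem nrm_mul_le (hρ : 0 ≤ ρ) (f g : Ser n) : nrm ρ (f * g) ≤ nrm ρ f * nrm ρ g := N_mul_le (wt_add_le hρ) f g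

theorem nrm_one (ρ : ℝ) : nrm ρ (1 : Ser n) = 1 := N_one (wt_zero_idx ρ)

theorem enorm_le_nrm (hρ : 0 ≤ ρ) (f : Ser n) : ‖f‖ₑ ≤ nrm ρ f := enorm_le_N (one_le_wt hρ) f

theorem nrm_zero_width (f : Ser n) : nrm 0 f = ‖f‖ₑ := by
  rw [enorm_eq, nrm, N]; simp [wt]

theorem nrm_pow_le (hρ : 0 ≤ ρ) (f : Ser n) (l : ℕ) : nrm ρ (f ^ l) ≤ nrm ρ f ^ l := by
  induction l with
  | zero => simp [nrm_one]
  | succ l ih =>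
    rw [pow_succ, pow_succ]
    exact (nrm_mul_le hρ _ _).trans (mul_le_mul_left ih _)

theorem nrm_algebraMap (ρ : ℝ) (c : ℂ) : nrm ρ (algebraMap ℂ (Ser n) c) = ‖c‖ₑ := by
  rw [Algebra.algebraMap_eq_smul_one, nrm, N_smul, N_one (wt_zero_idx ρ), mul_one]

end weights

section multipliers

/-- The character `e^{2πi k·ψ}`. -/
def chr (k : Fin n → ℤ) (ψ : CVec n) : ℂ :=
  Complex.exp (2 * π * Complex.I * ∑ j, (k j : ℂ) * ψ j)

theorem chr_add (k l : Fin n → ℤ) (ψ : CVec n) : chr (k + l) ψ = chr k ψ * chr l ψ := by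
  rw [chr, chr, chr, ← Complex.exp_add, ← mul_add, ← Finset.sum_add_distrib]
  simp [add_mul]

theorem chr_add_arg (k : Fin n → ℤ) (ψ φ : CVec n) : chr k (ψ + φ) = chr k ψ * chr k φ := by
  rw [chr, chr, chr, ← Complex.exp_add, ← mul_add, ← Finset.sum_add_distrib]
  simp [mul_add]

theorem chr_zero (ψ : CVec n) : chr 0 ψ = 1 := by simp [chr]

theorem chr_zero_arg (k : Fin n → ℤ) : chr k 0 = 1 := by simp [chr]

theorem chr_intPt (k m : Fin n → ℤ) : chr k (intPt m) = 1 := by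
  rw [chr, Complex.exp_eq_one_iff]
  refine ⟨∑ j, k j * m j, ?_⟩
  simp only [intPt]; push_cast; ring

theorem norm_chr (k : Fin n → ℤ) (ψ : CVec n) : ‖chr k ψ‖ = Real.exp
    (-2 * π * ∑ j, (k j : ℝ) * (ψ j).im) := by
  rw [chr, Complex.norm_exp]
  congr 1
  have : (2 * π * Complex.I * ∑ j, (k j : ℂ) * ψ j)
      = ((2 * π : ℝ) : ℂ) * (Complex.I * ∑ j, (k j : ℂ) * ψ j) := by push_cast; ring
  rw [this, Complex.re_ofReal_mul, Complex.I_mul_re, Complex.im_sum]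
  have h2 : ∀ j, ((k j : ℂ) * ψ j).im = (k j : ℝ) * (ψ j).im := fun j => by
    rw [← Complex.ofReal_intCast, Complex.im_ofReal_mul]
  simp only [h2]; ring

theorem norm_chr_real (k : Fin n → ℤ) (x : Vec n) : ‖chr k (toC x)‖ = 1 := by
  rw [norm_chr]; simp [toC]

theorem enorm_chr_real (k : Fin n → ℤ) (x : Vec n) : ‖chr k (toC x)‖ₑ = 1 := by
  rw [← ofReal_norm, norm_chr_real, ENNReal.ofReal_one]

theorem norm_chr_le (hψ : ψ ∈ closedStrip n ρ) (k : Fin n → ℤ) : ‖chr k ψ‖ ≤ Real.exp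
    (2 * π * ρ * len k) := by
  rw [norm_chr, Real.exp_le_exp]
  have : -∑ j, (k j : ℝ) * (ψ j).im ≤ ρ * len k := by
    rw [len, Finset.mul_sum, ← Finset.sum_neg_distrib]
    refine Finset.sum_le_sum fun j _ => ?_
    calc -((k j : ℝ) * (ψ j).im) ≤ |(k j : ℝ) * (ψ j).im| := neg_le_abs _
      _ = |(ψ j).im| * |(k j : ℝ)| := by rw [abs_mul, mul_comm]
      _ ≤ ρ * |(k j : ℝ)| := mul_le_mul_of_nonneg_right (hψ j) (abs_nonneg _)
  nlinarith [Real.pi_pos]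

theorem toC_neg (x : Vec n) : toC (-x) = -toC x := by ext; simp [toC]
theorem toC_add (x y : Vec n) : toC (x + y) = toC x + toC y := by ext; simp [toC]

/-- The shift `ψ ↦ ψ + Ω`. -/
def shf (Ω : Vec n) (f : Ser n) : Ser n := diag (fun i => chr i.1 (toC Ω)) f

theorem shf_apply (Ω : Vec n) (f : Ser n) (i : Idx n) : shf Ω f i = chr i.1 (toC Ω) * f i :=
  diag_apply (diagDom_of_bound one_ne_top (fun _ => (enorm_chr_real _ _).le) f) i

/-- The average over the angles. -/
def ave (f : Ser n) : Ser n := diag (fun i => if i.1 = 0 then 1 else 0) f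

theorem ave_apply (f : Ser n) (i : Idx n) : ave f i = if i.1 = 0 then f i else 0 := by
  rw [ave, diag_apply (diagDom_of_bound one_ne_top (fun i => ?_) f)]
  · split_ifs <;> simp
  · split_ifs <;> simp

variable (Ω : Vec n)

theorem shf_add (f g : Ser n) : shf Ω (f + g) = shf Ω f + shf Ω g := by
  ext i; simp [shf_apply, mul_add]
theorem shf_sub (f g : Ser n) : shf Ω (f - g) = shf Ω f - shf Ω g := by
  ext i; simp [shf_apply, mul_sub]
theorem shf_mul (f g : Ser n) : shf Ω (f * g) = shf Ω f * shf Ω g := by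
  refine diag_mul (c := fun i : Idx n => chr i.1 (toC Ω)) (fun i j => chr_add i.1 j.1 (toC Ω)) ?_ ?_
  · exact diagDom_of_bound one_ne_top (fun _ => (enorm_chr_real _ _).le) f
  · exact diagDom_of_bound one_ne_top (fun _ => (enorm_chr_real _ _).le) g
theorem shf_one : shf Ω (1 : Ser n) = 1 := by
  ext i
  rw [shf_apply, one_apply]
  split_ifs with h
  · simp [h, chr_zero]
  · simp
theorem shf_neg_shf (f : Ser n) : shf (-Ω) (shf Ω f) = f := by
  ext i
  rw [shf_apply, shf_apply, ← mul_assoc, ← chr_add_arg, toC_neg, neg_add_cancel, chr_zero_arg,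
    one_mul]
theorem nrm_shf (ρ : ℝ) (f : Ser n) : nrm ρ (shf Ω f) = nrm ρ f := by
  simp only [nrm, N, shf_apply, enorm_mul, enorm_chr_real, one_mul]

theorem ave_add (f g : Ser n) : ave (f + g) = ave f + ave g := by
  ext i; simp only [ave_apply, add_apply]; split_ifs <;> simp
theorem ave_sub (f g : Ser n) : ave (f - g) = ave f - ave g := by
  ext i; simp only [ave_apply, sub_apply]; split_ifs <;> simp
theorem ave_smul (c : ℂ) (f : Ser n) : ave (c • f) = c • ave f := by
  ext i; simp only [ave_apply, smul_apply]; split_ifs <;> simp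
theorem ave_zero : ave (0 : Ser n) = 0 := by ext i; simp [ave_apply]
theorem ave_one : ave (1 : Ser n) = 1 := by
  ext i; rw [ave_apply, one_apply]
  by_cases h : i = 0
  · simp [h]
  · simp [h]
theorem ave_ave (f : Ser n) : ave (ave f) = ave f := by
  ext i; simp only [ave_apply]; split_ifs <;> simp
theorem ave_shf (f : Ser n) : ave (shf Ω f) = ave f := by
  ext i; simp only [ave_apply, shf_apply]; split_ifs with h
  · rw [h, chr_zero, one_mul]
  · rfl
theorem shf_ave (f : Ser n) : shf Ω (ave f) = ave f := by
  ext i; simp only [ave_apply, shf_apply]; split_ifs with h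
  · rw [h, chr_zero, one_mul]
  · simp
theorem ave_mul_of_ave (hX : ave X = X) (f : Ser n) : ave (X * f) = X * ave f := by
  ext m
  rw [ave_apply, mul_apply, mul_apply]
  have hX' : ∀ i : Idx n, i.1 ≠ 0 → X i = 0 := fun i hi => by rw [← hX, ave_apply, if_neg hi]
  split_ifs with hm
  · congr 1; ext p
    rw [ave_apply]
    split_ifs with h1 h2
    · rfl
    · have : p.1.1 ≠ 0 := fun h0 => h2 (by
        have := congrArg Prod.fst h1; simp only [Prod.fst_add, h0, zero_add, hm] at this; exact this)
      rw [hX' _ this, zero_mul, zero_mul]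
    · rfl
  · symm
    refine (tsum_congr fun p => ?_).trans tsum_zero
    rw [ave_apply]
    split_ifs with h1 h2
    · have : p.1.1 ≠ 0 := fun h0 => hm (by
        have := congrArg Prod.fst h1; simp only [Prod.fst_add, h0, zero_add, h2] at this
        exact this.symm)
      rw [hX' _ this, zero_mul]
    · simp
    · rfl
theorem nrm_ave_le (f : Ser n) : nrm ρ (ave f) ≤ nrm ρ' f := by
  refine tsum_le_tsum fun i => ?_
  rw [ave_apply]
  split_ifs with h
  · rw [wt_of_zero ρ h, wt_of_zero ρ' h]
  · simp
theorem nrm_of_ave (hX : ave X = X) (ρ : ℝ) : nrm ρ X = ‖X‖ₑ := by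
  rw [enorm_eq]
  refine tsum_congr fun i => ?_
  by_cases h : i.1 = 0
  · rw [wt_of_zero ρ h, mul_one]
  · rw [← hX, ave_apply, if_neg h]; simp
theorem ave_algebraMap (c : ℂ) : ave (algebraMap ℂ (Ser n) c) = algebraMap ℂ _ c := by
  rw [Algebra.algebraMap_eq_smul_one, ave_smul, ave_one]
theorem shf_of_ave (hX : ave X = X) : shf Ω X = X := by
  rw [← hX, shf_ave]

/-- The solution operator of the twisted cohomological equation `f(· + Ω) - χ f = g - ⟨g⟩`. -/
def sol (χ : ℝ) (f : Ser n) : Ser n :=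
  diag (fun i => if i.1 = 0 then 0 else (chr i.1 (toC Ω) - χ)⁻¹) f

/-- Small divisor bounds for all twisted cohomological equations with real twist. -/
def SmallDiv (C : ℝ) (p : ℕ) : Prop := ∀ k : Fin n → ℤ, k ≠ 0 → ∀ χ δ : ℝ, 0 < δ →
  1 ≤ C * δ⁻¹ ^ p * Real.exp (2 * π * δ * len k) * ‖chr k (toC Ω) - χ‖

variable {Ω}

theorem SmallDiv.ne (h : SmallDiv Ω C p) {k : Fin n → ℤ} (hk : k ≠ 0) (χ : ℝ) : chr k (toC Ω) - χ ≠ 0 := fun h0 => by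
  have := h k hk χ 1 one_pos
  rw [h0, norm_zero, mul_zero] at this
  linarith

theorem SmallDiv.enorm_le (h : SmallDiv Ω C p) (hδ : 0 < δ) (ρ χ : ℝ) (i : Idx n) :
    ‖(if i.1 = 0 then 0 else (chr i.1 (toC Ω) - χ)⁻¹ : ℂ)‖ₑ * wt n ρ i ≤ ofReal (C * δ⁻¹ ^ p) * wt n (ρ + δ)
    i := by
  split_ifs with hi
  · simp
  · have h1 := h i.1 hi χ δ hδ
    have hpos : 0 < ‖chr i.1 (toC Ω) - χ‖ := norm_pos_iff.2 (h.ne hi χ)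
    rw [wt, wt, ← ofReal_norm, ← ofReal_mul (norm_nonneg _)]
    rcases lt_or_ge (C * δ⁻¹ ^ p) 0 with hneg | hpos'
    · have h3 := mul_pos (Real.exp_pos (2 * π * δ * len i.1)) hpos
      nlinarith
    rw [← ofReal_mul hpos']
    refine ofReal_le_ofReal ?_
    rw [norm_inv, mul_add, add_mul, Real.exp_add]
    have h2 : ‖chr i.1 (toC Ω) - χ‖⁻¹ ≤ C * δ⁻¹ ^ p * Real.exp (2 * π * δ * len i.1) := by
      rw [inv_le_iff_one_le_mul₀ hpos]; exact h1
    calc _ ≤ C * δ⁻¹ ^ p * Real.exp (2 * π * δ * len i.1) * Real.exp (2 * π * ρ * len i.1) :=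
          mul_le_mul_of_nonneg_right h2 (Real.exp_pos _).le
      _ = _ := by ring

theorem SmallDiv.nrm_sol (h : SmallDiv Ω C p) (hδ : 0 < δ) (ρ χ : ℝ) (f : Ser n) : nrm ρ (sol Ω χ f) ≤
    ofReal (C * δ⁻¹ ^ p) * nrm (ρ + δ) f := N_diag_le (h.enorm_le hδ ρ χ) f

/-- Functions with a finite norm on a strip of positive width. -/
def Fin' (f : Ser n) : Prop := ∃ ρ : ℝ, 0 < ρ ∧ nrm ρ f ≠ ∞

theorem SmallDiv.dom (h : SmallDiv Ω C p) (χ : ℝ) (hf : Fin' f) : DiagDom (fun i : Idx n => if i.1 = 0 then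
    0 else (chr i.1 (toC Ω) - χ)⁻¹) f := by
  obtain ⟨ρ, hρ, hf⟩ := hf
  refine diagDom_of_N (w := wt n ρ) (C := ofReal (C * ρ⁻¹ ^ p)) ofReal_ne_top (fun i => ?_) hf
  have := h.enorm_le hρ 0 χ i
  simpa [wt] using this

theorem SmallDiv.sol_apply (h : SmallDiv Ω C p) (χ : ℝ) (hf : Fin' f) (i : Idx n) : sol Ω χ f i = if i.1 = 0
    then 0 else (chr i.1 (toC Ω) - χ)⁻¹ * f i := by
  rw [sol, diag_apply (h.dom χ hf)]; split_ifs <;> simp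

theorem SmallDiv.sol_eq (h : SmallDiv Ω C p) (χ : ℝ) (hf : Fin' f) : shf Ω (sol Ω χ f) - (χ : ℂ) • sol Ω χ f
    = f - ave f := by
  ext i
  simp only [sub_apply, smul_apply, shf_apply, h.sol_apply χ hf, ave_apply]
  split_ifs with hi
  · simp
  · rw [← sub_mul, ← mul_assoc, mul_inv_cancel₀ (h.ne hi χ)]; simp

theorem SmallDiv.ave_sol (h : SmallDiv Ω C p) (χ : ℝ) (hf : Fin' f) : ave (sol Ω χ f) = 0 := by
  ext i; rw [ave_apply, h.sol_apply χ hf]; split_ifs <;> simp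

theorem SmallDiv.eq_sol (h : SmallDiv Ω C p) (χ : ℝ) (hg : ave g = 0)
    (h1 : shf Ω g - (χ : ℂ) • g = f - ave f) : sol Ω χ f = g := by
  refine diag_eq fun i => ?_
  have h2 := congrArg (fun f : Ser n => f i) h1
  have h3 := congrArg (fun f : Ser n => f i) hg
  simp only [sub_apply, smul_apply, shf_apply, ave_apply, zero_apply] at h2 h3
  split_ifs with hi
  · rw [if_pos hi] at h3; simp [h3]
  · rw [if_neg hi, sub_zero] at h2
    rw [← h2, ← sub_mul, ← mul_assoc, inv_mul_cancel₀ (h.ne hi χ), one_mul]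

theorem SmallDiv.sol_add (h : SmallDiv Ω C p) (χ : ℝ) (hf : Fin' f) (hg : Fin' g) : sol Ω χ (f + g) = sol Ω
    χ f + sol Ω χ g := by
  refine h.eq_sol χ (by rw [ave_add, h.ave_sol χ hf, h.ave_sol χ hg, add_zero]) ?_
  rw [shf_add, smul_add, add_sub_add_comm, h.sol_eq χ hf, h.sol_eq χ hg, ave_add]; abel

theorem SmallDiv.sol_mul (h : SmallDiv Ω C p) (χ : ℝ) (hX : ave X = X) (hf : Fin' f) : sol Ω χ (X * f) = X *
    sol Ω χ f := by
  refine h.eq_sol χ (by rw [ave_mul_of_ave hX, h.ave_sol χ hf, mul_zero]) ?_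
  rw [shf_mul, shf_of_ave Ω hX, ← mul_smul_comm, ← mul_sub, h.sol_eq χ hf, ave_mul_of_ave hX,
    mul_sub]

end multipliers

section diophantine

theorem norm_exp_sub_real_ge (θ χ : ℝ) : |Real.sin θ| ≤ ‖Complex.exp (θ * Complex.I) - χ‖ := by
  have : (Complex.exp (θ * Complex.I) - χ).im = Real.sin θ := by
    rw [Complex.sub_im, Complex.exp_ofReal_mul_I_im, Complex.ofReal_im, sub_zero]
  rw [← this]; exact Complex.abs_im_le_norm _

theorem two_mul_abs_sub_round_le (x : ℝ) : 2 * |x - round x| ≤ |Real.sin (π * x)| := by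
  have h1 : |π * (x - round x)| ≤ π / 2 := by
    rw [abs_mul, abs_of_pos Real.pi_pos]
    have := abs_sub_round x
    nlinarith [Real.pi_pos]
  have h2 := Real.mul_abs_le_abs_sin h1
  have h3 : |Real.sin (π * (x - round x))| = |Real.sin (π * x)| := by
    rw [mul_sub, mul_comm π (round x : ℝ), Real.sin_sub_int_mul_pi, abs_mul, abs_zpow]
    simp
  rw [h3, abs_mul, abs_of_pos Real.pi_pos] at h2
  calc 2 * |x - round x| = 2 / π * (π * |x - round x|) := by
        field_simp
    _ ≤ _ := h2

theorem IsDiophantine.smallDiv {κ τ : ℝ} (hκ : 0 < κ) (h : IsDiophantine κ τ Ω) : ∃ (C : ℝ) (p : ℕ), 0 < C ∧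
    SmallDiv Ω C p := by
  set p := ⌈τ⌉₊ with hp
  refine ⟨(p.factorial : ℝ) / (2 * κ), p, by positivity, fun k hk χ δ hδ => ?_⟩
  have hk2 : (2 : ℤ) • k ≠ 0 := smul_ne_zero two_ne_zero hk
  set x : ℝ := ∑ j, (((2 : ℤ) • k) j : ℝ) * Ω j with hx
  have h1 := h _ hk2 (round x)
  have hlen : ∑ j, |((((2 : ℤ) • k) j : ℤ) : ℝ)| = 2 * len k := by
    rw [len, Finset.mul_sum]; refine Finset.sum_congr rfl fun j _ => ?_
    simp [abs_mul]
  rw [hlen, ← hx] at h1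
  have hL := one_le_len hk
  have h2 := two_mul_abs_sub_round_le x
  have h3 := norm_exp_sub_real_ge (π * x) χ
  have h4 : chr k (toC Ω) = Complex.exp ((π * x : ℝ) * Complex.I) := by
    rw [chr, hx]; congr 1
    push_cast
    rw [Finset.mul_sum, Finset.mul_sum, Finset.sum_mul]
    refine Finset.sum_congr rfl fun j _ => ?_
    simp [toC]; ring
  rw [← h4] at h3
  have hd : 2 * κ * (2 * len k) ^ (-τ) ≤ ‖chr k (toC Ω) - χ‖ := by nlinarith
  have h5 : (2 * len k) ^ τ ≤ (2 * len k) ^ p := by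
    rw [← Real.rpow_natCast]
    exact Real.rpow_le_rpow_of_exponent_le (by linarith) (Nat.le_ceil τ)
  have h6 : (π * δ * (2 * len k)) ^ p / p.factorial ≤ Real.exp (2 * π * δ * len k) := by
    have := Real.pow_div_factorial_le_exp (π * δ * (2 * len k)) (by have := Real.pi_pos; positivity) p
    rwa [show π * δ * (2 * len k) = 2 * π * δ * len k by ring] at this ⊢
  have hpi : (1 : ℝ) ≤ π ^ p := one_le_pow₀ (by linarith [Real.pi_gt_three])
  have hlp : 0 < (2 * len k) ^ τ := Real.rpow_pos_of_pos (by linarith) _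
  have h7 : (2 * len k) ^ τ ≤ p.factorial * δ⁻¹ ^ p * Real.exp (2 * π * δ * len k) := by
    have hfac : (0 : ℝ) < p.factorial := by positivity
    rw [div_le_iff₀ hfac, mul_pow, mul_pow] at h6
    have hδp : 0 < δ ^ p := by positivity
    have h8 : δ ^ p * (2 * len k) ^ p ≤ Real.exp (2 * π * δ * len k) * p.factorial := by
      refine le_trans ?_ h6
      have : 0 ≤ δ ^ p * (2 * len k) ^ p := by have := len_nonneg k; positivity
      nlinarith
    rw [inv_pow]
    calc (2 * len k) ^ τ ≤ (2 * len k) ^ p := h5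
      _ = (δ ^ p)⁻¹ * (δ ^ p * (2 * len k) ^ p) := by field_simp
      _ ≤ (δ ^ p)⁻¹ * (Real.exp (2 * π * δ * len k) * p.factorial) := by gcongr
      _ = _ := by ring
  calc (1 : ℝ) = (2 * len k) ^ τ * (1 / (2 * κ)) * (2 * κ * (2 * len k) ^ (-τ)) := by
        rw [Real.rpow_neg (by linarith)]; field_simp
    _ ≤ (p.factorial * δ⁻¹ ^ p * Real.exp (2 * π * δ * len k)) * (1 / (2 * κ)) * ‖chr k (toC Ω) - χ‖ := by
        have : 0 ≤ 2 * κ * (2 * len k) ^ (-τ) := by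
          have := Real.rpow_pos_of_pos (show 0 < 2 * len k by linarith) (-τ); positivity
        gcongr
    _ = _ := by ring

end diophantine

section eval

/-- The monomial `e^{2πi k·ψ} ζ^j`. -/
def mono (ζ : ℂ) (ψ : CVec n) (i : Idx n) : ℂ := chr i.1 ψ * ζ ^ i.2

theorem mono_add (ζ : ℂ) (ψ : CVec n) (i j : Idx n) : mono ζ ψ (i + j) = mono ζ ψ i * mono ζ ψ j := by
  simp only [mono, Prod.fst_add, Prod.snd_add, chr_add, pow_add]; ring

/-- The value of a Fourier-Taylor series. -/
def ev (ζ : ℂ) (ψ : CVec n) (f : Ser n) : ℂ := total (diag (mono ζ ψ) f)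

theorem enorm_mono_le (hζ : ‖ζ‖ ≤ 1) (hψ : ψ ∈ closedStrip n ρ) (i : Idx n) : ‖mono ζ ψ i‖ₑ ≤ wt n ρ i := by
  rw [mono, ← ofReal_norm, wt]
  refine ofReal_le_ofReal ?_
  rw [norm_mul, norm_pow]
  calc _ ≤ Real.exp (2 * π * ρ * len i.1) * 1 := by
        gcongr
        · exact norm_chr_le hψ _
        · exact pow_le_one₀ (norm_nonneg _) hζ
    _ = _ := mul_one _

theorem ev_dom (hζ : ‖ζ‖ ≤ 1) (hψ : ψ ∈ closedStrip n ρ) (hf : nrm ρ f ≠ ∞) : DiagDom (mono ζ ψ) f :=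
  diagDom_of_N (C := 1) one_ne_top (by simpa using enorm_mono_le hζ hψ) hf

theorem ev_eq (hζ : ‖ζ‖ ≤ 1) (hψ : ψ ∈ closedStrip n ρ) (hf : nrm ρ f ≠ ∞) : ev ζ ψ f = ∑' i, mono ζ ψ i * f
    i := by
  rw [ev, total]; simp only [diag_apply (ev_dom hζ hψ hf)]

theorem ev_summable (hζ : ‖ζ‖ ≤ 1) (hψ : ψ ∈ closedStrip n ρ) (hf : nrm ρ f ≠ ∞) : Summable fun i => ‖mono ζ
    ψ i * f i‖ := ev_dom hζ hψ hf

theorem ev_mul (hζ : ‖ζ‖ ≤ 1) (hψ : ψ ∈ closedStrip n ρ) (hf : nrm ρ f ≠ ∞) (hg : nrm ρ g ≠ ∞) : ev ζ ψ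
    (f * g) = ev ζ ψ f * ev ζ ψ g := by
  rw [ev, diag_mul (mono_add ζ ψ) (ev_dom hζ hψ hf) (ev_dom hζ hψ hg), total_mul]; rfl

theorem ev_add (hζ : ‖ζ‖ ≤ 1) (hψ : ψ ∈ closedStrip n ρ) (hf : nrm ρ f ≠ ∞) (hg : nrm ρ g ≠ ∞) : ev ζ ψ
    (f + g) = ev ζ ψ f + ev ζ ψ g := by
  have : nrm ρ (f + g) ≠ ∞ := ne_top_of_le_ne_top (add_ne_top.2 ⟨hf, hg⟩) (N_add_le f g)
  rw [ev_eq hζ hψ hf, ev_eq hζ hψ hg, ev_eq hζ hψ this,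
    ← (ev_summable hζ hψ hf).of_norm.tsum_add (ev_summable hζ hψ hg).of_norm]
  simp [mul_add]

theorem ev_smul (hζ : ‖ζ‖ ≤ 1) (hψ : ψ ∈ closedStrip n ρ) (c : ℂ) (hf : nrm ρ f ≠ ∞) : ev ζ ψ (c • f) = c *
    ev ζ ψ f := by
  have : nrm ρ (c • f) ≠ ∞ := by rw [nrm, N_smul]; exact mul_ne_top enorm_ne_top hf
  rw [ev_eq hζ hψ hf, ev_eq hζ hψ this, ← tsum_mul_left]
  congr 1; ext i; rw [smul_apply]; ring

theorem ev_sub (hζ : ‖ζ‖ ≤ 1) (hψ : ψ ∈ closedStrip n ρ) (hf : nrm ρ f ≠ ∞) (hg : nrm ρ g ≠ ∞) : ev ζ ψ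
    (f - g) = ev ζ ψ f - ev ζ ψ g := by
  have h1 : f - g = f + (-1 : ℂ) • g := by rw [neg_one_smul, sub_eq_add_neg]
  have h2 : nrm ρ ((-1 : ℂ) • g) ≠ ∞ := by rw [neg_one_smul, nrm, N_neg]; exact hg
  rw [h1, ev_add hζ hψ hf h2, ev_smul hζ hψ _ hg]; ring

theorem ev_one : ev ζ ψ (1 : Ser n) = 1 := by
  have : diag (mono ζ ψ) (1 : Ser n) = 1 := by
    refine diag_eq fun i => ?_
    rw [one_apply]
    split_ifs with h
    · simp [h, mono, chr_zero]
    · simp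
  rw [ev, this, total, tsum_eq_single 0]
  · simp [one_apply]
  · intro i hi; simp [one_apply, hi]

theorem ev_zero : ev ζ ψ (0 : Ser n) = 0 := by
  have : diag (mono ζ ψ) (0 : Ser n) = 0 := diag_eq fun i => by simp
  rw [ev, this, total]; simp

theorem ev_algebraMap (c : ℂ) : ev ζ ψ (algebraMap ℂ (Ser n) c) = c := by
  have : diag (mono ζ ψ) (algebraMap ℂ (Ser n) c) = algebraMap ℂ (Ser n) c := by
    refine diag_eq fun i => ?_
    rw [Algebra.algebraMap_eq_smul_one, smul_apply, one_apply]
    split_ifs with h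
    · simp [h, mono, chr_zero]
    · simp
  rw [ev, this, total, Algebra.algebraMap_eq_smul_one, tsum_eq_single 0]
  · simp [one_apply]
  · intro i hi; simp [one_apply, hi]

theorem ev_pow (hρ : 0 ≤ ρ) (hζ : ‖ζ‖ ≤ 1) (hψ : ψ ∈ closedStrip n ρ) (hf : nrm ρ f ≠ ∞) (l : ℕ) : ev ζ ψ
    (f ^ l) = ev ζ ψ f ^ l := by
  induction l with
  | zero => simp [ev_one]
  | succ l ih =>
    have : nrm ρ (f ^ l) ≠ ∞ := ne_top_of_le_ne_top (pow_ne_top hf) (nrm_pow_le hρ f l)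
    rw [pow_succ, pow_succ, ev_mul hζ hψ this hf, ih]

theorem ev_shf (Ω : Vec n) (f : Ser n) : ev ζ ψ (shf Ω f) = ev ζ (ψ + toC Ω) f := by
  have h : ∀ i, mono ζ ψ i * shf Ω f i = mono ζ (ψ + toC Ω) i * f i := fun i => by
    rw [mono, mono, shf_apply, chr_add_arg]; ring
  by_cases hd : DiagDom (mono ζ ψ) (shf Ω f)
  · have hd' : DiagDom (mono ζ (ψ + toC Ω)) f := by unfold DiagDom at hd ⊢; simpa only [h] using hd
    rw [ev, ev, total, total]; simp only [diag_apply hd, diag_apply hd', h]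
  · have hd' : ¬ DiagDom (mono ζ (ψ + toC Ω)) f := by
      unfold DiagDom at hd ⊢; simpa only [h] using hd
    rw [ev, ev, diag_of_not hd, diag_of_not hd']

theorem ev_ave (hζ : ‖ζ‖ ≤ 1) (hf : ave f = f) : ev ζ ψ f = ev ζ 0 f := by
  have h : ∀ i, mono ζ ψ i * f i = mono ζ 0 i * f i := fun i => by
    by_cases hi : i.1 = 0
    · simp [mono, hi, chr_zero]
    · rw [← hf, ave_apply, if_neg hi]; simp
  have h0 : DiagDom (mono ζ (0 : CVec n)) f := by
    refine ev_dom (ρ := 0) hζ (fun j => by simp) ?_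
    rw [nrm_zero_width]; exact enorm_ne_top
  have hd' : DiagDom (mono ζ ψ) f := by unfold DiagDom at h0 ⊢; simpa only [h] using h0
  rw [ev, ev, total, total]; simp only [diag_apply h0, diag_apply hd', h]

theorem enorm_ev_le (hζ : ‖ζ‖ ≤ 1) (hψ : ψ ∈ closedStrip n ρ) (hf : nrm ρ f ≠ ∞) : ‖ev ζ ψ f‖ₑ ≤ nrm ρ
    f := by
  rw [ev_eq hζ hψ hf]
  refine enorm_tsum_le_tsum_enorm.trans (tsum_le_tsum fun i => ?_)
  rw [enorm_mul, mul_comm]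
  exact mul_le_mul_right (enorm_mono_le hζ hψ i) _

theorem ev_tsum (hρ : 0 ≤ ρ) (hζ : ‖ζ‖ ≤ 1) (hψ : ψ ∈ closedStrip n ρ) {α : Type*} {F : α → Ser n}
    (hF : ∑' a, nrm ρ (F a) ≠ ∞) : HasSum (fun a => ev ζ ψ (F a)) (ev ζ ψ (∑' a, F a)) := by
  have hs : Summable F := summable_of_N (one_le_wt hρ) hF
  have hFa : ∀ a, nrm ρ (F a) ≠ ∞ := fun a => ne_top_of_le_ne_top hF (ENNReal.le_tsum a)
  have hsum : nrm ρ (∑' a, F a) ≠ ∞ := ne_top_of_le_ne_top hF (N_tsum_le hs)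
  have hprod : Summable (fun p : α × Idx n => mono ζ ψ p.2 * F p.1 p.2) := by
    refine Summable.of_norm (tsum_enorm_ne_top_iff_summable_norm.1 ?_)
    rw [ENNReal.tsum_prod (f := fun a i => ‖mono ζ ψ i * F a i‖ₑ)]
    refine ne_top_of_le_ne_top hF (tsum_le_tsum fun a => tsum_le_tsum fun i => ?_)
    rw [enorm_mul, mul_comm]
    exact mul_le_mul_right (enorm_mono_le hζ hψ i) _
  have h1 := hprod.hasSum.prod_fiberwise (fun a => (ev_summable hζ hψ (hFa a)).of_norm.hasSum)
  have h2 : ∑' p : α × Idx n, mono ζ ψ p.2 * F p.1 p.2 = ev ζ ψ (∑' a, F a) := by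
    rw [ev_eq hζ hψ hsum, ← (Equiv.prodComm (Idx n) α).tsum_eq]
    have hp : Summable fun c : Idx n × α => mono ζ ψ c.1 * F c.2 c.1 :=
      (Equiv.prodComm (Idx n) α).summable_iff.2 hprod
    refine hp.tsum_prod.trans (tsum_congr fun i => ?_)
    rw [tsum_apply hs, ← tsum_mul_left]
  rw [h2] at h1
  refine h1.congr_fun fun a => ?_
  rw [ev_eq hζ hψ (hFa a)]

end eval

section power_series

/-- The composition of a power series with coefficients in `Wien` with an element. -/
def comp (a : ℕ → Ser n) (u : Ser n) : Ser n := ∑' l, a l * u ^ l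

/-- The coefficients of the derivative of a power series. -/
def der (a : ℕ → Ser n) (l : ℕ) : Ser n := ((l + 1 : ℕ) : Ser n) * a (l + 1)

/-- Divided differences of the powers. -/
def divDiff (u b : Ser n) : ℕ → Ser n
  | 0 => 0
  | l + 1 => (u + b) ^ l + u * divDiff u b l

/-- Second order divided differences of the powers. -/
def divDiff2 (u b : Ser n) : ℕ → Ser n
  | 0 => 0
  | l + 1 => (u + b) * divDiff2 u b l + (l : Ser n) * u ^ (l - 1)

theorem pow_eq_divDiff (u b : Ser n) (l : ℕ) : (u + b) ^ l = u ^ l + b * divDiff u b l := by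
  induction l with
  | zero => simp [divDiff]
  | succ l ih => rw [divDiff]; linear_combination u * ih

theorem pow_eq_divDiff2 (u b : Ser n) (l : ℕ) : (u + b) ^ l = u ^ l + (l : Ser n) * u ^ (l - 1) * b + b ^ 2
    * divDiff2 u b l := by
  induction l with
  | zero => simp [divDiff2]
  | succ l ih =>
    rw [divDiff2, pow_succ, ih]
    cases l with
    | zero => simp; ring
    | succ l =>
      rw [show l + 1 + 1 - 1 = l + 1 from rfl, show l + 1 - 1 = l from rfl]
      push_cast; ring

theorem nrm_natCast_le (ρ : ℝ) (l : ℕ) : nrm ρ (l : Ser n) = l := by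
  have := nrm_algebraMap (n := n) ρ (l : ℂ)
  rw [map_natCast] at this
  rw [this, ← ofReal_norm]; simp

theorem tsum_two_inv_pow : ∑' l : ℕ, (2⁻¹ : ℝ≥0∞) ^ l = 2 := by
  rw [ENNReal.tsum_geometric, ENNReal.one_sub_inv_two, inv_inv]

theorem tsum_pow_le {x : ℝ≥0∞} (hx : x ≤ 2⁻¹) : ∑' l : ℕ, x ^ l ≤ 2 := by
  rw [← tsum_two_inv_pow]
  exact tsum_le_tsum fun l => pow_le_pow_left' hx l

variable (hρ : 0 ≤ ρ) {b : Ser n} {t : ℝ≥0∞}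
include hρ

theorem nrm_divDiff_le (ht : nrm ρ u + nrm ρ b ≤ t) (l : ℕ) : nrm ρ (divDiff u b (l + 1)) ≤ (2 * t) ^
    l := by
  have hu : nrm ρ u ≤ t := le_self_add.trans ht
  have hub : nrm ρ (u + b) ≤ t := (N_add_le _ _).trans ht
  induction l with
  | zero => simp [divDiff, nrm_one]
  | succ l ih =>
    rw [divDiff]
    calc nrm ρ ((u + b) ^ (l + 1) + u * divDiff u b (l + 1))
        ≤ nrm ρ (u + b) ^ (l + 1) + nrm ρ u * nrm ρ (divDiff u b (l + 1)) :=
          (N_add_le _ _).trans (add_le_add (nrm_pow_le hρ _ _) (nrm_mul_le hρ _ _))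
      _ ≤ t ^ (l + 1) + t * (2 * t) ^ l := by gcongr
      _ = (1 + 2 ^ l) * t ^ (l + 1) := by ring
      _ ≤ (2 ^ (l + 1)) * t ^ (l + 1) := by
          gcongr
          rw [pow_succ, mul_two]
          gcongr
          exact one_le_pow₀ one_le_two
      _ = _ := by ring

theorem nrm_divDiff2_le (ht : nrm ρ u + nrm ρ b ≤ t) (l : ℕ) : nrm ρ (divDiff2 u b (l + 2)) ≤ (4 * t) ^
    l := by
  have hu : nrm ρ u ≤ t := le_self_add.trans ht
  have hub : nrm ρ (u + b) ≤ t := (N_add_le _ _).trans ht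
  induction l with
  | zero => simp [divDiff2, nrm_one]
  | succ l ih =>
    rw [divDiff2]
    calc nrm ρ ((u + b) * divDiff2 u b (l + 2) + ((l + 2 : ℕ) : Ser n) * u ^ (l + 2 - 1))
        ≤ nrm ρ (u + b) * nrm ρ (divDiff2 u b (l + 2))
          + nrm ρ ((l + 2 : ℕ) : Ser n) * nrm ρ u ^ (l + 1) := by
          refine (N_add_le _ _).trans (add_le_add (nrm_mul_le hρ _ _) ?_)
          refine (nrm_mul_le hρ _ _).trans ?_
          gcongr
          exact nrm_pow_le hρ _ _
      _ ≤ t * (4 * t) ^ l + ((l + 2 : ℕ) : ℝ≥0∞) * t ^ (l + 1) := by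
          rw [nrm_natCast_le]; gcongr
      _ = (4 ^ l + ((l + 2 : ℕ) : ℝ≥0∞)) * t ^ (l + 1) := by ring
      _ ≤ (4 ^ (l + 1)) * t ^ (l + 1) := by
          gcongr
          have : 4 ^ l + (l + 2) ≤ 4 ^ (l + 1) := by
            have : l + 1 ≤ 4 ^ l := by
              have := (Nat.lt_pow_self (n := l) (show 1 < 4 by norm_num)); omega
            rw [pow_succ]; omega
          exact_mod_cast this
      _ = _ := by ring

variable {M : ℝ≥0∞} (hM : M ≠ ∞) (ha : ∀ l, nrm ρ (a l) ≤ M * B ^ l)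
include hM ha

omit hM in
theorem tsum_nrm_comp_le (hu : B * nrm ρ u ≤ 8⁻¹) : ∑' l, nrm ρ (a l * u ^ l) ≤ 2 * M := by
  have h : B * nrm ρ u ≤ 2⁻¹ := hu.trans (by gcongr; norm_num)
  calc ∑' l, nrm ρ (a l * u ^ l) ≤ ∑' l, M * (B * nrm ρ u) ^ l := by
        refine tsum_le_tsum fun l => (nrm_mul_le hρ _ _).trans ?_
        rw [mul_pow, ← mul_assoc]
        exact mul_le_mul' (ha l) (nrm_pow_le hρ _ _)
    _ ≤ M * 2 := by rw [ENNReal.tsum_mul_left]; gcongr; exact tsum_pow_le h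
    _ = _ := mul_comm _ _

theorem summable_comp (hu : B * nrm ρ u ≤ 8⁻¹) : Summable fun l => a l * u ^ l :=
  summable_of_N (one_le_wt hρ) (ne_top_of_le_ne_top (mul_ne_top ENNReal.ofNat_ne_top hM)
    (tsum_nrm_comp_le hρ ha hu))

theorem nrm_comp_le (hu : B * nrm ρ u ≤ 8⁻¹) : nrm ρ (comp a u) ≤ 2 * M :=
  (N_tsum_le (summable_comp hρ hM ha hu)).trans (tsum_nrm_comp_le hρ ha hu)

theorem ev_comp (hu : B * nrm ρ u ≤ 8⁻¹) (hu' : nrm ρ u ≠ ∞) (hB : B ≠ ∞) (hζ : ‖ζ‖ ≤ 1)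
    (hψ : ψ ∈ closedStrip n ρ) : HasSum (fun l => ev ζ ψ (a l) * ev ζ ψ u ^ l) (ev ζ ψ (comp a u)) := by
  have := ev_tsum hρ hζ hψ (ne_top_of_le_ne_top (mul_ne_top ENNReal.ofNat_ne_top hM)
    (tsum_nrm_comp_le hρ ha hu))
  refine this.congr_fun fun l => ?_
  rw [ev_mul hζ hψ (ne_top_of_le_ne_top (mul_ne_top hM (pow_ne_top hB)) (ha l))
    (ne_top_of_le_ne_top (pow_ne_top hu') (nrm_pow_le hρ u l)), ev_pow hρ hζ hψ hu']

theorem nrm_comp_sub_le (hB : B ≠ ∞) (ht : nrm ρ u + nrm ρ b ≤ t) (hBt : B * t ≤ 8⁻¹) : nrm ρ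
    (comp a (u + b) - comp a u) ≤ 2 * M * B * nrm ρ b := by
  have hu : B * nrm ρ u ≤ 8⁻¹ := le_trans (by gcongr; exact le_self_add.trans ht) hBt
  have hub : B * nrm ρ (u + b) ≤ 8⁻¹ := le_trans (by gcongr; exact (N_add_le _ _).trans ht) hBt
  have h4 : B * (2 * t) ≤ 2⁻¹ := by
    calc B * (2 * t) = 2 * (B * t) := by ring
      _ ≤ 4 * 8⁻¹ := by gcongr; norm_num
      _ = 2⁻¹ := by
        rw [show (8 : ℝ≥0∞) = 4 * 2 by norm_num, ENNReal.mul_inv (by simp) (by simp), ← mul_assoc,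
          ENNReal.mul_inv_cancel (by simp) (by simp), one_mul]
  have hs : ∑' l, nrm ρ (a l * divDiff u b l) ≤ 2 * M * B := by
    rw [tsum_eq_zero_add' ENNReal.summable]
    simp only [divDiff, mul_zero, N_zero, zero_add]
    calc ∑' l, nrm ρ (a (l + 1) * divDiff u b (l + 1)) ≤ ∑' l, M * B * (B * (2 * t)) ^ l := by
          refine tsum_le_tsum fun l => (nrm_mul_le hρ _ _).trans ?_
          calc _ ≤ M * B ^ (l + 1) * (2 * t) ^ l :=
                mul_le_mul' (ha _) (nrm_divDiff_le hρ ht l)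
            _ = _ := by rw [mul_pow]; ring
      _ ≤ M * B * 2 := by rw [ENNReal.tsum_mul_left]; gcongr; exact tsum_pow_le h4
      _ = _ := by ring
  have hsum : Summable fun l => a l * divDiff u b l := summable_of_N (one_le_wt hρ)
    (ne_top_of_le_ne_top (by finiteness) hs)
  have : comp a (u + b) - comp a u = b * ∑' l, a l * divDiff u b l := by
    rw [comp, comp, ← (summable_comp hρ hM ha hub).tsum_sub (summable_comp hρ hM ha hu),
      ← hsum.tsum_mul_left]
    congr 1; ext1 l
    rw [pow_eq_divDiff]; ring
  rw [this, mul_comm]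
  refine (nrm_mul_le hρ _ _).trans ?_
  gcongr
  exact (N_tsum_le hsum).trans hs

theorem nrm_comp_sub_sub_le (hB : B ≠ ∞) (ht : nrm ρ u + nrm ρ b ≤ t) (hBt : B * t ≤ 8⁻¹) : nrm ρ
    (comp a (u + b) - comp a u - comp (der a) u * b) ≤ 2 * M * B ^ 2 * nrm ρ b ^ 2 := by
  have hu : B * nrm ρ u ≤ 8⁻¹ := le_trans (by gcongr; exact le_self_add.trans ht) hBt
  have hub : B * nrm ρ (u + b) ≤ 8⁻¹ := le_trans (by gcongr; exact (N_add_le _ _).trans ht) hBt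
  have h4 : B * (4 * t) ≤ 2⁻¹ := by
    calc B * (4 * t) = 4 * (B * t) := by ring
      _ ≤ 4 * 8⁻¹ := by gcongr
      _ = 2⁻¹ := by
        rw [show (8 : ℝ≥0∞) = 4 * 2 by norm_num, ENNReal.mul_inv (by simp) (by simp), ← mul_assoc,
          ENNReal.mul_inv_cancel (by simp) (by simp), one_mul]
  have hs : ∑' l, nrm ρ (a l * divDiff2 u b l) ≤ 2 * M * B ^ 2 := by
    rw [tsum_eq_zero_add' ENNReal.summable, tsum_eq_zero_add' ENNReal.summable]
    simp only [divDiff2, mul_zero, N_zero, zero_add, Nat.cast_zero, zero_mul, add_zero]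
    calc ∑' l, nrm ρ (a (l + 1 + 1) * divDiff2 u b (l + 1 + 1)) ≤ ∑' l, M * B ^ 2 * (B * (4 * t)) ^ l := by
          refine tsum_le_tsum fun l => (nrm_mul_le hρ _ _).trans ?_
          calc _ ≤ M * B ^ (l + 1 + 1) * (4 * t) ^ l :=
                mul_le_mul' (ha _) (nrm_divDiff2_le hρ ht l)
            _ = _ := by rw [mul_pow]; ring
      _ ≤ M * B ^ 2 * 2 := by rw [ENNReal.tsum_mul_left]; gcongr; exact tsum_pow_le h4
      _ = _ := by ring
  have hsum : Summable fun l => a l * divDiff2 u b l := summable_of_N (one_le_wt hρ)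
    (ne_top_of_le_ne_top (by finiteness) hs)
  have hd : Summable fun l => a l * ((l : Ser n) * u ^ (l - 1)) := by
    refine summable_of_N (one_le_wt hρ) (ne_top_of_le_ne_top (b := 2 * M * B) (by finiteness) ?_)
    rw [tsum_eq_zero_add' ENNReal.summable]
    simp only [Nat.cast_zero, zero_mul, mul_zero, N_zero, zero_add]
    calc ∑' l, nrm ρ (a (l + 1) * (((l + 1 : ℕ) : Ser n) * u ^ (l + 1 - 1)))
        ≤ ∑' l, M * B * (B * (4 * t)) ^ l := by
          refine tsum_le_tsum fun l => (nrm_mul_le hρ _ _).trans ?_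
          have h1 : nrm ρ (((l + 1 : ℕ) : Ser n) * u ^ (l + 1 - 1)) ≤ 4 ^ l * t ^ l := by
            refine (nrm_mul_le hρ _ _).trans ?_
            rw [nrm_natCast_le]
            refine mul_le_mul' ?_ ((nrm_pow_le hρ _ _).trans (pow_le_pow_left' (le_self_add.trans ht) _))
            have : l + 1 ≤ 4 ^ l := (Nat.lt_pow_self (n := l) (show 1 < 4 by norm_num))
            exact_mod_cast this
          calc _ ≤ M * B ^ (l + 1) * (4 ^ l * t ^ l) := mul_le_mul' (ha _) h1
            _ = _ := by rw [mul_pow, mul_pow]; ring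
      _ ≤ M * B * 2 := by rw [ENNReal.tsum_mul_left]; gcongr; exact tsum_pow_le h4
      _ = _ := by ring
  have hder : comp (der a) u = ∑' l, a l * ((l : Ser n) * u ^ (l - 1)) := by
    rw [hd.tsum_eq_zero_add, comp]
    simp only [Nat.cast_zero, zero_mul, mul_zero, zero_add, der, Nat.add_sub_cancel]
    congr 1; ext1 l; ring
  have : comp a (u + b) - comp a u - comp (der a) u * b = b ^ 2 * ∑' l, a l * divDiff2 u b l := by
    rw [hder, comp, comp, ← (summable_comp hρ hM ha hub).tsum_sub (summable_comp hρ hM ha hu),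
      ← hsum.tsum_mul_left, ← hd.tsum_mul_right,
      ← ((summable_comp hρ hM ha hub).sub (summable_comp hρ hM ha hu)).tsum_sub (hd.mul_right b)]
    congr 1; ext1 l
    rw [pow_eq_divDiff2]; ring
  rw [this, mul_comm]
  refine (nrm_mul_le hρ _ _).trans ?_
  gcongr
  · exact (N_tsum_le hsum).trans hs
  · exact nrm_pow_le hρ b 2

omit hM in
theorem nrm_der_le (l : ℕ) : nrm ρ (der a l) ≤ (M * B) * (2 * B) ^ l := by
  rw [der]
  refine (nrm_mul_le hρ _ _).trans ?_
  rw [nrm_natCast_le]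
  have : l + 1 ≤ 2 ^ l := Nat.lt_pow_self one_lt_two
  have h2 : ((l + 1 : ℕ) : ℝ≥0∞) ≤ 2 ^ l := by exact_mod_cast this
  calc _ ≤ 2 ^ l * (M * B ^ (l + 1)) := mul_le_mul' h2 (ha _)
    _ = _ := by rw [mul_pow]; ring

end power_series

section inverse

theorem exists_inv_one_add (hρ : 0 ≤ ρ) {x : Ser n} (hx : nrm ρ x ≤ 2⁻¹) : ∃ y : Ser n, (1 + x) * y = 1 ∧
    nrm ρ y ≤ 2 ∧ nrm ρ (y - 1) ≤ 2 * nrm ρ x := by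
  have hx1 : ‖-x‖ₑ < 1 := by
    rw [enorm_neg]
    exact ((enorm_le_nrm hρ x).trans hx).trans_lt (by simp)
  have h1 : ‖-x‖ < 1 := by
    rwa [← ofReal_norm, ENNReal.ofReal_lt_one] at hx1
  have hs : ∑' l : ℕ, nrm ρ ((-x) ^ l) ≤ 2 := by
    refine (tsum_le_tsum fun l => (nrm_pow_le hρ (-x) l)).trans (tsum_pow_le ?_)
    rw [nrm, N_neg]; exact hx
  have hsum : Summable fun l : ℕ => (-x) ^ l := summable_of_N (one_le_wt hρ)
    (ne_top_of_le_ne_top ENNReal.ofNat_ne_top hs)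
  have hy := mul_neg_geom_series (-x) h1
  rw [sub_neg_eq_add] at hy
  have hy2 : nrm ρ (∑' l : ℕ, (-x) ^ l) ≤ 2 := (N_tsum_le hsum).trans hs
  refine ⟨∑' l : ℕ, (-x) ^ l, hy, hy2, ?_⟩
  have h3 : (∑' l : ℕ, (-x) ^ l) - 1 = -((∑' l : ℕ, (-x) ^ l) * x) := by linear_combination hy
  rw [h3, nrm, N_neg]
  exact (nrm_mul_le hρ _ _).trans (by gcongr)

end inverse

section finiteness

theorem Fin'.add (hf : Fin' f) (hg : Fin' g) : Fin' (f + g) := by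
  obtain ⟨ρ, hρ, hf⟩ := hf
  obtain ⟨ρ', hρ', hg⟩ := hg
  refine ⟨min ρ ρ', lt_min hρ hρ', ne_top_of_le_ne_top (add_ne_top.2 ⟨hf, hg⟩) ?_⟩
  exact (N_add_le _ _).trans (add_le_add (nrm_mono (min_le_left _ _) _) (nrm_mono (min_le_right _ _) _))

theorem Fin'.neg (hf : Fin' f) : Fin' (-f) := by
  obtain ⟨ρ, hρ, hf⟩ := hf
  exact ⟨ρ, hρ, by rw [nrm, N_neg]; exact hf⟩

theorem Fin'.sub (hf : Fin' f) (hg : Fin' g) : Fin' (f - g) := by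
  rw [sub_eq_add_neg]; exact hf.add hg.neg

theorem Fin'.mul (hf : Fin' f) (hg : Fin' g) : Fin' (f * g) := by
  obtain ⟨ρ, hρ, hf⟩ := hf
  obtain ⟨ρ', hρ', hg⟩ := hg
  refine ⟨min ρ ρ', lt_min hρ hρ', ne_top_of_le_ne_top (mul_ne_top hf hg) ?_⟩
  exact (nrm_mul_le (lt_min hρ hρ').le _ _).trans (mul_le_mul' (nrm_mono (min_le_left _ _) _)
    (nrm_mono (min_le_right _ _) _))

theorem Fin'.shf (hf : Fin' f) (Ω : Vec n) : Fin' (shf Ω f) := by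
  obtain ⟨ρ, hρ, hf⟩ := hf
  exact ⟨ρ, hρ, by rw [nrm_shf]; exact hf⟩

theorem Fin'.of_ave (hf : ave f = f) : Fin' f := ⟨1, one_pos, by rw [nrm_of_ave hf]; exact enorm_ne_top⟩

theorem Fin'.zero : Fin' (0 : Ser n) := Fin'.of_ave ave_zero

theorem Fin'.one : Fin' (1 : Ser n) := Fin'.of_ave ave_one

theorem Fin'.pow (hf : Fin' f) (l : ℕ) : Fin' (f ^ l) := by
  induction l with
  | zero => rw [pow_zero]; exact Fin'.one
  | succ l ih => rw [pow_succ]; exact ih.mul hf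

theorem Fin'.sol (hf : Fin' f) (h : SmallDiv Ω C p) (χ : ℝ) : Fin' (sol Ω χ f) := by
  obtain ⟨ρ, hρ, hf⟩ := hf
  refine ⟨ρ / 2, by positivity, ne_top_of_le_ne_top ?_ (h.nrm_sol (half_pos hρ) (ρ / 2) χ f)⟩
  rw [add_halves]
  exact mul_ne_top ofReal_ne_top hf

/-- Constants as elements of the algebra. -/
def cst (c : ℂ) : Ser n := algebraMap ℂ _ c

theorem ave_cst (c : ℂ) : ave (cst c : Ser n) = cst c := ave_algebraMap c
theorem shf_cst (Ω : Vec n) (c : ℂ) : shf Ω (cst c : Ser n) = cst c := shf_of_ave Ω (ave_cst c)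
theorem Fin'.cst (c : ℂ) : Fin' (cst c : Ser n) := Fin'.of_ave (ave_cst c)
theorem nrm_cst (ρ : ℝ) (c : ℂ) : nrm ρ (cst c : Ser n) = ‖c‖ₑ := nrm_algebraMap ρ c
theorem cst_mul (c d : ℂ) : (cst (c * d) : Ser n) = cst c * cst d := map_mul _ _ _
theorem cst_one : (cst 1 : Ser n) = 1 := map_one _
theorem cst_sub (c d : ℂ) : (cst (c - d) : Ser n) = cst c - cst d := map_sub _ _ _
theorem cst_smul (c : ℂ) (f : Ser n) : c • f = cst c * f := Algebra.smul_def _ _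

end finiteness

/-- The coefficients of the triangular system of cohomological equations. -/
structure Pt (n : ℕ) where
  φ : Ser n
  q : Ser n
  ω : Ser n

section chain

variable (Ω : Vec n) (χ : ℝ)

/-- First unknown of the triangular system. -/
def stJ (I : Fin 8 → Ser n) : Ser n := sol Ω χ (shf Ω (I 0)) + I 5

/-- Second unknown of the triangular system. -/
def stY (P : Pt n) (I : Fin 8 → Ser n) : Ser n :=
  sol Ω χ⁻¹ (P.q * stJ Ω χ I + I 2) + I 6

/-- Source of the third equation of the triangular system. -/
def srcI (P : Pt n) (I : Fin 8 → Ser n) : Ser n :=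
  cst χ * shf Ω (I 1 - P.φ ^ 3 * P.ω * stY Ω χ P I)

/-- Third unknown of the triangular system. -/
def stI (P : Pt n) (I : Fin 8 → Ser n) : Ser n :=
  sol Ω (χ ^ 2) (srcI Ω χ P I) + I 7

/-- Fourth unknown of the triangular system. -/
def stG (P : Pt n) (I : Fin 8 → Ser n) : Ser n :=
  sol Ω 1 (P.q * stI Ω χ P I + I 4)

/-- The compatibility conditions of the triangular system. -/
def res (P : Pt n) (I : Fin 8 → Ser n) : Fin 5 → Ser n :=
  ![ave (I 0) - cst (1 - χ) * I 5,
    ave (P.q * stJ Ω χ I + I 2) - cst (1 - (χ : ℂ)⁻¹) * I 6,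
    ave (P.φ * stY Ω χ P I + I 3),
    ave (srcI Ω χ P I) - cst (1 - χ ^ 2) * I 7,
    ave (P.q * stI Ω χ P I + I 4)]

variable {Ω χ} (hS : SmallDiv Ω C p)

/-- Finiteness of the coefficients. -/
def Pt.Ok (P : Pt n) : Prop := Fin' P.φ ∧ Fin' P.q ∧ Fin' P.ω

include hS

theorem fin_stJ (hI : ∀ k, Fin' (I k)) : Fin' (stJ Ω χ I) := (((hI 0).shf Ω).sol hS χ).add (hI 5)

theorem fin_srcY {P : Pt n} (hP : P.Ok) (hI : ∀ k, Fin' (I k)) : Fin' (P.q * stJ Ω χ I + I 2) := (hP.2.1.mul (fin_stJ hS hI)).add (hI 2)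

theorem fin_stY {P : Pt n} (hP : P.Ok) (hI : ∀ k, Fin' (I k)) : Fin' (stY Ω χ P I) := ((fin_srcY hS hP hI).sol hS _).add (hI 6)

theorem fin_srcI {P : Pt n} (hP : P.Ok) (hI : ∀ k, Fin' (I k)) : Fin' (srcI Ω χ P I) :=
  (Fin'.cst _).mul (((hI 1).sub (((hP.1.pow 3).mul hP.2.2).mul (fin_stY hS hP hI))).shf Ω)

theorem fin_stI {P : Pt n} (hP : P.Ok) (hI : ∀ k, Fin' (I k)) : Fin' (stI Ω χ P I) := ((fin_srcI hS hP hI).sol hS _).add (hI 7)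

theorem fin_srcG {P : Pt n} (hP : P.Ok) (hI : ∀ k, Fin' (I k)) : Fin' (P.q * stI Ω χ P I + I 4) := (hP.2.1.mul (fin_stI hS hP hI)).add (hI 4)

theorem fin_stG {P : Pt n} (hP : P.Ok) (hI : ∀ k, Fin' (I k)) : Fin' (stG Ω χ P I) := (fin_srcG hS hP hI).sol hS _

/-- The equations solved by the triangular system, when the compatibility conditions hold. -/
theorem chain_eqs {P : Pt n} (hP : P.Ok) (hI : ∀ k, Fin' (I k)) (h5 : ave (I 5) = I 5)
    (h6 : ave (I 6) = I 6) (h7 : ave (I 7) = I 7) (h : res Ω χ P I = 0) : shf Ω (stJ Ω χ I) - cst χ * stJ Ω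
    χ I = shf Ω (I 0) ∧ shf Ω (stY Ω χ P I) - cst ((χ : ℂ)⁻¹) * stY Ω χ P I = P.q * stJ Ω χ I + I 2 ∧ ave
    (P.φ * stY Ω χ P I + I 3) = 0 ∧ shf Ω (stI Ω χ P I) - cst (χ ^ 2) * stI Ω χ P I = srcI Ω χ P I ∧ shf Ω
    (stG Ω χ P I) - stG Ω χ P I = P.q * stI Ω χ P I + I 4 := by
  have r0 := congrFun h 0
  have r1 := congrFun h 1
  have r2 := congrFun h 2
  have r3 := congrFun h 3
  have r4 := congrFun h 4
  simp only [res, Pi.zero_apply, Matrix.cons_val] at r0 r1 r2 r3 r4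
  have e0 := hS.sol_eq χ ((hI 0).shf Ω)
  have e1 := hS.sol_eq χ⁻¹ (fin_srcY (χ := χ) hS hP hI)
  have e3 := hS.sol_eq (χ ^ 2) (fin_srcI (χ := χ) hS hP hI)
  have e4 := hS.sol_eq 1 (fin_srcG (χ := χ) hS hP hI)
  simp only [cst_smul] at e0 e1 e3 e4
  rw [ave_shf] at e0
  push_cast at e1 e3 e4
  refine ⟨?_, ?_, r2, ?_, ?_⟩
  · rw [stJ, shf_add, shf_of_ave Ω h5]
    rw [cst_sub, cst_one] at r0
    linear_combination e0 + r0 * (-1)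
  · rw [stY, shf_add, shf_of_ave Ω h6]
    rw [cst_sub, cst_one] at r1
    linear_combination e1 + r1 * (-1)
  · rw [stI, shf_add, shf_of_ave Ω h7]
    rw [cst_sub, cst_one] at r3
    linear_combination e3 + r3 * (-1)
  · rw [stG]
    rw [cst_one] at e4
    linear_combination e4 + r4 * (-1)

omit hS in
/-- The source of the difference of two solutions of triangular systems. -/
def diffInp (Ω : Vec n) (χ : ℝ) (P P' : Pt n) (I I' : Fin 8 → Ser n) :
    Fin 8 → Ser n :=
  ![I 0 - I' 0, I 1 - I' 1 - (P.φ ^ 3 * P.ω - P'.φ ^ 3 * P'.ω) * stY Ω χ P' I',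
    I 2 - I' 2 + (P.q - P'.q) * stJ Ω χ I', I 3 - I' 3 + (P.φ - P'.φ) * stY Ω χ P' I',
    I 4 - I' 4 + (P.q - P'.q) * stI Ω χ P' I', I 5 - I' 5, I 6 - I' 6, I 7 - I' 7]

theorem chain_diff {P P' : Pt n} (hP : P.Ok) (hP' : P'.Ok) {I' : Fin 8 → Ser n} (hI : ∀ k, Fin' (I k))
    (hI' : ∀ k, Fin' (I' k)) : (∀ k, Fin' (diffInp Ω χ P P' I I' k)) ∧ stJ Ω χ I = stJ Ω χ I' + stJ Ω χ
    (diffInp Ω χ P P' I I') ∧ stY Ω χ P I = stY Ω χ P' I' + stY Ω χ P (diffInp Ω χ P P' I I') ∧ stI Ω χ P I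
    = stI Ω χ P' I' + stI Ω χ P (diffInp Ω χ P P' I I') ∧ stG Ω χ P I = stG Ω χ P' I' + stG Ω χ P
    (diffInp Ω χ P P' I I') ∧ res Ω χ P I = res Ω χ P' I' + res Ω χ P (diffInp Ω χ P P' I I') := by
  have hY' := fin_stY (χ := χ) hS hP' hI'
  have hJ' := fin_stJ (χ := χ) hS hI'
  have hI3' := fin_stI (χ := χ) hS hP' hI'
  set D := diffInp Ω χ P P' I I' with hD
  have D0 : D 0 = I 0 - I' 0 := rfl
  have D1 : D 1 = I 1 - I' 1 - (P.φ ^ 3 * P.ω - P'.φ ^ 3 * P'.ω) * stY Ω χ P' I' := rfl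
  have D2 : D 2 = I 2 - I' 2 + (P.q - P'.q) * stJ Ω χ I' := rfl
  have D3 : D 3 = I 3 - I' 3 + (P.φ - P'.φ) * stY Ω χ P' I' := rfl
  have D4 : D 4 = I 4 - I' 4 + (P.q - P'.q) * stI Ω χ P' I' := rfl
  have D5 : D 5 = I 5 - I' 5 := rfl
  have D6 : D 6 = I 6 - I' 6 := rfl
  have D7 : D 7 = I 7 - I' 7 := rfl
  have hDf : ∀ k, Fin' (D k) := by
    intro k
    fin_cases k
    · exact (hI 0).sub (hI' 0)
    · exact ((hI 1).sub (hI' 1)).sub ((((hP.1.pow 3).mul hP.2.2).sub ((hP'.1.pow 3).mul hP'.2.2)).mul hY')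
    · exact ((hI 2).sub (hI' 2)).add ((hP.2.1.sub hP'.2.1).mul hJ')
    · exact ((hI 3).sub (hI' 3)).add ((hP.1.sub hP'.1).mul hY')
    · exact ((hI 4).sub (hI' 4)).add ((hP.2.1.sub hP'.2.1).mul hI3')
    · exact (hI 5).sub (hI' 5)
    · exact (hI 6).sub (hI' 6)
    · exact (hI 7).sub (hI' 7)
  have hJ : stJ Ω χ I = stJ Ω χ I' + stJ Ω χ D := by
    have : shf Ω (I 0) = shf Ω (I' 0) + shf Ω (D 0) := by rw [← shf_add, D0]; congr 1; ring
    rw [stJ, this, hS.sol_add χ ((hI' 0).shf Ω) ((hDf 0).shf Ω), stJ, stJ, D5]; ring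
  have sY : P.q * stJ Ω χ I + I 2 = (P'.q * stJ Ω χ I' + I' 2) + (P.q * stJ Ω χ D + D 2) := by
    rw [hJ, D2]; ring
  have hY : stY Ω χ P I = stY Ω χ P' I' + stY Ω χ P D := by
    rw [stY, sY, hS.sol_add _ (fin_srcY hS hP' hI') (fin_srcY hS hP hDf), stY, stY, D6]; ring
  have sI : srcI Ω χ P I = srcI Ω χ P' I' + srcI Ω χ P D := by
    rw [srcI, srcI, srcI, ← mul_add, ← shf_add, hY, D1]; congr 2; ring
  have hI3 : stI Ω χ P I = stI Ω χ P' I' + stI Ω χ P D := by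
    rw [stI, sI, hS.sol_add _ (fin_srcI hS hP' hI') (fin_srcI hS hP hDf), stI, stI, D7]; ring
  have sG : P.q * stI Ω χ P I + I 4 = (P'.q * stI Ω χ P' I' + I' 4) + (P.q * stI Ω χ P D + D 4) := by
    rw [hI3, D4]; ring
  have hG : stG Ω χ P I = stG Ω χ P' I' + stG Ω χ P D := by
    rw [stG, sG, hS.sol_add _ (fin_srcG hS hP' hI') (fin_srcG hS hP hDf), stG, stG]
  refine ⟨hDf, hJ, hY, hI3, hG, ?_⟩
  have s3 : P.φ * stY Ω χ P I + I 3 = (P'.φ * stY Ω χ P' I' + I' 3) + (P.φ * stY Ω χ P D + D 3) := by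
    rw [hY, D3]; ring
  have s0 : I 0 = I' 0 + D 0 := by rw [D0]; ring
  funext k
  fin_cases k
  · simp only [res, Pi.add_apply, Fin.zero_eta, Matrix.cons_val]
    rw [s0, ave_add, D5]; ring
  · simp only [res, Pi.add_apply, Fin.mk_one, Matrix.cons_val]
    rw [sY, ave_add, D6]; ring
  · simp only [res, Pi.add_apply, Fin.reduceFinMk, Matrix.cons_val]
    rw [s3, ave_add]
  · simp only [res, Pi.add_apply, Fin.reduceFinMk, Matrix.cons_val]
    rw [sI, ave_add, D7]; ring
  · simp only [res, Pi.add_apply, Fin.reduceFinMk, Matrix.cons_val]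
    rw [sG, ave_add]

theorem res_add {P : Pt n} (hP : P.Ok) {I' : Fin 8 → Ser n} (hI : ∀ k, Fin' (I k)) (hI' : ∀ k, Fin' (I' k))
    : res Ω χ P (I + I') = res Ω χ P I + res Ω χ P I' := by
  have h := (chain_diff (χ := χ) hS hP hP (I := I + I') (I' := I)
    (fun k => (hI k).add (hI' k)) hI).2.2.2.2.2
  rw [h]; congr 2
  funext k; fin_cases k <;> simp [diffInp]

theorem chain_mul {P : Pt n} (hP : P.Ok) (hI : ∀ k, Fin' (I k)) (hX : ave X = X) : stJ Ω χ (X • I) = X * stJ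
    Ω χ I ∧ stY Ω χ P (X • I) = X * stY Ω χ P I ∧ stI Ω χ P (X • I) = X * stI Ω χ P I ∧ stG Ω χ P (X • I) =
    X * stG Ω χ P I ∧ res Ω χ P (X • I) = X • res Ω χ P I := by
  have hsm : ∀ k, (X • I) k = X * I k := fun k => rfl
  have hJ : stJ Ω χ (X • I) = X * stJ Ω χ I := by
    rw [stJ, hsm, hsm, shf_mul, shf_of_ave Ω hX, hS.sol_mul χ hX ((hI 0).shf Ω), stJ]; ring
  have sY : P.q * stJ Ω χ (X • I) + (X • I) 2 = X * (P.q * stJ Ω χ I + I 2) := by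
    rw [hJ, hsm]; ring
  have hY : stY Ω χ P (X • I) = X * stY Ω χ P I := by
    rw [stY, sY, hS.sol_mul _ hX (fin_srcY hS hP hI), stY, hsm]; ring
  have sI : srcI Ω χ P (X • I) = X * srcI Ω χ P I := by
    have : (X • I) 1 - P.φ ^ 3 * P.ω * (X * stY Ω χ P I)
      = X * (I 1 - P.φ ^ 3 * P.ω * stY Ω χ P I) := by rw [hsm]; ring
    rw [srcI, srcI, hY, this, shf_mul, shf_of_ave Ω hX]; ring
  have hI3 : stI Ω χ P (X • I) = X * stI Ω χ P I := by
    rw [stI, sI, hS.sol_mul _ hX (fin_srcI hS hP hI), stI, hsm]; ring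
  have sG : P.q * stI Ω χ P (X • I) + (X • I) 4 = X * (P.q * stI Ω χ P I + I 4) := by
    rw [hI3, hsm]; ring
  have hG : stG Ω χ P (X • I) = X * stG Ω χ P I := by
    rw [stG, sG, hS.sol_mul _ hX (fin_srcG hS hP hI), stG]
  refine ⟨hJ, hY, hI3, hG, ?_⟩
  have s3 : P.φ * stY Ω χ P (X • I) + (X • I) 3 = X * (P.φ * stY Ω χ P I + I 3) := by
    rw [hY, hsm]; ring
  funext k
  fin_cases k
  · simp only [res, Pi.smul_apply, smul_eq_mul, Fin.zero_eta, Matrix.cons_val]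
    rw [ave_mul_of_ave hX]; ring
  · simp only [res, Pi.smul_apply, smul_eq_mul, Fin.mk_one, Matrix.cons_val]
    rw [show P.q * stJ Ω χ (X • I) + X * I 2 = X * (P.q * stJ Ω χ I + I 2) from sY,
      ave_mul_of_ave hX]; ring
  · simp only [res, Pi.smul_apply, smul_eq_mul, Fin.reduceFinMk, Matrix.cons_val]
    rw [show P.φ * stY Ω χ P (X • I) + X * I 3 = X * (P.φ * stY Ω χ P I + I 3) from s3,
      ave_mul_of_ave hX]
  · simp only [res, Pi.smul_apply, smul_eq_mul, Fin.reduceFinMk, Matrix.cons_val]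
    rw [sI, ave_mul_of_ave hX]; ring
  · simp only [res, Pi.smul_apply, smul_eq_mul, Fin.reduceFinMk, Matrix.cons_val]
    rw [show P.q * stI Ω χ P (X • I) + X * I 4 = X * (P.q * stI Ω χ P I + I 4) from sG,
      ave_mul_of_ave hX]

end chain

section bounds

variable {E : ℝ≥0∞} {a b : ℕ}

theorem bd_up (hΛ : 2 ≤ Λ) (h : nrm ρ f ≤ Λ ^ a * E) (hab : a ≤ b) : nrm ρ f ≤ Λ ^ b * E :=
  h.trans (mul_le_mul_left (pow_le_pow_right₀ (one_le_two.trans hΛ) hab) _)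

theorem two_mul_le_pow (hΛ : 2 ≤ Λ) (a : ℕ) : Λ ^ a * E + Λ ^ a * E ≤ Λ ^ (a + 1) * E := by
  calc Λ ^ a * E + Λ ^ a * E = 2 * (Λ ^ a * E) := by ring
    _ ≤ Λ * (Λ ^ a * E) := by gcongr
    _ = _ := by ring

theorem bd_add (hΛ : 2 ≤ Λ) (hf : nrm ρ f ≤ Λ ^ a * E) (hg : nrm ρ g ≤ Λ ^ a * E) : nrm ρ (f + g) ≤ Λ ^
    (a + 1) * E := (N_add_le _ _).trans ((add_le_add hf hg).trans (two_mul_le_pow hΛ a))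

theorem bd_sub (hΛ : 2 ≤ Λ) (hf : nrm ρ f ≤ Λ ^ a * E) (hg : nrm ρ g ≤ Λ ^ a * E) : nrm ρ (f - g) ≤ Λ ^
    (a + 1) * E := (N_sub_le _ _).trans ((add_le_add hf hg).trans (two_mul_le_pow hΛ a))

theorem bd_mul (hρ : 0 ≤ ρ) (hf : nrm ρ f ≤ Λ ^ a) (hg : nrm ρ g ≤ Λ ^ b * E) : nrm ρ (f * g) ≤ Λ ^ (a + b)
    * E := (nrm_mul_le hρ _ _).trans ((mul_le_mul' hf hg).trans (by rw [pow_add, mul_assoc]))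

theorem bd_sol (hS : SmallDiv Ω C p) (hδ : 0 < δ) (hL : ofReal (C * δ⁻¹ ^ p) ≤ Λ) (χ : ℝ)
    (hf : nrm (ρ + δ) f ≤ Λ ^ b * E) : nrm ρ (sol Ω χ f) ≤ Λ ^ (b + 1) * E :=
  (hS.nrm_sol hδ ρ χ f).trans ((mul_le_mul' hL hf).trans (by rw [pow_succ']; exact (mul_assoc _ _ _).symm.le))

/-- Estimates for the triangular system. -/
theorem chain_bound (hS : SmallDiv Ω C p) (hδ : 0 < δ) (hρ : 0 ≤ ρ) (hΛ : 2 ≤ Λ)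
    (hL : ofReal (C * δ⁻¹ ^ p) ≤ Λ) (hχ : ‖(χ : ℂ)‖ₑ ≤ Λ) (hχ1 : ‖1 - (χ : ℂ)‖ₑ ≤ Λ)
    (hχ2 : ‖1 - (χ : ℂ)⁻¹‖ₑ ≤ Λ) (hχ3 : ‖1 - (χ : ℂ) ^ 2‖ₑ ≤ Λ) {P : Pt n} (hφ : nrm (ρ + 4 * δ) P.φ ≤ Λ)
    (hq : nrm (ρ + 4 * δ) P.q ≤ Λ) (hω : nrm (ρ + 4 * δ) P.ω ≤ Λ) (hI : ∀ k, nrm (ρ + 4 * δ) (I k) ≤ E) :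
    nrm ρ (stJ Ω χ I) ≤ Λ ^ 20 * E ∧ nrm ρ (stY Ω χ P I) ≤ Λ ^ 20 * E ∧ nrm ρ (stI Ω χ P I) ≤ Λ ^ 20 * E ∧
    nrm ρ (stG Ω χ P I) ≤ Λ ^ 20 * E ∧ ∀ k, nrm ρ (res Ω χ P I k) ≤ Λ ^ 20 * E := by
  have hI0 : ∀ (ρ' : ℝ), ρ' ≤ ρ + 4 * δ → ∀ k, nrm ρ' (I k) ≤ Λ ^ 0 * E := fun ρ' h k => by
    rw [pow_zero, one_mul]; exact (nrm_mono h _).trans (hI k)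
  have hP1 : ∀ (ρ' : ℝ), ρ' ≤ ρ + 4 * δ → ∀ {f : Ser n}, nrm (ρ + 4 * δ) f ≤ Λ →
      nrm ρ' f ≤ Λ ^ 1 := fun ρ' h f hf => by rw [pow_one]; exact (nrm_mono h _).trans hf
  have hφ3 : nrm (ρ + 2 * δ) (P.φ ^ 3 * P.ω) ≤ Λ ^ 4 := by
    refine (nrm_mul_le (by positivity) _ _).trans ?_
    calc _ ≤ Λ ^ 3 * Λ := mul_le_mul' ((nrm_pow_le (by positivity) _ _).trans
          (pow_le_pow_left' ((nrm_mono (by linarith) _).trans hφ) _))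
          ((nrm_mono (by linarith) _).trans hω)
      _ = _ := by ring
  have hJ : nrm (ρ + 3 * δ) (stJ Ω χ I) ≤ Λ ^ 2 * E := by
    refine bd_add hΛ (bd_sol hS hδ hL χ ?_) (bd_up hΛ (hI0 _ (by linarith) 5) zero_le_one)
    rw [nrm_shf]; exact hI0 _ (by linarith) 0
  have hsY : nrm (ρ + 3 * δ) (P.q * stJ Ω χ I + I 2) ≤ Λ ^ 4 * E :=
    bd_add hΛ (bd_mul (by positivity) (hP1 _ (by linarith) hq) hJ)
      (bd_up hΛ (hI0 _ (by linarith) 2) (by norm_num))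
  have hY : nrm (ρ + 2 * δ) (stY Ω χ P I) ≤ Λ ^ 6 * E := by
    refine bd_add hΛ (bd_sol hS hδ hL _ ?_) (bd_up hΛ (hI0 _ (by linarith) 6) (by norm_num))
    rw [show ρ + 2 * δ + δ = ρ + 3 * δ by ring]; exact hsY
  have hsI : nrm (ρ + 2 * δ) (srcI Ω χ P I) ≤ Λ ^ 12 * E := by
    refine bd_mul (a := 1) (b := 11) (by positivity) (by rw [nrm_cst, pow_one]; exact hχ) ?_
    rw [nrm_shf]
    exact bd_sub hΛ (bd_up hΛ (hI0 _ (by linarith) 1) (by norm_num)) (bd_mul (by positivity) hφ3 hY)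
  have hI3 : nrm (ρ + δ) (stI Ω χ P I) ≤ Λ ^ 14 * E := by
    refine bd_add hΛ (bd_sol hS hδ hL _ ?_) (bd_up hΛ (hI0 _ (by linarith) 7) (by norm_num))
    rw [show ρ + δ + δ = ρ + 2 * δ by ring]; exact hsI
  have hsG : nrm (ρ + δ) (P.q * stI Ω χ P I + I 4) ≤ Λ ^ 16 * E :=
    bd_add hΛ (bd_mul (a := 1) (by positivity) (hP1 _ (by linarith) hq) hI3)
      (bd_up hΛ (hI0 _ (by linarith) 4) (by norm_num))
  have hG : nrm ρ (stG Ω χ P I) ≤ Λ ^ 17 * E := bd_sol hS hδ hL _ hsG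
  have hav : ∀ {f : Ser n} {ρ' : ℝ} {a : ℕ}, nrm ρ' f ≤ Λ ^ a * E →
      nrm ρ (ave f) ≤ Λ ^ a * E := fun h => (nrm_ave_le _).trans h
  refine ⟨bd_up hΛ ((nrm_mono (by linarith) _).trans hJ) (by norm_num),
    bd_up hΛ ((nrm_mono (by linarith) _).trans hY) (by norm_num),
    bd_up hΛ ((nrm_mono (by linarith) _).trans hI3) (by norm_num),
    bd_up hΛ hG (by norm_num), ?_⟩
  have hc : ∀ c : ℂ, ‖c‖ₑ ≤ Λ → ∀ k, nrm ρ (cst c * I k) ≤ Λ ^ 1 * E := fun c hc k =>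
    bd_mul (a := 1) (b := 0) hρ (by rw [nrm_cst, pow_one]; exact hc) (hI0 _ (by linarith) k)
  intro k
  fin_cases k
  · exact bd_up hΛ (bd_sub hΛ (bd_up hΛ (hav (hI0 ρ (by linarith) 0)) zero_le_one)
      (hc _ hχ1 5)) (by norm_num)
  · exact bd_up hΛ (bd_sub hΛ (hav hsY) (bd_up hΛ (hc _ hχ2 6) (by norm_num))) (by norm_num)
  · exact bd_up hΛ (hav (bd_add hΛ (bd_mul (a := 1) (by positivity)
      (hP1 (ρ + 2 * δ) (by linarith) hφ) hY) (bd_up hΛ (hI0 _ (by linarith) 3) (by norm_num))))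
      (by norm_num)
  · exact bd_up hΛ (bd_sub hΛ (hav hsI) (bd_up hΛ (hc _ hχ3 7) (by norm_num))) (by norm_num)
  · exact bd_up hΛ (hav hsG) (by norm_num)

end bounds

section matrix

theorem exists_inv_near {A : Type*} [NormedCommRing A] [CompleteSpace A] {m : ℕ}
    (M₀ : Matrix (Fin m) (Fin m) A) (h : IsUnit M₀.det) : ∃ ε K : ℝ, 0 < ε ∧ 0 < K ∧ ∀ M : Matrix (Fin m)
    (Fin m) A, (∀ i j, ‖M i j - M₀ i j‖ < ε) → IsUnit M.det ∧ ∀ i j, ‖M⁻¹ i j‖ ≤ K := by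
  have hdet : Continuous fun M : Fin m → Fin m → A => Matrix.det (M : Matrix (Fin m) (Fin m) A) :=
    Continuous.matrix_det (A := fun M : Fin m → Fin m → A => (M : Matrix (Fin m) (Fin m) A)) continuous_id
  have h1 : ∀ᶠ M : Fin m → Fin m → A in 𝓝 (fun i j => M₀ i j),
      IsUnit (Matrix.det (M : Matrix (Fin m) (Fin m) A)) :=
    hdet.continuousAt.eventually (Units.isOpen.mem_nhds h)
  have h2 : ∀ i j, ContinuousAt (fun M : Fin m → Fin m → A =>
      ‖(Matrix.of M)⁻¹ i j‖) (fun i j => M₀ i j) := by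
    intro i j
    have hadj : Continuous fun M : Fin m → Fin m → A =>
        Matrix.adjugate (M : Matrix (Fin m) (Fin m) A) :=
      Continuous.matrix_adjugate (A := fun M : Fin m → Fin m → A => (M : Matrix (Fin m) (Fin m) A))
        continuous_id
    have hinv : ContinuousAt (fun M : Fin m → Fin m → A =>
        Ring.inverse (Matrix.det (M : Matrix (Fin m) (Fin m) A))) (fun i j => M₀ i j) := by
      obtain ⟨x, hx⟩ := h
      have := NormedRing.inverse_continuousAt x
      rw [hx] at this
      exact ContinuousAt.comp (f := fun M : Fin m → Fin m → A =>
        Matrix.det (M : Matrix (Fin m) (Fin m) A)) this hdet.continuousAt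
    have : (fun M : Fin m → Fin m → A => ‖(Matrix.of M)⁻¹ i j‖)
        = fun M : Fin m → Fin m → A => ‖Ring.inverse (Matrix.det (M : Matrix (Fin m) (Fin m) A))
          * Matrix.adjugate (M : Matrix (Fin m) (Fin m) A) i j‖ := by
      funext M; rw [Matrix.inv_def]; rfl
    rw [this]
    exact (hinv.mul (hadj.matrix_elem i j).continuousAt).norm
  set b : Fin m → Fin m → ℝ := fun i j => ‖M₀⁻¹ i j‖ with hb
  have hb0 : ∀ i j, 0 ≤ b i j := fun _ _ => norm_nonneg _
  set K : ℝ := (∑ i, ∑ j, b i j) + 1 with hK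
  have hK0 : ∀ i j, b i j < K := fun i j => by
    have h3 := Finset.single_le_sum (f := b i) (fun _ _ => hb0 _ _) (Finset.mem_univ j)
    have h4 := Finset.single_le_sum (f := fun i => ∑ j, b i j)
      (fun _ _ => Finset.sum_nonneg fun _ _ => hb0 _ _) (Finset.mem_univ i)
    linarith
  have h3 : ∀ᶠ M : Fin m → Fin m → A in 𝓝 (fun i j => M₀ i j),
      ∀ i j, ‖(Matrix.of M)⁻¹ i j‖ < K := by
    rw [eventually_all]; intro i
    rw [eventually_all]; intro j
    exact (h2 i j).eventually_lt_const (hK0 i j)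
  obtain ⟨ε, hε, H⟩ := Metric.eventually_nhds_iff.1 (h1.and h3)
  refine ⟨ε, K, hε, ?_, fun M hM => ?_⟩
  · have : 0 ≤ ∑ i, ∑ j, b i j :=
      Finset.sum_nonneg fun _ _ => Finset.sum_nonneg fun _ _ => hb0 _ _
    linarith
  · have := H (y := fun i j => M i j) (by
      rw [dist_pi_lt_iff hε]; intro i
      rw [dist_pi_lt_iff hε]; intro j
      rw [dist_eq_norm]; exact hM i j)
    exact ⟨this.1, fun i j => (this.2 i j).le⟩

end matrix

variable {P : Pt n}

section matrix

/-- The unit inputs of the triangular system for the five scalar unknowns. -/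
def unitInp (φ v : Ser n) : Fin 5 → Fin 8 → Ser n :=
  ![![-(φ * v), -(φ ^ 2), 0, 0, 0, 0, 0, 0], ![-φ, 0, 0, 0, 0, 0, 0, 0],
    ![0, 0, 0, 0, 0, 1, 0, 0], ![0, 0, 0, 0, 0, 0, 1, 0], ![0, 0, 0, 0, 0, 0, 0, 1]]

/-- The matrix of the scalar linear system. -/
def mat (Ω : Vec n) (χ : ℝ) (P : Pt n) (v : Ser n) :
    Matrix (Fin 5) (Fin 5) (Ser n) :=
  Matrix.of fun b a => res Ω χ P (unitInp P.φ v a) b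

theorem fin_unitInp (hφ : Fin' φ) (hv : Fin' v) (a : Fin 5) (k : Fin 8) : Fin' (unitInp φ v a k) := by
  fin_cases a <;> fin_cases k <;> first
    | exact Fin'.zero
    | exact Fin'.one
    | exact (hφ.mul hv).neg
    | exact (hφ.pow 2).neg
    | exact hφ.neg

theorem exists_mul_le {K : ℝ≥0∞} (hK : K ≠ ∞) (hε : 0 < ε) : ∃ η : ℝ≥0∞, 0 < η ∧ η ≤ 1 ∧ K * η ≤ ε := by
  refine ⟨min 1 (ε / (K + 1)), lt_min one_pos (ENNReal.div_pos hε.ne' (by finiteness)),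
    min_le_left _ _, ?_⟩
  calc K * min 1 (ε / (K + 1)) ≤ (K + 1) * (ε / (K + 1)) := by
        gcongr
        · exact le_self_add
        · exact min_le_right _ _
    _ ≤ ε := ENNReal.mul_div_le

theorem le_of_sub_le {f₀ : Ser n} (h : nrm ρ (f - f₀) ≤ ε) : nrm ρ f ≤ nrm ρ f₀ + ε := by
  have : f = f₀ + (f - f₀) := by ring
  rw [this]; exact (N_add_le _ _).trans (by gcongr)

/-- Entrywise comparison of the unit inputs at two base points. -/
theorem unitInp_rel {Q : Ser n → Ser n → Prop} {φ' v' : Ser n} (h0 : Q 0 0) (h1 : Q 1 1)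
    (h2 : Q (-(φ * v)) (-(φ' * v'))) (h3 : Q (-(φ ^ 2)) (-(φ' ^ 2))) (h4 : Q (-φ) (-φ')) (a : Fin 5)
    (k : Fin 8) : Q (unitInp φ v a k) (unitInp φ' v' a k) := by
  fin_cases a <;> fin_cases k <;> first
    | exact h0
    | exact h1
    | exact h2
    | exact h3
    | exact h4

theorem unitInp_const (φ v : Ser n) (a : Fin 5) {k : Fin 8} (hk : k = 5 ∨ k = 6 ∨ k = 7) : ave
    (unitInp φ v a k) = unitInp φ v a k := by
  rcases hk with rfl | rfl | rfl <;> fin_cases a <;> simp [unitInp, ave_zero, ave_one]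

theorem diffInp_bound (hR : 0 ≤ R) (b1 : 2 ≤ Λ) {P' : Pt n} {I' : Fin 8 → Ser n}
    (hI : ∀ k, nrm R (I k - I' k) ≤ Λ ^ 30 * ε) (cube : nrm R (P.φ ^ 3 * P.ω - P'.φ ^ 3 * P'.ω) ≤ Λ ^ 6 * ε)
    (hφ : nrm R (P.φ - P'.φ) ≤ Λ ^ 0 * ε) (hq : nrm R (P.q - P'.q) ≤ Λ ^ 0 * ε)
    (hJ : nrm R (stJ Ω χ I') ≤ Λ ^ 22) (hY : nrm R (stY Ω χ P' I') ≤ Λ ^ 22)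
    (hG : nrm R (stI Ω χ P' I') ≤ Λ ^ 22) (k : Fin 8) : nrm R (diffInp Ω χ P P' I I' k) ≤ Λ ^ 40 * ε := by
  have mulY : ∀ {f g : Ser n} {b : ℕ}, nrm R f ≤ Λ ^ b * ε → nrm R g ≤ Λ ^ 22 →
      nrm R (f * g) ≤ Λ ^ (22 + b) * ε := fun hf hg => by
    rw [mul_comm]; exact bd_mul hR hg hf
  have h0 : ∀ k, nrm R (I k - I' k) ≤ Λ ^ 40 * ε := fun k => bd_up b1 (hI k) (by norm_num)
  fin_cases k
  · exact h0 0
  · exact bd_up b1 (bd_sub b1 (hI 1) (bd_up b1 (mulY cube hY) (by norm_num))) (by norm_num)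
  · exact bd_up b1 (bd_add b1 (hI 2) (bd_up b1 (mulY hq hJ) (by norm_num))) (by norm_num)
  · exact bd_up b1 (bd_add b1 (hI 3) (bd_up b1 (mulY hφ hY) (by norm_num))) (by norm_num)
  · exact bd_up b1 (bd_add b1 (hI 4) (bd_up b1 (mulY hq hG) (by norm_num))) (by norm_num)
  · exact h0 5
  · exact h0 6
  · exact h0 7

theorem mat_sub_le (hS : SmallDiv Ω C p) (hR : 0 < R) {P₀ : Pt n} {v₀ : Ser n} (hΛt : Λ ≠ ∞) (b1 : 2 ≤ Λ)
    (b2 : ofReal (C * (R / 8)⁻¹ ^ p) ≤ Λ) (b3 : ‖(χ : ℂ)‖ₑ ≤ Λ) (b4 : ‖1 - (χ : ℂ)‖ₑ ≤ Λ)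
    (b5 : ‖1 - (χ : ℂ)⁻¹‖ₑ ≤ Λ) (b6 : ‖1 - (χ : ℂ) ^ 2‖ₑ ≤ Λ) (c1 : nrm R P.φ ≤ Λ) (c2 : nrm R P.q ≤ Λ)
    (c3 : nrm R P.ω ≤ Λ) (c4 : nrm R v ≤ Λ) (d1 : nrm R P₀.φ ≤ Λ) (d2 : nrm R P₀.q ≤ Λ)
    (d3 : nrm R P₀.ω ≤ Λ) (d4 : nrm R v₀ ≤ Λ) (hφ : nrm R (P.φ - P₀.φ) ≤ ε) (hq : nrm R (P.q - P₀.q) ≤ ε)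
    (hω : nrm R (P.ω - P₀.ω) ≤ ε) (hv : nrm R (v - v₀) ≤ ε) (i a : Fin 5) : ‖mat Ω χ P v i a - mat Ω χ P₀ v₀
    i a‖ₑ ≤ Λ ^ 60 * ε := by
  have fin : ∀ {f : Ser n}, nrm R f ≤ Λ → Fin' f := fun h =>
    ⟨R, hR, ne_top_of_le_ne_top hΛt h⟩
  have hP : P.Ok := ⟨fin c1, fin c2, fin c3⟩
  have hP₀ : P₀.Ok := ⟨fin d1, fin d2, fin d3⟩
  have hR0 := hR.le
  have hd := chain_diff (χ := χ) hS hP hP₀ (fin_unitInp (fin c1) (fin c4) a)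
    (fin_unitInp (fin d1) (fin d4) a)
  have hd1 := congrFun hd.2.2.2.2.2 i
  have e1 : mat Ω χ P v i a - mat Ω χ P₀ v₀ i a
      = res Ω χ P (diffInp Ω χ P P₀ (unitInp P.φ v a) (unitInp P₀.φ v₀ a)) i := by
    rw [mat, mat, Matrix.of_apply, Matrix.of_apply, hd1, Pi.add_apply]; ring
  have hone : (1 : ℝ≥0∞) ≤ Λ := one_le_two.trans b1
  have hmul : ∀ {f g : Ser n}, nrm R f ≤ Λ → nrm R g ≤ Λ → nrm R (f * g) ≤ Λ ^ 2 :=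
    fun hf hg => (nrm_mul_le hR0 _ _).trans (by rw [sq]; exact mul_le_mul' hf hg)
  have hu0 : ∀ k, nrm R (unitInp P₀.φ v₀ a k) ≤ Λ ^ 2 := by
    refine unitInp_rel (Q := fun f _ => nrm R f ≤ Λ ^ 2) (φ' := P₀.φ) (v' := v₀) ?_ ?_ ?_ ?_ ?_ a
    · exact (N_zero (w := wt n R)).le.trans zero_le
    · exact (nrm_one R).le.trans (one_le_pow₀ hone)
    · exact (N_neg (w := wt n R) _).le.trans (hmul d1 d4)
    · exact (N_neg (w := wt n R) _).le.trans ((congrArg (nrm R) (sq P₀.φ)).le.trans (hmul d1 d1))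
    · exact (N_neg (w := wt n R) _).le.trans (d1.trans (le_self_pow₀ hone two_ne_zero))
  have hRR : R / 2 + 4 * (R / 8) = R := by ring
  have hRR' : 0 + 4 * (R / 8) = R / 2 := by ring
  have hc0 := chain_bound hS (δ := R / 8) (ρ := R / 2) (by positivity) (by positivity) b1 b2
    b3 b4 b5 b6 (P := P₀) (by rwa [hRR]) (by rwa [hRR]) (by rwa [hRR])
    (I := unitInp P₀.φ v₀ a) (E := Λ ^ 2) (by rwa [hRR])
  obtain ⟨hJ, hY, hI, -, -⟩ := hc0
  rw [← pow_add] at hJ hY hI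
  have mo : ∀ {f : Ser n} {x : ℝ≥0∞}, nrm R f ≤ x → nrm (R / 2) f ≤ x := fun h =>
    (nrm_mono (by linarith) _).trans h
  have hR2 : 0 ≤ R / 2 := by positivity
  have m1 : ∀ {f : Ser n}, nrm R f ≤ Λ → nrm (R / 2) f ≤ Λ ^ 1 := fun h => by
    rw [pow_one]; exact mo h
  have m0 : ∀ {f : Ser n}, nrm R f ≤ ε → nrm (R / 2) f ≤ Λ ^ 0 * ε := fun h => by
    rw [pow_zero, one_mul]; exact mo h
  have cube : nrm (R / 2) ((P.φ ^ 3 * P.ω - P₀.φ ^ 3 * P₀.ω)) ≤ Λ ^ 6 * ε := by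
    have : P.φ ^ 3 * P.ω - P₀.φ ^ 3 * P₀.ω = P.φ * P.φ * P.ω * (P.φ - P₀.φ)
      + (P.φ * P₀.φ * P.ω * (P.φ - P₀.φ)
        + (P₀.φ * P₀.φ * P.ω * (P.φ - P₀.φ) + P₀.φ * P₀.φ * P₀.φ * (P.ω - P₀.ω))) := by ring
    rw [this]
    have m3 : ∀ {f g h : Ser n}, nrm R f ≤ Λ → nrm R g ≤ Λ → nrm R h ≤ Λ →
        nrm (R / 2) (f * g * h) ≤ Λ ^ 3 := fun hf hg hh => by
      refine mo ((nrm_mul_le hR0 _ _).trans ((mul_le_mul' ((nrm_mul_le hR0 _ _).trans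
        (mul_le_mul' hf hg)) hh).trans (le_of_eq ?_)))
      ring
    exact bd_add b1 (bd_up b1 (bd_mul hR2 (m3 c1 c1 c3) (m0 hφ)) (by norm_num))
      (bd_add b1 (bd_up b1 (bd_mul hR2 (m3 c1 d1 c3) (m0 hφ)) (by norm_num))
        (bd_add b1 (bd_mul hR2 (m3 d1 d1 c3) (m0 hφ)) (bd_mul hR2 (m3 d1 d1 d1) (m0 hω))))
  have hu : ∀ k, nrm (R / 2) (unitInp P.φ v a k - unitInp P₀.φ v₀ a k) ≤ Λ ^ 30 * ε := by
    refine unitInp_rel (Q := fun f g => nrm (R / 2) (f - g) ≤ Λ ^ 30 * ε) ?_ ?_ ?_ ?_ ?_ a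
    · rw [sub_self, nrm, N_zero]; exact zero_le
    · rw [sub_self, nrm, N_zero]; exact zero_le
    · have : -(P.φ * v) - -(P₀.φ * v₀) = -(P.φ * (v - v₀) + v₀ * (P.φ - P₀.φ)) := by ring
      rw [this, nrm, N_neg]
      exact bd_up b1 (bd_add b1 (bd_mul hR2 (m1 c1) (m0 hv)) (bd_mul hR2 (m1 d4) (m0 hφ))) (by norm_num)
    · have : -P.φ ^ 2 - -P₀.φ ^ 2 = -(P.φ * (P.φ - P₀.φ) + P₀.φ * (P.φ - P₀.φ)) := by ring
      rw [this, nrm, N_neg]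
      exact bd_up b1 (bd_add b1 (bd_mul hR2 (m1 c1) (m0 hφ)) (bd_mul hR2 (m1 d1) (m0 hφ))) (by norm_num)
    · have : -P.φ - -P₀.φ = -(P.φ - P₀.φ) := by ring
      rw [this, nrm, N_neg]
      exact bd_up b1 (m0 hφ) (by norm_num)
  have hdiff := diffInp_bound (Ω := Ω) (χ := χ) hR2 b1 hu cube (m0 hφ) (m0 hq) hJ hY hI
  have hfin := (chain_bound hS (δ := R / 8) (ρ := 0) (by positivity) le_rfl b1 b2
    b3 b4 b5 b6 (P := P) (by rw [hRR']; exact mo c1) (by rw [hRR']; exact mo c2)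
    (by rw [hRR']; exact mo c3)
    (I := diffInp Ω χ P P₀ (unitInp P.φ v a) (unitInp P₀.φ v₀ a)) (E := Λ ^ 40 * ε)
    (by rwa [hRR'])).2.2.2.2 i
  rw [e1, ← nrm_zero_width]
  exact hfin.trans (le_of_eq (by ring))

theorem mat_near (hS : SmallDiv Ω C p) (χ : ℝ) (hR : 0 < R) {P₀ : Pt n} {v₀ : Ser n} (hφ₀ : nrm R P₀.φ ≠ ∞)
    (hq₀ : nrm R P₀.q ≠ ∞) (hω₀ : nrm R P₀.ω ≠ ∞) (hv₀ : nrm R v₀ ≠ ∞) (hdet : IsUnit (mat Ω χ P₀ v₀).det) :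
    ∃ ε K : ℝ≥0∞, 0 < ε ∧ K ≠ ∞ ∧ ∀ (P : Pt n) (v : Ser n), nrm R (P.φ - P₀.φ) ≤ ε → nrm R (P.q - P₀.q) ≤ ε
    → nrm R (P.ω - P₀.ω) ≤ ε → nrm R (v - v₀) ≤ ε → IsUnit (mat Ω χ P v).det ∧ ∀ i j, ‖(mat Ω χ P v)⁻¹ i j‖ₑ
    ≤ K := by
  obtain ⟨ε₁, K₁, hε₁, hK₁, H⟩ := exists_inv_near _ hdet
  set Λ : ℝ≥0∞ := 2 + ofReal (C * (R / 8)⁻¹ ^ p) + ‖(χ : ℂ)‖ₑ + ‖1 - (χ : ℂ)‖ₑ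
    + ‖1 - (χ : ℂ)⁻¹‖ₑ + ‖1 - (χ : ℂ) ^ 2‖ₑ + (nrm R P₀.φ + 1) + (nrm R P₀.q + 1)
    + (nrm R P₀.ω + 1) + (nrm R v₀ + 1) with hΛ
  have hΛt : Λ ≠ ∞ := by finiteness
  have b1 : 2 ≤ Λ := by rw [hΛ]; iterate 9 apply le_add_right
                        exact le_rfl
  have b2 : ofReal (C * (R / 8)⁻¹ ^ p) ≤ Λ := by
    rw [hΛ]; iterate 8 apply le_add_right
    exact le_add_self
  have b3 : ‖(χ : ℂ)‖ₑ ≤ Λ := by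
    rw [hΛ]; iterate 7 apply le_add_right
    exact le_add_self
  have b4 : ‖1 - (χ : ℂ)‖ₑ ≤ Λ := by
    rw [hΛ]; iterate 6 apply le_add_right
    exact le_add_self
  have b5 : ‖1 - (χ : ℂ)⁻¹‖ₑ ≤ Λ := by
    rw [hΛ]; iterate 5 apply le_add_right
    exact le_add_self
  have b6 : ‖1 - (χ : ℂ) ^ 2‖ₑ ≤ Λ := by
    rw [hΛ]; iterate 4 apply le_add_right
    exact le_add_self
  have b7 : nrm R P₀.φ + 1 ≤ Λ := by
    rw [hΛ]; iterate 3 apply le_add_right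
    exact le_add_self
  have b8 : nrm R P₀.q + 1 ≤ Λ := by
    rw [hΛ]; iterate 2 apply le_add_right
    exact le_add_self
  have b9 : nrm R P₀.ω + 1 ≤ Λ := by
    rw [hΛ]; apply le_add_right
    exact le_add_self
  have b10 : nrm R v₀ + 1 ≤ Λ := by
    rw [hΛ]; exact le_add_self
  obtain ⟨ε, hε, hε1, hεK⟩ := exists_mul_le (K := Λ ^ 60) (by finiteness)
    (ENNReal.ofReal_pos.2 (half_pos hε₁))
  refine ⟨ε, ofReal K₁, hε, ofReal_ne_top, fun P v hφ hq hω hv => ?_⟩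
  have c1 : nrm R P.φ ≤ Λ := (le_of_sub_le hφ).trans (le_trans (by gcongr) b7)
  have c2 : nrm R P.q ≤ Λ := (le_of_sub_le hq).trans (le_trans (by gcongr) b8)
  have c3 : nrm R P.ω ≤ Λ := (le_of_sub_le hω).trans (le_trans (by gcongr) b9)
  have c4 : nrm R v ≤ Λ := (le_of_sub_le hv).trans (le_trans (by gcongr) b10)
  have d1 : nrm R P₀.φ ≤ Λ := le_self_add.trans b7
  have d2 : nrm R P₀.q ≤ Λ := le_self_add.trans b8
  have d3 : nrm R P₀.ω ≤ Λ := le_self_add.trans b9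
  have d4 : nrm R v₀ ≤ Λ := le_self_add.trans b10
  have key : ∀ i j, ‖mat Ω χ P v i j - mat Ω χ P₀ v₀ i j‖ < ε₁ := by
    intro i a
    have h5 := (mat_sub_le hS hR hΛt b1 b2 b3 b4 b5 b6 c1 c2 c3 c4 d1 d2 d3 d4 hφ hq hω hv i a).trans hεK
    rw [← ofReal_norm, ENNReal.ofReal_le_ofReal_iff (by positivity)] at h5
    linarith
  obtain ⟨h1, h2⟩ := H _ key
  refine ⟨h1, fun i j => ?_⟩
  rw [← ofReal_norm]
  exact ofReal_le_ofReal (h2 i j)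

end matrix

section vanishing

/-- Divisibility by the expansion parameter. -/
def Van (f : Ser n) : Prop := ∀ k, f (k, 0) = 0

theorem Van.add (hf : Van f) (hg : Van g) : Van (f + g) := fun k => by
  rw [add_apply, hf k, hg k, add_zero]

theorem Van.neg (hf : Van f) : Van (-f) := fun k => by
  rw [neg_apply, hf k, neg_zero]

theorem Van.sub (hf : Van f) (hg : Van g) : Van (f - g) := fun k => by
  rw [sub_apply, hf k, hg k, sub_zero]

theorem Van.zero : Van (0 : Ser n) := fun _ => rfl

theorem Van.mul (hg : Van g) (f : Ser n) : Van (f * g) := fun k => by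
  rw [mul_apply]
  refine (tsum_congr fun p => ?_).trans tsum_zero
  split_ifs with h
  · have h2 : p.2.2 = 0 := (Nat.add_eq_zero_iff.1 (congrArg Prod.snd h)).2
    rw [show p.2 = (p.2.1, 0) from Prod.ext rfl h2, hg, mul_zero]
  · rfl

theorem Van.diag (hf : Van f) (c : Idx n → ℂ) : Van (diag c f) := fun k => by
  by_cases h : DiagDom c f
  · rw [diag_apply h, hf k, mul_zero]
  · rw [diag_of_not h, zero_apply]

theorem Van.shf (hf : Van f) (Ω : Vec n) : Van (shf Ω f) := hf.diag _

theorem Van.ave (hf : Van f) : Van (ave f) := hf.diag _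

theorem Van.sol (hf : Van f) (Ω : Vec n) (χ : ℝ) : Van (sol Ω χ f) := hf.diag _

theorem Van.tsum {α : Type*} {F : α → Ser n} (hF : Summable F) (h : ∀ a, Van (F a)) : Van (∑' a, F a) := fun k => by
  rw [tsum_apply hF]; simp only [h _ k, tsum_zero]

theorem Van.sum {α : Type*} {s : Finset α} {F : α → Ser n} (h : ∀ a, Van (F a)) : Van (∑ a ∈ s, F a) := by
  classical
  induction s using Finset.induction_on with
  | empty => rw [Finset.sum_empty]; exact Van.zero
  | insert a s ha ih => rw [Finset.sum_insert ha]; exact (h a).add ih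

theorem van_chain (Ω : Vec n) (χ : ℝ) (P : Pt n) (hI : ∀ k, Van (I k)) : Van (stY Ω χ P I) ∧ Van
    (stG Ω χ P I) ∧ ∀ b, Van (res Ω χ P I b) := by
  have hJ : Van (stJ Ω χ I) := (((hI 0).shf Ω).sol Ω χ).add (hI 5)
  have sY : Van (P.q * stJ Ω χ I + I 2) := (hJ.mul _).add (hI 2)
  have hY : Van (stY Ω χ P I) := (sY.sol Ω _).add (hI 6)
  have sI : Van (srcI Ω χ P I) := (((hI 1).sub (hY.mul _)).shf Ω).mul _
  have hI3 : Van (stI Ω χ P I) := (sI.sol Ω _).add (hI 7)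
  have sG : Van (P.q * stI Ω χ P I + I 4) := (hI3.mul _).add (hI 4)
  refine ⟨hY, sG.sol Ω _, fun b => ?_⟩
  fin_cases b
  · exact ((hI 0).ave).sub ((hI 5).mul _)
  · exact sY.ave.sub ((hI 6).mul _)
  · exact ((hY.mul _).add (hI 3)).ave
  · exact sI.ave.sub ((hI 7).mul _)
  · exact sG.ave

end vanishing

section linear

theorem ave_res (h5 : ave (I 5) = I 5) (h6 : ave (I 6) = I 6) (h7 : ave (I 7) = I 7) (k : Fin 5) : ave
    (res Ω χ P I k) = res Ω χ P I k := by
  have hc : ∀ (c : ℂ) {f : Ser n}, ave f = f → ave (cst c * f) = cst c * f := fun c f hf => by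
    rw [ave_mul_of_ave (ave_cst c), hf]
  fin_cases k <;> simp only [res, Fin.zero_eta, Fin.mk_one, Fin.reduceFinMk, Matrix.cons_val,
    ave_sub, ave_ave]
  · rw [hc _ h5]
  · rw [hc _ h6]
  · rw [hc _ h7]

theorem ave_mat (b a : Fin 5) : ave (mat Ω χ P v b a) = mat Ω χ P v b a := by
  rw [mat, Matrix.of_apply]
  exact ave_res (I := unitInp P.φ v a) (unitInp_const P.φ v a (Or.inl rfl))
    (unitInp_const P.φ v a (Or.inr (Or.inl rfl))) (unitInp_const P.φ v a (Or.inr (Or.inr rfl))) b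

theorem nrm_source_le (hρ : 0 ≤ ρ) {E G : Ser n} (hφ : nrm ρ φ ≤ Λ) (hE : nrm ρ E ≤ e) (hG : nrm ρ G ≤ e)
    (k : Fin 8) : nrm ρ ((![-(φ * E), -(φ * G), 0, 0, 0, 0, 0, 0] : Fin 8 → Ser n) k) ≤ Λ * e := by
  have h0 : nrm ρ (0 : Ser n) ≤ Λ * e := (N_zero (w := wt n _)).le.trans zero_le
  have hm : ∀ {X : Ser n}, nrm ρ X ≤ e → nrm ρ (-(φ * X)) ≤ Λ * e := fun h =>
    (N_neg (w := wt n _) _).le.trans ((nrm_mul_le hρ _ _).trans (mul_le_mul' hφ h))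
  fin_cases k
  · exact hm hE
  · exact hm hG
  all_goals exact h0

set_option maxHeartbeats 1000000 in
/-- Solution of the linearized problem, up to the error of the factorization. -/
theorem linear_solve (hS : SmallDiv Ω C p) (hδ : 0 < δ) (hρ : 0 ≤ ρ) (hΛ : 2 ≤ Λ) (hΛt : Λ ≠ ∞) (he : e ≠ ∞)
    (hL : ofReal (C * δ⁻¹ ^ p) ≤ Λ) (hχ : ‖(χ : ℂ)‖ₑ ≤ Λ) (hχ1 : ‖1 - (χ : ℂ)‖ₑ ≤ Λ)
    (hχ2 : ‖1 - (χ : ℂ)⁻¹‖ₑ ≤ Λ) (hχ3 : ‖1 - (χ : ℂ) ^ 2‖ₑ ≤ Λ) (hφ : nrm (ρ + 4 * δ) P.φ ≤ Λ)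
    (hq : nrm (ρ + 4 * δ) P.q ≤ Λ) (hω : nrm (ρ + 4 * δ) P.ω ≤ Λ) (hv : nrm (ρ + 4 * δ) v ≤ Λ)
    (hdet : IsUnit (mat Ω χ P v).det) (hinv : ∀ i j, ‖(mat Ω χ P v)⁻¹ i j‖ₑ ≤ Λ) {E G : Ser n}
    (hE : nrm (ρ + 4 * δ) E ≤ e) (hG : nrm (ρ + 4 * δ) G ≤ e) : ∃ s D j y i g : Ser n, ave s = s ∧ ave D = D
    ∧ shf Ω j - cst χ * j = shf Ω (-(P.φ * (E + s * v + D))) ∧ shf Ω y - cst ((χ : ℂ)⁻¹) * y = P.q * j ∧ ave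
    (P.φ * y) = 0 ∧ shf Ω i - cst (χ ^ 2) * i = cst χ * shf Ω (-(P.φ * (G + s * P.φ)) - P.φ ^ 3 * P.ω * y) ∧
    shf Ω g - g = P.q * i ∧ nrm ρ s ≤ Λ ^ 50 * e ∧ nrm ρ D ≤ Λ ^ 50 * e ∧ nrm ρ y ≤ Λ ^ 50 * e ∧ nrm ρ g ≤ Λ
    ^ 50 * e ∧ (Van E → Van G → Van s ∧ Van D ∧ Van y ∧ Van g) := by
  have hpos : 0 < ρ + 4 * δ := by positivity
  have fin : ∀ {f : Ser n}, nrm (ρ + 4 * δ) f ≤ Λ → Fin' f := fun h =>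
    ⟨_, hpos, ne_top_of_le_ne_top hΛt h⟩
  have fin' : ∀ {f : Ser n}, nrm (ρ + 4 * δ) f ≤ e → Fin' f := fun h =>
    ⟨_, hpos, ne_top_of_le_ne_top he h⟩
  have hP : P.Ok := ⟨fin hφ, fin hq, fin hω⟩
  set I₀ : Fin 8 → Ser n := ![-(P.φ * E), -(P.φ * G), 0, 0, 0, 0, 0, 0] with hI₀
  have hI₀f : ∀ k, Fin' (I₀ k) := by
    intro k
    fin_cases k <;> first
    | exact ((fin hφ).mul (fin' hE)).neg
    | exact ((fin hφ).mul (fin' hG)).neg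
    | exact Fin'.zero
  have hm : ∀ {ρ' : ℝ} {f : Ser n}, nrm ρ' f ≤ Λ → nrm ρ' f ≤ Λ ^ 1 := fun h => by
    rwa [pow_one]
  have he0 : ∀ {ρ' : ℝ} {f : Ser n}, nrm ρ' f ≤ e → nrm ρ' f ≤ Λ ^ 0 * e := fun h => by
    rwa [pow_zero, one_mul]
  have hI₀b : ∀ k, nrm (ρ + 4 * δ) (I₀ k) ≤ Λ ^ 1 * e := by
    rw [pow_one]; exact nrm_source_le hpos.le hφ hE hG
  set r : Fin 5 → Ser n := res Ω χ P I₀ with hr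
  have hrb : ∀ k, ‖r k‖ₑ ≤ Λ ^ 21 * e := fun k => by
    have := (chain_bound hS hδ hρ hΛ hL hχ hχ1 hχ2 hχ3 hφ hq hω hI₀b).2.2.2.2 k
    refine (enorm_le_nrm hρ _).trans (this.trans (le_of_eq ?_))
    ring
  have hrave : ∀ k, ave (r k) = r k := ave_res ave_zero ave_zero ave_zero
  have hMave := ave_mat (Ω := Ω) (χ := χ) (P := P) (v := v)
  set X' : Fin 5 → Ser n := -((mat Ω χ P v)⁻¹.mulVec r) with hX'
  have hMX' : (mat Ω χ P v).mulVec X' = -r := by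
    rw [hX', Matrix.mulVec_neg, Matrix.mulVec_mulVec, Matrix.mul_nonsing_inv _ hdet,
      Matrix.one_mulVec]
  set X : Fin 5 → Ser n := fun a => ave (X' a) with hX
  have hXave : ∀ a, ave (X a) = X a := fun a => ave_ave _
  have hMX : ∀ b, r b + ∑ a, X a * mat Ω χ P v b a = 0 := by
    intro b
    have h1 := congrFun hMX' b
    rw [Matrix.mulVec, dotProduct] at h1
    have h2 := congrArg ave h1
    rw [Pi.neg_apply] at h2
    have h3 : ave (-r b) = -r b := by
      rw [← zero_sub, ave_sub, ave_zero, hrave]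
    rw [h3] at h2
    have h4 : ave (∑ a, mat Ω χ P v b a * X' a) = ∑ a, X a * mat Ω χ P v b a := by
      simp only [Fin.sum_univ_five, ave_add, hX]
      simp only [ave_mul_of_ave (hMave b _)]
      ring
    rw [← h4, h2]; ring
  have hXb : ∀ a, ‖X a‖ₑ ≤ Λ ^ 25 * e := by
    intro a
    have h1 : ‖X a‖ₑ ≤ ‖X' a‖ₑ := by
      rw [← nrm_zero_width, ← nrm_zero_width]; exact nrm_ave_le _
    refine h1.trans ?_
    rw [hX', Pi.neg_apply, enorm_neg, Matrix.mulVec, dotProduct]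
    refine (enorm_sum_le _ _).trans ?_
    have h2 : ∀ i : Fin 5, ‖(mat Ω χ P v)⁻¹ a i * r i‖ₑ ≤ Λ ^ 22 * e := fun i => by
      rw [← nrm_zero_width]
      refine (nrm_mul_le le_rfl _ _).trans ?_
      rw [nrm_zero_width, nrm_zero_width]
      exact (mul_le_mul' (hinv a i) (hrb i)).trans (le_of_eq (by ring))
    refine (Finset.sum_le_sum fun i _ => h2 i).trans ?_
    rw [Finset.sum_const, Finset.card_univ, Fintype.card_fin, nsmul_eq_mul]
    calc ((5 : ℕ) : ℝ≥0∞) * (Λ ^ 22 * e) ≤ 2 ^ 3 * (Λ ^ 22 * e) := by gcongr; norm_num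
      _ ≤ Λ ^ 3 * (Λ ^ 22 * e) := by gcongr
      _ = _ := by ring
  have hXn : ∀ (ρ' : ℝ) a, nrm ρ' (X a) ≤ Λ ^ 25 * e := fun ρ' a => by
    rw [nrm_of_ave (hXave a)]; exact hXb a
  set U := unitInp P.φ v with hU
  have hUf : ∀ a k, Fin' (U a k) := fin_unitInp (fin hφ) (fin hv)
  have hXUf : ∀ a k, Fin' ((X a • U a) k) := fun a k => (Fin'.of_ave (hXave a)).mul (hUf a k)
  set I : Fin 8 → Ser n := I₀ + X 0 • U 0 + X 1 • U 1 + X 2 • U 2 + X 3 • U 3 + X 4 • U 4 with hI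
  have f0 : ∀ k, Fin' ((I₀ + X 0 • U 0) k) := fun k => (hI₀f k).add (hXUf 0 k)
  have f1 : ∀ k, Fin' ((I₀ + X 0 • U 0 + X 1 • U 1) k) := fun k => (f0 k).add (hXUf 1 k)
  have f2 : ∀ k, Fin' ((I₀ + X 0 • U 0 + X 1 • U 1 + X 2 • U 2) k) := fun k =>
    (f1 k).add (hXUf 2 k)
  have f3 : ∀ k, Fin' ((I₀ + X 0 • U 0 + X 1 • U 1 + X 2 • U 2 + X 3 • U 3) k) := fun k =>
    (f2 k).add (hXUf 3 k)
  have f4 : ∀ k, Fin' (I k) := fun k => (f3 k).add (hXUf 4 k)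
  have hres : res Ω χ P I = 0 := by
    rw [hI, res_add hS hP f3 (hXUf 4), res_add hS hP f2 (hXUf 3), res_add hS hP f1 (hXUf 2),
      res_add hS hP f0 (hXUf 1), res_add hS hP hI₀f (hXUf 0)]
    simp only [(chain_mul (χ := χ) hS hP (hUf _) (hXave _)).2.2.2.2]
    funext b
    have := hMX b
    simp only [Fin.sum_univ_five, mat, Matrix.of_apply] at this
    simp only [Pi.add_apply, Pi.smul_apply, smul_eq_mul, Pi.zero_apply, ← hr]
    linear_combination this
  have i0 : I 0 = -(P.φ * (E + X 0 * v + X 1)) := by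
    simp only [hI, hI₀, hU, unitInp, Pi.add_apply, Pi.smul_apply, smul_eq_mul, Matrix.cons_val]
    ring
  have i1 : I 1 = -(P.φ * (G + X 0 * P.φ)) := by
    simp only [hI, hI₀, hU, unitInp, Pi.add_apply, Pi.smul_apply, smul_eq_mul, Matrix.cons_val]
    ring
  have iz : ∀ k : Fin 8, k = 2 ∨ k = 3 ∨ k = 4 → I k = 0 := by
    rintro k (rfl | rfl | rfl) <;>
    simp [hI, hI₀, hU, unitInp]
  have i5 : I 5 = X 2 := by simp [hI, hI₀, hU, unitInp]
  have i6 : I 6 = X 3 := by simp [hI, hI₀, hU, unitInp]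
  have i7 : I 7 = X 4 := by simp [hI, hI₀, hU, unitInp]
  obtain ⟨e1, e2, e3, e4, e5⟩ := chain_eqs hS hP f4 (by rw [i5, hXave]) (by rw [i6, hXave])
    (by rw [i7, hXave]) hres
  have hIb : ∀ k, nrm (ρ + 4 * δ) (I k) ≤ Λ ^ 29 * e := by
    have h0 : nrm (ρ + 4 * δ) (I 0) ≤ Λ ^ 29 * e := by
      rw [i0, nrm, N_neg]
      refine bd_mul (a := 1) (b := 28) hpos.le (hm hφ) (bd_add hΛ (bd_add hΛ
        (bd_up hΛ (he0 hE) (by norm_num)) ?_) (bd_up hΛ (hXn _ 1) (by norm_num)))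
      rw [mul_comm (X 0)]
      exact bd_up hΛ (bd_mul hpos.le (hm hv) (hXn _ 0)) (by norm_num)
    have h1 : nrm (ρ + 4 * δ) (I 1) ≤ Λ ^ 29 * e := by
      rw [i1, nrm, N_neg]
      refine bd_mul (a := 1) (b := 28) hpos.le (hm hφ) (bd_add hΛ (bd_up hΛ (he0 hG) (by norm_num)) ?_)
      rw [mul_comm (X 0)]
      exact bd_up hΛ (bd_mul hpos.le (hm hφ) (hXn _ 0)) (by norm_num)
    have hz : nrm (ρ + 4 * δ) (0 : Ser n) ≤ Λ ^ 29 * e := by rw [nrm, N_zero]; exact zero_le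
    intro k
    fin_cases k
    · exact h0
    · exact h1
    · exact (congrArg (nrm _) (iz 2 (by simp))).le.trans hz
    · exact (congrArg (nrm _) (iz 3 (by simp))).le.trans hz
    · exact (congrArg (nrm _) (iz 4 (by simp))).le.trans hz
    · exact (congrArg (nrm _) i5).le.trans (bd_up hΛ (hXn _ 2) (by norm_num))
    · exact (congrArg (nrm _) i6).le.trans (bd_up hΛ (hXn _ 3) (by norm_num))
    · exact (congrArg (nrm _) i7).le.trans (bd_up hΛ (hXn _ 4) (by norm_num))
  obtain ⟨-, hYb, -, hGb, -⟩ := chain_bound hS hδ hρ hΛ hL hχ hχ1 hχ2 hχ3 hφ hq hω hIb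
  have hup : ∀ {f : Ser n}, nrm ρ f ≤ Λ ^ 20 * (Λ ^ 29 * e) → nrm ρ f ≤ Λ ^ 50 * e :=
    fun h => bd_up hΛ (a := 49) (h.trans (le_of_eq (by ring))) (by norm_num)
  have hvan : Van E → Van G → Van (X 0) ∧ Van (X 1) ∧ Van (stY Ω χ P I) ∧ Van (stG Ω χ P I) := by
    intro hE hG
    have v1 : ∀ k, Van (I₀ k) := fun k => by
      rw [hI₀]
      fin_cases k
      · exact (hE.mul _).neg
      · exact (hG.mul _).neg
      all_goals exact Van.zero
    have v2 : ∀ a, Van (X a) := fun a =>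
      (Van.neg (Van.sum fun b => ((van_chain Ω χ P v1).2.2 b).mul _)).ave
    have v3 : ∀ a k, Van ((X a • U a) k) := fun a k => by
      rw [Pi.smul_apply, smul_eq_mul, mul_comm]; exact (v2 a).mul _
    have v4 : ∀ k, Van (I k) := fun k =>
      (((((v1 k).add (v3 0 k)).add (v3 1 k)).add (v3 2 k)).add (v3 3 k)).add (v3 4 k)
    exact ⟨v2 0, v2 1, (van_chain Ω χ P v4).1, (van_chain Ω χ P v4).2.1⟩
  refine ⟨X 0, X 1, stJ Ω χ I, stY Ω χ P I, stI Ω χ P I, stG Ω χ P I, hXave 0, hXave 1,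
    by rw [e1, i0], ?_, ?_, ?_, ?_,
    bd_up hΛ (hXn _ 0) (by norm_num), bd_up hΛ (hXn _ 1) (by norm_num), hup hYb, hup hGb,
    hvan⟩
  · rw [e2, iz 2 (by simp), add_zero]
  · rw [← e3, iz 3 (by simp), add_zero]
  · rw [e4, srcI, i1]
  · rw [e5, iz 4 (by simp), add_zero]

end linear

section newton

theorem factored_linear {R : Type*} [CommRing R] {χ χ' φ φp φm q qm y yp ym j jm V F G : R}
    (hχ : χ * χ' = 1) (hq : φ * φp * q = 1) (hqm : φm * φ * qm = 1) (h1 : yp - χ' * y = q * j)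
    (h2 : y - χ' * ym = qm * jm) (h3 : j - χ * jm = -(φ * F)) (hG : G = χ' * φp + χ * φm + V * φ) : F + φp *
    yp + φm * ym + V * (φ * y) = G * y := by
  have e1 : φp * yp = φp * (χ' * y + q * j) := by rw [← h1]; ring
  have e2 : φm * ym = φm * (χ * (y - qm * jm)) := by
    rw [← h2]; linear_combination (-(φm * ym)) * hχ
  have hF : F = -(q * φp) * (j - χ * jm) := by rw [h3]; linear_combination (-F) * hq
  have e3 : φm * qm = q * φp := by
    linear_combination (-(φm * qm)) * hq + (q * φp) * hqm
  rw [e1, e2, hF, hG]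
  linear_combination (-χ * jm) * e3

theorem factored_linear' {R : Type*} [CommRing R] {χ χ' φ φp φm q qm g gp gm i im V F G : R}
    (hχ : χ * χ' = 1) (hq : φ * φp * q = 1) (hqm : φm * φ * qm = 1) (h1 : gp - g = q * i)
    (h2 : g - gm = qm * im) (h3 : i - χ ^ 2 * im = χ * -(φ * F)) (hG : G = χ' * φp + χ * φm + V * φ) : F +
    χ' * (φp * gp) + χ * (φm * gm) + V * (φ * g) = G * g := by
  have hF : F = -(q * φp) * (χ' * (i - χ ^ 2 * im)) := by
    rw [h3]; linear_combination (-F) * hq + (-(φ * φp * q * F)) * hχ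
  have e3 : φm * qm = q * φp := by
    linear_combination (-(φm * qm)) * hq + (q * φp) * hqm
  have e1 : gp = g + q * i := by rw [← h1]; ring
  have e2 : gm = g - qm * im := by rw [← h2]; ring
  rw [e1, e2, hF, hG]
  linear_combination (-χ * im) * e3 + (q * φp * im * χ) * hχ

/-- The equilibrium functional on series. -/
def errE (Ω : Vec n) (a : ℕ → Ser n) (v₀ u σ lam : Ser n) : Ser n :=
  shf Ω (v₀ + u) + shf (-Ω) (v₀ + u) - 2 * (v₀ + u) + comp a u + σ * (v₀ + u) + lam

/-- The factorization functional on series, in the unknown whose quotients are the factors. -/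
def errG (Ω : Vec n) (χ : ℝ) (a : ℕ → Ser n) (u σ φ : Ser n) : Ser n :=
  cst ((χ : ℂ)⁻¹) * shf Ω φ + cst χ * shf (-Ω) φ - 2 * φ + comp (der a) u * φ + σ * φ

/-- The errors after a Newton step are quadratic. -/
theorem newton_eqs (hχ : χ ≠ 0) {v₀ q s D j y i : Ser n} (hq : φ * shf Ω φ * q = 1) (h1 : shf Ω j - cst χ *
    j = shf Ω (-(φ * (errE Ω a v₀ u σ lam + s * (v₀ + u) + D))))
    (h2 : shf Ω y - cst ((χ : ℂ)⁻¹) * y = q * j) (h3 : shf Ω i - cst ((χ : ℂ) ^ 2) * i = cst χ * shf Ω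
    (-(φ * (errG Ω χ a u σ φ + s * φ)) - φ ^ 3 * comp (der (der a)) u * y)) (h4 : shf Ω g - g = q * i) :
    errE Ω a v₀ (u + φ * y) (σ + s) (lam + D) = errG Ω χ a u σ φ * y + (comp a (u + φ * y) - comp a u - comp
    (der a) u * (φ * y)) + s * (φ * y) ∧ errG Ω χ a (u + φ * y) (σ + s) (φ + φ * g) = errG Ω χ a u σ φ * g +
    (comp (der a) (u + φ * y) - comp (der a) u - comp (der (der a)) u * (φ * y)) * φ +
    (comp (der a) (u + φ * y) - comp (der a) u) * (φ * g) + s * (φ * g) := by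
  have c1 : (cst χ * cst ((χ : ℂ)⁻¹) : Ser n) = 1 := by
    rw [← cst_mul, mul_inv_cancel₀ (Complex.ofReal_ne_zero.2 hχ), cst_one]
  have back : ∀ {f g : Ser n}, f = g → shf (-Ω) f = shf (-Ω) g := fun h => by rw [h]
  have hqm := back hq
  rw [shf_mul, shf_mul, shf_neg_shf, shf_one] at hqm
  have h1m := back h1
  rw [shf_sub, shf_neg_shf, shf_neg_shf, shf_mul, shf_cst] at h1m
  have h2m := back h2
  rw [shf_sub, shf_neg_shf, shf_mul, shf_mul, shf_cst] at h2m
  have h3m := back h3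
  rw [shf_sub, shf_neg_shf, shf_mul, shf_mul, shf_cst, shf_cst, shf_neg_shf] at h3m
  have h4m := back h4
  rw [shf_sub, shf_neg_shf, shf_mul] at h4m
  have hG : errG Ω χ a u σ φ = cst ((χ : ℂ)⁻¹) * shf Ω φ + cst χ * shf (-Ω) φ
      + (comp (der a) u - 2 + σ) * φ := by rw [errG]; ring
  constructor
  · have e := factored_linear c1 hq hqm h2 h2m h1m hG
    have e2 : errE Ω a v₀ (u + φ * y) (σ + s) (lam + D)
      = (errE Ω a v₀ u σ lam + s * (v₀ + u) + D) + shf Ω φ * shf Ω y + shf (-Ω) φ * shf (-Ω) y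
        + (comp (der a) u - 2 + σ) * (φ * y)
        + (comp a (u + φ * y) - comp a u - comp (der a) u * (φ * y)) + s * (φ * y) := by
      simp only [errE, ← add_assoc v₀, shf_add, shf_mul]; ring
    rw [e2, e]
  · have h3' : i - cst (χ : ℂ) ^ 2 * shf (-Ω) i = cst χ * -(φ * (errG Ω χ a u σ φ + s * φ
        + φ ^ 2 * comp (der (der a)) u * y)) := by
      have : (cst ((χ : ℂ) ^ 2) : Ser n) = cst (χ : ℂ) ^ 2 := by rw [sq, sq, cst_mul]
      rw [this] at h3m
      rw [h3m]; ring
    have e := factored_linear' c1 hq hqm h4 h4m h3' hG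
    have e2 : errG Ω χ a (u + φ * y) (σ + s) (φ + φ * g)
      = (errG Ω χ a u σ φ + s * φ + φ ^ 2 * comp (der (der a)) u * y)
        + cst ((χ : ℂ)⁻¹) * (shf Ω φ * shf Ω g) + cst χ * (shf (-Ω) φ * shf (-Ω) g)
        + (comp (der a) u - 2 + σ) * (φ * g)
        + (comp (der a) (u + φ * y) - comp (der a) u - comp (der (der a)) u * (φ * y)) * φ
        + (comp (der a) (u + φ * y) - comp (der a) u) * (φ * g) + s * (φ * g) := by
      simp only [errG, shf_add, shf_mul]; ring
    rw [e2, e]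

theorem van_pow_sub {u' : Ser n} (hu : Van (u - u')) (l : ℕ) : Van (u ^ l - u' ^ l) := by
  obtain ⟨c, hc⟩ := sub_dvd_pow_sub_pow u u' l
  rw [hc, mul_comm]; exact hu.mul c

theorem van_comp_sub {u' : Ser n} (h : Summable fun l => a l * u ^ l) (h' : Summable fun l => a l * u' ^ l)
    (hu : Van (u - u')) : Van (comp a u - comp a u') := by
  rw [comp, comp, ← h.tsum_sub h']
  refine Van.tsum (h.sub h') fun l => ?_
  rw [← mul_sub]; exact (van_pow_sub hu l).mul _

theorem van_mul_sub {f' g' : Ser n} (hf : Van (f - f')) (hg : Van (g - g')) : Van (f * g - f' * g') := by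
  rw [show f * g - f' * g' = g * (f - f') + f' * (g - g') by ring]
  exact (hf.mul _).add (hg.mul _)

theorem van_errE_sub (Ω : Vec n) {v₀ u' σ' lam' : Ser n} (h : Summable fun l => a l * u ^ l)
    (h' : Summable fun l => a l * u' ^ l) (hu : Van (u - u')) (hσ : Van (σ - σ')) (hl : Van (lam - lam')) :
    Van (errE Ω a v₀ u σ lam - errE Ω a v₀ u' σ' lam') := by
  have hv : Van ((v₀ + u) - (v₀ + u')) := by rwa [add_sub_add_left_eq_sub]
  have : errE Ω a v₀ u σ lam - errE Ω a v₀ u' σ' lam' = shf Ω ((v₀ + u) - (v₀ + u'))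
      + shf (-Ω) ((v₀ + u) - (v₀ + u')) - 2 * ((v₀ + u) - (v₀ + u'))
      + (comp a u - comp a u') + (σ * (v₀ + u) - σ' * (v₀ + u')) + (lam - lam') := by
    simp only [errE, shf_sub]; ring
  rw [this]
  exact (((((hv.shf _).add (hv.shf _)).sub (hv.mul _)).add (van_comp_sub h h' hu)).add
    (van_mul_sub hσ hv)).add hl

theorem van_errG_sub (Ω : Vec n) (χ : ℝ) {u' σ' φ' : Ser n} (h : Summable fun l => der a l * u ^ l)
    (h' : Summable fun l => der a l * u' ^ l) (hu : Van (u - u')) (hσ : Van (σ - σ')) (hφ : Van (φ - φ')) :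
    Van (errG Ω χ a u σ φ - errG Ω χ a u' σ' φ') := by
  have : errG Ω χ a u σ φ - errG Ω χ a u' σ' φ' = cst ((χ : ℂ)⁻¹) * shf Ω (φ - φ')
      + cst χ * shf (-Ω) (φ - φ') - 2 * (φ - φ') + (comp (der a) u * φ - comp (der a) u' * φ')
      + (σ * φ - σ' * φ') := by
    simp only [errG, shf_sub]; ring
  rw [this]
  exact (((((hφ.shf _).mul _).add ((hφ.shf _).mul _)).sub (hφ.mul _)).add
    (van_mul_sub (van_comp_sub h h' hu) hφ)).add (van_mul_sub hσ hφ)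

/-- Inverses of products close to an invertible product. -/
theorem exists_inv_near' (hρ : 0 ≤ ρ) {z z₀ q₀ : Ser n} (h₀ : z₀ * q₀ = 1)
    (h : nrm ρ q₀ * nrm ρ (z - z₀) ≤ 2⁻¹) : ∃ q, z * q = 1 ∧ nrm ρ (q - q₀) ≤ 2 * nrm ρ q₀ ^ 2 * nrm ρ
    (z - z₀) := by
  have hx : nrm ρ (q₀ * (z - z₀)) ≤ nrm ρ q₀ * nrm ρ (z - z₀) := nrm_mul_le hρ _ _
  obtain ⟨y, hy, -, hy1⟩ := exists_inv_one_add hρ (hx.trans h)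
  refine ⟨q₀ * y, ?_, ?_⟩
  · linear_combination hy + y * h₀
  · rw [show q₀ * y - q₀ = q₀ * (y - 1) by ring]
    calc _ ≤ nrm ρ q₀ * (2 * (nrm ρ q₀ * nrm ρ (z - z₀))) :=
          (nrm_mul_le hρ _ _).trans (by gcongr; exact hy1.trans (by gcongr))
      _ = _ := by ring

end newton

section step

theorem bd_mul_self (hρ : 0 ≤ ρ) {a b : ℕ} (hf : nrm ρ f ≤ Λ ^ a * e) (hg : nrm ρ g ≤ Λ ^ b * e) : nrm ρ
    (f * g) ≤ Λ ^ (a + b) * (e * e) :=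
  (nrm_mul_le hρ _ _).trans ((mul_le_mul' hf hg).trans (by rw [pow_add]; exact le_of_eq (by ring)))

/-- Bounds for a power series and its first two derivatives with common constants. -/
theorem der_bounds (hR : 0 ≤ R) {M : ℝ≥0∞} (ha : ∀ l, nrm R (a l) ≤ M * B ^ l) : ∃ M' B' : ℝ≥0∞, M' = M + M
    * B + M * B * (2 * B) ∧ B' = 4 * B ∧ (∀ l, nrm R (a l) ≤ M' * B' ^ l) ∧
    (∀ l, nrm R (der a l) ≤ M' * B' ^ l) ∧ ∀ l, nrm R (der (der a) l) ≤ M' * B' ^ l := by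
  have h1 := nrm_der_le hR ha
  have h2 := nrm_der_le hR h1
  have b1 : B ≤ 4 * B := le_mul_of_one_le_left zero_le (by norm_num)
  have b2 : 2 * B ≤ 4 * B := by gcongr; norm_num
  refine ⟨_, _, rfl, rfl, fun l => (ha l).trans ?_, fun l => (h1 l).trans ?_, fun l => (h2 l).trans ?_⟩
  · refine mul_le_mul' ?_ (pow_le_pow_left' b1 l)
    exact le_add_right le_self_add
  · refine mul_le_mul' ?_ (pow_le_pow_left' b2 l)
    exact le_add_right le_add_self
  · refine mul_le_mul' le_add_self (pow_le_pow_left' (le_of_eq ?_) l)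
    ring

theorem nrm_mul_shf_sub_le (hρ : 0 ≤ ρ) (Ω : Vec n) {φ₀ : Ser n} {η : ℝ≥0∞} (h : nrm ρ (φ - φ₀) ≤ η)
    (hη : η ≤ 1) : nrm ρ (φ * shf Ω φ - φ₀ * shf Ω φ₀) ≤ (2 * nrm ρ φ₀ + 1) * η := by
  have h1 : nrm ρ φ ≤ nrm ρ φ₀ + 1 := (le_of_sub_le h).trans (by gcongr)
  rw [show φ * shf Ω φ - φ₀ * shf Ω φ₀ = φ * (shf Ω φ - shf Ω φ₀) + shf Ω φ₀ * (φ - φ₀) by ring,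
    ← shf_sub]
  calc _ ≤ (nrm ρ φ₀ + 1) * η + nrm ρ φ₀ * η := by
        refine (N_add_le _ _).trans (add_le_add ((nrm_mul_le hρ _ _).trans (mul_le_mul' h1 ?_))
          ((nrm_mul_le hρ _ _).trans (mul_le_mul' ?_ h)))
        · rw [nrm_shf]; exact h
        · rw [nrm_shf]
    _ = _ := by ring

/-- One Newton step. -/
theorem newton_step (hS : SmallDiv Ω C p) (hχ : χ ≠ 0) (hR' : 0 < R') (hRR : R' ≤ R) {v₀ φ₀ q₀ ω₀ : Ser n}
    (hv₀ : nrm R v₀ ≠ ∞) (hφ₀ : nrm R φ₀ ≠ ∞) (hq₀ : nrm R q₀ ≠ ∞) (hω₀ : nrm R ω₀ ≠ ∞)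
    (h₀ : φ₀ * shf Ω φ₀ * q₀ = 1) (hdet : IsUnit (mat Ω χ ⟨φ₀, q₀, ω₀⟩ v₀).det) {M : ℝ≥0∞} (hM : M ≠ ∞)
    (hB : B ≠ ∞) : ∃ η L : ℝ≥0∞, 0 < η ∧ η ≤ 1 ∧ L ≠ ∞ ∧ 2 ≤ L ∧ (4 * B) * (2 * η) ≤ 8⁻¹ ∧ nrm R q₀ *
    ((2 * nrm R φ₀ + 1) * η) ≤ 2⁻¹ ∧ ∀ a : ℕ → Ser n, (∀ l, nrm R (a l) ≤ M * B ^ l) → nrm R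
    (comp (der (der a)) 0 - ω₀) ≤ η → ∀ (ρ δ : ℝ) (Λ e : ℝ≥0∞), R' ≤ ρ → 0 < δ → ρ + 4 * δ ≤ R → L ≤ Λ → Λ ≠
    ∞ → e ≠ ∞ → ofReal (C * δ⁻¹ ^ p) ≤ Λ → Λ ^ 60 * e ≤ η → ∀ u σ lam φ : Ser n, nrm (ρ + 4 * δ) u ≤ η → nrm
    (ρ + 4 * δ) (φ - φ₀) ≤ η → nrm (ρ + 4 * δ) (errE Ω a v₀ u σ lam) ≤ e → nrm (ρ + 4 * δ)
    (errG Ω χ a u σ φ) ≤ e → ∃ s D b f : Ser n, ave s = s ∧ ave D = D ∧ ave b = 0 ∧ nrm ρ s ≤ Λ ^ 60 * e ∧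
    nrm ρ D ≤ Λ ^ 60 * e ∧ nrm ρ b ≤ Λ ^ 60 * e ∧ nrm ρ f ≤ Λ ^ 60 * e ∧ nrm ρ
    (errE Ω a v₀ (u + b) (σ + s) (lam + D)) ≤ Λ ^ 120 * (e * e) ∧ nrm ρ (errG Ω χ a (u + b) (σ + s) (φ + f))
    ≤ Λ ^ 120 * (e * e) ∧ (Van (errE Ω a v₀ u σ lam) → Van (errG Ω χ a u σ φ) → Van s ∧ Van D ∧ Van b ∧ Van
    f) := by
  have hR : 0 < R := hR'.trans_le hRR
  have fm : ∀ {f : Ser n}, nrm R f ≠ ∞ → nrm R' f ≠ ∞ := fun h =>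
    ne_top_of_le_ne_top h (nrm_mono hRR _)
  obtain ⟨ε, K, hε, hK, hmat⟩ := mat_near hS χ hR' (P₀ := ⟨φ₀, q₀, ω₀⟩) (fm hφ₀) (fm hq₀) (fm hω₀)
    (fm hv₀) hdet
  set M' := M + M * B + M * B * (2 * B) with hM'
  have hM't : M' ≠ ∞ := by finiteness
  set B' := 4 * B with hB'
  have hB't : B' ≠ ∞ := by finiteness
  set A := nrm R q₀ * (2 * nrm R φ₀ + 1) with hA
  set A2 := 2 * nrm R q₀ ^ 2 * (2 * nrm R φ₀ + 1) with hA2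
  set A3 := 2 * M' * B' + 1 with hA3
  obtain ⟨η₁, p1, p2, p3⟩ := exists_mul_le (K := B' * 2) (ε := 8⁻¹) (by finiteness) (by simp)
  obtain ⟨η₂, p4, p5, p6⟩ := exists_mul_le (K := A) (ε := 2⁻¹) (by finiteness) (by simp)
  obtain ⟨η₃, p7, p8, p9⟩ := exists_mul_le (K := A2) (ε := min ε 1) (by finiteness) (lt_min hε one_pos)
  obtain ⟨η₄, p10, p11, p12⟩ := exists_mul_le (K := A3) (ε := min ε 1) (by finiteness) (lt_min hε one_pos)
  set η := min ε (min (min η₁ η₂) (min η₃ η₄)) with hη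
  have hη0 : 0 < η := lt_min hε (lt_min (lt_min p1 p4) (lt_min p7 p10))
  have le1 : η ≤ η₁ := (min_le_right _ _).trans ((min_le_left _ _).trans (min_le_left _ _))
  have le2 : η ≤ η₂ := (min_le_right _ _).trans ((min_le_left _ _).trans (min_le_right _ _))
  have le3 : η ≤ η₃ := (min_le_right _ _).trans ((min_le_right _ _).trans (min_le_left _ _))
  have le4 : η ≤ η₄ := (min_le_right _ _).trans ((min_le_right _ _).trans (min_le_right _ _))
  have hηε : η ≤ ε := min_le_left _ _
  have hη1 : η ≤ 1 := le1.trans p2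
  have q1 : B' * (2 * η) ≤ 8⁻¹ := by rw [← mul_assoc]; exact le_trans (by gcongr) p3
  have q2 : nrm R q₀ * ((2 * nrm R φ₀ + 1) * η) ≤ 2⁻¹ := by
    rw [← mul_assoc]; exact le_trans (by gcongr) p6
  have q3 : A2 * η ≤ min ε 1 := le_trans (by gcongr) p9
  have q4 : A3 * η ≤ min ε 1 := le_trans (by gcongr) p12
  set l₁ := ‖(χ : ℂ)‖ₑ + ‖1 - (χ : ℂ)‖ₑ + ‖1 - (χ : ℂ)⁻¹‖ₑ + ‖1 - (χ : ℂ) ^ 2‖ₑ with hl₁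
  set l₂ := (nrm R φ₀ + 1) + (nrm R q₀ + 1) + (nrm R ω₀ + 1) + (nrm R v₀ + 1) with hl₂
  set l₃ := 2 * M' * B' + 2 * M' * B' ^ 2 with hl₃
  refine ⟨η, 2 + K + l₁ + l₂ + l₃, hη0, hη1, by finiteness, ?_, q1, q2, ?_⟩
  · exact le_add_right (le_add_right (le_add_right le_self_add))
  intro a ha hω ρ δ Λ e hρ hδ hρδ hL hΛt het hC hΛe u σ lam φ hu hφ hE hG
  have hΛ2 : 2 ≤ Λ := (le_add_right (le_add_right (le_add_right le_self_add))).trans hL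
  have hΛK : K ≤ Λ := (le_add_right (le_add_right (le_add_right le_add_self))).trans hL
  have hΛ1 : l₁ ≤ Λ := (le_add_right (le_add_right le_add_self)).trans hL
  have hΛl2 : l₂ ≤ Λ := (le_add_right le_add_self).trans hL
  have hΛ3 : l₃ ≤ Λ := le_add_self.trans hL
  have hΛ3a : 2 * M' * B' ≤ Λ ^ 1 := by rw [pow_one]; exact le_self_add.trans hΛ3
  have hΛ3b : 2 * M' * B' ^ 2 ≤ Λ ^ 1 := by rw [pow_one]; exact le_add_self.trans hΛ3
  have hχ0 : ‖(χ : ℂ)‖ₑ ≤ Λ := (le_add_right (le_add_right le_self_add)).trans hΛ1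
  have hχ1 : ‖1 - (χ : ℂ)‖ₑ ≤ Λ := (le_add_right (le_add_right le_add_self)).trans hΛ1
  have hχ2 : ‖1 - (χ : ℂ)⁻¹‖ₑ ≤ Λ := (le_add_right le_add_self).trans hΛ1
  have hχ3 : ‖1 - (χ : ℂ) ^ 2‖ₑ ≤ Λ := le_add_self.trans hΛ1
  have hφl : nrm R φ₀ + 1 ≤ Λ := (le_add_right (le_add_right le_self_add)).trans hΛl2
  have hql : nrm R q₀ + 1 ≤ Λ := (le_add_right (le_add_right le_add_self)).trans hΛl2
  have hωl : nrm R ω₀ + 1 ≤ Λ := (le_add_right le_add_self).trans hΛl2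
  have hvl : nrm R v₀ + 1 ≤ Λ := le_add_self.trans hΛl2
  set τ := ρ + 4 * δ with hτ
  have hρ0 : 0 ≤ ρ := hR'.le.trans hρ
  have hρτ : ρ ≤ τ := by rw [hτ]; linarith
  have hR'τ : R' ≤ τ := hρ.trans hρτ
  have hτ0 : 0 ≤ τ := hρ0.trans hρτ
  obtain ⟨_, _, e1, e2, ha0, ha1, ha2⟩ := der_bounds hR.le ha
  rw [← hM'] at e1
  rw [← hB'] at e2
  rw [e1, e2] at ha0 ha1 ha2
  have dn : ∀ {a : ℕ → Ser n}, (∀ l, nrm R (a l) ≤ M' * B' ^ l) → ∀ {ρ}, ρ ≤ R →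
      ∀ l, nrm ρ (a l) ≤ M' * B' ^ l := fun h ρ hρ l => (nrm_mono hρ _).trans (h l)
  -- the inverse factor
  have hz : nrm τ (φ * shf Ω φ - φ₀ * shf Ω φ₀) ≤ (2 * nrm R φ₀ + 1) * η :=
    (nrm_mul_shf_sub_le hτ0 Ω hφ hη1).trans (by gcongr; exact nrm_mono hρδ _)
  obtain ⟨q, hq, hqq⟩ := exists_inv_near' hτ0 h₀ ((mul_le_mul' (nrm_mono hρδ q₀) hz).trans q2)
  have hqq' : nrm τ (q - q₀) ≤ min ε 1 := by
    refine hqq.trans (le_trans ?_ q3)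
    calc _ ≤ 2 * nrm R q₀ ^ 2 * ((2 * nrm R φ₀ + 1) * η) := by
          gcongr
          exact nrm_mono hρδ _
      _ = _ := by rw [hA2]; ring
  set ω := comp (der (der a)) u with hωd
  have hωω : nrm τ (ω - ω₀) ≤ min ε 1 := by
    have h1 := nrm_comp_sub_le hτ0 hM't (dn ha2 hρδ) hB't (u := 0) (b := u) (t := 2 * η)
      (by rw [nrm, N_zero, zero_add]; exact hu.trans (le_mul_of_one_le_left zero_le (by norm_num))) q1
    rw [zero_add] at h1
    rw [show ω - ω₀ = (ω - comp (der (der a)) 0) + (comp (der (der a)) 0 - ω₀) by ring]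
    refine (N_add_le _ _).trans ((add_le_add h1 ((nrm_mono hρδ _).trans hω)).trans (le_trans ?_ q4))
    calc _ ≤ 2 * M' * B' * η + η := by gcongr
      _ = _ := by rw [hA3]; ring
  have hv : nrm τ (v₀ + u - v₀) ≤ η := by rwa [add_sub_cancel_left]
  have cl : ∀ {f f₀ : Ser n}, nrm τ (f - f₀) ≤ 1 → nrm R f₀ + 1 ≤ Λ → nrm τ f ≤ Λ :=
    fun h h' => (le_of_sub_le h).trans (le_trans (by gcongr; exact nrm_mono hρδ _) h')
  obtain ⟨hdet', hinv⟩ := hmat ⟨φ, q, ω⟩ (v₀ + u) ((nrm_mono hR'τ _).trans (hφ.trans hηε))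
    ((nrm_mono hR'τ _).trans (hqq'.trans (min_le_left _ _)))
    ((nrm_mono hR'τ _).trans (hωω.trans (min_le_left _ _)))
    ((nrm_mono hR'τ _).trans (hv.trans hηε))
  have hφΛ := cl (hφ.trans hη1) hφl
  obtain ⟨s, D, j, y, i, g, hs, hD, k1, k2, k3, k4, k5, n1, n2, n3, n4, hvan⟩ :=
    linear_solve hS hδ hρ0 hΛ2 hΛt het hC hχ0 hχ1 hχ2 hχ3 (P := ⟨φ, q, ω⟩) (v := v₀ + u)
      hφΛ (cl (hqq'.trans (min_le_right _ _)) hql)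
      (cl (hωω.trans (min_le_right _ _)) hωl) (cl (hv.trans hη1) hvl) hdet'
      (fun i j => (hinv i j).trans hΛK) hE hG
  obtain ⟨r1, r2⟩ := newton_eqs (Ω := Ω) hχ hq k1 k2 k4 k5
  have hφ1 : nrm ρ φ ≤ Λ ^ 1 := by rw [pow_one]; exact (nrm_mono hρτ _).trans hφΛ
  have nb : nrm ρ (φ * y) ≤ Λ ^ 51 * e := bd_up hΛ2 (bd_mul hρ0 hφ1 n3) (by norm_num)
  have nf : nrm ρ (φ * g) ≤ Λ ^ 51 * e := bd_up hΛ2 (bd_mul hρ0 hφ1 n4) (by norm_num)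
  have nbη : nrm ρ (φ * y) ≤ η := (bd_up hΛ2 nb (by norm_num)).trans hΛe
  have htt : nrm ρ u + nrm ρ (φ * y) ≤ 2 * η := by
    rw [two_mul]; exact add_le_add ((nrm_mono hρτ _).trans hu) nbη
  have hρR : ρ ≤ R := hρτ.trans hρδ
  have t0 := nrm_comp_sub_sub_le hρ0 hM't (dn ha0 hρR) hB't htt q1
  have t1 := nrm_comp_sub_sub_le hρ0 hM't (dn ha1 hρR) hB't htt q1
  have t2 := nrm_comp_sub_le hρ0 hM't (dn ha1 hρR) hB't htt q1
  have sq' : 2 * M' * B' ^ 2 * nrm ρ (φ * y) ^ 2 ≤ Λ ^ 103 * (e * e) := by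
    calc _ ≤ Λ ^ 1 * (Λ ^ 51 * e) ^ 2 := by gcongr
      _ = _ := by ring
  have li' : 2 * M' * B' * nrm ρ (φ * y) ≤ Λ ^ 52 * e := by
    calc _ ≤ Λ ^ 1 * (Λ ^ 51 * e) := by gcongr
      _ = _ := by ring
  have g0 : nrm ρ (errG Ω χ a u σ φ) ≤ Λ ^ 0 * e := by
    rw [pow_zero, one_mul]; exact (nrm_mono hρτ _).trans hG
  have up : ∀ {f : Ser n} {k}, nrm ρ f ≤ Λ ^ k * (e * e) → k ≤ 110 →
      nrm ρ f ≤ Λ ^ 110 * (e * e) := fun h h' => bd_up hΛ2 h h'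
  refine ⟨s, D, φ * y, φ * g, hs, hD, k3, bd_up hΛ2 n1 (by norm_num), bd_up hΛ2 n2 (by norm_num),
    bd_up hΛ2 nb (by norm_num), bd_up hΛ2 nf (by norm_num), ?_, ?_, fun h h' => ?_⟩
  · rw [r1]
    exact bd_up hΛ2 (bd_add hΛ2 (bd_add hΛ2 (up (bd_mul_self hρ0 g0 n3) (by norm_num))
      (up (t0.trans sq') (by norm_num))) (bd_up hΛ2 (up (bd_mul_self hρ0 n1 nb) (by norm_num))
      (by norm_num))) (by norm_num)
  · rw [r2]
    refine bd_up hΛ2 (bd_add hΛ2 (bd_add hΛ2 (bd_add hΛ2 (up (bd_mul_self hρ0 g0 n4) (by norm_num))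
      (up (k := 104) ?_ (by norm_num)))
      (bd_up hΛ2 (up (bd_mul_self hρ0 (t2.trans li') nf) (by norm_num)) (by norm_num)))
      (bd_up hΛ2 (up (bd_mul_self hρ0 n1 nf) (by norm_num)) (by norm_num))) (by norm_num)
    rw [mul_comm]
    exact bd_up hΛ2 (bd_mul hρ0 hφ1 (t1.trans sq')) (by norm_num)
  · obtain ⟨v1, v2, v3, v4⟩ := hvan h h'
    exact ⟨v1, v2, v3.mul _, v4.mul _⟩

end step

section limits

theorem isometry_shf (Ω : Vec n) : Isometry (shf (n := n) Ω) := fun f g => by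
  rw [edist_eq_enorm_sub, edist_eq_enorm_sub, ← shf_sub, ← nrm_zero_width, nrm_shf, nrm_zero_width]

theorem tendsto_coeff {x : ℕ → Ser n} (h : Tendsto x atTop (𝓝 X)) (i : Idx n) : Tendsto (fun j => x j i)
    atTop (𝓝 (X i)) := ((coeff i).continuous.tendsto X).comp h

theorem coeff_eq_of_tendsto {x : ℕ → Ser n} (h : Tendsto x atTop (𝓝 X)) {i : Idx n} {c : ℂ}
    (h0 : ∀ j, x j i = c) : X i = c := by
  refine tendsto_nhds_unique (tendsto_coeff h i) ?_
  simp only [h0]; exact tendsto_const_nhds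

theorem ave_eq_zero_iff : ave f = 0 ↔ ∀ j, f (0, j) = 0 := by
  constructor
  · intro h j
    have := congrArg (fun f : Ser n => f (0, j)) h
    simpa [ave_apply] using this
  · intro h; ext i
    rw [ave_apply]
    split_ifs with hi
    · rw [show i = (0, i.2) from Prod.ext hi rfl, h, zero_apply]
    · rfl

theorem ave_eq_self_iff : ave f = f ↔ ∀ i : Idx n, i.1 ≠ 0 → f i = 0 := by
  constructor
  · intro h i hi
    rw [← h, ave_apply, if_neg hi]
  · intro h; ext i
    rw [ave_apply]
    split_ifs with hi
    · rfl
    · rw [h i hi]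

theorem tendsto_of_geometric (hR : 0 ≤ R) {η : ℝ≥0∞} (hη : η ≠ ∞) {x : ℕ → Ser n} (h : ∀ j, nrm R
    (x (j + 1) - x j) ≤ η * 2⁻¹ ^ (j + 1)) : ∃ X, Tendsto x atTop (𝓝 X) ∧ nrm R (X - x 0) ≤ η := by
  have hs : ∑' j, nrm R (x (j + 1) - x j) ≤ η := by
    refine (tsum_le_tsum h).trans ?_
    rw [ENNReal.tsum_mul_left]
    simp only [pow_succ]
    rw [ENNReal.tsum_mul_right, tsum_two_inv_pow, ENNReal.mul_inv_cancel two_ne_zero (by simp),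
      mul_one]
  have hsum := summable_of_N (one_le_wt hR) (ne_top_of_le_ne_top hη hs)
  refine ⟨x 0 + ∑' j, (x (j + 1) - x j), ?_, ?_⟩
  · have := hsum.hasSum.tendsto_sum_nat
    simp only [Finset.sum_range_sub] at this
    simpa using this.const_add (x 0)
  · rw [add_sub_cancel_left]
    exact (N_tsum_le hsum).trans hs

theorem tendsto_comp {M η : ℝ≥0∞} (hM : M ≠ ∞) (hB : B ≠ ∞) (ha : ∀ l, nrm 0 (a l) ≤ M * B ^ l) (hη : 0 < η)
    (hBη : B * (2 * η) ≤ 8⁻¹) {x : ℕ → Ser n} (h : Tendsto x atTop (𝓝 X)) (hx : ∀ j, nrm 0 (x j) ≤ η) :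
    Tendsto (fun j => comp a (x j)) atTop (𝓝 (comp a X)) := by
  have h0 : Tendsto (fun j => ‖X - x j‖ₑ) atTop (𝓝 0) := by
    have := tendsto_iff_edist_tendsto_0.1 h
    simpa only [edist_comm _ X, edist_eq_enorm_sub] using this
  rw [tendsto_iff_edist_tendsto_0]
  have h1 : Tendsto (fun j => 2 * M * B * ‖X - x j‖ₑ) atTop (𝓝 0) := by
    have := ENNReal.Tendsto.const_mul (a := 2 * M * B) h0 (Or.inr (by finiteness))
    rwa [mul_zero] at this
  refine tendsto_of_tendsto_of_tendsto_of_le_of_le' tendsto_const_nhds h1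
    (Eventually.of_forall fun _ => zero_le) ?_
  filter_upwards [h0.eventually_le_const hη] with j hj
  have := nrm_comp_sub_le le_rfl hM ha hB (u := x j) (b := X - x j) (t := 2 * η)
    (by rw [two_mul, nrm_zero_width (X - x j)]; exact add_le_add (hx j) hj) hBη
  rwa [add_sub_cancel, nrm_zero_width, nrm_zero_width, ← edist_eq_enorm_sub, edist_comm] at this

end limits

section iteration

theorem exists_seq_of_step {α : Type*} {P : ℕ → α → Prop} {D : ℕ → α → α → Prop} {x₀ : α} (h₀ : P 0 x₀)
    (h : ∀ j x, P j x → ∃ y, P (j + 1) y ∧ D j x y) : ∃ x : ℕ → α, x 0 = x₀ ∧ ∀ j, P j (x j) ∧ D j (x j)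
    (x (j + 1)) := by
  choose! f hf hf' using h
  have hP : ∀ j, P j (Nat.rec x₀ (fun j y => f j y) j : α) := fun j => by
    induction j with
    | zero => exact h₀
    | succ j ih => exact hf j _ ih
  exact ⟨fun j => Nat.rec x₀ (fun j y => f j y) j, rfl, fun j => ⟨hP j, hf' j _ (hP j)⟩⟩

theorem mul_two_inv_pow_succ (η : ℝ≥0∞) (j : ℕ) : η * 2⁻¹ ^ (j + 1) + η * 2⁻¹ ^ (j + 1) = η * 2⁻¹ ^ j := by
  rw [← two_mul, pow_succ, show 2 * (η * (2⁻¹ ^ j * 2⁻¹)) = η * 2⁻¹ ^ j * (2 * 2⁻¹) by ring,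
    ENNReal.mul_inv_cancel two_ne_zero (by simp), mul_one]

/-- The scales of the Newton iteration: widths, losses, bounds and errors. -/
theorem exists_scales (hRR : R' < R) (C : ℝ) (p : ℕ) {η L : ℝ≥0∞} (hη : 0 < η) (hη1 : η ≤ 1) (hLt : L ≠ ∞)
    (hL2 : 2 ≤ L) : ∃ (r d : ℕ → ℝ) (lm e : ℕ → ℝ≥0∞), r 0 = R ∧ 0 < e 0 ∧ (∀ j, 0 < d j) ∧
    (∀ j, r (j + 1) + 4 * d j = r j) ∧ (∀ j, R' ≤ r j) ∧ (∀ j, r j ≤ R) ∧ (∀ j, L ≤ lm j) ∧ (∀ j, lm j ≠ ∞)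
    ∧ (∀ j, e j ≠ ∞) ∧ (∀ j, ofReal (C * (d j)⁻¹ ^ p) ≤ lm j) ∧ (∀ j, lm j ^ 60 * e j ≤ η * 2⁻¹ ^ (j + 1)) ∧
    (∀ j, lm j ^ 120 * (e j * e j) ≤ e (j + 1)) ∧ Tendsto e atTop (𝓝 0) := by
  have hηt : η ≠ ∞ := ne_top_of_le_ne_top one_ne_top hη1
  have hpos := sub_pos.2 hRR
  obtain ⟨Q, hQ⟩ : ∃ Q : ℝ≥0∞, Q = 2 ^ (p + 1) := ⟨_, rfl⟩
  have hQ2 : 2 ≤ Q := by rw [hQ]; exact le_self_pow₀ (by norm_num) (by simp)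
  have hQ0 : Q ≠ 0 := (lt_of_lt_of_le (by norm_num) hQ2).ne'
  have hQt : Q ≠ ∞ := by rw [hQ]; finiteness
  obtain ⟨t, ht⟩ : ∃ t : ℝ≥0∞, t = Q⁻¹ := ⟨_, rfl⟩
  have hQQ : Q * t = 1 := by rw [ht]; exact ENNReal.mul_inv_cancel hQ0 hQt
  have hQi : t ≤ 2⁻¹ := by rw [ht]; exact ENNReal.inv_le_inv.2 hQ2
  have htt : t ≠ ∞ := ne_top_of_le_ne_top (by simp) hQi
  have ht0 : 0 < t := by rw [ht]; exact ENNReal.inv_pos.2 hQt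
  obtain ⟨L', hL'⟩ : ∃ L', L' = L + ofReal (C * (8 / (R - R')) ^ p) := ⟨_, rfl⟩
  have hL't : L' ≠ ∞ := by rw [hL']; finiteness
  have hLL : L ≤ L' := by rw [hL']; exact le_self_add
  have hL'1 : 1 ≤ L' := (one_le_two.trans hL2).trans hLL
  obtain ⟨c, hc0, hc1, hc⟩ := exists_mul_le (K := 2 * L' ^ 120 * Q ^ 120) (ε := η) (by finiteness) hη
  have hct : c ≠ ∞ := ne_top_of_le_ne_top one_ne_top hc1
  have hQ1 : 1 ≤ Q ^ 120 := one_le_pow₀ (one_le_two.trans hQ2)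
  have hcc1 : L' ^ 120 * Q ^ 120 * c ≤ 1 := by
    refine le_trans (mul_le_mul' ?_ le_rfl) (hc.trans hη1)
    rw [mul_assoc]
    exact le_mul_of_one_le_left zero_le (by norm_num)
  have hcc2 : 2 * (L' ^ 60 * c) ≤ η := by
    refine le_trans ?_ hc
    calc 2 * (L' ^ 60 * c) = 2 * L' ^ 60 * 1 * c := by ring
      _ ≤ _ := mul_le_mul' (mul_le_mul' (mul_le_mul' le_rfl
        (pow_le_pow_right₀ hL'1 (by norm_num))) hQ1) le_rfl
  have hQj : ∀ j, Q ^ j * t ^ j = 1 := fun j => by rw [← mul_pow, hQQ, one_pow]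
  have hpw : ∀ m : ℕ, m ≠ 0 → ∀ j, t ^ (m * j) ≤ 2⁻¹ ^ j := fun m hm j => by
    rw [pow_mul]
    exact pow_le_pow_left' ((pow_le_of_le_one zero_le (hQi.trans (by simp)) hm).trans hQi) j
  refine ⟨fun j => R' + (R - R') * (1 / 2) ^ j, fun j => (R - R') * (1 / 2) ^ j / 8,
    fun j => L' * Q ^ j, fun j => c * t ^ (120 * j), ?_, ?_, fun j => ?_, fun j => ?_, fun j => ?_,
    fun j => ?_, fun j => ?_, fun j => ?_, fun j => ?_, fun j => ?_, fun j => ?_, fun j => ?_, ?_⟩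
  · simp
  · simpa using hc0
  · dsimp only; positivity
  · simp only [pow_succ]; ring
  · have : 0 ≤ (R - R') * (1 / 2) ^ j := by positivity
    dsimp only; linarith
  · have h1 : ((1 : ℝ) / 2) ^ j ≤ 1 := pow_le_one₀ (by norm_num) (by norm_num)
    dsimp only; nlinarith
  · exact hLL.trans (le_mul_of_one_le_right zero_le (one_le_pow₀ (one_le_two.trans hQ2)))
  · exact mul_ne_top hL't (pow_ne_top hQt)
  · exact mul_ne_top hct (pow_ne_top htt)
  · have e1 : C * ((R - R') * (1 / 2) ^ j / 8)⁻¹ ^ p = C * (8 / (R - R')) ^ p * (2 ^ p) ^ j := by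
      rw [← pow_mul, mul_comm p j, pow_mul, mul_assoc, ← mul_pow]
      congr 2
      rw [inv_div, one_div, inv_pow, ← div_div, div_inv_eq_mul]
    rw [e1, ENNReal.ofReal_mul' (by positivity)]
    refine mul_le_mul' (by rw [hL']; exact le_add_self) ?_
    rw [ENNReal.ofReal_pow (by positivity), ENNReal.ofReal_pow (by positivity)]
    refine pow_le_pow_left' ?_ j
    rw [hQ, pow_succ, ENNReal.ofReal_ofNat]
    exact le_mul_of_one_le_right zero_le (by norm_num)
  · dsimp only
    calc (L' * Q ^ j) ^ 60 * (c * t ^ (120 * j))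
        = L' ^ 60 * c * (Q ^ j * t ^ j) ^ 60 * t ^ (60 * j) := by ring
      _ = L' ^ 60 * c * t ^ (60 * j) := by rw [hQj, one_pow, mul_one]
      _ ≤ L' ^ 60 * c * 2⁻¹ ^ j := mul_le_mul' le_rfl (hpw 60 (by norm_num) j)
      _ = 2 * (L' ^ 60 * c) * 2⁻¹ ^ (j + 1) := by
          rw [← mul_two_inv_pow_succ, ← two_mul]; ring
      _ ≤ _ := mul_le_mul' hcc2 le_rfl
  · dsimp only
    calc (L' * Q ^ j) ^ 120 * (c * t ^ (120 * j) * (c * t ^ (120 * j)))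
        = L' ^ 120 * c * (Q ^ j * t ^ j) ^ 120 * (c * t ^ (120 * j)) := by ring
      _ = L' ^ 120 * c * (Q ^ 120 * t ^ 120) * (c * t ^ (120 * j)) := by
          rw [hQj, one_pow, hQj 120]
      _ = (L' ^ 120 * Q ^ 120 * c) * (c * t ^ (120 * (j + 1))) := by ring
      _ ≤ 1 * (c * t ^ (120 * (j + 1))) := mul_le_mul' hcc1 le_rfl
      _ = _ := one_mul _
  · have h1 : Tendsto (fun j => c * (2⁻¹ : ℝ≥0∞) ^ j) atTop (𝓝 (c * 0)) :=
      ENNReal.Tendsto.const_mul (ENNReal.tendsto_pow_atTop_nhds_zero_of_lt_one (by simp)) (Or.inr hct)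
    rw [mul_zero] at h1
    exact tendsto_of_tendsto_of_tendsto_of_le_of_le tendsto_const_nhds h1 (fun _ => zero_le)
      fun j => mul_le_mul' le_rfl (hpw 120 (by norm_num) j)

/-- The unknowns of the Newton iteration. -/
structure St (n : ℕ) where
  u : Ser n
  σ : Ser n
  lam : Ser n
  φ : Ser n

/-- Closeness of the distances of two states to a bound. -/
structure St.Close (R : ℝ) (κ : ℝ≥0∞) (x y : St n) : Prop where
  u : nrm R (y.u - x.u) ≤ κ
  σ : nrm R (y.σ - x.σ) ≤ κ
  lam : nrm R (y.lam - x.lam) ≤ κ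
  φ : nrm R (y.φ - x.φ) ≤ κ

/-- The algebraic invariants of the Newton iteration. -/
structure St.Norm (x₀ x : St n) : Prop where
  u : ave x.u = 0
  σ : ave x.σ = x.σ
  lam : ave x.lam = x.lam
  vu : Van (x.u - x₀.u)
  vσ : Van (x.σ - x₀.σ)
  vlam : Van (x.lam - x₀.lam)
  vφ : Van (x.φ - x₀.φ)

/-- The analytic invariants of the Newton iteration. -/
structure St.Inv (Ω : Vec n) (χ : ℝ) (a : ℕ → Ser n) (v₀ φ₀ : Ser n) (r : ℝ)
    (e κ η : ℝ≥0∞) (x : St n) : Prop where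
  E : nrm r (errE Ω a v₀ x.u x.σ x.lam) ≤ e
  G : nrm r (errG Ω χ a x.u x.σ x.φ) ≤ e
  u : nrm r x.u + κ ≤ η
  φ : nrm r (x.φ - φ₀) + κ ≤ η

theorem St.Norm.step {x₀ x : St n} (hx : St.Norm x₀ x) {s D b : Ser n} (hs : ave s = s) (hD : ave D = D)
    (hb : ave b = 0) (vs : Van s) (vD : Van D) (vb : Van b) (vf : Van f) : St.Norm x₀
    ⟨x.u + b, x.σ + s, x.lam + D, x.φ + f⟩ where
  u := by dsimp only; rw [ave_add, hx.u, hb, add_zero]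
  σ := by dsimp only; rw [ave_add, hx.σ, hs]
  lam := by dsimp only; rw [ave_add, hx.lam, hD]
  vu := by dsimp only; rw [add_sub_right_comm]; exact hx.vu.add vb
  vσ := by dsimp only; rw [add_sub_right_comm]; exact hx.vσ.add vs
  vlam := by dsimp only; rw [add_sub_right_comm]; exact hx.vlam.add vD
  vφ := by dsimp only; rw [add_sub_right_comm]; exact hx.vφ.add vf

theorem St.Norm.limit {x₀ : St n} {x : ℕ → St n} (hx : ∀ j, St.Norm x₀ (x j))
    (hu : Tendsto (fun j => (x j).u) atTop (𝓝 u)) (hσ : Tendsto (fun j => (x j).σ) atTop (𝓝 σ))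
    (hlam : Tendsto (fun j => (x j).lam) atTop (𝓝 lam)) (hφ : Tendsto (fun j => (x j).φ) atTop (𝓝 φ)) :
    St.Norm x₀ ⟨u, σ, lam, φ⟩ := by
  have vl : ∀ {y : ℕ → Ser n} {Y Y₀ : Ser n}, Tendsto y atTop (𝓝 Y) →
      (∀ j, Van (y j - Y₀)) → Van (Y - Y₀) := fun {y Y Y₀} h hj k =>
    coeff_eq_of_tendsto (h.sub_const Y₀) fun j => hj j k
  have al : ∀ {y : ℕ → Ser n} {Y : Ser n}, Tendsto y atTop (𝓝 Y) →
      (∀ j, ave (y j) = y j) → ave Y = Y := fun {y Y} h hj =>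
    ave_eq_self_iff.2 fun i hi => coeff_eq_of_tendsto h fun j => ave_eq_self_iff.1 (hj j) i hi
  exact ⟨ave_eq_zero_iff.2 fun k => coeff_eq_of_tendsto hu fun j => ave_eq_zero_iff.1 (hx j).u k,
    al hσ fun j => (hx j).σ, al hlam fun j => (hx j).lam, vl hu fun j => (hx j).vu,
    vl hσ fun j => (hx j).vσ, vl hlam fun j => (hx j).vlam, vl hφ fun j => (hx j).vφ⟩

theorem eq_zero_of_tendsto (hR' : 0 ≤ R') {r : ℕ → ℝ} {e : ℕ → ℝ≥0∞} (hr : ∀ j, R' ≤ r j)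
    (te : Tendsto e atTop (𝓝 0)) {y : ℕ → Ser n} (hy : Tendsto y atTop (𝓝 Y))
    (hyb : ∀ j, nrm (r j) (y j) ≤ e j) : Y = 0 := by
  have h1 : Tendsto y atTop (𝓝 0) := by
    rw [tendsto_iff_edist_tendsto_0]
    refine tendsto_of_tendsto_of_tendsto_of_le_of_le tendsto_const_nhds te (fun _ => zero_le) fun j => ?_
    dsimp only
    rw [edist_eq_enorm_sub, sub_zero]
    exact (enorm_le_nrm (hR'.trans (hr j)) _).trans (hyb j)
  exact tendsto_nhds_unique hy h1

theorem tendsto_err {v₀ : Ser n} {M η : ℝ≥0∞} (hM : M ≠ ∞) (hB : B ≠ ∞) (ha : ∀ l, nrm 0 (a l) ≤ M * B ^ l)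
    (ha' : ∀ l, nrm 0 (der a l) ≤ M * B ^ l) (hη : 0 < η) (hBη : B * (2 * η) ≤ 8⁻¹) {x : ℕ → St n}
    (hx : ∀ j, nrm 0 (x j).u ≤ η) (hu : Tendsto (fun j => (x j).u) atTop (𝓝 u))
    (hσ : Tendsto (fun j => (x j).σ) atTop (𝓝 σ)) (hlam : Tendsto (fun j => (x j).lam) atTop (𝓝 lam))
    (hφ : Tendsto (fun j => (x j).φ) atTop (𝓝 φ)) : Tendsto (fun j => errE Ω a v₀ (x j).u (x j).σ (x j).lam)
    atTop (𝓝 (errE Ω a v₀ u σ lam)) ∧ Tendsto (fun j => errG Ω χ a (x j).u (x j).σ (x j).φ) atTop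
    (𝓝 (errG Ω χ a u σ φ)) := by
  have cs : ∀ {Ω' : Vec n} {y : ℕ → Ser n} {Y : Ser n}, Tendsto y atTop (𝓝 Y) →
      Tendsto (fun j => shf Ω' (y j)) atTop (𝓝 (shf Ω' Y)) := fun {Ω'} _ _ h =>
    ((isometry_shf Ω').continuous.tendsto _).comp h
  have tv : Tendsto (fun j => v₀ + (x j).u) atTop (𝓝 (v₀ + u)) := hu.const_add _
  exact ⟨(((((cs tv).add (cs tv)).sub (tv.const_mul 2)).add (tendsto_comp hM hB ha hη hBη hu
    hx)).add (hσ.mul tv)).add hlam,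
    (((((cs hφ).const_mul _).add ((cs hφ).const_mul _)).sub (hφ.const_mul 2)).add ((tendsto_comp
      hM hB ha' hη hBη hu hx).mul hφ)).add (hσ.mul hφ)⟩

/-- Convergence of the Newton iteration with loss of domain. -/
theorem exists_solution (hS : SmallDiv Ω C p) (hχ : χ ≠ 0) (hR' : 0 < R') (hRR : R' < R)
    {v₀ φ₀ q₀ ω₀ : Ser n} (hv₀ : nrm R v₀ ≠ ∞) (hφ₀ : nrm R φ₀ ≠ ∞) (hq₀ : nrm R q₀ ≠ ∞)
    (hω₀ : nrm R ω₀ ≠ ∞) (h₀ : φ₀ * shf Ω φ₀ * q₀ = 1) (hdet : IsUnit (mat Ω χ ⟨φ₀, q₀, ω₀⟩ v₀).det)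
    {M : ℝ≥0∞} (hM : M ≠ ∞) (hB : B ≠ ∞) : ∃ ε : ℝ≥0∞, 0 < ε ∧ ∀ (a : ℕ → Ser n) (σ₀ lam₀ : Ser n),
    (∀ l, nrm R (a l) ≤ M * B ^ l) → nrm R (comp (der (der a)) 0 - ω₀) ≤ ε → ave σ₀ = σ₀ → ave lam₀ = lam₀ →
    nrm R (errE Ω a v₀ 0 σ₀ lam₀) ≤ ε → nrm R (errG Ω χ a 0 σ₀ φ₀) ≤ ε → Van (errE Ω a v₀ 0 σ₀ lam₀) → Van
    (errG Ω χ a 0 σ₀ φ₀) → ∃ u σ lam φ q : Ser n, errE Ω a v₀ u σ lam = 0 ∧ errG Ω χ a u σ φ = 0 ∧ 4 * B *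
    nrm R' u ≤ 8⁻¹ ∧ nrm R' u ≠ ∞ ∧ nrm R' φ ≠ ∞ ∧ nrm R' q ≠ ∞ ∧ φ * shf Ω φ * q = 1 ∧ St.Norm
    ⟨0, σ₀, lam₀, φ₀⟩ ⟨u, σ, lam, φ⟩ := by
  obtain ⟨η, L, hη, hη1, hLt, hL2, hBη, hqη, H⟩ := newton_step hS hχ hR' hRR.le hv₀ hφ₀ hq₀ hω₀ h₀
    hdet hM hB
  have hηt : η ≠ ∞ := ne_top_of_le_ne_top one_ne_top hη1
  have hR : 0 < R := hR'.trans hRR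
  obtain ⟨r, d, lm, e, r0, e0, hd, hrd, hr, hrR, hlmL, hlmt, het, hlmC, hlme, hlme2, te⟩ :=
    exists_scales hRR C p hη hη1 hLt hL2
  refine ⟨min (e 0) η, lt_min e0 hη, fun a σ₀ lam₀ ha hω hσ₀ hlam₀ hE hG vE vG => ?_⟩
  have hω' := hω.trans (min_le_right _ _)
  obtain ⟨M', B', e1, e2, ha0, ha1, ha2⟩ := der_bounds hR.le ha
  have hM't : M' ≠ ∞ := by rw [e1]; finiteness
  have hB't : B' ≠ ∞ := by rw [e2]; finiteness
  rw [← e2] at hBη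
  have z0 : ∀ {f : Ser n}, nrm 0 f ≤ nrm R f := nrm_mono hR.le _
  have sm : ∀ {f : Ser n}, nrm 0 f ≤ η → B' * nrm 0 f ≤ 8⁻¹ := fun h =>
    (mul_le_mul' le_rfl (h.trans (le_mul_of_one_le_left zero_le (by norm_num)))).trans hBη
  have b0 := fun l => z0.trans (ha0 l)
  have b1 := fun l => z0.trans (ha1 l)
  have su : ∀ {f : Ser n}, nrm 0 f ≤ η → (Summable fun l => a l * f ^ l) ∧
      Summable fun l => der a l * f ^ l := fun h =>
    ⟨summable_comp le_rfl hM't b0 (sm h), summable_comp le_rfl hM't b1 (sm h)⟩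
  have n0 : nrm 0 (0 : Ser n) ≤ η := by rw [nrm, N_zero]; exact zero_le
  have step : ∀ j x, St.Inv Ω χ a v₀ φ₀ (r j) (e j) (η * 2⁻¹ ^ j) η x ∧
      St.Norm ⟨0, σ₀, lam₀, φ₀⟩ x → ∃ y, (St.Inv Ω χ a v₀ φ₀ (r (j + 1)) (e (j + 1))
        (η * 2⁻¹ ^ (j + 1)) η y ∧ St.Norm ⟨0, σ₀, lam₀, φ₀⟩ y) ∧
      St.Close R' (η * 2⁻¹ ^ (j + 1)) x y := by
    rintro j x ⟨hx, hx'⟩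
    have su1 : nrm (r j) x.u ≤ η := le_self_add.trans hx.u
    have su2 : nrm (r j) (x.φ - φ₀) ≤ η := le_self_add.trans hx.φ
    have uu : nrm 0 x.u ≤ η := (nrm_mono (hR'.le.trans (hr j)) _).trans su1
    obtain ⟨s, D, b, f, hs, hD, hb, n1, n2, n3, n4, n5, n6, hv⟩ := H a ha hω' (r (j + 1)) (d j)
      (lm j) (e j) (hr _) (hd j) (by rw [hrd]; exact hrR j) (hlmL j) (hlmt j) (het j)
      (hlmC j) ((hlme j).trans (mul_le_of_le_one_right zero_le (pow_le_one₀ zero_le (by simp))))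
      x.u x.σ x.lam x.φ (by rwa [hrd]) (by rwa [hrd]) (by rw [hrd]; exact hx.E)
      (by rw [hrd]; exact hx.G)
    have v1 : Van (errE Ω a v₀ x.u x.σ x.lam) := by
      have := (van_errE_sub Ω (v₀ := v₀) (su uu).1 (su n0).1 hx'.vu hx'.vσ hx'.vlam).add vE
      rwa [sub_add_cancel] at this
    have v2 : Van (errG Ω χ a x.u x.σ x.φ) := by
      have := (van_errG_sub Ω χ (su uu).2 (su n0).2 hx'.vu hx'.vσ hx'.vφ).add vG
      rwa [sub_add_cancel] at this
    obtain ⟨w1, w2, w3, w4⟩ := hv v1 v2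
    have acc : ∀ {f g : Ser n}, nrm (r j) f + η * 2⁻¹ ^ j ≤ η → nrm (r (j + 1)) g ≤ lm j ^ 60 * e j →
        nrm (r (j + 1)) (f + g) + η * 2⁻¹ ^ (j + 1) ≤ η := fun {f g} hf hg => by
      refine le_trans ?_ hf
      rw [← mul_two_inv_pow_succ η j, ← add_assoc]
      refine add_le_add ((N_add_le _ _).trans (add_le_add (nrm_mono ?_ _) (hg.trans (hlme j)))) le_rfl
      have := hrd j
      have := hd j
      linarith
    have fin : ∀ {f g : Ser n}, nrm (r (j + 1)) g ≤ lm j ^ 60 * e j →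
        nrm R' (f + g - f) ≤ η * 2⁻¹ ^ (j + 1) := fun hg => by
      rw [add_sub_cancel_left]
      exact (nrm_mono (hr _) _).trans (hg.trans (hlme j))
    refine ⟨⟨x.u + b, x.σ + s, x.lam + D, x.φ + f⟩, ⟨⟨n5.trans (hlme2 j), n6.trans (hlme2 j),
      acc hx.u n3, ?_⟩, hx'.step hs hD hb w1 w2 w3 w4⟩, ⟨fin n3, fin n1, fin n2, fin n4⟩⟩
    dsimp only; rw [add_sub_right_comm]; exact acc hx.φ n4
  have init : St.Inv Ω χ a v₀ φ₀ (r 0) (e 0) (η * 2⁻¹ ^ 0) η ⟨0, σ₀, lam₀, φ₀⟩ ∧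
      St.Norm ⟨0, σ₀, lam₀, φ₀⟩ (⟨0, σ₀, lam₀, φ₀⟩ : St n) := by
    refine ⟨⟨?_, ?_, ?_, ?_⟩, ⟨ave_zero, hσ₀, hlam₀, ?_, ?_, ?_, ?_⟩⟩
    · rw [r0]; exact hE.trans (min_le_left _ _)
    · rw [r0]; exact hG.trans (min_le_left _ _)
    · rw [pow_zero, mul_one, nrm, N_zero, zero_add]
    · rw [pow_zero, mul_one, sub_self, nrm, N_zero, zero_add]
    all_goals rw [sub_self]; exact Van.zero
  obtain ⟨x, hx0, hx⟩ := exists_seq_of_step (α := St n)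
    (P := fun j x => St.Inv Ω χ a v₀ φ₀ (r j) (e j) (η * 2⁻¹ ^ j) η x ∧ St.Norm ⟨0, σ₀, lam₀, φ₀⟩ x)
    (D := fun j x y => St.Close R' (η * 2⁻¹ ^ (j + 1)) x y) init step
  obtain ⟨u, hu, hu'⟩ := tendsto_of_geometric (x := fun j => (x j).u) hR'.le hηt fun j => (hx j).2.u
  obtain ⟨σ, hσ, -⟩ := tendsto_of_geometric (x := fun j => (x j).σ) hR'.le hηt fun j => (hx j).2.σ
  obtain ⟨lam, hlam, -⟩ := tendsto_of_geometric (x := fun j => (x j).lam) hR'.le hηt fun j => (hx j).2.lam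
  obtain ⟨φ, hφ, hφ'⟩ := tendsto_of_geometric (x := fun j => (x j).φ) hR'.le hηt fun j => (hx j).2.φ
  rw [hx0] at hu' hφ'
  dsimp only at hu' hφ'
  rw [sub_zero] at hu'
  have hxu : ∀ j, nrm 0 ((x j).u) ≤ η := fun j =>
    (nrm_mono (hR'.le.trans (hr j)) _).trans (le_self_add.trans (hx j).1.1.u)
  obtain ⟨tE, tG⟩ := tendsto_err (Ω := Ω) (χ := χ) (v₀ := v₀) hM't hB't b0 b1 hη hBη hxu hu hσ hlam hφ
  have hz := (nrm_mul_shf_sub_le hR'.le Ω hφ' hη1).trans (b := _)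
    (c := (2 * nrm R φ₀ + 1) * η) (by gcongr; exact nrm_mono hRR.le _)
  obtain ⟨q, hq, hqq⟩ := exists_inv_near' hR'.le h₀ ((mul_le_mul' (nrm_mono hRR.le q₀) hz).trans hqη)
  have ft : ∀ {f : Ser n}, nrm R f ≠ ∞ → nrm R' f ≠ ∞ := fun h =>
    ne_top_of_le_ne_top h (nrm_mono hRR.le _)
  have hφ₀' := ft hφ₀
  have hq₀' := ft hq₀
  refine ⟨u, σ, lam, φ, q, eq_zero_of_tendsto hR'.le hr te tE fun j => (hx j).1.1.E,
    eq_zero_of_tendsto hR'.le hr te tG fun j => (hx j).1.1.G, ?_,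
    ne_top_of_le_ne_top hηt hu', ?_, ?_, hq, St.Norm.limit (fun j => (hx j).1.2) hu hσ hlam hφ⟩
  · rw [← e2]
    exact (mul_le_mul' le_rfl (hu'.trans (le_mul_of_one_le_left zero_le (by norm_num)))).trans hBη
  · exact ne_top_of_le_ne_top (by finiteness) (le_of_sub_le hφ')
  · refine ne_top_of_le_ne_top ?_ (le_of_sub_le (hqq.trans (mul_le_mul' le_rfl hz)))
    have := ft hφ₀
    finiteness

end iteration

open MeasureTheory

section realTorus

/-- Continuous periodic functions of real arguments. -/
structure Per (g : Vec n → ℂ) : Prop where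
  cont : Continuous g
  per : ∀ x (m : Fin n → ℤ), g (x + fun j => (m j : ℝ)) = g x

/-- The average of a function of real arguments. -/
def ravg (g : Vec n → ℂ) : ℂ := ∫ x in Set.Icc (0 : Vec n) 1, g x

/-- The Fourier coefficients of a function of real arguments. -/
def fc (g : Vec n → ℂ) (k : Fin n → ℤ) : ℂ := ravg fun x => chr (-k) (toC x) * g x

theorem continuous_toC : Continuous (toC (n := n)) := by
  unfold toC; fun_prop

theorem continuous_chr (k : Fin n → ℤ) : Continuous (chr k) := by
  unfold chr; fun_prop

theorem toC_add_int (x : Vec n) (m : Fin n → ℤ) : toC (x + fun j => (m j : ℝ)) = toC x + intPt m := by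
  ext j; simp [toC, intPt]

theorem per_chr (k : Fin n → ℤ) : Per fun x : Vec n => chr k (toC x) where
  cont := (continuous_chr k).comp continuous_toC
  per x m := by rw [toC_add_int, chr_add_arg, chr_intPt, mul_one]

theorem Per.mul {f g : Vec n → ℂ} (hf : Per f) (hg : Per g) : Per fun x => f x * g x where
  cont := hf.cont.mul hg.cont
  per x m := by rw [hf.per, hg.per]

theorem Per.sub {f g : Vec n → ℂ} (hf : Per f) (hg : Per g) : Per fun x => f x - g x where
  cont := hf.cont.sub hg.cont
  per x m := by rw [hf.per, hg.per]

theorem Per.const (c : ℂ) : Per fun _ : Vec n => c := ⟨continuous_const, fun _ _ => rfl⟩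

theorem Per.conj {f : Vec n → ℂ} (hf : Per f) : Per fun x => conj (f x) where
  cont := Complex.continuous_conj.comp hf.cont
  per x m := by rw [hf.per]

theorem Per.inv {f : Vec n → ℂ} (hf : Per f) (h : ∀ x, f x ≠ 0) : Per fun x => (f x)⁻¹ where
  cont := hf.cont.inv₀ h
  per x m := by rw [hf.per]

theorem Per.shift {f : Vec n → ℂ} (hf : Per f) (a : Vec n) : Per fun x => f (x + a) where
  cont := hf.cont.comp (continuous_id.add_const a)
  per x m := by rw [add_right_comm, hf.per]

/-- The projection to the torus. -/
def proj (x : Vec n) : UnitAddTorus (Fin n) := fun i => (x i : UnitAddCircle)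

theorem isQuotientMap_proj : IsQuotientMap (proj (n := n)) := by
  have h : IsOpenQuotientMap (proj (n := n)) := by
    have h1 : IsOpenQuotientMap ((↑) : ℝ → UnitAddCircle) := QuotientAddGroup.isOpenQuotientMap_mk
    refine ⟨fun y => ?_, ?_, ?_⟩
    · choose x hx using fun i => h1.surjective (y i)
      exact ⟨x, funext hx⟩
    · exact continuous_pi fun i => h1.continuous.comp (continuous_apply i)
    · exact IsOpenMap.piMap (fun _ => h1.isOpenMap) (by simp)
  exact h.isQuotientMap

theorem Per.desc {g : Vec n → ℂ} (hg : Per g) : ∃ F : C(UnitAddTorus (Fin n), ℂ), ∀ x, F (proj x) = g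
    x := by
  have h : Function.FactorsThrough g proj := by
    intro x y hxy
    have : ∀ i, ∃ m : ℤ, y i = x i + m := fun i => by
      have := congrFun hxy i
      simp only [proj] at this
      obtain ⟨m, hm⟩ := (QuotientAddGroup.eq_iff_sub_mem.1 this.symm)
      refine ⟨m, ?_⟩
      simp only [zsmul_eq_mul, mul_one] at hm
      linarith
    choose m hm using this
    rw [show y = x + fun j => (m j : ℝ) from funext hm, hg.per]
  exact ⟨IsQuotientMap.lift (f := ⟨proj, isQuotientMap_proj.continuous⟩) isQuotientMap_proj
    ⟨g, hg.cont⟩ h, fun x =>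
    congrFun (congrArg DFunLike.coe (IsQuotientMap.lift_comp
      (f := ⟨proj, isQuotientMap_proj.continuous⟩) isQuotientMap_proj ⟨g, hg.cont⟩ h)) x⟩

theorem mFourier_proj (k : Fin n → ℤ) (x : Vec n) : UnitAddTorus.mFourier k (proj x) = chr k (toC x) := by
  simp only [UnitAddTorus.mFourier, ContinuousMap.coe_mk, proj, fourier_coe_apply, chr,
    ← Complex.exp_sum, toC, Finset.mul_sum]
  congr 1
  refine Finset.sum_congr rfl fun i _ => ?_
  push_cast; ring

/-- The unit cell with a given corner. -/
def cell (a : Vec n) : Set (Vec n) := {x | ∀ i, x i ∈ Set.Ioc (a i) (a i + 1)}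

theorem ravg_eq_cell_zero (g : Vec n → ℂ) : ravg g = ∫ x in cell 0, g x := by
  have : (cell 0 : Set (Vec n)) = Set.pi Set.univ fun i => Set.Ioc (0 : ℝ) 1 := by
    ext x; simp [cell]
  rw [ravg, this]
  exact setIntegral_congr_set (Measure.univ_pi_Ioc_ae_eq_Icc (μ := fun _ => volume)
    (f := (0 : Vec n)) (g := 1)).symm

theorem fc_eq {g : Vec n → ℂ} {F : C(UnitAddTorus (Fin n), ℂ)} (hF : ∀ x, F (proj x) = g x) (k : Fin n → ℤ)
    : UnitAddTorus.mFourierCoeff F k = fc g k := by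
  rw [UnitAddTorus.mFourierCoeff_eq_integral F k 0, fc, ravg_eq_cell_zero]
  congr 1
  funext x
  rw [smul_eq_mul]
  exact congrArg₂ _ (mFourier_proj _ x) (hF x)

theorem ravg_eq_cell {g : Vec n → ℂ} (hg : Per g) (a : Vec n) : ravg g = ∫ x in cell a, g x := by
  obtain ⟨F, hF⟩ := hg.desc
  have h : ∀ a : Vec n, UnitAddTorus.mFourierCoeff F 0 = ∫ x in cell a, g x := fun a => by
    rw [UnitAddTorus.mFourierCoeff_eq_integral F 0 a]
    congr 1
    funext x
    rw [smul_eq_mul, neg_zero, UnitAddTorus.mFourier_zero, ContinuousMap.one_apply, one_mul]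
    exact hF x
  rw [ravg_eq_cell_zero, ← h 0, h a]

theorem ravg_shift {g : Vec n → ℂ} (hg : Per g) (a : Vec n) : ravg (fun x => g (x + a)) = ravg g := by
  rw [ravg_eq_cell_zero, ravg_eq_cell hg a]
  have : (cell 0 : Set (Vec n)) = (fun x => x + a) ⁻¹' cell a := by
    ext x; simp [cell, Set.mem_Ioc, add_comm (x _)]
  rw [this]
  exact (measurePreserving_add_right volume a).setIntegral_preimage_emb
    (MeasurableEquiv.addRight a).measurableEmbedding g _

theorem integrableOn_cube {g : Vec n → ℂ} (hg : Continuous g) : IntegrableOn g (Set.Icc (0 : Vec n) 1) := hg.continuousOn.integrableOn_compact isCompact_Icc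

theorem ravg_add {f g : Vec n → ℂ} (hf : Continuous f) (hg : Continuous g) : ravg (fun x => f x + g x) =
    ravg f + ravg g := integral_add (integrableOn_cube hf) (integrableOn_cube hg)

theorem ravg_sub {f g : Vec n → ℂ} (hf : Continuous f) (hg : Continuous g) : ravg (fun x => f x - g x) =
    ravg f - ravg g := integral_sub (integrableOn_cube hf) (integrableOn_cube hg)

theorem ravg_mul_left (c : ℂ) (f : Vec n → ℂ) : ravg (fun x => c * f x) = c * ravg f :=
  integral_const_mul _ _

theorem ravg_mul_right (c : ℂ) (f : Vec n → ℂ) : ravg (fun x => f x * c) = ravg f * c :=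
  integral_mul_const _ _

theorem ravg_const (c : ℂ) : ravg (fun _ : Vec n => c) = c := by
  rw [ravg, setIntegral_const, Measure.real, Real.volume_Icc_pi]; simp

theorem ravg_conj (f : Vec n → ℂ) : ravg (fun x => conj (f x)) = conj (ravg f) := integral_conj

theorem norm_ravg_le {f : Vec n → ℂ} (h : ∀ x, ‖f x‖ ≤ M) : ‖ravg f‖ ≤ M := by
  have := norm_setIntegral_le_of_norm_le_const (μ := volume) (s := Set.Icc (0 : Vec n) 1)
    (f := f) (C := M) (by rw [Real.volume_Icc_pi]; simp) fun x _ => h x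
  rw [Measure.real, Real.volume_Icc_pi] at this
  rw [ravg]; simpa using this

theorem fc_zero (g : Vec n → ℂ) : fc g 0 = ravg g := by
  rw [fc]; simp only [neg_zero, chr_zero, one_mul]

theorem fc_shift {g : Vec n → ℂ} (hg : Per g) (a : Vec n) (k : Fin n → ℤ) : fc (fun x => g (x + a)) k = chr
    k (toC a) * fc g k := by
  have h := ravg_shift ((per_chr (-k)).mul hg) a
  rw [fc, fc, ← h, ← ravg_mul_left]
  congr 1; funext x
  rw [toC_add, chr_add_arg (-k)]
  have : chr k (toC a) * chr (-k) (toC a) = 1 := by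
    rw [← chr_add, add_neg_cancel, chr_zero]
  linear_combination (-(chr (-k) (toC x) * g (x + a))) * this

theorem Per.hasSum {g : Vec n → ℂ} (hg : Per g) (h : Summable (fc g)) (x : Vec n) : HasSum
    (fun k => fc g k * chr k (toC x)) (g x) := by
  obtain ⟨F, hF⟩ := hg.desc
  have e : UnitAddTorus.mFourierCoeff F = fc g := funext (fc_eq hF)
  have := UnitAddTorus.hasSum_mFourier_series_apply_of_summable (f := F) (by rwa [e]) (proj x)
  rw [hF, e] at this
  simpa only [mFourier_proj, smul_eq_mul] using this

theorem Per.eq_const {g : Vec n → ℂ} (hg : Per g) (h : ∀ k, k ≠ 0 → fc g k = 0) (x : Vec n) : g x = ravg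
    g := by
  have hs : Summable (fc g) := summable_of_ne_finset_zero (s := {0}) fun k hk =>
    h k (by simpa using hk)
  have h1 := hg.hasSum hs x
  have h2 := hasSum_single (f := fun k => fc g k * chr k (toC x)) 0 fun k hk => by
    rw [h k hk, zero_mul]
  rw [h1.unique h2, fc_zero, chr_zero, mul_one]

theorem exists_int_translate (x : Vec n) : ∃ m : Fin n → ℤ, (x + fun j => (m j : ℝ)) ∈ Set.Icc (0 : Vec n)
    1 := by
  refine ⟨fun j => -⌊x j⌋, fun j => ?_, fun j => ?_⟩
  · simp only [Pi.zero_apply, Pi.add_apply, Int.cast_neg]; linarith [Int.floor_le (x j)]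
  · simp only [Pi.one_apply, Pi.add_apply, Int.cast_neg]; linarith [Int.lt_floor_add_one (x j)]

theorem Icc_subset_closure_interior : Set.Icc (0 : Vec n) 1 ⊆ closure
    (interior (Set.Icc (0 : Vec n) 1)) := by
  have h : (interior (Set.Icc (0 : Vec n) 1)).Nonempty := by
    rw [← Set.pi_univ_Icc, interior_pi_set Set.finite_univ]
    refine ⟨fun _ => 1 / 2, fun i _ => ?_⟩
    simp only [Pi.zero_apply, Pi.one_apply, interior_Icc]
    constructor <;> norm_num
  rw [(convex_Icc (𝕜 := ℝ) (0 : Vec n) 1).closure_interior_eq_closure_of_nonempty_interior h]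
  exact subset_closure

/-- A nonnegative periodic function with zero average vanishes. -/
theorem eq_zero_of_ravg_eq_zero {h : Vec n → ℝ} (hp : Per fun x => (h x : ℂ)) (h0 : ∀ x, 0 ≤ h x)
    (hi : ravg (fun x => (h x : ℂ)) = 0) (x : Vec n) : h x = 0 := by
  have hc : Continuous h := by
    have := Complex.continuous_re.comp hp.cont
    simpa [Function.comp_def] using this
  have h1 : ∫ x in Set.Icc (0 : Vec n) 1, h x = 0 := by
    have : ravg (fun x => (h x : ℂ)) = ((∫ x in Set.Icc (0 : Vec n) 1, h x : ℝ) : ℂ) :=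
      integral_ofReal
    rw [this] at hi
    exact_mod_cast hi
  rw [setIntegral_eq_zero_iff_of_nonneg_ae (Eventually.of_forall h0)
    (hc.continuousOn.integrableOn_compact isCompact_Icc)] at h1
  have h2 := Measure.eqOn_of_ae_eq h1 hc.continuousOn continuousOn_const Icc_subset_closure_interior
  obtain ⟨m, hm⟩ := exists_int_translate x
  have h3 := hp.per x m
  have h4 : h (x + fun j => (m j : ℝ)) = 0 := h2 hm
  rw [h4] at h3
  exact_mod_cast h3.symm

/-- Twisted-invariant functions are constant. -/
theorem Per.const_of_twisted (hS : SmallDiv Ω C p) {y : Vec n → ℂ} (hy : Per y)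
    (h : ∀ x, y (x + Ω) = χ * y x) (x : Vec n) : y x = ravg y := by
  refine hy.eq_const (fun k hk => ?_) x
  have h1 := fc_shift hy Ω k
  have h2 : fc (fun x => y (x + Ω)) k = χ * fc y k := by
    rw [fc, fc, ← ravg_mul_left]
    congr 1; funext x; rw [h]; ring
  have h3 : (chr k (toC Ω) - χ) * fc y k = 0 := by rw [sub_mul, ← h1, h2, sub_self]
  exact (mul_eq_zero.1 h3).resolve_left (hS.ne hk χ)

end realTorus

section expSum

variable {E : Type*} [NormedAddCommGroup E] [NormedSpace ℂ E] {α : Type*}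

/-- The power series of an exponential of a linear form. -/
def expLin (c : ℂ) (L : E →L[ℂ] ℂ) : FormalMultilinearSeries ℂ E ℂ := fun m =>
  (c * ((m.factorial : ℂ))⁻¹) •
    (ContinuousMultilinearMap.mkPiAlgebraFin ℂ m ℂ).compContinuousLinearMap fun _ => L

theorem expLin_apply (c : ℂ) (L : E →L[ℂ] ℂ) (m : ℕ) (y : E) : expLin c L m (fun _ => y) = c *
    (((m.factorial : ℂ))⁻¹ * L y ^ m) := by
  simp [expLin, mul_assoc]

theorem norm_expLin_le (c : ℂ) (L : E →L[ℂ] ℂ) (m : ℕ) : ‖expLin c L m‖ ≤ ‖c‖ *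
    (((m.factorial : ℝ))⁻¹ * ‖L‖ ^ m) := by
  rw [expLin, norm_smul, norm_mul, norm_inv, Complex.norm_natCast, mul_assoc]
  gcongr
  refine (ContinuousMultilinearMap.norm_compContinuousLinearMap_le _ _).trans ?_
  simp

theorem hasSum_exp_real (x : ℝ) : HasSum (fun m : ℕ => ((m.factorial : ℝ))⁻¹ * x ^ m) (Real.exp x) := by
  have := NormedSpace.expSeries_div_hasSum_exp (𝔸 := ℝ) x
  rw [← Real.exp_eq_exp_ℝ] at this
  simpa only [div_eq_inv_mul] using this

theorem hasSum_exp_complex (x : ℂ) : HasSum (fun m : ℕ => ((m.factorial : ℂ))⁻¹ * x ^ m)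
    (Complex.exp x) := by
  have := NormedSpace.expSeries_div_hasSum_exp (𝔸 := ℂ) x
  rw [← Complex.exp_eq_exp_ℂ] at this
  simpa only [div_eq_inv_mul] using this

/-- Absolutely convergent sums of exponentials of linear forms are analytic. -/
theorem analyticAt_tsum_exp {c : α → ℂ} {L : α → E →L[ℂ] ℂ} (hr : 0 < r)
    (h : Summable fun k => ‖c k‖ * Real.exp (‖L k‖ * r)) : AnalyticAt ℂ
    (fun y => ∑' k, c k * Complex.exp (L k y)) 0 := by
  have hs : Summable fun q : α × ℕ => ‖c q.1‖ * (((q.2.factorial : ℝ))⁻¹ * (‖L q.1‖ * r) ^ q.2) := by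
    refine (summable_prod_of_nonneg fun q => by positivity).2 ⟨fun k => ?_, ?_⟩
    · exact ((hasSum_exp_real (‖L k‖ * r)).mul_left ‖c k‖).summable
    · refine h.congr fun k => ?_
      exact ((hasSum_exp_real (‖L k‖ * r)).mul_left ‖c k‖).tsum_eq.symm
  have hb : ∀ q : α × ℕ, ‖expLin (c q.1) (L q.1) q.2‖ * r ^ q.2
      ≤ ‖c q.1‖ * (((q.2.factorial : ℝ))⁻¹ * (‖L q.1‖ * r) ^ q.2) := fun q => by
    refine (mul_le_mul_of_nonneg_right (norm_expLin_le _ _ _) (by positivity)).trans (le_of_eq ?_)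
    rw [mul_pow]; ring
  have hs' := Summable.of_nonneg_of_le (fun q => by positivity) hb hs
  have hsm : ∀ m, Summable fun k => ‖expLin (c k) (L k) m‖ := fun m => by
    have := hs'.comp_injective (i := fun k => (k, m)) fun a b hab => by simpa using hab
    have h2 := this.mul_right ((r ^ m)⁻¹)
    refine h2.congr fun k => ?_
    simp only [Function.comp]
    rw [mul_assoc, mul_inv_cancel₀ (by positivity), mul_one]
  obtain ⟨P, hP⟩ : ∃ P : FormalMultilinearSeries ℂ E ℂ, ∀ m, P m = ∑' k, expLin (c k) (L k) m :=
    ⟨fun m => ∑' k, expLin (c k) (L k) m, fun _ => rfl⟩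
  have hswap : Summable fun q : ℕ × α => ‖expLin (c q.2) (L q.2) q.1‖ * r ^ q.1 :=
    hs'.comp_injective (i := Prod.swap) Prod.swap_injective
  refine ⟨P, ofReal r, ?_, ENNReal.ofReal_pos.2 hr, ?_⟩
  · refine P.le_radius_of_summable (r := ⟨r, hr.le⟩) ?_ |>.trans' (le_of_eq ?_)
    · have h2 := hswap.prod
      refine Summable.of_nonneg_of_le (fun m => by positivity) (fun m => ?_) h2
      rw [hP]
      refine le_trans ?_ (le_of_eq (tsum_mul_right (f := fun k => ‖expLin (c k) (L k) m‖)
        (a := r ^ m)).symm)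
      exact mul_le_mul_of_nonneg_right (norm_tsum_le_tsum_norm (hsm m)) (by positivity)
    · rw [ofReal, Real.toNNReal_of_nonneg hr.le]
      rfl
  · intro y hy
    have hy' : ‖y‖ < r := by
      rw [Metric.eball_ofReal, mem_ball_zero_iff] at hy; exact hy
    rw [zero_add]
    have e1 : ∀ m, P m (fun _ => y) = ∑' k, expLin (c k) (L k) m (fun _ => y) := fun m => by
      have hsum : Summable fun k => expLin (c k) (L k) m := (hsm m).of_norm
      rw [hP]
      exact (ContinuousMultilinearMap.apply ℂ (fun _ : Fin m => E) ℂ (fun _ => y)).map_tsum hsum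
    obtain ⟨F, hF⟩ : ∃ F : ℕ → α → ℂ, ∀ m k, F m k = expLin (c k) (L k) m fun _ => y :=
      ⟨_, fun _ _ => rfl⟩
    have hsy : Summable (Function.uncurry F) := by
      refine Summable.of_norm_bounded hswap fun q => ?_
      rw [Function.uncurry, hF]
      refine (ContinuousMultilinearMap.le_opNorm _ _).trans ?_
      simp only [Finset.prod_const, Finset.card_univ, Fintype.card_fin]
      gcongr
    have h3 := hsy.hasSum.prod_fiberwise fun m => (hsy.prod_factor m).hasSum
    have e2 : ∑' k, c k * Complex.exp (L k y) = ∑' q : ℕ × α, Function.uncurry F q := by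
      rw [hsy.tsum_prod, show (∑' (b : ℕ) (c : α), Function.uncurry F (b, c)) = ∑' k, ∑' m, F m k
        from hsy.tsum_comm.symm]
      refine tsum_congr fun k => ?_
      simp only [hF, expLin_apply]
      exact ((hasSum_exp_complex (L k y)).mul_left (c k)).tsum_eq.symm
    rw [e2]
    have e4 : (fun m => P m fun _ => y) = fun m => ∑' k, Function.uncurry F (m, k) := by
      funext m; rw [e1]; exact tsum_congr fun k => (hF m k).symm
    rw [e4]; exact h3

end expSum

section holomorphic

/-- The linear form in the exponent of a character. -/
def chrLin (k : Fin n → ℤ) : CVec n →L[ℂ] ℂ :=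
  (2 * π * Complex.I : ℂ) • ∑ j, (k j : ℂ) • ContinuousLinearMap.proj j

theorem chr_eq_exp (k : Fin n → ℤ) (ψ : CVec n) : chr k ψ = Complex.exp (chrLin k ψ) := by
  simp [chr, chrLin]

theorem norm_chrLin_le (k : Fin n → ℤ) : ‖chrLin k‖ ≤ 2 * π * len k := by
  rw [chrLin, norm_smul]
  have h1 : ‖(2 * π * Complex.I : ℂ)‖ = 2 * π := by
    simp [abs_of_pos Real.pi_pos]
  rw [h1]
  refine mul_le_mul_of_nonneg_left ?_ (by positivity)
  refine (norm_sum_le _ _).trans (Finset.sum_le_sum fun j _ => ?_)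
  rw [norm_smul, Complex.norm_intCast]
  refine mul_le_of_le_one_right (abs_nonneg _) ?_
  refine ContinuousLinearMap.opNorm_le_bound _ zero_le_one fun x => ?_
  rw [one_mul]; exact norm_le_pi_norm x j

theorem isOpen_openStrip (n : ℕ) (ρ : ℝ) : IsOpen (openStrip n ρ) := by
  have : openStrip n ρ = ⋂ j, {ψ : CVec n | |(ψ j).im| < ρ} := by ext; simp [openStrip]
  rw [this]
  refine isOpen_iInter_of_finite fun j => isOpen_lt ?_ continuous_const
  exact (Complex.continuous_im.comp (continuous_apply j)).abs

theorem exists_margin (hρ : 0 < ρ) (hψ : ψ ∈ openStrip n ρ) : ∃ ρ' : ℝ, 0 < ρ' ∧ ρ' < ρ ∧ ψ ∈ closedStrip n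
    ρ' := by
  have h : ∀ᶠ ρ' in 𝓝[<] ρ, (∀ j, |(ψ j).im| ≤ ρ') ∧ 0 < ρ' ∧ ρ' < ρ := by
    refine Filter.Eventually.and (eventually_all.2 fun j => ?_) (Filter.Eventually.and ?_ ?_)
    · exact eventually_nhdsWithin_of_eventually_nhds (eventually_ge_nhds (hψ j))
    · exact eventually_nhdsWithin_of_eventually_nhds (eventually_gt_nhds hρ)
    · exact eventually_nhdsWithin_of_forall fun _ h => h
  obtain ⟨ρ', h1, h2, h3⟩ := h.exists
  exact ⟨ρ', h2, h3, h1⟩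

theorem closedStrip_subset_openStrip (h : ρ' < ρ) : closedStrip n ρ' ⊆ openStrip n ρ :=
  fun _ hψ j => (hψ j).trans_lt h

theorem closedStrip_mono (h : ρ' ≤ ρ) : closedStrip n ρ' ⊆ closedStrip n ρ := fun _ hψ j => (hψ j).trans h

theorem openStrip_subset (n : ℕ) (ρ : ℝ) : openStrip n ρ ⊆ closedStrip n ρ := fun _ hψ j => (hψ j).le

theorem toC_mem (hρ : 0 ≤ ρ) (x : Vec n) : toC x ∈ closedStrip n ρ := fun j => by
  simpa [toC] using hρ

theorem mono_norm_le (hζ : ‖ζ‖ ≤ 1) (hψ : ψ ∈ closedStrip n ρ) (i : Idx n) : ‖mono ζ ψ i‖ ≤ Real.exp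
    (2 * π * ρ * len i.1) := by
  rw [mono, norm_mul, norm_pow]
  exact (mul_le_of_le_one_right (norm_nonneg _) (pow_le_one₀ (norm_nonneg _) hζ)).trans (norm_chr_le hψ _)

theorem summable_of_nrm (hf : nrm ρ f ≠ ∞) : Summable fun i : Idx n => ‖f i‖ * Real.exp
    (2 * π * ρ * len i.1) := by
  have h : ∑' i : Idx n, ofReal (‖f i‖ * Real.exp (2 * π * ρ * len i.1)) ≠ ∞ := by
    refine ne_of_eq_of_ne (tsum_congr fun i => ?_) hf
    rw [ofReal_mul (norm_nonneg _), ofReal_norm, wt]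
  have := ENNReal.summable_toReal h
  refine this.congr fun i => ENNReal.toReal_ofReal (by positivity)

/-- Absolutely convergent Fourier series are analytic functions on a strip. -/
theorem holA_ev (hρ : 0 < ρ) (hζ : ‖ζ‖ ≤ 1) (hf : nrm ρ f ≠ ∞) : HolA n ρ fun ψ => ev ζ ψ f where
  analytic ψ hψ := by
    obtain ⟨ρ', h0, h1, h2⟩ := exists_margin hρ hψ
    have h := analyticAt_tsum_exp (c := fun i : Idx n => mono ζ ψ i * f i)
      (L := fun i => chrLin i.1) (r := ρ - ρ') (sub_pos.2 h1) (by
        refine Summable.of_nonneg_of_le (fun _ => by positivity) (fun i => ?_) (summable_of_nrm hf)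
        calc _ ≤ Real.exp (2 * π * ρ' * len i.1) * ‖f i‖ * Real.exp (2 * π * len i.1 * (ρ - ρ')) := by
              rw [norm_mul]
              refine mul_le_mul (mul_le_mul_of_nonneg_right (mono_norm_le hζ h2 i)
                (norm_nonneg _)) (Real.exp_le_exp.2 ?_) (by positivity) (by positivity)
              exact mul_le_mul_of_nonneg_right (norm_chrLin_le _) (sub_pos.2 h1).le
          _ = ‖f i‖ * (Real.exp (2 * π * ρ' * len i.1) * Real.exp (2 * π * len i.1 * (ρ - ρ'))) := by ring
          _ = _ := by rw [← Real.exp_add]; ring_nf)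
    have h' : AnalyticAt ℂ (fun φ : CVec n => φ - ψ) ψ := analyticAt_id.sub analyticAt_const
    have h3 := AnalyticAt.fun_comp (f := fun φ : CVec n => φ - ψ) (by rwa [sub_self]) h'
    refine h3.congr ?_
    filter_upwards [(isOpen_openStrip n ρ).mem_nhds hψ] with φ hφ
    rw [ev_eq hζ (openStrip_subset n ρ hφ) hf]
    refine tsum_congr fun i => ?_
    rw [← chr_eq_exp, mono, mono, mul_right_comm, mul_right_comm (chr i.1 ψ), ← chr_add_arg,
      add_sub_cancel, mul_right_comm]
  continuousOn := by
    have h : ContinuousOn (fun ψ => ∑' i : Idx n, mono ζ ψ i * f i) (closedStrip n ρ) := by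
      refine continuousOn_tsum (fun i => ?_) (summable_of_nrm hf) fun i ψ hψ => ?_
      · exact (((continuous_chr i.1).mul continuous_const).mul continuous_const).continuousOn
      · rw [norm_mul, mul_comm]
        exact mul_le_mul_of_nonneg_left (mono_norm_le hζ hψ i) (norm_nonneg _)
    exact h.congr fun ψ hψ => ev_eq hζ hψ hf
  periodic ψ _ m := by
    have : mono ζ (ψ + intPt m) = (mono ζ ψ : Idx n → ℂ) := by
      funext i; rw [mono, mono, chr_add_arg, chr_intPt, mul_one]
    rw [ev, ev, this]

end holomorphic

section holAlgebra

variable {f g : Fn n}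

theorem HolA.mono (hf : HolA n ρ f) (h : ρ' ≤ ρ) : HolA n ρ' f where
  analytic := hf.analytic.mono fun _ hψ j => (hψ j).trans_le h
  continuousOn := hf.continuousOn.mono (closedStrip_mono h)
  periodic ψ hψ := hf.periodic ψ (closedStrip_mono h hψ)

theorem HolA.add (hf : HolA n ρ f) (hg : HolA n ρ g) : HolA n ρ fun ψ => f ψ + g ψ where
  analytic := hf.analytic.add hg.analytic
  continuousOn := hf.continuousOn.add hg.continuousOn
  periodic ψ hψ m := by rw [hf.periodic ψ hψ, hg.periodic ψ hψ]

theorem HolA.sub (hf : HolA n ρ f) (hg : HolA n ρ g) : HolA n ρ fun ψ => f ψ - g ψ where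
  analytic := hf.analytic.sub hg.analytic
  continuousOn := hf.continuousOn.sub hg.continuousOn
  periodic ψ hψ m := by rw [hf.periodic ψ hψ, hg.periodic ψ hψ]

theorem HolA.mul (hf : HolA n ρ f) (hg : HolA n ρ g) : HolA n ρ fun ψ => f ψ * g ψ where
  analytic := hf.analytic.mul hg.analytic
  continuousOn := hf.continuousOn.mul hg.continuousOn
  periodic ψ hψ m := by rw [hf.periodic ψ hψ, hg.periodic ψ hψ]

theorem HolA.const (c : ℂ) : HolA n ρ fun _ => c where
  analytic := analyticOnNhd_const
  continuousOn := continuousOn_const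
  periodic _ _ _ := rfl

theorem HolA.inv (hf : HolA n ρ f) (h : ∀ ψ ∈ closedStrip n ρ, f ψ ≠ 0) : HolA n ρ fun ψ => (f ψ)⁻¹ where
  analytic := hf.analytic.inv fun ψ hψ => h ψ (openStrip_subset n ρ hψ)
  continuousOn := hf.continuousOn.inv₀ h
  periodic ψ hψ m := by rw [hf.periodic ψ hψ]

theorem add_toC_mem_closed (hψ : ψ ∈ closedStrip n ρ) (a : Vec n) : ψ + toC a ∈ closedStrip n ρ := fun j => by simpa [toC] using hψ j

theorem add_toC_mem_open (hψ : ψ ∈ openStrip n ρ) (a : Vec n) : ψ + toC a ∈ openStrip n ρ := fun j => by simpa [toC] using hψ j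

theorem sub_toC_mem_closed (hψ : ψ ∈ closedStrip n ρ) (a : Vec n) : ψ - toC a ∈ closedStrip n ρ := fun j => by simpa [toC] using hψ j

theorem HolA.shift (hf : HolA n ρ f) (a : Vec n) : HolA n ρ fun ψ => f (ψ + toC a) where
  analytic ψ hψ := AnalyticAt.fun_comp (hf.analytic _ (add_toC_mem_open hψ a))
    (analyticAt_id.add analyticAt_const)
  continuousOn := hf.continuousOn.comp (by fun_prop) fun ψ hψ => add_toC_mem_closed hψ a
  periodic ψ hψ m := by rw [add_right_comm, hf.periodic _ (add_toC_mem_closed hψ a)]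

theorem HolA.shift_neg (hf : HolA n ρ f) (a : Vec n) : HolA n ρ fun ψ => f (ψ - toC a) := by
  have := hf.shift (-a)
  simpa only [toC_neg, ← sub_eq_add_neg] using this

theorem HolA.exp (hf : HolA n ρ f) : HolA n ρ fun ψ => Complex.exp (f ψ) where
  analytic := hf.analytic.cexp
  continuousOn := hf.continuousOn.cexp
  periodic ψ hψ m := by rw [hf.periodic ψ hψ]

theorem holA_chr (k : Fin n → ℤ) : HolA n ρ (chr k) where
  analytic ψ _ := by
    have : chr k = fun ψ => Complex.exp (chrLin k ψ) := funext (chr_eq_exp k)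
    rw [this]
    exact ((chrLin k).analyticAt ψ).cexp
  continuousOn := (continuous_chr k).continuousOn
  periodic ψ _ m := by rw [chr_add_arg, chr_intPt, mul_one]

theorem HolA.per (hρ : 0 ≤ ρ) (hf : HolA n ρ f) : Per fun x => f (toC x) where
  cont := hf.continuousOn.comp_continuous continuous_toC (toC_mem hρ)
  per x m := by rw [toC_add_int, hf.periodic _ (toC_mem hρ x)]

/-- A fundamental domain of the closed strip. -/
def stripCell (n : ℕ) (ρ : ℝ) : Set (CVec n) :=
  Set.pi Set.univ fun _ => Set.Icc (0 : ℝ) 1 ×ℂ Set.Icc (-ρ) ρ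

theorem isCompact_stripCell (n : ℕ) (ρ : ℝ) : IsCompact (stripCell n ρ) :=
  isCompact_univ_pi fun _ => isCompact_Icc.reProdIm isCompact_Icc

theorem stripCell_subset (n : ℕ) (ρ : ℝ) : stripCell n ρ ⊆ closedStrip n ρ := fun _ hψ j =>
  abs_le.2 (Complex.mem_reProdIm.1 (hψ j trivial)).2

theorem exists_translate_mem_stripCell (hψ : ψ ∈ closedStrip n ρ) : ∃ m : Fin n → ℤ, ψ + intPt m ∈ stripCell
    n ρ := by
  refine ⟨fun j => -⌊(ψ j).re⌋, fun j _ => Complex.mem_reProdIm.2 ⟨?_, ?_⟩⟩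
  · have h1 := Int.floor_le (ψ j).re
    have h2 := (Int.lt_floor_add_one (ψ j).re).le
    have h3 : ((ψ + intPt fun j => -⌊(ψ j).re⌋) j).re = (ψ j).re - ⌊(ψ j).re⌋ := by
      simp [intPt, sub_eq_add_neg]
    rw [h3, Set.mem_Icc]
    constructor <;> linarith
  · simpa [intPt] using abs_le.1 (hψ j)

theorem HolA.bounded (hf : HolA n ρ f) : ∃ M : ℝ, 0 < M ∧ ∀ ψ ∈ closedStrip n ρ, ‖f ψ‖ ≤ M := by
  obtain ⟨M, hM⟩ := (isCompact_stripCell n ρ).exists_bound_of_continuousOn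
    (hf.continuousOn.mono (stripCell_subset n ρ))
  refine ⟨max M 1, by positivity, fun ψ hψ => ?_⟩
  obtain ⟨m, hm⟩ := exists_translate_mem_stripCell hψ
  rw [← hf.periodic ψ hψ m]
  exact (hM _ hm).trans (le_max_left _ _)

end holAlgebra

section identity

/-- A holomorphic function on a convex domain which vanishes for real arguments vanishes. -/
theorem eq_zero_at_I {V : Set ℂ} (hV : IsOpen V) (hc : Convex ℝ V) (h0 : (0 : ℂ) ∈ V) (hI : Complex.I ∈ V)
    {G : ℂ → ℂ} (hG : DifferentiableOn ℂ G V) (hr : ∀ᶠ t : ℝ in 𝓝 0, G t = 0) : G Complex.I = 0 := by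
  refine (hG.analyticOnNhd hV).eqOn_zero_of_preconnected_of_frequently_eq_zero hc.isPreconnected h0 ?_ hI
  have ht : Tendsto (fun t : ℝ => (t : ℂ)) (𝓝[≠] 0) (𝓝[≠] 0) := by
    refine tendsto_nhdsWithin_iff.2 ⟨?_, ?_⟩
    · have := Complex.continuous_ofReal.tendsto (0 : ℝ)
      rw [Complex.ofReal_zero] at this
      exact this.mono_left nhdsWithin_le_nhds
    · exact eventually_nhdsWithin_of_forall fun t ht => by simpa using ht
  exact ht.frequently (eventually_nhdsWithin_of_eventually_nhds hr).frequently

/-- The parameters `t` for which the point `x + t y` is in the strip. -/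
def lineDom (ρ : ℝ) (y : Vec n) : Set ℂ := {t | ∀ j, |t.im * y j| < ρ}

theorem isOpen_lineDom (ρ : ℝ) (y : Vec n) : IsOpen (lineDom ρ y) := by
  have : lineDom ρ y = ⋂ j, {t : ℂ | |t.im * y j| < ρ} := by ext; simp [lineDom]
  rw [this]
  exact isOpen_iInter_of_finite fun j => isOpen_lt (by fun_prop) continuous_const

theorem convex_lineDom (ρ : ℝ) (y : Vec n) : Convex ℝ (lineDom ρ y) := by
  intro s hs t ht a b ha hb hab j
  have h : (a • s + b • t).im * y j = a * (s.im * y j) + b * (t.im * y j) := by simp; ring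
  rw [h]
  have h1 := abs_lt.1 (hs j)
  have h2 := abs_lt.1 (ht j)
  have := convex_Ioo (-ρ) ρ h1 h2 ha hb hab
  exact abs_lt.2 this

theorem mem_lineDom {y : Vec n} {t : ℂ} : t ∈ lineDom ρ y ↔ ∀ x, toC x + t • toC y ∈ openStrip n ρ := by
  simp [lineDom, openStrip, toC]

theorem eqOn_openStrip (hρ : 0 < ρ) {f g : Fn n} (hf : AnalyticOnNhd ℂ f (openStrip n ρ))
    (hg : AnalyticOnNhd ℂ g (openStrip n ρ)) (h : ∀ x, f (toC x) = g (toC x)) : Set.EqOn f g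
    (openStrip n ρ) := by
  intro ψ hψ
  set x : Vec n := fun j => (ψ j).re
  set y : Vec n := fun j => (ψ j).im
  have hx : ψ = toC x + Complex.I • toC y := by
    ext j; simp [toC, x, y, mul_comm Complex.I, Complex.re_add_im]
  refine sub_eq_zero.1 ?_
  rw [hx]
  refine eq_zero_at_I (V := lineDom ρ y) (isOpen_lineDom ρ y) (convex_lineDom ρ y)
    (fun j => by simpa using hρ) (fun j => by simpa [y] using hψ j)
    (G := fun t => f (toC x + t • toC y) - g (toC x + t • toC y)) ?_ ?_
  · intro t ht
    have hd : DifferentiableAt ℂ (fun t : ℂ => toC x + t • toC y) t := by fun_prop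
    have hm := mem_lineDom.1 ht x
    exact (((hf _ hm).differentiableAt.comp t hd).sub
      ((hg _ hm).differentiableAt.comp t hd)).differentiableWithinAt
  · refine Eventually.of_forall fun t => ?_
    have : toC x + (t : ℂ) • toC y = toC (x + t • y) := by ext j; simp [toC]
    rw [this, h, sub_self]

theorem closedStrip_subset_closure (hρ : 0 < ρ) : closedStrip n ρ ⊆ closure (openStrip n ρ) := by
  intro ψ hψ
  have ht : Tendsto (fun s : ℝ => fun j => ((ψ j).re : ℂ) + ((s * (ψ j).im : ℝ) : ℂ) * Complex.I)
      (𝓝[<] 1) (𝓝 ψ) := by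
    have h1 : Continuous fun s : ℝ => (fun j => ((ψ j).re : ℂ) + ((s * (ψ j).im : ℝ) : ℂ) * Complex.I :
        CVec n) := by fun_prop
    have h2 := h1.tendsto 1
    simp only [one_mul, Complex.re_add_im] at h2
    exact h2.mono_left nhdsWithin_le_nhds
  refine mem_closure_of_tendsto ht ?_
  have h0 : ∀ᶠ s : ℝ in 𝓝[<] 1, 0 < s := eventually_nhdsWithin_of_eventually_nhds
    (eventually_gt_nhds one_pos)
  filter_upwards [h0, self_mem_nhdsWithin] with s hs hs1 j
  have h2 : s < 1 := hs1
  simp only [Complex.add_im, Complex.ofReal_im, Complex.mul_im, Complex.ofReal_re, Complex.I_im,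
    Complex.I_re, mul_zero, mul_one, zero_add, add_zero, abs_mul, abs_of_pos hs]
  rcases (abs_nonneg (ψ j).im).eq_or_lt with h | h
  · rw [← h, mul_zero]; exact hρ
  · exact (mul_lt_of_lt_one_left h h2).trans_le (hψ j)

theorem HolA.eq_on (hρ : 0 < ρ) {f g : Fn n} (hf : HolA n ρ f) (hg : HolA n ρ g)
    (h : ∀ x, f (toC x) = g (toC x)) : Set.EqOn f g (closedStrip n ρ) :=
  (eqOn_openStrip hρ hf.analytic hg.analytic h).of_subset_closure hf.continuousOn hg.continuousOn
    (openStrip_subset n ρ) (closedStrip_subset_closure hρ)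

end identity

section contour

theorem HolA.ravg_translate {f : Fn n} (hf : HolA n ρ f) {y : Vec n} (hy : ∀ j, |y j| < ρ) (hρ : 0 < ρ) :
    ravg (fun x => f (toC x + Complex.I • toC y)) = ravg fun x => f (toC x) := by
  obtain ⟨M, hM0, hM⟩ := hf.bounded
  have hcont : ∀ z ∈ lineDom ρ y, Continuous fun x : Vec n => f (toC x + z • toC y) := by
    intro z hz
    exact hf.continuousOn.comp_continuous (continuous_toC.add continuous_const)
      fun x => openStrip_subset n ρ (mem_lineDom.1 hz x)
  have hderiv : ∀ z ∈ lineDom ρ y, ∀ x,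
      HasDerivAt (fun w : ℂ => f (toC x + w • toC y)) (fderiv ℂ f (toC x + z • toC y) (toC y)) z := by
    intro z hz x
    have h1 := (hf.analytic _ (mem_lineDom.1 hz x)).differentiableAt.hasFDerivAt
    have h2 : HasDerivAt (fun w : ℂ => toC x + w • toC y) (toC y) z := by
      have := ((hasDerivAt_id z).smul_const (toC y)).const_add (toC x)
      simpa using this
    exact h1.comp_hasDerivAt z h2
  refine sub_eq_zero.1 (eq_zero_at_I (V := lineDom ρ y) (isOpen_lineDom ρ y) (convex_lineDom ρ y)
    (fun j => by simpa using hρ) (fun j => by simpa using hy j)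
    (G := fun z => ravg (fun x => f (toC x + z • toC y)) - ravg fun x => f (toC x)) ?_ ?_)
  · intro z hz
    refine DifferentiableAt.differentiableWithinAt (DifferentiableAt.sub_const ?_ _)
    obtain ⟨ε, hε, hball⟩ := Metric.isOpen_iff.1 (isOpen_lineDom ρ y) z hz
    have hin : ∀ w ∈ Metric.ball z (ε / 2), Metric.closedBall w (ε / 4) ⊆ lineDom ρ y := by
      intro w hw u hu
      refine hball ?_
      rw [Metric.mem_ball] at hw ⊢
      rw [Metric.mem_closedBall] at hu
      linarith [dist_triangle u w z]
    have hself : ∀ w ∈ Metric.ball z (ε / 2), w ∈ lineDom ρ y := fun w hw =>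
      hin w hw (Metric.mem_closedBall_self (by positivity))
    refine (hasDerivAt_integral_of_dominated_loc_of_deriv_le (F := fun w x => f (toC x + w • toC y))
      (F' := fun w x => fderiv ℂ f (toC x + w • toC y) (toC y)) (bound := fun _ => M / (ε / 4))
      (Metric.ball_mem_nhds z (half_pos hε)) ?_ ?_ ?_ ?_ ?_ ?_).2.differentiableAt
    · filter_upwards [Metric.ball_mem_nhds z (half_pos hε)] with w hw
      exact (hcont w (hself w hw)).aestronglyMeasurable
    · exact integrableOn_cube (hcont z hz)
    · refine Continuous.aestronglyMeasurable ?_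
      refine Continuous.clm_apply ?_ continuous_const
      exact hf.analytic.fderiv.continuousOn.comp_continuous (continuous_toC.add continuous_const)
        fun x => mem_lineDom.1 hz x
    · refine Eventually.of_forall fun x w hw => ?_
      rw [← (hderiv w (hself w hw) x).deriv]
      refine Complex.norm_deriv_le_of_forall_mem_sphere_norm_le (by positivity) ?_ fun u hu => ?_
      · refine DifferentiableOn.diffContOnCl ?_
        rw [closure_ball _ (by positivity)]
        intro u hu
        exact (hderiv u (hin w hw hu) x).differentiableAt.differentiableWithinAt
      · exact hM _ (openStrip_subset n ρ (mem_lineDom.1 (hin w hw (Metric.sphere_subset_closedBall hu)) x))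
    · exact continuousOn_const.integrableOn_compact isCompact_Icc
    · exact Eventually.of_forall fun x w hw => hderiv w (hself w hw) x
  · refine Eventually.of_forall fun t => sub_eq_zero.2 ?_
    have h : ∀ x, toC x + (t : ℂ) • toC y = toC (x + t • y) := fun x => by
      ext j; simp [toC]
    simp only [h]
    exact ravg_shift (hf.per hρ.le) (t • y)

theorem HolA.norm_fc_le {f : Fn n} (hf : HolA n ρ f) (h0 : 0 ≤ ρ') (h1 : ρ' < ρ)
    (hM : ∀ ψ ∈ closedStrip n ρ, ‖f ψ‖ ≤ M) (k : Fin n → ℤ) : ‖fc (fun x => f (toC x)) k‖ ≤ M * Real.exp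
    (-(2 * π * ρ' * len k)) := by
  set y : Vec n := fun j => -(ρ' * SignType.sign (k j))
  have hsign : ∀ a : ℤ, |((SignType.sign a : ℤ) : ℝ)| ≤ 1 := fun a => by
    rcases lt_trichotomy a 0 with h | h | h <;> simp [h]
  have hy' : ∀ j, |y j| ≤ ρ' := fun j => by
    simp only [y, abs_neg, abs_mul, abs_of_nonneg h0]
    exact mul_le_of_le_one_right h0 (by simpa using hsign (k j))
  have hy : ∀ j, |y j| < ρ := fun j => (hy' j).trans_lt h1
  have h := (holA_chr (-k)).mul hf |>.ravg_translate hy (h0.trans_lt h1)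
  rw [fc, ← h]
  refine norm_ravg_le fun x => ?_
  have hm : toC x + Complex.I • toC y ∈ closedStrip n ρ := fun j => by
    simpa [toC] using (hy j).le
  rw [norm_mul, mul_comm]
  refine mul_le_mul (hM _ hm) ?_ (norm_nonneg _) ((norm_nonneg _).trans (hM _ hm))
  rw [norm_chr]
  refine Real.exp_le_exp.2 (le_of_eq ?_)
  simp only [len, Finset.mul_sum, ← Finset.sum_neg_distrib]
  refine Finset.sum_congr rfl fun j _ => ?_
  have h3 : ((SignType.sign (k j) : ℤ) : ℝ) * (k j : ℝ) = |(k j : ℝ)| := by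
    rw [← Int.cast_abs, ← Int.cast_mul, sign_mul_self]
  have h4 : (SignType.sign (k j) : ℝ) = ((SignType.sign (k j) : ℤ) : ℝ) := by simp
  have h5 : ((toC x + Complex.I • toC y) j).im = y j := by simp [toC]
  rw [h5, ← h3]
  simp only [y, h4, Pi.neg_apply, Int.cast_neg]
  ring

end contour

section summability

theorem tsum_pi_prod (g : ℤ → ℝ≥0∞) (n : ℕ) : ∑' k : Fin n → ℤ, ∏ j, g (k j) = (∑' m, g m) ^ n := by
  induction n with
  | zero => simp
  | succ n ih =>
    rw [← (Fin.consEquiv fun _ : Fin (n + 1) => ℤ).tsum_eq, ENNReal.tsum_prod', pow_succ', ← ih,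
      ← ENNReal.tsum_mul_right]
    refine tsum_congr fun m => ?_
    rw [← ENNReal.tsum_mul_left]
    refine tsum_congr fun k => ?_
    rw [Fin.prod_univ_succ]; simp [Fin.consEquiv]

theorem tsum_exp_len_ne_top {c : ℝ} (hc : 0 < c) : ∑' k : Fin n → ℤ, ofReal (Real.exp (-(c * len k))) ≠
    ∞ := by
  have h : ∀ k : Fin n → ℤ, ofReal (Real.exp (-(c * len k)))
      = ∏ j, ofReal (Real.exp (-(c * |(k j : ℝ)|))) := fun k => by
    rw [← ENNReal.ofReal_prod_of_nonneg fun _ _ => (Real.exp_pos _).le, ← Real.exp_sum, len,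
      Finset.mul_sum, Finset.sum_neg_distrib]
  simp only [h]
  rw [tsum_pi_prod fun m => ofReal (Real.exp (-(c * |(m : ℝ)|)))]
  refine pow_ne_top ?_
  have hs : Summable fun m : ℤ => Real.exp (-(c * |(m : ℝ)|)) := by
    have h1 : Summable fun m : ℕ => Real.exp (-(c * m)) := by
      have := Real.summable_exp_nat_mul_iff.2 (neg_lt_zero.2 hc)
      refine this.congr fun m => ?_
      rw [mul_comm, neg_mul]
    refine Summable.of_nat_of_neg ?_ ?_ <;> simpa using h1
  exact hs.tsum_ofReal_ne_top

end summability

section lift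

open Classical in
/-- The Fourier-Taylor series with the Taylor coefficients `G j`. -/
def lift (G : ℕ → Fn n) : Ser n :=
  if h : Summable fun i : Idx n => ‖fc (fun x => G i.2 (toC x)) i.1‖ then
    mk (fun i : Idx n => fc (fun x => G i.2 (toC x)) i.1) h else 0

/-- Geometrically bounded Taylor coefficients. -/
def Geo (ρ M : ℝ) (G : ℕ → Fn n) : Prop :=
  ∀ j, HolA n ρ (G j) ∧ ∀ ψ ∈ closedStrip n ρ, ‖G j ψ‖ ≤ M * (2⁻¹ : ℝ) ^ j

/-- The constant in the estimate of Fourier series by functions on a larger strip. -/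
def liftK (n : ℕ) (ρ ρ' : ℝ) : ℝ≥0∞ :=
  2 * ∑' k : Fin n → ℤ, ofReal (Real.exp (-(π * (ρ - ρ') * len k)))

variable {G : ℕ → Fn n}

theorem liftK_ne_top (h : ρ' < ρ) : liftK n ρ ρ' ≠ ∞ :=
  mul_ne_top (by simp) (tsum_exp_len_ne_top (mul_pos Real.pi_pos (sub_pos.2 h)))

theorem Geo.nonneg (hρ : 0 ≤ ρ) (hG : Geo ρ M G) : 0 ≤ M := by
  have := (norm_nonneg _).trans ((hG 0).2 (toC 0) (toC_mem hρ 0))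
  simpa using this

theorem Geo.tsum_le (hG : Geo ρ M G) (h0 : 0 ≤ ρ') (h1 : ρ' < ρ) : ∑' i : Idx n, ‖fc
    (fun x => G i.2 (toC x)) i.1‖ₑ * wt n ρ' i ≤ ofReal M * liftK n ρ ρ' := by
  have hM := hG.nonneg (h0.trans h1.le)
  have hb : ∀ (k : Fin n → ℤ) (j : ℕ), ‖fc (fun x => G j (toC x)) k‖ₑ * wt n ρ' (k, j)
      ≤ ofReal M * (ofReal (Real.exp (-(π * (ρ - ρ') * len k))) * (2⁻¹ : ℝ≥0∞) ^ j) := by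
    intro k j
    have h := (hG j).1.norm_fc_le (ρ' := (ρ + ρ') / 2) (by linarith) (by linarith) (hG j).2 k
    rw [← ofReal_norm, wt, ← ofReal_mul (norm_nonneg _)]
    have e : (2⁻¹ : ℝ≥0∞) ^ j = ofReal ((2⁻¹ : ℝ) ^ j) := by
      rw [ENNReal.ofReal_pow (by norm_num), ENNReal.ofReal_inv_of_pos two_pos]; simp
    rw [e, ← ofReal_mul (Real.exp_pos _).le, ← ofReal_mul hM]
    refine ofReal_le_ofReal ?_
    refine (mul_le_mul_of_nonneg_right h (Real.exp_pos _).le).trans (le_of_eq ?_)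
    rw [mul_assoc, ← Real.exp_add]
    have : -(2 * π * ((ρ + ρ') / 2) * len k) + 2 * π * ρ' * len k = -(π * (ρ - ρ') * len k) := by ring
    rw [this]; ring
  rw [ENNReal.tsum_prod']
  refine (tsum_le_tsum fun k => tsum_le_tsum fun j => hb k j).trans ?_
  simp only [ENNReal.tsum_mul_left, ENNReal.tsum_mul_right, tsum_two_inv_pow]
  rw [liftK, mul_comm (2 : ℝ≥0∞)]

theorem Geo.lift_apply (hρ : 0 < ρ) (hG : Geo ρ M G) (i : Idx n) : lift G i = fc (fun x => G i.2 (toC x))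
    i.1 := by
  have h := hG.tsum_le le_rfl hρ
  have hs : Summable fun i : Idx n => ‖fc (fun x => G i.2 (toC x)) i.1‖ := by
    refine tsum_enorm_ne_top_iff_summable_norm.1 (ne_top_of_le_ne_top
      (mul_ne_top ofReal_ne_top (liftK_ne_top hρ)) (le_trans (le_of_eq ?_) h))
    refine tsum_congr fun i => ?_
    simp [wt]
  rw [lift, dif_pos hs, mk_apply]

theorem Geo.nrm_lift_le (hG : Geo ρ M G) (h0 : 0 ≤ ρ') (h1 : ρ' < ρ) : nrm ρ' (lift G) ≤ ofReal M * liftK n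
    ρ ρ' := by
  refine le_trans (le_of_eq ?_) (hG.tsum_le h0 h1)
  refine tsum_congr fun i => ?_
  rw [hG.lift_apply (h0.trans_lt h1)]

theorem Geo.nrm_lift_ne_top (hG : Geo ρ M G) (h0 : 0 ≤ ρ') (h1 : ρ' < ρ) : nrm ρ' (lift G) ≠ ∞ :=
  ne_top_of_le_ne_top (mul_ne_top ofReal_ne_top (liftK_ne_top h1)) (hG.nrm_lift_le h0 h1)

open Classical in
/-- The part of order `j`, as a series of order zero. -/
def slice (j : ℕ) (f : Ser n) : Ser n :=
  mk (fun i : Idx n => if i.2 = 0 then f (i.1, j) else 0) (by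
    have h := f.summable_norm.comp_injective (i := fun k : Fin n → ℤ => (k, j))
      fun a b hab => by simpa using hab
    have h2 : Summable fun k : Fin n → ℤ => ‖f (k, j)‖ := h
    refine (Function.Injective.summable_iff (g := fun k : Fin n → ℤ => ((k, 0) : Idx n))
      (fun a b hab => by simpa using hab) fun i hi => ?_).1 (by simpa [Function.comp_def] using h2)
    have : i.2 ≠ 0 := fun h0 => hi ⟨i.1, by rw [← h0]⟩
    simp [this])

theorem slice_apply (j : ℕ) (f : Ser n) (i : Idx n) : slice j f i = if i.2 = 0 then f (i.1, j) else 0 := by rw [slice, mk_apply]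

theorem nrm_slice (ρ : ℝ) (j : ℕ) (f : Ser n) : nrm ρ (slice j f) = ∑' k : Fin n → ℤ, ‖f (k, j)‖ₑ * wt n ρ
    (k, 0) := by
  rw [nrm, N, ENNReal.tsum_prod']
  refine tsum_congr fun k => ?_
  rw [tsum_eq_single 0 fun m hm => by simp [slice_apply, hm]]
  simp [slice_apply]

theorem tsum_nrm_slice (ρ : ℝ) (f : Ser n) : ∑' j, nrm ρ (slice j f) = nrm ρ f := by
  simp only [nrm_slice]
  rw [ENNReal.tsum_comm, nrm, N, ENNReal.tsum_prod']
  rfl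

theorem nrm_slice_le (ρ : ℝ) (j : ℕ) (f : Ser n) : nrm ρ (slice j f) ≤ nrm ρ f := by
  exact (ENNReal.le_tsum (f := fun j => nrm ρ (slice j f)) j).trans (tsum_nrm_slice ρ f).le

theorem ev_slice_eq (hψ : ψ ∈ closedStrip n ρ) (hf : nrm ρ f ≠ ∞) (j : ℕ) : ev 0 ψ (slice j f) = ∑' k : Fin
    n → ℤ, chr k ψ * f (k, j) := by
  have hf' := ne_top_of_le_ne_top hf (nrm_slice_le ρ j f)
  rw [ev_eq (by simp) hψ hf', (ev_summable (by simp) hψ hf').of_norm.tsum_prod]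
  refine tsum_congr fun k => ?_
  rw [tsum_eq_single 0 fun m hm => by simp [slice_apply, hm]]
  simp [slice_apply, mono]

theorem ev_hasSum_slice (hζ : ‖ζ‖ ≤ 1) (hψ : ψ ∈ closedStrip n ρ) (hf : nrm ρ f ≠ ∞) : HasSum
    (fun j => ζ ^ j * ev 0 ψ (slice j f)) (ev ζ ψ f) := by
  have h := (ev_summable hζ hψ hf).of_norm
  have h' : Summable fun q : ℕ × (Fin n → ℤ) => mono ζ ψ (q.2, q.1) * f (q.2, q.1) :=
    h.comp_injective (i := Prod.swap) Prod.swap_injective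
  have h1 := h'.hasSum.prod_fiberwise fun j => (h'.prod_factor j).hasSum
  have h2 : ∑' q : ℕ × (Fin n → ℤ), mono ζ ψ (q.2, q.1) * f (q.2, q.1) = ev ζ ψ f := by
    rw [ev_eq hζ hψ hf]
    exact (Equiv.prodComm ℕ (Fin n → ℤ)).tsum_eq fun i : Idx n => mono ζ ψ i * f i
  rw [h2] at h1
  have h3 : (fun j => ζ ^ j * ev 0 ψ (slice j f))
      = fun j => ∑' k : Fin n → ℤ, mono ζ ψ (k, j) * f (k, j) := by
    funext j
    rw [ev_slice_eq hψ hf, ← tsum_mul_left]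
    refine tsum_congr fun k => ?_
    rw [mono]; ring
  rw [h3]; exact h1

theorem fc_summable (hρ : 0 < ρ) {g : Fn n} (hg : HolA n ρ g) : Summable (fc fun x => g (toC x)) := by
  obtain ⟨M, -, hM⟩ := hg.bounded
  have h : ∀ k, ‖fc (fun x => g (toC x)) k‖ ≤ M * Real.exp (-(π * ρ * len k)) := fun k => by
    have := hg.norm_fc_le (ρ' := ρ / 2) (by linarith) (by linarith) hM k
    rwa [show 2 * π * (ρ / 2) = π * ρ by ring] at this
  have hs := ENNReal.summable_toReal (tsum_exp_len_ne_top (n := n) (mul_pos Real.pi_pos hρ))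
  refine Summable.of_norm_bounded (hs.mul_left M) fun k => ?_
  rw [ENNReal.toReal_ofReal (Real.exp_pos _).le]; exact h k

theorem Geo.ev_slice_lift (hG : Geo ρ M G) (h0 : 0 < ρ') (h1 : ρ' < ρ) (j : ℕ) (hψ : ψ ∈ closedStrip n ρ') :
    ev 0 ψ (slice j (lift G)) = G j ψ := by
  have hf := hG.nrm_lift_ne_top h0.le h1
  have hs : nrm ρ' (slice j (lift G)) ≠ ∞ := ne_top_of_le_ne_top hf (nrm_slice_le _ _ _)
  refine HolA.eq_on h0 (holA_ev h0 (by simp) hs) ((hG j).1.mono h1.le) (fun x => ?_) hψ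
  rw [ev_slice_eq (toC_mem h0.le x) hf]
  have hj := (hG j).1.per (h0.trans h1).le
  have h2 := hj.hasSum (fc_summable (h0.trans h1) (hG j).1) x
  rw [← h2.tsum_eq]
  refine tsum_congr fun k => ?_
  rw [hG.lift_apply (h0.trans h1), mul_comm]

theorem Geo.ev_lift (hG : Geo ρ M G) (h0 : 0 < ρ') (h1 : ρ' < ρ) (hζ : ‖ζ‖ ≤ 1) (hψ : ψ ∈ closedStrip n ρ')
    : HasSum (fun j => ζ ^ j * G j ψ) (ev ζ ψ (lift G)) := by
  have := ev_hasSum_slice hζ hψ (hG.nrm_lift_ne_top h0.le h1)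
  simpa only [hG.ev_slice_lift h0 h1 _ hψ] using this

end lift

section single

/-- The Fourier series of a function. -/
def lift₁ (f : Fn n) : Ser n := lift fun j => if j = 0 then f else fun _ => 0

variable {f : Fn n}

theorem HolA.geo (hf : HolA n ρ f) : ∃ M, Geo ρ M fun j => if j = 0 then f else fun _ => 0 := by
  obtain ⟨M, hM0, hM⟩ := hf.bounded
  refine ⟨M, fun j => ?_⟩
  rcases eq_or_ne j 0 with rfl | hj
  · simpa using ⟨hf, hM⟩
  · simp only [if_neg hj, norm_zero]
    exact ⟨HolA.const 0, fun _ _ => by positivity⟩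

theorem HolA.nrm_lift (hf : HolA n ρ f) (h0 : 0 ≤ ρ') (h1 : ρ' < ρ) : nrm ρ' (lift₁ f) ≠ ∞ := by
  obtain ⟨M, hM⟩ := hf.geo
  exact hM.nrm_lift_ne_top h0 h1

theorem HolA.ev_lift (hf : HolA n ρ f) (h0 : 0 < ρ') (h1 : ρ' < ρ) (hζ : ‖ζ‖ ≤ 1)
    (hψ : ψ ∈ closedStrip n ρ') : ev ζ ψ (lift₁ f) = f ψ := by
  obtain ⟨M, hM⟩ := hf.geo
  rw [lift₁, ← (hM.ev_lift h0 h1 hζ hψ).tsum_eq, tsum_eq_single 0 fun j hj => by simp [hj]]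
  simp

/-- The part of order zero. -/
def ord0 (f : Ser n) : Ser n := diag (fun i => if i.2 = 0 then 1 else 0) f

theorem ord0_dom (f : Ser n) : DiagDom (fun i : Idx n => if i.2 = 0 then (1 : ℂ) else 0) f :=
  diagDom_of_bound one_ne_top (fun i => by split_ifs <;> simp) f

theorem ord0_apply (f : Ser n) (i : Idx n) : ord0 f i = if i.2 = 0 then f i else 0 := by
  rw [ord0, diag_apply (ord0_dom f)]
  split_ifs <;> simp

theorem ord0_add (f g : Ser n) : ord0 (f + g) = ord0 f + ord0 g := by
  ext i; simp only [ord0_apply, add_apply]; split_ifs <;> simp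
theorem ord0_sub (f g : Ser n) : ord0 (f - g) = ord0 f - ord0 g := by
  ext i; simp only [ord0_apply, sub_apply]; split_ifs <;> simp
theorem ord0_neg (f : Ser n) : ord0 (-f) = -ord0 f := by
  ext i; simp only [ord0_apply, neg_apply]; split_ifs <;> simp
theorem ord0_smul (c : ℂ) (f : Ser n) : ord0 (c • f) = c • ord0 f := by
  ext i; simp only [ord0_apply, smul_apply]; split_ifs <;> simp
theorem ord0_zero : ord0 (0 : Ser n) = 0 := by ext i; simp [ord0_apply]
theorem ord0_one : ord0 (1 : Ser n) = 1 := by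
  ext i; rw [ord0_apply, one_apply]
  by_cases h : i = 0
  · simp [h]
  · simp [h]
theorem ord0_mul (f g : Ser n) : ord0 (f * g) = ord0 f * ord0 g := by
  refine diag_mul (c := fun i : Idx n => if i.2 = 0 then (1 : ℂ) else 0) (fun i j => ?_)
    (ord0_dom f) (ord0_dom g)
  by_cases hi : i.2 = 0 <;> by_cases hj : j.2 = 0 <;> simp [hi, hj]

theorem ord0_diag {f : Ser n} (hf : ord0 f = f) (c : Idx n → ℂ) : ord0 (diag c f) = diag c f := by
  by_cases h : DiagDom c f
  · ext i
    rw [ord0_apply, diag_apply h]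
    split_ifs with h0
    · rfl
    · rw [← hf, ord0_apply, if_neg h0, mul_zero]
  · rw [diag_of_not h, ord0_zero]

theorem ord0_cst (c : ℂ) : ord0 (cst c : Ser n) = cst c := by
  rw [cst, Algebra.algebraMap_eq_smul_one, ord0_smul, ord0_one]

theorem ord0_eq_zero_iff {f : Ser n} : ord0 f = 0 ↔ Van f := by
  constructor
  · intro h k
    have := congrArg (fun g : Ser n => g (k, 0)) h
    simpa [ord0_apply] using this
  · intro h; ext i
    rw [ord0_apply]
    split_ifs with h0
    · rw [← Prod.mk.eta (p := i), h0, h, zero_apply]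
    · rfl

theorem HolA.ord0_lift (hρ : 0 < ρ) (hf : HolA n ρ f) : ord0 (lift₁ f) = lift₁ f := by
  obtain ⟨M, hM⟩ := hf.geo
  ext i
  rw [ord0_apply, lift₁, hM.lift_apply hρ]
  split_ifs with h0
  · rfl
  · simp [fc, ravg]

theorem ev_zero_ord0 (ψ : CVec n) (f : Ser n) : ev 0 ψ (ord0 f) = ev 0 ψ f := by
  have h : ∀ i : Idx n, mono 0 ψ i * ord0 f i = mono 0 ψ i * f i := fun i => by
    rw [ord0_apply]
    split_ifs with h0
    · rfl
    · simp [mono, h0]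
  by_cases hd : DiagDom (mono 0 ψ) f
  · have hd' : DiagDom (mono 0 ψ) (ord0 f) := by unfold DiagDom at hd ⊢; simpa only [h] using hd
    rw [ev, ev, total, total]; simp only [diag_apply hd, diag_apply hd', h]
  · have hd' : ¬ DiagDom (mono 0 ψ) (ord0 f) := by unfold DiagDom at hd ⊢; simpa only [h] using hd
    rw [ev, ev, diag_of_not hd, diag_of_not hd']

end single

section coefficients

theorem ravg_chr {k : Fin n → ℤ} (hk : k ≠ 0) : ravg (fun x => chr k (toC x)) = 0 := by
  obtain ⟨j, hj⟩ : ∃ j, k j ≠ 0 := by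
    by_contra! h; exact hk (funext h)
  set a : Vec n := Pi.single j ((2 * (k j : ℝ))⁻¹) with ha
  have h := ravg_shift (per_chr k) a
  have hc : chr k (toC a) = -1 := by
    rw [chr, Finset.sum_eq_single j]
    · have hj' : (k j : ℂ) ≠ 0 := by exact_mod_cast hj
      have : (2 * π * Complex.I * ((k j : ℂ) * toC a j)) = π * Complex.I := by
        simp only [toC, ha, Pi.single_eq_same]
        push_cast
        field_simp
      rw [this, Complex.exp_pi_mul_I]
    · intro i _ hi; simp [toC, ha, hi]
    · simp
  simp only [toC_add, chr_add_arg, hc, mul_neg_one] at h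
  have h2 : ravg (fun x : Vec n => -chr k (toC x)) = -ravg fun x => chr k (toC x) := by
    have := ravg_mul_left (-1) fun x : Vec n => chr k (toC x)
    simpa using this
  rw [h2] at h
  exact self_eq_neg.1 h.symm

theorem fc_ev (hζ : ‖ζ‖ ≤ 1) (f : Ser n) (k : Fin n → ℤ) : fc (fun x => ev ζ (toC x) f) k = ∑' i : Idx n, if
    i.1 = k then ζ ^ i.2 * f i else 0 := by
  have hf : nrm 0 f ≠ ∞ := by rw [nrm_zero_width]; exact enorm_ne_top
  have hev : ∀ x, ev ζ (toC x) f = ∑' i, mono ζ (toC x) i * f i := fun x =>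
    ev_eq hζ (toC_mem le_rfl x) hf
  have hnorm : ∀ (i : Idx n) (x : Vec n), ‖chr (-k) (toC x) * (mono ζ (toC x) i * f i)‖ ≤ ‖f i‖ :=
    fun i x => by
      rw [norm_mul, norm_mul, mono, norm_mul, norm_chr_real, norm_chr_real, one_mul, one_mul, norm_pow]
      exact mul_le_of_le_one_left (norm_nonneg _) (pow_le_one₀ (norm_nonneg _) hζ)
  have hcont : ∀ i : Idx n, Continuous fun x : Vec n =>
      chr (-k) (toC x) * (mono ζ (toC x) i * f i) := fun i => by
    have h1 := (continuous_chr (-k)).comp (continuous_toC (n := n))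
    have h2 := (continuous_chr i.1).comp (continuous_toC (n := n))
    exact h1.mul ((h2.mul continuous_const).mul continuous_const)
  have hint := hasSum_integral_of_summable_integral_norm (μ := volume.restrict (Set.Icc (0 : Vec n) 1))
    (F := fun (i : Idx n) (x : Vec n) => chr (-k) (toC x) * (mono ζ (toC x) i * f i))
    (fun i => integrableOn_cube (hcont i)) (by
      refine Summable.of_nonneg_of_le (fun i => integral_nonneg fun _ => norm_nonneg _) (fun i => ?_)
        f.summable_norm
      have : IsFiniteMeasure (volume.restrict (Set.Icc (0 : Vec n) 1)) :=
        ⟨by simpa using isCompact_Icc.measure_lt_top⟩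
      have h1 := norm_integral_le_of_norm_le_const (μ := volume.restrict (Set.Icc (0 : Vec n) 1))
        (f := fun x => ‖chr (-k) (toC x) * (mono ζ (toC x) i * f i)‖) (C := ‖f i‖)
        (Eventually.of_forall fun x => by rw [norm_norm]; exact hnorm i x)
      refine (Real.le_norm_self _).trans (h1.trans (le_of_eq ?_))
      simp [Measure.real, Real.volume_Icc_pi])
  rw [fc, ravg]
  simp only [hev, ← tsum_mul_left]
  rw [← hint.tsum_eq]
  refine tsum_congr fun i => ?_
  have h1 : ∀ x, chr (-k) (toC x) * (mono ζ (toC x) i * f i)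
      = (ζ ^ i.2 * f i) * chr (i.1 - k) (toC x) := fun x => by
    rw [mono, sub_eq_add_neg, chr_add]; ring
  simp only [h1]
  have h2 := ravg_mul_left (ζ ^ i.2 * f i) fun x => chr (i.1 - k) (toC x)
  rw [ravg] at h2
  rw [h2]
  split_ifs with hk
  · rw [hk, sub_self]; simp [chr_zero, ravg_const]
  · rw [ravg_chr (sub_ne_zero.2 hk), mul_zero]

theorem ravg_ev (hζ : ‖ζ‖ ≤ 1) (f : Ser n) : ravg (fun x => ev ζ (toC x) f) = ev ζ 0 (ave f) := by
  rw [← fc_zero, fc_ev hζ]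
  have hf : nrm 0 (ave f) ≠ ∞ := by rw [nrm_zero_width]; exact enorm_ne_top
  rw [ev_eq hζ (ρ := 0) (fun j => by simp) hf]
  refine tsum_congr fun i => ?_
  rw [ave_apply, mono, chr_zero_arg, one_mul]
  split_ifs <;> simp

theorem van_of_ev (h : ∀ x, ev 0 (toC x) f = 0) : Van f := fun k => by
  have h1 := fc_ev (ζ := 0) (by simp) f k
  simp only [h] at h1
  rw [tsum_eq_single (k, 0)] at h1
  · have : fc (fun _ : Vec n => (0 : ℂ)) k = 0 := by simp [fc, ravg]
    rw [this] at h1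
    simpa using h1.symm
  · rintro ⟨l, j⟩ hne
    by_cases hl : l = k
    · have : j ≠ 0 := fun hj => hne (by rw [hl, hj])
      simp [hl, this]
    · simp [hl]

end coefficients

section factorization

theorem conj_chr (k : Fin n → ℤ) (ψ : CVec n) : conj (chr k ψ) = chr (-k) (fun j => conj (ψ j)) := by
  rw [chr, chr, ← Complex.exp_conj]
  congr 1
  simp only [map_mul, map_sum, Complex.conj_I, Complex.conj_ofReal, map_ofNat, map_intCast,
    Pi.neg_apply, Int.cast_neg, neg_mul, Finset.sum_neg_distrib]
  ring

theorem conj_toC (x : Vec n) : (fun j => conj (toC x j)) = toC x := by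
  ext j; simp [toC]

theorem chr_mul_chr_neg (k : Fin n → ℤ) (ψ : CVec n) : chr k ψ * chr (-k) ψ = 1 := by
  rw [← chr_add, add_neg_cancel, chr_zero]

theorem HolA.const_mul {f : Fn n} (c : ℂ) (hf : HolA n ρ f) : HolA n ρ fun ψ => c * f ψ := (HolA.const c).mul hf

theorem chr_sub_arg (k : Fin n → ℤ) (ψ : CVec n) (a : Vec n) : chr k (ψ - toC a) = chr k ψ * chr (-k)
    (toC a) := by
  have h := chr_add_arg k (ψ - toC a) (toC a)
  rw [sub_add_cancel] at h
  rw [h, mul_assoc, chr_mul_chr_neg, mul_one]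

variable {v a b c d : Fn n} {σ : ℂ}

/-- The relations between the coefficients of a factorization. -/
theorem Factorizes.relations (hn : 1 ≤ n) (hS : SmallDiv Ω C p) (h : Factorizes Ω β η U ρ v σ a b c d)
    (hψ : ψ ∈ closedStrip n ρ) : a ψ * c (ψ + toC Ω) = 1 ∧ b ψ * d ψ = 1 ∧ dBeta β U (hull β η ψ (v ψ)) + σ
    - 2 = -(a ψ * d (ψ + toC Ω)) - b ψ * c ψ := by
  set e : Fin n → ℤ := Pi.single ⟨0, hn⟩ 1 with he
  have he0 : e ≠ 0 := fun h0 => by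
    have := congrFun h0 ⟨0, hn⟩
    simp [he] at this
  have hcos : InA n ρ fun ψ => (1 / 2 : ℂ) * (chr e ψ + chr (-e) ψ) := by
    refine ⟨((holA_chr e).add (holA_chr (-e))).const_mul _, fun x => ?_⟩
    refine Complex.conj_eq_iff_im.1 ?_
    simp only [map_mul, map_add, conj_chr, conj_toC, neg_neg, map_div₀, map_one, map_ofNat]
    ring
  have hsin : InA n ρ fun ψ => (-Complex.I / 2 : ℂ) * (chr e ψ - chr (-e) ψ) := by
    refine ⟨((holA_chr e).sub (holA_chr (-e))).const_mul _, fun x => ?_⟩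
    refine Complex.conj_eq_iff_im.1 ?_
    simp only [map_mul, map_sub, conj_chr, conj_toC, neg_neg, map_div₀, map_neg, Complex.conj_I,
      map_ofNat]
    ring
  have hone : InA n ρ fun _ => (1 : ℂ) := ⟨HolA.const 1, fun _ => by simp⟩
  have e1 := h.eq _ hone ψ hψ
  have e2 := h.eq _ hcos ψ hψ
  have e3 := h.eq _ hsin ψ hψ
  simp only [linEquil, opPlus, opMinus, add_sub_cancel_right, chr_add_arg, chr_sub_arg, neg_neg] at e1 e2 e3
  set V := dBeta β U (hull β η ψ (v ψ))
  have hz := chr_mul_chr_neg e ψ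
  have hw := chr_mul_chr_neg e (toC Ω)
  have hw1 := hS.ne he0 1
  have hw2 := hS.ne he0 (-1)
  set z := chr e ψ
  set z' := chr (-e) ψ
  set w := chr e (toC Ω)
  set w' := chr (-e) (toC Ω)
  push_cast at hw1 hw2
  obtain ⟨P, hP⟩ : ∃ P, P = 1 - a ψ * c (ψ + toC Ω) := ⟨_, rfl⟩
  obtain ⟨Q, hQ⟩ : ∃ Q, Q = 1 - b ψ * d ψ := ⟨_, rfl⟩
  obtain ⟨S, hS⟩ : ∃ S, S = V + σ - 2 + a ψ * d (ψ + toC Ω) + b ψ * c ψ := ⟨_, rfl⟩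
  have f1 : P + Q + S = 0 := by rw [hP, hQ, hS]; linear_combination e1
  have f2 : P * (z * w + z' * w') + Q * (z * w' + z' * w) + S * (z + z') = 0 := by
    rw [hP, hQ, hS]; linear_combination 2 * e2
  have f3 : P * (z * w - z' * w') + Q * (z * w' - z' * w) + S * (z - z') = 0 := by
    rw [hP, hQ, hS]
    linear_combination 2 * Complex.I * e3 + ((1 - a ψ * c (ψ + toC Ω)) * (z * w - z' * w')
      + (1 - b ψ * d ψ) * (z * w' - z' * w)
      + (V + σ - 2 + a ψ * d (ψ + toC Ω) + b ψ * c ψ) * (z - z')) * Complex.I_sq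
  have f4 : P * w + Q * w' + S = 0 := by
    linear_combination (z' / 2) * f2 + (z' / 2) * f3 - (P * w + Q * w' + S) * hz
  have f5 : P * w' + Q * w + S = 0 := by
    linear_combination (z / 2) * f2 - (z / 2) * f3 - (P * w' + Q * w + S) * hz
  have f6 : (P - Q) * ((w - 1) * (w - -1)) = 0 := by
    linear_combination w * f4 - w * f5 + (P - Q) * hw
  have hPQ : P = Q := sub_eq_zero.1 ((mul_eq_zero.1 f6).resolve_right (mul_ne_zero hw1 hw2))
  have f7 : P * ((w - 1) * (w - 1)) = 0 := by
    rw [← hPQ] at f1 f4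
    linear_combination w * f4 - w * f1 - P * hw
  have hP0 : P = 0 := (mul_eq_zero.1 f7).resolve_right (mul_ne_zero hw1 hw1)
  have hQ0 : Q = 0 := hPQ ▸ hP0
  refine ⟨?_, ?_, ?_⟩
  · linear_combination hP - hP0
  · linear_combination hQ - hQ0
  · rw [hP0, hQ0] at f1; linear_combination f1 - hS

end factorization

section families

variable (β : Vec (n + 1))

theorem AnalyticFamily.hasFDerivAt (h : AnalyticFamily 𝒟 W) (hp : (μ, x) ∈ 𝒟) : HasFDerivAt
    (fun p : ℂ × CVec (n + 1) => W p.1 p.2)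
    (fderiv ℂ (fun p : ℂ × CVec (n + 1) => W p.1 p.2) (μ, x)) (μ, x) :=
  (h.analytic _ hp).differentiableAt.hasFDerivAt

theorem AnalyticFamily.hasDerivAt_line (h : AnalyticFamily 𝒟 W) {e t : ℂ} {y : CVec (n + 1)}
    (hp : (μ + t * e, x + t • y) ∈ 𝒟) : HasDerivAt (fun t : ℂ => W (μ + t * e) (x + t • y))
    (fderiv ℂ (fun p : ℂ × CVec (n + 1) => W p.1 p.2) (μ + t * e, x + t • y) (e, y)) t := by
  have h1 : HasDerivAt (fun t : ℂ => (μ + t * e, x + t • y)) (e, y) t := by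
    have a1 : HasDerivAt (fun t : ℂ => μ + t * e) e t := by
      simpa using ((hasDerivAt_id t).mul_const e).const_add μ
    have a2 : HasDerivAt (fun t : ℂ => x + t • y) y t := by
      simpa using ((hasDerivAt_id t).smul_const y).const_add x
    exact a1.prodMk a2
  exact (h.hasFDerivAt hp).comp_hasDerivAt t h1

theorem AnalyticFamily.dBeta_eq (h : AnalyticFamily 𝒟 W) (hp : (μ, x) ∈ 𝒟) : dBeta β (W μ) x = fderiv ℂ
    (fun p : ℂ × CVec (n + 1) => W p.1 p.2) (μ, x) (0, toC β) := by
  have := h.hasDerivAt_line (μ := μ) (x := x) (e := 0) (t := 0) (y := toC β) (by simpa using hp)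
  simp only [mul_zero, add_zero, zero_smul] at this
  exact this.deriv

/-- The derivative of a family with respect to its parameter. -/
def dPar (W : ℂ → Fn (n + 1)) : ℂ → Fn (n + 1) :=
  fun μ x => deriv (fun μ' => W μ' x) μ

theorem AnalyticFamily.dPar_eq (h : AnalyticFamily 𝒟 W) (hp : (μ, x) ∈ 𝒟) : dPar W μ x = fderiv ℂ
    (fun p : ℂ × CVec (n + 1) => W p.1 p.2) (μ, x) (1, 0) := by
  have := h.hasDerivAt_line (μ := 0) (x := x) (e := 1) (t := μ) (y := 0) (by simpa using hp)
  simp only [mul_one, zero_add, smul_zero, add_zero] at this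
  exact this.deriv

theorem AnalyticFamily.analytic_fderiv (h : AnalyticFamily 𝒟 W) (e : ℂ × CVec (n + 1)) : AnalyticOnNhd
    ℂ (fun p => fderiv ℂ (fun p : ℂ × CVec (n + 1) => W p.1 p.2) p e) 𝒟 :=
  fun p hp => ((ContinuousLinearMap.apply ℂ ℂ e).analyticAt _).comp (h.analytic.fderiv p hp)

theorem AnalyticFamily.dBeta (h : AnalyticFamily 𝒟 W) : AnalyticFamily 𝒟 fun μ => dBeta β (W μ) where
  isOpen := h.isOpen
  analytic p hp := (h.analytic_fderiv (0, toC β) p hp).congr (by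
    filter_upwards [h.isOpen.mem_nhds hp] with q hq
    exact (h.dBeta_eq β hq).symm)
  periodic μ x hp m := by
    refine ⟨(h.periodic μ x hp m).1, ?_⟩
    refine Filter.EventuallyEq.deriv_eq ?_
    have hc : Continuous fun t : ℂ => (μ, x + t • toC β) := by fun_prop
    have hmem : ∀ᶠ t in 𝓝 (0 : ℂ), (μ, x + t • toC β) ∈ 𝒟 :=
      hc.continuousAt.eventually (h.isOpen.mem_nhds (by simpa using hp))
    filter_upwards [hmem] with t ht
    rw [add_right_comm]
    exact (h.periodic μ _ ht m).2

theorem AnalyticFamily.dPar (h : AnalyticFamily 𝒟 W) : AnalyticFamily 𝒟 (dPar W) where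
  isOpen := h.isOpen
  analytic p hp := (h.analytic_fderiv (1, 0) p hp).congr (by
    filter_upwards [h.isOpen.mem_nhds hp] with q hq
    exact (h.dPar_eq hq).symm)
  periodic μ x hp m := by
    refine ⟨(h.periodic μ x hp m).1, ?_⟩
    refine Filter.EventuallyEq.deriv_eq ?_
    have hc : Continuous fun t : ℂ => (t, x) := by fun_prop
    filter_upwards [hc.continuousAt.eventually (h.isOpen.mem_nhds hp)] with t ht
    exact (h.periodic t _ ht m).2

variable {β}
theorem hull_add_intPt (β : Vec (n + 1)) (η : ℝ) (ψ : CVec n) (s : ℂ) (m : Fin n → ℤ) : hull β η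
    (ψ + intPt m) s = hull β η ψ s + intPt (Fin.snoc m 0 : Fin (n + 1) → ℤ) := by
  ext i
  refine Fin.lastCases ?_ (fun j => ?_) i
  · simp [hull, intPt]
  · simp [hull, intPt]; ring

theorem hull_add (β : Vec (n + 1)) (η : ℝ) (ψ : CVec n) (s t : ℂ) : hull β η ψ (s + t) = hull β η ψ s + t
    • toC β := by
  rw [hull, hull, add_smul, add_assoc]

theorem continuous_hull (β : Vec (n + 1)) (η : ℝ) : Continuous fun p : (CVec n) × ℂ => hull β η p.1
    p.2 := by
  refine continuous_pi fun i => ?_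
  refine Fin.lastCases ?_ (fun j => ?_) i
  · simp only [hull, Pi.add_apply, Fin.snoc_last]; fun_prop
  · simp only [hull, Pi.add_apply, Fin.snoc_castSucc]; fun_prop

theorem analyticAt_hull (β : Vec (n + 1)) (η : ℝ) {v : Fn n} (hv : AnalyticAt ℂ v ψ) : AnalyticAt ℂ
    (fun ψ => hull β η ψ (v ψ)) ψ := by
  refine analyticAt_pi_iff.2 fun i => ?_
  refine Fin.lastCases ?_ (fun j => ?_) i
  · simp only [hull, Pi.add_apply, Fin.snoc_last, Pi.smul_apply, smul_eq_mul]
    exact analyticAt_const.add (hv.mul analyticAt_const)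
  · simp only [hull, Pi.add_apply, Fin.snoc_castSucc, Pi.smul_apply, smul_eq_mul]
    exact ((ContinuousLinearMap.proj (R := ℂ) (φ := fun _ : Fin n => ℂ) j).analyticAt ψ).add
      (hv.mul analyticAt_const)

/-- A family of potentials evaluated on a hull. -/
theorem AnalyticFamily.holA (h : AnalyticFamily 𝒟 W) {v : Fn n} (hv : HolA n ρ v) (hD : ∀ ψ ∈ closedStrip n
    ρ, (μ, hull β η ψ (v ψ)) ∈ 𝒟) : HolA n ρ fun ψ => W μ (hull β η ψ (v ψ)) where
  analytic ψ hψ := by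
    have h1 : AnalyticAt ℂ (fun ψ => (μ, hull β η ψ (v ψ))) ψ :=
      analyticAt_const.prod (analyticAt_hull β η (hv.analytic ψ hψ))
    exact AnalyticAt.fun_comp (g := fun p : ℂ × CVec (n + 1) => W p.1 p.2)
      (f := fun ψ => (μ, hull β η ψ (v ψ)))
      (h.analytic _ (hD ψ (openStrip_subset n ρ hψ))) h1
  continuousOn := by
    refine ContinuousOn.comp (g := fun p : ℂ × CVec (n + 1) => W p.1 p.2)
      (f := fun ψ => (μ, hull β η ψ (v ψ))) h.analytic.continuousOn ?_ hD
    exact continuousOn_const.prodMk ((continuous_hull β η).comp_continuousOn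
      (continuousOn_id.prodMk hv.continuousOn))
  periodic ψ hψ m := by
    rw [hv.periodic ψ hψ, hull_add_intPt]
    exact (h.periodic _ _ (hD ψ hψ) _).2

end families

section logarithm

theorem convex_openStrip (n : ℕ) (ρ : ℝ) : Convex ℝ (openStrip n ρ) := by
  intro x hx y hy a b ha hb hab j
  have h : ((a • x + b • y) j).im = a * (x j).im + b * (y j).im := by simp
  rw [h]
  exact abs_lt.2 (convex_Ioo (-ρ) ρ (abs_lt.1 (hx j)) (abs_lt.1 (hy j)) ha hb hab)

/-- A continuous logarithm of an analytic function is analytic. -/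
theorem analyticAt_of_exp {E : Type*} [NormedAddCommGroup E] [NormedSpace ℂ E] {f g : E → ℂ} {x : E}
    (hf : ContinuousAt f x) (hg : AnalyticAt ℂ g x) (h : ∀ᶠ y in 𝓝 x, Complex.exp (f y) = g y) : AnalyticAt
    ℂ f x := by
  have h1 : AnalyticAt ℂ (fun y => f x + Complex.log (g y * Complex.exp (-f x))) x := by
    refine analyticAt_const.add (AnalyticAt.clog (hg.mul analyticAt_const) ?_)
    rw [← h.self_of_nhds, ← Complex.exp_add, add_neg_cancel, Complex.exp_zero]
    exact Complex.one_mem_slitPlane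
  refine h1.congr ?_
  have h2 : ∀ᶠ y in 𝓝 x, |(f y - f x).im| < π := by
    have hc : ContinuousAt (fun y => |(f y - f x).im|) x :=
      (Complex.continuous_im.continuousAt.comp (hf.sub continuousAt_const)).abs
    refine hc.eventually (eventually_lt_nhds ?_)
    simp [Real.pi_pos]
  filter_upwards [h, h2] with y hy hy2
  rw [← hy, ← Complex.exp_add, ← sub_eq_add_neg, Complex.log_exp (abs_lt.1 hy2).1 (abs_lt.1 hy2).2.le]
  ring

theorem isSimplyConnected_openStrip (hρ : 0 < ρ) : IsSimplyConnected (openStrip n ρ) := by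
  have : ContractibleSpace (openStrip n ρ) :=
    (convex_openStrip n ρ).contractibleSpace ⟨0, fun j => by simpa using hρ⟩
  exact SimplyConnectedSpace.ofContractible _

theorem eq_zero_of_sin_eq_zero {g : Vec n → ℝ} (hg : Continuous g) (h0 : g 0 = 0)
    (h : ∀ x, Real.sin (g x) = 0) (x : Vec n) : g x = 0 := by
  by_contra hx
  have hpos : 0 < |g x| := abs_pos.2 hx
  have hc : ContinuousOn (fun t : ℝ => |g (t • x)|) (Set.Icc 0 1) := by
    have : Continuous fun t : ℝ => t • x := by fun_prop
    exact (hg.comp this).abs.continuousOn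
  have hiv := intermediate_value_Icc zero_le_one hc
  have hm : min |g x| 1 ∈ Set.Icc |g ((0 : ℝ) • x)| |g ((1 : ℝ) • x)| := by
    rw [zero_smul, one_smul, h0, abs_zero]
    exact ⟨(lt_min hpos one_pos).le, min_le_left _ _⟩
  obtain ⟨t, -, ht⟩ := hiv hm
  have h1 : 0 < |g (t • x)| := by simp only [ht]; exact lt_min hpos one_pos
  have h2 : |g (t • x)| < π := by
    simp only [ht]; exact (min_le_right _ _).trans_lt (by linarith [Real.pi_gt_three])
  have h3 := Real.sin_pos_of_pos_of_lt_pi h1 h2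
  rcases abs_choice (g (t • x)) with h4 | h4 <;> rw [h4] at h3
  · rw [h] at h3; exact lt_irrefl _ h3
  · rw [Real.sin_neg, h, neg_zero] at h3; exact lt_irrefl _ h3

theorem exists_log (hρ : 0 < ρ) {c : Fn n} (hc : InA n ρ c) (hne : ∀ ψ ∈ closedStrip n ρ, c ψ ≠ 0) : ∃
    (s : ℝ) (l : Fn n), s ≠ 0 ∧ (∀ R < ρ, HolA n R l) ∧ (∀ x, (l (toC x)).im = 0) ∧ ∀ ψ ∈ openStrip n ρ, c ψ
    = s * Complex.exp (l ψ) := by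
  have h00 : (toC (0 : Vec n)) ∈ openStrip n ρ := fun j => by simpa [toC] using hρ
  obtain ⟨s, hs⟩ : ∃ s : ℝ, (s : ℂ) = c (toC 0) :=
    ⟨(c (toC 0)).re, Complex.ext (by simp) (by simp [hc.real_of_real 0])⟩
  have hs0 : (s : ℂ) ≠ 0 := by rw [hs]; exact hne _ (openStrip_subset n ρ h00)
  obtain ⟨f, hf, hfe⟩ := Complex.exists_continuousOn_eqOn_exp_comp
    (isSimplyConnected_openStrip (n := n) hρ) (isOpen_openStrip n ρ) (g := fun ψ => c ψ / s)
    ((hc.continuousOn.mono (openStrip_subset n ρ)).div_const _) (by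
      rintro ⟨ψ, hψ, h0⟩
      exact hne ψ (openStrip_subset n ρ hψ) ((div_eq_zero_iff.1 h0).resolve_right hs0))
  obtain ⟨l, hl⟩ : ∃ l : Fn n, ∀ ψ, l ψ = f ψ - f (toC 0) := ⟨_, fun _ => rfl⟩
  have hlc : ContinuousOn l (openStrip n ρ) :=
    (hf.sub continuousOn_const).congr fun ψ _ => hl ψ
  have hf0 : Complex.exp (f (toC 0)) = 1 := by
    have := hfe h00
    simp only [Function.comp, ← hs] at this
    rwa [div_self hs0] at this
  have hle : ∀ ψ ∈ openStrip n ρ, Complex.exp (l ψ) = c ψ / s := fun ψ hψ => by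
    rw [hl, Complex.exp_sub, hf0, div_one]; exact hfe hψ
  have hla : AnalyticOnNhd ℂ l (openStrip n ρ) := fun ψ hψ => by
    have hn := (isOpen_openStrip n ρ).mem_nhds hψ
    refine analyticAt_of_exp (g := fun ψ => c ψ / s) (hlc.continuousAt hn) ?_ ?_
    · exact (hc.analytic ψ hψ).div analyticAt_const hs0
    · filter_upwards [hn] with φ hφ using hle φ hφ
  have hx : ∀ x, toC x ∈ openStrip n ρ := fun x j => by simpa [toC] using hρ
  have hreal : ∀ x, (l (toC x)).im = 0 := by
    refine eq_zero_of_sin_eq_zero ?_ ?_ fun x => ?_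
    · exact Complex.continuous_im.comp (hlc.comp_continuous continuous_toC hx)
    · rw [hl, sub_self, Complex.zero_im]
    · have h1 := congrArg Complex.im (hle _ (hx x))
      rw [Complex.exp_im, Complex.div_ofReal_im, hc.real_of_real, zero_div] at h1
      exact (mul_eq_zero.1 h1).resolve_left (Real.exp_ne_zero _)
  have hper : ∀ m : Fin n → ℤ, Set.EqOn (fun ψ => l (ψ + intPt m)) l (openStrip n ρ) := fun m => by
    refine eqOn_openStrip hρ ?_ hla fun x => ?_
    · intro ψ hψ
      refine AnalyticAt.fun_comp (hla _ fun j => ?_) (analyticAt_id.add analyticAt_const)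
      simpa [intPt] using hψ j
    · rw [← toC_add_int]
      have h1 := hle _ (hx (x + fun j => (m j : ℝ)))
      rw [toC_add_int x m, hc.periodic _ (toC_mem hρ.le x), ← hle _ (hx x), ← toC_add_int] at h1
      have h2 : ∀ x, l (toC x) = ((l (toC x)).re : ℂ) := fun x =>
        Complex.ext (by simp) (by simp [hreal x])
      rw [h2, h2 x] at h1 ⊢
      rw [← Complex.ofReal_exp, ← Complex.ofReal_exp] at h1
      rw [Real.exp_injective (Complex.ofReal_injective h1)]
  refine ⟨s, l, by exact_mod_cast hs0, fun R hR => ⟨?_, ?_, ?_⟩, hreal, fun ψ hψ => ?_⟩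
  · exact hla.mono fun ψ hψ j => (hψ j).trans hR
  · exact hlc.mono (closedStrip_subset_openStrip hR)
  · exact fun ψ hψ m => hper m (closedStrip_subset_openStrip hR hψ)
  · rw [hle ψ hψ, mul_div_cancel₀ _ hs0]

/-- Reduction of a nonvanishing function to a constant by a multiplicative coboundary. -/
theorem exists_coboundary (hρ : 0 < ρ) (hS : SmallDiv Ω C p) {c : Fn n} (hc : InA n ρ c)
    (hne : ∀ ψ ∈ closedStrip n ρ, c ψ ≠ 0) : ∃ (χ : ℝ) (φ : Fn n), χ ≠ 0 ∧ (∀ R, 0 < R → R < ρ → HolA n R φ)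
    ∧ (∀ ψ, φ ψ ≠ 0) ∧ (∀ x, ∃ r : ℝ, 0 < r ∧ φ (toC x) = r) ∧ ∀ ψ ∈ openStrip n ρ, c ψ * φ ψ = χ * φ
    (ψ - toC Ω) := by
  obtain ⟨s, l, hs, hl, hlr, hle⟩ := exists_log hρ hc hne
  have hfin : ∀ R, 0 ≤ R → R < ρ → nrm R (lift₁ l) ≠ ∞ := fun R h0 h1 =>
    (hl ((R + ρ) / 2) (by linarith)).nrm_lift h0 (by linarith)
  have hev : ∀ R, 0 < R → R < ρ → ∀ ψ ∈ closedStrip n R, ev 0 ψ (lift₁ l) = l ψ := fun R h0 h1 ψ hψ =>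
    (hl ((R + ρ) / 2) (by linarith)).ev_lift h0 (by linarith) (by simp) hψ
  set H : Ser n := sol Ω 1 (shf Ω (lift₁ l)) with hH
  have hfin2 : Fin' (shf Ω (lift₁ l)) := ⟨ρ / 2, by linarith, by
    rw [nrm_shf]; exact hfin _ (by linarith) (by linarith)⟩
  have hHfin : ∀ R, 0 ≤ R → R < ρ → nrm R H ≠ ∞ := fun R h0 h1 => by
    refine ne_top_of_le_ne_top ?_ (hS.nrm_sol (δ := (ρ - R) / 2) (by linarith) R 1 _)
    rw [nrm_shf]
    exact mul_ne_top ofReal_ne_top (hfin _ (by linarith) (by linarith))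
  obtain ⟨m, hm⟩ : ∃ m : ℂ, m = ev 0 0 (ave (lift₁ l)) := ⟨_, rfl⟩
  obtain ⟨h, hh⟩ : ∃ h : Fn n, ∀ ψ, h ψ = -ev 0 ψ H := ⟨_, fun _ => rfl⟩
  have hhol : ∀ R, 0 < R → R < ρ → HolA n R h := fun R h0 h1 => by
    have := (holA_ev (ζ := 0) h0 (by simp) (hHfin R h0.le h1)).const_mul (-1)
    simpa only [neg_one_mul, ← hh] using this
  have hcob : ∀ ψ ∈ openStrip n ρ, h (ψ - toC Ω) - h ψ = l ψ - m := fun ψ hψ => by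
    obtain ⟨R, h0, h1, h2⟩ := exists_margin hρ hψ
    have h2' := sub_toC_mem_closed h2 Ω
    have e := hS.sol_eq 1 hfin2
    rw [← hH, Complex.ofReal_one, one_smul, ave_shf] at e
    have e2 := congrArg (ev 0 (ψ - toC Ω)) e
    have hshf : ∀ f : Ser n, nrm R f ≠ ∞ → nrm R (shf Ω f) ≠ ∞ := fun f hf => by
      rwa [nrm_shf]
    have have_ : nrm R (ave (lift₁ l)) ≠ ∞ :=
      ne_top_of_le_ne_top (hfin R h0.le h1) (nrm_ave_le (ρ' := R) _)
    rw [ev_sub (by simp) h2' (hshf _ (hHfin R h0.le h1)) (hHfin R h0.le h1),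
      ev_sub (by simp) h2' (hshf _ (hfin R h0.le h1)) have_, ev_shf, ev_shf, sub_add_cancel,
      ev_ave (by simp) (ave_ave _), hev R h0 h1 ψ h2, ← hm] at e2
    rw [hh, hh]; linear_combination e2
  have hx : ∀ x, toC x ∈ openStrip n ρ := fun x j => by simpa [toC] using hρ
  have hp : Per fun x => h (toC x) := (hhol (ρ / 2) (by linarith) (by linarith)).per (by linarith)
  have hy := hp.sub hp.conj
  have hstep : ∀ x, (h (toC (x + Ω)) - conj (h (toC (x + Ω))))
      = (h (toC x) - conj (h (toC x))) + (m - conj m) := fun x => by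
    have e1 := hcob _ (hx (x + Ω))
    rw [toC_add, add_sub_cancel_right] at e1
    have e2 := congrArg conj e1
    simp only [map_sub] at e2
    rw [← toC_add] at e1 e2
    rw [Complex.conj_eq_iff_im.2 (hlr (x + Ω))] at e2
    linear_combination e2 - e1
  have hm0 : m - conj m = 0 := by
    have e1 := ravg_shift hy Ω
    simp only [hstep] at e1
    rw [ravg_add hy.cont continuous_const, ravg_const] at e1
    linear_combination e1
  have hconst : ∀ x, h (toC x) - conj (h (toC x)) = ravg fun x => h (toC x) - conj (h (toC x)) :=
    hy.const_of_twisted hS (χ := 1) fun x => by rw [hstep, hm0]; simp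
  obtain ⟨k, hk⟩ : ∃ k : ℂ, ∀ x, h (toC x) - conj (h (toC x)) = k := ⟨_, hconst⟩
  have hkc : conj k = -k := by
    rw [← hk 0, map_sub, Complex.conj_conj]; ring
  have hmr : m = (m.re : ℂ) := by
    rw [sub_eq_zero] at hm0
    exact (Complex.conj_eq_iff_re.1 hm0.symm).symm
  refine ⟨s * Real.exp m.re, fun ψ => Complex.exp (h ψ - k / 2), mul_ne_zero hs (Real.exp_ne_zero _),
    fun R h0 h1 => ((hhol R h0 h1).sub (HolA.const _)).exp, fun ψ => Complex.exp_ne_zero _,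
    fun x => ⟨Real.exp (h (toC x) - k / 2).re, Real.exp_pos _, ?_⟩, fun ψ hψ => ?_⟩
  · have : conj (h (toC x) - k / 2) = h (toC x) - k / 2 := by
      rw [map_sub, map_div₀, hkc, map_ofNat]; linear_combination (hk x) * (-1)
    rw [Complex.ofReal_exp, Complex.conj_eq_iff_re.1 this]
  · push_cast
    rw [← hmr, hle ψ hψ, mul_assoc, mul_assoc, ← Complex.exp_add, ← Complex.exp_add]
    congr 2
    linear_combination -hcob ψ hψ

end logarithm

/-- The data of an equilibrium whose linearization factorizes, with the factors written as
quotients of a single function. -/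
structure Base (Ω : Vec n) (β : Vec (n + 1)) (η : ℝ) (U : Fn (n + 1)) (ρ : ℝ)
    (v₀ : Fn n) (σ₀ : ℂ) (c₀ : Fn n) (χ : ℝ) (φ : Fn n) :
    Prop where
  pos : 0 < ρ
  χ_ne : χ ≠ 0
  hol_v : HolA n ρ v₀
  hol_w : HolA n ρ fun ψ => dBeta β U (hull β η ψ (v₀ ψ))
  hol_w' : HolA n ρ fun ψ => dBeta β (dBeta β U) (hull β η ψ (v₀ ψ))
  hol_c : HolA n ρ c₀
  c_ne : ∀ ψ ∈ closedStrip n ρ, c₀ ψ ≠ 0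
  fac : ∀ ψ ∈ closedStrip n ρ,
    (-c₀ ψ + 2 - dBeta β U (hull β η ψ (v₀ ψ)) - σ₀) * c₀ (ψ + toC Ω) = 1
  hol_φ : ∀ R, 0 < R → R < ρ → HolA n R φ
  φ_ne : ∀ ψ, φ ψ ≠ 0
  φ_pos : ∀ x, ∃ r : ℝ, 0 < r ∧ φ (toC x) = r
  cob : ∀ ψ ∈ openStrip n ρ, c₀ ψ * φ ψ = χ * φ (ψ - toC Ω)

section uniqueness

variable {φ : Fn n}

theorem toC_sub (x y : Vec n) : toC (x - y) = toC x - toC y := by ext; simp [toC]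

theorem Per.shift_sub {f : Vec n → ℂ} (hf : Per f) (a : Vec n) : Per fun x => f (x - a) := by
  simpa only [sub_eq_add_neg] using hf.shift (-a)

theorem Base.mem (hb : Base Ω β η U ρ v₀ σ₀ c₀ χ φ) (x : Vec n) : toC x ∈ openStrip n ρ := fun j => by
  simpa [toC] using hb.pos

theorem Base.per_φ (hb : Base Ω β η U ρ v₀ σ₀ c₀ χ φ) : Per fun x => φ (toC x) :=
  (hb.hol_φ (ρ / 2) (half_pos hb.pos) (half_lt_self hb.pos)).per (half_pos hb.pos).le

theorem ravg_pos_ne_zero {f : Vec n → ℂ} (hf : Per f) (h : ∀ x, ∃ r : ℝ, 0 < r ∧ f x = r) : ravg f ≠ 0 := by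
  intro h0
  choose r hr hfr using h
  have e : f = fun x => (r x : ℂ) := funext hfr
  rw [e] at hf h0
  exact (hr 0).ne' (eq_zero_of_ravg_eq_zero hf (fun x => (hr x).le) h0 0)

theorem ravg_shift_sub {g : Vec n → ℂ} (hg : Per g) (a : Vec n) : ravg (fun x => g (x - a)) = ravg g := by
  simpa only [sub_eq_add_neg] using ravg_shift hg (-a)

/-- Energy estimate: uniqueness for a product of two twisted difference operators. -/
theorem eq_zero_of_energy (hS : SmallDiv Ω C p) (hχ : χ ≠ 0) {r : Vec n → ℝ} (hr : ∀ x, 0 < r x)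
    (hrp : Per fun x => (r x : ℂ)) {B : Vec n → ℂ} (hB : Per B) {D : ℂ} (hB0 : ravg B = 0) (h : ∀ x, r x * B
    (x + Ω) - (χ : ℂ)⁻¹ * r (x + Ω) * B x - χ * (r (x - Ω) * B x - (χ : ℂ)⁻¹ * r x * B (x - Ω)) =
    -(r x * D)) : D = 0 ∧ ∀ x, B x = 0 := by
  have hχ' : (χ : ℂ) ≠ 0 := by exact_mod_cast hχ
  have hr0 : ∀ x, (r x : ℂ) ≠ 0 := fun x => by exact_mod_cast (hr x).ne'
  obtain ⟨y, hy⟩ : ∃ y : Vec n → ℂ, ∀ x, y x = B x * (r x : ℂ)⁻¹ := ⟨_, fun _ => rfl⟩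
  have hBy : ∀ x, B x = r x * y x := fun x => by rw [hy, mul_left_comm, mul_inv_cancel₀ (hr0 x), mul_one]
  have hyp : Per y := by rw [show y = _ from funext hy]; exact hB.mul (hrp.inv hr0)
  obtain ⟨j, hj⟩ : ∃ j : Vec n → ℂ, ∀ x, j x = r x * r (x + Ω) * (y (x + Ω) - (χ : ℂ)⁻¹ * y x) :=
    ⟨_, fun _ => rfl⟩
  have hjp : Per j := by
    rw [show j = _ from funext hj]
    exact (hrp.mul (hrp.shift Ω)).mul ((hyp.shift Ω).sub ((Per.const _).mul hyp))
  have hjeq : ∀ x, j x - χ * j (x - Ω) = -(r x * D) := fun x => by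
    rw [← h x, hj, hj, sub_add_cancel, hBy, hBy, hBy]; ring
  have e1 : ravg (fun x => conj (y x) * (j x - χ * j (x - Ω))) = 0 := by
    have e : ∀ x, conj (y x) * (j x - χ * j (x - Ω)) = -D * conj (B x) :=
      fun x => by
        rw [hjeq, hBy, map_mul, Complex.conj_ofReal]; ring
    simp only [e]
    rw [ravg_mul_left, ravg_conj, hB0, map_zero, mul_zero]
  have e2 : ravg (fun x => conj (y x) * j (x - Ω)) = ravg fun x => conj (y (x + Ω)) * j x := by
    have := ravg_shift_sub ((hyp.conj.shift Ω).mul hjp) Ω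
    simpa only [sub_add_cancel] using this
  have e3 : ravg (fun x => ((‖j x‖ ^ 2 * (r x * r (x + Ω))⁻¹ : ℝ) : ℂ)) = 0 := by
    have e : ∀ x, ((‖j x‖ ^ 2 * (r x * r (x + Ω))⁻¹ : ℝ) : ℂ)
        = conj (y (x + Ω)) * j x - (χ : ℂ)⁻¹ * (conj (y x) * j x) := fun x => by
      have h1 : conj (j x) = r x * r (x + Ω) * (conj (y (x + Ω)) - (χ : ℂ)⁻¹ * conj (y x)) := by
        rw [hj]; simp
      have h2 : ((‖j x‖ ^ 2 : ℝ) : ℂ) = conj (j x) * j x := by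
        rw [Complex.conj_mul']; push_cast; rfl
      rw [Complex.ofReal_mul, h2, h1]
      push_cast
      have := hr0 x
      have := hr0 (x + Ω)
      field_simp
    simp only [e]
    have p1 := (hyp.conj.shift Ω).mul hjp
    have p2 := hyp.conj.mul hjp
    have p3 := hyp.conj.mul (hjp.shift_sub Ω)
    rw [ravg_sub p1.cont ((Per.const (χ : ℂ)⁻¹).mul p2).cont, ravg_mul_left, ← e2]
    have e4 : ravg (fun x => conj (y x) * (j x - χ * j (x - Ω))) = ravg (fun x => conj (y x) * j x)
          - χ * ravg fun x => conj (y x) * j (x - Ω) := by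
      rw [← ravg_mul_left, ← ravg_sub p2.cont ((Per.const (χ : ℂ)).mul p3).cont]
      congr 1; funext x; ring
    rw [e4] at e1
    have h5 := mul_inv_cancel₀ hχ'
    linear_combination (-(χ : ℂ)⁻¹) * e1 - (ravg fun x => conj (y x) * j (x - Ω)) * h5
  have hnn : Per fun x => ((‖j x‖ ^ 2 * (r x * r (x + Ω))⁻¹ : ℝ) : ℂ) := by
    have p1 := (hjp.conj.mul hjp).mul ((hrp.mul (hrp.shift Ω)).inv fun x => mul_ne_zero (hr0 _) (hr0 _))
    refine cast (congrArg Per (funext fun x => ?_)) p1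
    rw [Complex.conj_mul']; push_cast; rfl
  have hj0 : ∀ x, j x = 0 := fun x => by
    have h6 := eq_zero_of_ravg_eq_zero hnn (fun x => by
      have := hr x; have := hr (x + Ω); positivity) e3 x
    have h7 : (r x * r (x + Ω))⁻¹ ≠ 0 := inv_ne_zero (mul_ne_zero (hr x).ne' (hr _).ne')
    have h8 := (mul_eq_zero.1 h6).resolve_right h7
    exact norm_eq_zero.1 (pow_eq_zero_iff two_ne_zero |>.1 h8)
  have hD : D = 0 := by
    have := hjeq 0
    rw [hj0, hj0, mul_zero, sub_zero, eq_comm, neg_eq_zero] at this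
    exact (mul_eq_zero.1 this).resolve_left (hr0 0)
  have hyc : ∀ x, y x = ravg y := hyp.const_of_twisted hS (χ := χ⁻¹) fun x => by
    have h1 := hj0 x
    rw [hj] at h1
    have h2 := (mul_eq_zero.1 h1).resolve_left (mul_ne_zero (hr0 _) (hr0 _))
    push_cast
    exact sub_eq_zero.1 h2
  obtain ⟨k, hk⟩ : ∃ k, ∀ x, y x = k := ⟨_, hyc⟩
  refine ⟨hD, fun x => ?_⟩
  have h9 : ravg (fun x => (r x : ℂ)) * k = 0 := by
    rw [← ravg_mul_right, ← hB0]
    congr 1; funext x; rw [hBy, hk]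
  have hk0 := (mul_eq_zero.1 h9).resolve_left (ravg_pos_ne_zero hrp fun x => ⟨r x, hr x, rfl⟩)
  rw [hBy, hk, hk0, mul_zero]

theorem Base.relations (hb : Base Ω β η U ρ v₀ σ₀ c₀ χ φ) (x : Vec n) : c₀ (toC x) * φ (toC x) = χ * φ
    (toC (x - Ω)) ∧ c₀ (toC (x + Ω)) * φ (toC (x + Ω)) = χ * φ (toC x) ∧ (-c₀ (toC x) + 2 - dBeta β U
    (hull β η (toC x) (v₀ (toC x))) - σ₀) * c₀ (toC (x + Ω)) = 1 := by
  refine ⟨?_, ?_, ?_⟩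
  · rw [toC_sub]; exact hb.cob _ (hb.mem x)
  · have := hb.cob _ (hb.mem (x + Ω))
    rwa [← toC_sub, add_sub_cancel_right] at this
  · rw [toC_add]; exact hb.fac _ (toC_mem hb.pos.le x)

theorem Base.potential_eq (hb : Base Ω β η U ρ v₀ σ₀ c₀ χ φ) (x : Vec n) : (dBeta β U
    (hull β η (toC x) (v₀ (toC x))) + σ₀ - 2) * φ (toC x) = -(χ * φ (toC (x - Ω))) - (χ : ℂ)⁻¹ * φ
    (toC (x + Ω)) := by
  have hχ' : (χ : ℂ) ≠ 0 := by exact_mod_cast hb.χ_ne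
  obtain ⟨h1, h2, h3⟩ := hb.relations x
  have hc : c₀ (toC (x + Ω)) ≠ 0 := fun h0 => by rw [h0, mul_zero] at h3; exact zero_ne_one h3
  have e1 : (χ : ℂ)⁻¹ * φ (toC (x + Ω)) * c₀ (toC (x + Ω)) = φ (toC x) := by
    rw [mul_assoc, mul_comm (φ (toC (x + Ω))), h2, ← mul_assoc, inv_mul_cancel₀ hχ', one_mul]
  refine mul_right_cancel₀ hc ?_
  linear_combination (-φ (toC x)) * h3 - c₀ (toC (x + Ω)) * h1 + e1

/-- Uniqueness for the linearized equilibrium equation without counterterm. -/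
theorem Base.equil_unique (hS : SmallDiv Ω C p) (hb : Base Ω β η U ρ v₀ σ₀ c₀ χ φ) {B : Fn n}
    (hB : Per fun x => B (toC x)) {D : ℂ} (hE : ∀ x, linEquil Ω β η U v₀ σ₀ B (toC x) + D = 0)
    (hB0 : avg B = 0) : D = 0 ∧ ∀ x, B (toC x) = 0 := by
  have hχ' : (χ : ℂ) ≠ 0 := by exact_mod_cast hb.χ_ne
  choose r hr hφr using hb.φ_pos
  refine eq_zero_of_energy hS hb.χ_ne hr (by simpa only [hφr] using hb.per_φ) hB hB0 fun x => ?_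
  have h4 := hb.potential_eq x
  have hE := hE x
  rw [linEquil, ← toC_add, ← toC_sub] at hE
  rw [hφr, hφr, hφr] at h4
  have h5 := mul_inv_cancel₀ hχ'
  linear_combination (r x : ℂ) * hE - B (toC x) * h4 + r x * B (toC (x - Ω)) * h5

theorem Base.factor_unique (hS : SmallDiv Ω C p) (hb : Base Ω β η U ρ v₀ σ₀ c₀ χ φ) {q : Fn n}
    (hq : Per fun x => q (toC x)) (hF : ∀ x, -(c₀ (toC (x + Ω)) * q (toC x)) + (-c₀ (toC x) + 2 - dBeta β U
    (hull β η (toC x) (v₀ (toC x))) - σ₀) * q (toC (x + Ω)) = 0) (hq0 : avg (fun ψ => q ψ / c₀ ψ) = 0)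
    (x : Vec n) : q (toC x) = 0 := by
  have hc : ∀ x, c₀ (toC x) ≠ 0 := fun x => hb.c_ne _ (toC_mem hb.pos.le x)
  have hφ := hb.per_φ
  have hcp := hb.hol_c.per hb.pos.le
  obtain ⟨h, hh⟩ : ∃ h : Vec n → ℂ, ∀ x, h x = q (toC x) * (c₀ (toC x))⁻¹ := ⟨_, fun _ => rfl⟩
  have hqh : ∀ x, q (toC x) = c₀ (toC x) * h x := fun x => by
    rw [hh, mul_left_comm, mul_inv_cancel₀ (hc x), mul_one]
  have hhp : Per h := by rw [show h = _ from funext hh]; exact hq.mul (hcp.inv hc)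
  obtain ⟨i, hi⟩ : ∃ i : Vec n → ℂ, ∀ x, i x = h x * (φ (toC x) * φ (toC (x - Ω))) :=
    ⟨_, fun _ => rfl⟩
  have hQp := hφ.mul (hφ.shift_sub Ω)
  have hip : Per i := by rw [show i = _ from funext hi]; exact hhp.mul hQp
  have hstep : ∀ x, h (x + Ω) = c₀ (toC (x + Ω)) * c₀ (toC x) * h x := fun x => by
    obtain ⟨-, -, h3⟩ := hb.relations x
    have := hF x
    rw [hqh x, hqh (x + Ω)] at this
    linear_combination this - h (x + Ω) * h3
  have hik : ∀ x, i x = ravg i := hip.const_of_twisted hS (χ := χ ^ 2) fun x => by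
    obtain ⟨h1, h2, -⟩ := hb.relations x
    rw [hi, hi, add_sub_cancel_right, hstep]
    push_cast
    linear_combination (c₀ (toC x) * φ (toC x) * h x) * h2 + χ * φ (toC x) * h x * h1
  obtain ⟨k, hk⟩ : ∃ k, ∀ x, i x = k := ⟨_, hik⟩
  have hQ0 : ∀ x, φ (toC x) * φ (toC (x - Ω)) ≠ 0 := fun x => mul_ne_zero (hb.φ_ne _) (hb.φ_ne _)
  have hhk : ∀ x, h x = (φ (toC x) * φ (toC (x - Ω)))⁻¹ * k := fun x => by
    rw [← hk x, hi, mul_comm (h x), ← mul_assoc, inv_mul_cancel₀ (hQ0 x), one_mul]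
  have h9 : ravg (fun x => (φ (toC x) * φ (toC (x - Ω)))⁻¹) * k = 0 := by
    rw [← ravg_mul_right, ← hq0]
    show _ = ravg _
    congr 1; funext x
    simp only [← hhk x, hh, div_eq_mul_inv]
  have hk0 := (mul_eq_zero.1 h9).resolve_left (ravg_pos_ne_zero (hQp.inv hQ0) fun x => by
    obtain ⟨r, hr, hr'⟩ := hb.φ_pos x
    obtain ⟨r', hr2, hr2'⟩ := hb.φ_pos (x - Ω)
    exact ⟨(r * r')⁻¹, by positivity, by rw [hr', hr2']; push_cast; rfl⟩)
  rw [hqh, hhk, hk0, mul_zero, mul_zero]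

theorem Base.holA_linEquil (hb : Base Ω β η U ρ v₀ σ₀ c₀ χ φ) (hR : R < ρ) {B : Fn n} (hB : HolA n R B) :
    HolA n R (linEquil Ω β η U v₀ σ₀ B) := by
  unfold linEquil
  exact (((((hB.shift Ω).add (hB.shift_neg Ω)).sub (hB.const_mul 2)).add
    ((hb.hol_w.mono hR.le).mul hB)).add (hB.const_mul σ₀))

theorem Base.holA_linFactor (hb : Base Ω β η U ρ v₀ σ₀ c₀ χ φ) (hR : R < ρ) {B q : Fn n} (hB : HolA n R B)
    (hq : HolA n R q) (s : ℂ) : HolA n R (linFactor Ω β η U v₀ σ₀ c₀ B s q) := by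
  unfold linFactor
  have hc := hb.hol_c.mono hR.le
  have hw := hb.hol_w.mono hR.le
  have hneg : HolA n R fun ψ => -(c₀ (ψ + toC Ω) * q ψ) := by
    simpa only [neg_one_mul] using ((hc.shift Ω).mul hq).const_mul (-1)
  have hnegc : HolA n R fun ψ => -c₀ ψ := by simpa only [neg_one_mul] using hc.const_mul (-1)
  exact ((hneg.add ((((hnegc.add (HolA.const 2)).sub hw).sub (HolA.const σ₀)).mul (hq.shift Ω))).sub
    ((hc.shift Ω).mul (HolA.const s))).sub
    (((hb.hol_w'.mono hR.le).mul (hc.shift Ω)).mul hB)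

/-- Uniqueness for both linearized equations. -/
theorem Base.linear_unique (hS : SmallDiv Ω C p) (hb : Base Ω β η U ρ v₀ σ₀ c₀ χ φ)
    (hT : Transversal Ω β η U ρ v₀ σ₀ c₀) (h0 : 0 < R) (hR : R < ρ) {B q : Fn n} (hB : HolA n R B)
    (hq : HolA n R q) {s D : ℂ} (hE : ∀ x, linEquil Ω β η U v₀ σ₀ B (toC x) + s * v₀ (toC x) + D = 0)
    (hF : ∀ x, linFactor Ω β η U v₀ σ₀ c₀ B s q (toC x) = 0) (hB0 : avg B = 0)
    (hq0 : avg (fun ψ => q ψ / c₀ ψ) = 0) : s = 0 ∧ D = 0 ∧ (∀ x, B (toC x) = 0) ∧ ∀ x, q (toC x) = 0 := by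
  have hs : s = 0 := by
    by_contra hs
    have hB' := hB.const_mul s⁻¹
    have hq' := hq.const_mul s⁻¹
    have hss := inv_mul_cancel₀ hs
    refine hT R _ _ (s⁻¹ * D) h0 hR hB' hq' ?_ ?_ ?_ ?_
    · have : avg (fun ψ => s⁻¹ * B ψ) = s⁻¹ * avg B := ravg_mul_left _ _
      rw [this, hB0, mul_zero]
    · refine ((((hb.holA_linEquil hR hB').add (hb.hol_v.mono hR.le)).add (HolA.const (s⁻¹ * D))).eq_on
        h0 (HolA.const 0) fun x => ?_)
      have := hE x
      simp only [linEquil] at this ⊢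
      linear_combination s⁻¹ * this - v₀ (toC x) * hss
    · refine ((hb.holA_linFactor hR hB' hq' 1).eq_on h0 (HolA.const 0) fun x => ?_)
      have := hF x
      simp only [linFactor] at this ⊢
      linear_combination s⁻¹ * this + c₀ (toC x + toC Ω) * hss
    · have : avg (fun ψ => s⁻¹ * q ψ / c₀ ψ) = s⁻¹ * avg fun ψ => q ψ / c₀ ψ := by
        simp only [mul_div_assoc]; exact ravg_mul_left _ _
      rw [this, hq0, mul_zero]
  subst hs
  have hE' : ∀ x, linEquil Ω β η U v₀ σ₀ B (toC x) + D = 0 := fun x => by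
    have := hE x; rwa [zero_mul, add_zero] at this
  obtain ⟨hD, hB1⟩ := hb.equil_unique hS (hB.per h0.le) hE' hB0
  refine ⟨rfl, hD, hB1, hb.factor_unique hS (hq.per h0.le) (fun x => ?_) hq0⟩
  have := hF x
  rwa [linFactor, hB1, mul_zero, mul_zero, sub_zero, sub_zero, ← toC_add] at this

end uniqueness

section values

/-- A series of finite norm takes the value `z` at a point. -/
def HasEv (R : ℝ) (ζ : ℂ) (ψ : CVec n) (f : Ser n) (z : ℂ) : Prop :=
  nrm R f ≠ ∞ ∧ ev ζ ψ f = z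

variable {w : ℂ}

theorem HasEv.mul (hR : 0 ≤ R) (hζ : ‖ζ‖ ≤ 1) (hψ : ψ ∈ closedStrip n R) (hf : HasEv R ζ ψ f z)
    (hg : HasEv R ζ ψ g w) : HasEv R ζ ψ (f * g) (z * w) :=
  ⟨ne_top_of_le_ne_top (mul_ne_top hf.1 hg.1) (nrm_mul_le hR _ _),
    by rw [ev_mul hζ hψ hf.1 hg.1, hf.2, hg.2]⟩

theorem HasEv.add (hζ : ‖ζ‖ ≤ 1) (hψ : ψ ∈ closedStrip n R) (hf : HasEv R ζ ψ f z) (hg : HasEv R ζ ψ g w) :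
    HasEv R ζ ψ (f + g) (z + w) :=
  ⟨ne_top_of_le_ne_top (add_ne_top.2 ⟨hf.1, hg.1⟩) (N_add_le _ _),
    by rw [ev_add hζ hψ hf.1 hg.1, hf.2, hg.2]⟩

theorem HasEv.sub (hζ : ‖ζ‖ ≤ 1) (hψ : ψ ∈ closedStrip n R) (hf : HasEv R ζ ψ f z) (hg : HasEv R ζ ψ g w) :
    HasEv R ζ ψ (f - g) (z - w) :=
  ⟨ne_top_of_le_ne_top (add_ne_top.2 ⟨hf.1, hg.1⟩) (N_sub_le _ _),
    by rw [ev_sub hζ hψ hf.1 hg.1, hf.2, hg.2]⟩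

theorem hasEv_cst (c : ℂ) : HasEv R ζ ψ (cst c) c := ⟨by rw [nrm_cst]; exact enorm_ne_top, ev_algebraMap c⟩

theorem HasEv.shf (hf : HasEv R ζ (ψ + toC Ω) f z) : HasEv R ζ ψ (shf Ω f) z :=
  ⟨by rw [nrm_shf]; exact hf.1, by rw [ev_shf, hf.2]⟩

theorem HasEv.shf_neg (hf : HasEv R ζ (ψ - toC Ω) f z) : HasEv R ζ ψ (FKRes.shf (-Ω) f) z :=
  HasEv.shf (by rwa [toC_neg, ← sub_eq_add_neg])

theorem hasEv_natCast (l : ℕ) : HasEv R ζ ψ (l : Ser n) l := by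
  have := hasEv_cst (R := R) (ζ := ζ) (ψ := ψ) (l : ℂ)
  rwa [cst, map_natCast] at this

theorem hasEv_two : HasEv R ζ ψ (2 : Ser n) 2 := by exact_mod_cast hasEv_natCast 2

theorem HasEv.neg (hζ : ‖ζ‖ ≤ 1) (hψ : ψ ∈ closedStrip n R) (hf : HasEv R ζ ψ f z) : HasEv R ζ ψ (-f) (-z) := by
  simpa [cst] using (hasEv_cst 0).sub hζ hψ hf

theorem HasEv.pow (hR : 0 ≤ R) (hζ : ‖ζ‖ ≤ 1) (hψ : ψ ∈ closedStrip n R) (hf : HasEv R ζ ψ f z) (l : ℕ) :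
    HasEv R ζ ψ (f ^ l) (z ^ l) :=
  ⟨ne_top_of_le_ne_top (pow_ne_top hf.1) (nrm_pow_le hR _ _), by rw [ev_pow hR hζ hψ hf.1, hf.2]⟩

end values

section determinant

variable {φ : Fn n}

/-- Uniqueness for the homogeneous triangular system. -/
theorem Base.chain_unique (hS : SmallDiv Ω C p) (hb : Base Ω β η U ρ v₀ σ₀ c₀ χ φ)
    (hT : Transversal Ω β η U ρ v₀ σ₀ c₀) (h0 : 0 < R) (hR : R < ρ) {J Y I G : Fn n} (hY : HolA n R Y)
    (hG : HolA n R G) {s D : ℂ} (e1 : ∀ x, J (toC (x + Ω)) - χ * J (toC x) =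
    -(φ (toC (x + Ω)) * (s * v₀ (toC (x + Ω)) + D))) (e2 : ∀ x, φ (toC x) * φ (toC (x + Ω)) *
    (Y (toC (x + Ω)) - (χ : ℂ)⁻¹ * Y (toC x)) = J (toC x)) (e3 : avg (fun ψ => φ ψ * Y ψ) = 0) (e4 : ∀ x, I
    (toC (x + Ω)) - χ ^ 2 * I (toC x) = χ * (-(φ (toC (x + Ω)) ^ 2 * s) - φ (toC (x + Ω)) ^ 3 * dBeta β
    (dBeta β U) (hull β η (toC (x + Ω)) (v₀ (toC (x + Ω)))) * Y (toC (x + Ω)))) (e5 : ∀ x, φ (toC x) * φ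
    (toC (x + Ω)) * (G (toC (x + Ω)) - G (toC x)) = I (toC x)) : s = 0 ∧ D = 0 ∧ (∀ x, J (toC x) = 0) ∧
    (∀ x, Y (toC x) = 0) ∧ ∀ x, I (toC x) = 0 := by
  have hχ' : (χ : ℂ) ≠ 0 := by exact_mod_cast hb.χ_ne
  have hχχ := mul_inv_cancel₀ hχ'
  have hB : HolA n R fun ψ => φ ψ * Y ψ := (hb.hol_φ R h0 hR).mul hY
  have hq : HolA n R fun ψ => c₀ ψ * (G (ψ - toC Ω) - G ψ) :=
    (hb.hol_c.mono hR.le).mul ((hG.shift_neg Ω).sub hG)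
  have key := hb.linear_unique hS hT h0 hR hB hq (s := s) (D := D)
  suffices h : (∀ x, linEquil Ω β η U v₀ σ₀ (fun ψ => φ ψ * Y ψ) (toC x)
      + s * v₀ (toC x) + D = 0) ∧ (∀ x, linFactor Ω β η U v₀ σ₀ c₀ (fun ψ => φ ψ * Y ψ) s
      (fun ψ => c₀ ψ * (G (ψ - toC Ω) - G ψ)) (toC x) = 0) ∧
      avg (fun ψ => c₀ ψ * (G (ψ - toC Ω) - G ψ) / c₀ ψ) = 0 by
    obtain ⟨hs, hD, hB0, hq0⟩ := key h.1 h.2.1 e3 h.2.2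
    have hY0 : ∀ x, Y (toC x) = 0 := fun x =>
      (mul_eq_zero.1 (hB0 x)).resolve_left (hb.φ_ne _)
    refine ⟨hs, hD, fun x => ?_, hY0, fun x => ?_⟩
    · rw [← e2, hY0, hY0]; ring
    · have h1 := (mul_eq_zero.1 (hq0 (x + Ω))).resolve_left (hb.c_ne _ (toC_mem hb.pos.le _))
      rw [← toC_sub, add_sub_cancel_right] at h1
      rw [← e5]
      linear_combination (-(φ (toC x) * φ (toC (x + Ω)))) * h1
  refine ⟨fun x => ?_, fun x => ?_, ?_⟩
  · have f1 := e1 (x - Ω)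
    have f2 := e2 (x - Ω)
    rw [sub_add_cancel] at f1 f2
    refine (mul_eq_zero.1 ?_).resolve_left (hb.φ_ne (toC x))
    rw [linEquil, ← toC_add, ← toC_sub]
    linear_combination f1 + e2 x - χ * f2 + φ (toC x) * Y (toC x) * hb.potential_eq x
      - φ (toC x) * φ (toC (x - Ω)) * Y (toC (x - Ω)) * hχχ
  · have f4 := e4 (x - Ω)
    have f5 := e5 (x - Ω)
    rw [sub_add_cancel] at f4 f5
    obtain ⟨r1, r2, r3⟩ := hb.relations x
    refine (mul_eq_zero.1 ?_).resolve_left (mul_ne_zero (hb.φ_ne (toC x)) (hb.φ_ne (toC (x + Ω))))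
    rw [linFactor, ← toC_add, ← toC_sub, ← toC_sub, add_sub_cancel_right]
    set K := -c₀ (toC x) + 2 - dBeta β U (hull β η (toC x) (v₀ (toC x))) - σ₀
    refine mul_left_cancel₀ (hb.φ_ne (toC x)) ?_
    set f := φ (toC x)
    set fp := φ (toC (x + Ω))
    set fm := φ (toC (x - Ω))
    linear_combination (f ^ 2 * fp * (G (toC x) - G (toC (x + Ω)))) * r3
      - (f ^ 2 * (s + dBeta β (dBeta β U) (hull β η (toC x) (v₀ (toC x))) * f * Y (toC x))
        + f ^ 2 * c₀ (toC x) * (G (toC (x - Ω)) - G (toC x))) * r2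
      - (χ * f ^ 2 * (G (toC (x - Ω)) - G (toC x))) * r1
      + χ ^ 2 * f * f5 - f * e5 x - f * f4
  · have hper := hG.per h0.le
    have : avg (fun ψ => c₀ ψ * (G (ψ - toC Ω) - G ψ) / c₀ ψ)
        = ravg fun x => G (toC (x - Ω)) - G (toC x) := by
      show ravg _ = _
      congr 1; funext x
      show c₀ (toC x) * (G (toC x - toC Ω) - G (toC x)) / c₀ (toC x) = _
      rw [mul_div_cancel_left₀ _ (hb.c_ne _ (toC_mem hb.pos.le _)), toC_sub]
    rw [this, ravg_sub (hper.shift_sub Ω).cont hper.cont, ravg_shift_sub hper, sub_self]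

theorem ord0_chain (Ω : Vec n) (χ : ℝ) (h1 : ord0 P.φ = P.φ) (h2 : ord0 P.q = P.q) (h3 : ord0 P.ω = P.ω)
    (hI : ∀ k, ord0 (I k) = I k) (b : Fin 5) : ord0 (res Ω χ P I b) = res Ω χ P I b := by
  have add : ∀ {f g : Ser n}, ord0 f = f → ord0 g = g → ord0 (f + g) = f + g :=
    fun hf hg => by rw [ord0_add, hf, hg]
  have sub : ∀ {f g : Ser n}, ord0 f = f → ord0 g = g → ord0 (f - g) = f - g :=
    fun hf hg => by rw [ord0_sub, hf, hg]
  have mul : ∀ {f g : Ser n}, ord0 f = f → ord0 g = g → ord0 (f * g) = f * g :=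
    fun hf hg => by rw [ord0_mul, hf, hg]
  have hJ : ord0 (stJ Ω χ I) = stJ Ω χ I := add (ord0_diag (ord0_diag (hI 0) _) _) (hI 5)
  have sY : ord0 (P.q * stJ Ω χ I + I 2) = P.q * stJ Ω χ I + I 2 := add (mul h2 hJ) (hI 2)
  have hY : ord0 (stY Ω χ P I) = stY Ω χ P I := add (ord0_diag sY _) (hI 6)
  have sI : ord0 (srcI Ω χ P I) = srcI Ω χ P I := by
    refine mul (ord0_cst _) (ord0_diag (sub (hI 1) (mul (mul ?_ h3) hY)) _)
    rw [pow_succ, pow_two]; exact mul (mul h1 h1) h1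
  have hI3 : ord0 (stI Ω χ P I) = stI Ω χ P I := add (ord0_diag sI _) (hI 7)
  have sG : ord0 (P.q * stI Ω χ P I + I 4) = P.q * stI Ω χ P I + I 4 := add (mul h2 hI3) (hI 4)
  fin_cases b
  · exact sub (ord0_diag (hI 0) _) (mul (ord0_cst _) (hI 5))
  · exact sub (ord0_diag sY _) (mul (ord0_cst _) (hI 6))
  · exact ord0_diag (add (mul h1 hY) (hI 3)) _
  · exact sub (ord0_diag sI _) (mul (ord0_cst _) (hI 7))
  · exact ord0_diag sG _

theorem eq_cst (h1 : ord0 f = f) (h2 : ave f = f) : f = cst (f 0) := by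
  ext i
  rw [cst, Algebra.algebraMap_eq_smul_one, smul_apply, one_apply]
  split_ifs with h
  · rw [h, mul_one]
  · rw [mul_zero]
    by_cases hi : i.2 = 0
    · have h' : ¬i.1 = 0 := fun h' => h (Prod.ext h' hi)
      rw [← h2, ave_apply, if_neg h']
    · rw [← h1, ord0_apply, if_neg hi]

theorem ev_cst (ζ : ℂ) (ψ : CVec n) (c : ℂ) : ev ζ ψ (cst c) = c := ev_algebraMap c

theorem ord0_unitInp {φ : Ser n} (hφ : ord0 φ = φ) (hv : ord0 v = v) (a : Fin 5) (k : Fin 8) : ord0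
    (unitInp φ v a k) = unitInp φ v a k := by
  refine unitInp_rel (Q := fun f g => ord0 f = g) (φ := φ) (v := v) (φ' := φ) (v' := v) ord0_zero
    ord0_one ?_ ?_ ?_ a k
  · rw [ord0_neg, ord0_mul, hφ, hv]
  · rw [ord0_neg, pow_two, ord0_mul, hφ]
  · rw [ord0_neg, hφ]

/-- A null vector of the matrix yields a solution of the homogeneous triangular system. -/
theorem exists_chain_of_null (hS : SmallDiv Ω C p) (hP : P.Ok) (hv : Fin' v) {X : Fin 5 → ℂ}
    (hX : ∀ b, ∑ a, cst (X a) * mat Ω χ P v b a = 0) : ∃ j y i g : Ser n, Fin' j ∧ Fin' y ∧ Fin' i ∧ Fin' g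
    ∧ shf Ω j - cst χ * j = shf Ω (-(P.φ * (cst (X 0) * v + cst (X 1)))) ∧ shf Ω y - cst ((χ : ℂ)⁻¹) * y =
    P.q * j ∧ ave (P.φ * y) = 0 ∧ shf Ω i - cst (χ ^ 2) * i = cst χ * shf Ω
    (-(P.φ * (cst (X 0) * P.φ)) - P.φ ^ 3 * P.ω * y) ∧ shf Ω g - g = P.q * i ∧ ave j = cst (X 2) ∧ ave y =
    cst (X 3) ∧ ave i = cst (X 4) := by
  set U := unitInp P.φ v with hU
  have hUf : ∀ a k, Fin' (U a k) := fin_unitInp hP.1 hv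
  have hXUf : ∀ a k, Fin' (((cst (X a) : Ser n) • U a) k) := fun a k =>
    (Fin'.cst _).mul (hUf a k)
  set I : Fin 8 → Ser n := (cst (X 0) : Ser n) • U 0 + (cst (X 1) : Ser n) • U 1
    + (cst (X 2) : Ser n) • U 2 + (cst (X 3) : Ser n) • U 3
    + (cst (X 4) : Ser n) • U 4 with hI
  have f1 : ∀ k, Fin' (((cst (X 0) : Ser n) • U 0 + (cst (X 1) : Ser n) • U 1) k) :=
    fun k => (hXUf 0 k).add (hXUf 1 k)
  have f2 : ∀ k, Fin' (((cst (X 0) : Ser n) • U 0 + (cst (X 1) : Ser n) • U 1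
      + (cst (X 2) : Ser n) • U 2) k) := fun k => (f1 k).add (hXUf 2 k)
  have f3 : ∀ k, Fin' (((cst (X 0) : Ser n) • U 0 + (cst (X 1) : Ser n) • U 1
      + (cst (X 2) : Ser n) • U 2 + (cst (X 3) : Ser n) • U 3) k) :=
    fun k => (f2 k).add (hXUf 3 k)
  have f4 : ∀ k, Fin' (I k) := fun k => (f3 k).add (hXUf 4 k)
  have hres : res Ω χ P I = 0 := by
    rw [hI, res_add hS hP f3 (hXUf 4), res_add hS hP f2 (hXUf 3), res_add hS hP f1 (hXUf 2),
      res_add hS hP (hXUf 0) (hXUf 1)]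
    simp only [(chain_mul (χ := χ) hS hP (hUf _) (ave_cst _)).2.2.2.2]
    funext b
    have := hX b
    simp only [Fin.sum_univ_five, mat, Matrix.of_apply] at this
    simp only [Pi.add_apply, Pi.smul_apply, smul_eq_mul, Pi.zero_apply]
    exact this
  have i0 : I 0 = -(P.φ * (cst (X 0) * v + cst (X 1))) := by
    simp only [hI, hU, unitInp, Pi.add_apply, Pi.smul_apply, smul_eq_mul, Matrix.cons_val]
    ring
  have i1 : I 1 = -(P.φ * (cst (X 0) * P.φ)) := by
    simp only [hI, hU, unitInp, Pi.add_apply, Pi.smul_apply, smul_eq_mul, Matrix.cons_val]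
    ring
  have iz : ∀ k : Fin 8, k = 2 ∨ k = 3 ∨ k = 4 → I k = 0 := by
    rintro k (rfl | rfl | rfl) <;> simp [hI, hU, unitInp]
  have i5 : I 5 = cst (X 2) := by simp [hI, hU, unitInp]
  have i6 : I 6 = cst (X 3) := by simp [hI, hU, unitInp]
  have i7 : I 7 = cst (X 4) := by simp [hI, hU, unitInp]
  obtain ⟨e1, e2, e3, e4, e5⟩ := chain_eqs hS hP f4 (by rw [i5, ave_cst]) (by rw [i6, ave_cst])
    (by rw [i7, ave_cst]) hres
  rw [i0] at e1
  rw [iz 2 (by simp), add_zero] at e2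
  rw [iz 3 (by simp), add_zero] at e3
  rw [srcI, i1] at e4
  rw [iz 4 (by simp), add_zero] at e5
  refine ⟨_, _, _, _, fin_stJ hS f4, fin_stY hS hP f4, fin_stI hS hP f4, fin_stG hS hP f4,
    e1, e2, e3, e4, e5, ?_, ?_, ?_⟩
  · rw [stJ, ave_add, hS.ave_sol _ ((f4 0).shf Ω), i5, zero_add, ave_cst]
  · rw [stY, ave_add, hS.ave_sol _ (fin_srcY hS hP f4), i6, zero_add, ave_cst]
  · rw [stI, ave_add, hS.ave_sol _ (fin_srcI hS hP f4), i7, zero_add, ave_cst]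

/-- The base point of the triangular system. -/
def basePt (Ω : Vec n) (β : Vec (n + 1)) (η : ℝ) (U : Fn (n + 1))
    (v₀ φ : Fn n) : Pt n where
  φ := lift₁ φ
  q := lift₁ fun ψ => (φ ψ * φ (ψ + toC Ω))⁻¹
  ω := lift₁ fun ψ => dBeta β (dBeta β U) (hull β η ψ (v₀ ψ))

theorem Base.hol_q (hb : Base Ω β η U ρ v₀ σ₀ c₀ χ φ) (h0 : 0 < R) (hR : R < ρ) : HolA n R fun ψ =>
    (φ ψ * φ (ψ + toC Ω))⁻¹ :=
  ((hb.hol_φ R h0 hR).mul ((hb.hol_φ R h0 hR).shift Ω)).inv fun _ _ =>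
    mul_ne_zero (hb.φ_ne _) (hb.φ_ne _)

theorem Base.isUnit_det (hS : SmallDiv Ω C p) (hb : Base Ω β η U ρ v₀ σ₀ c₀ χ φ)
    (hT : Transversal Ω β η U ρ v₀ σ₀ c₀) : IsUnit (mat Ω χ (basePt Ω β η U v₀ φ) (lift₁ v₀)).det := by
  set P := basePt Ω β η U v₀ φ with hP
  set R := ρ / 2 with hRdef
  set R₁ := ρ / 4 with hR₁def
  have hρ := hb.pos
  have hR : 0 < R := by positivity
  have hR₁ : 0 < R₁ := by positivity
  have hRρ : R < ρ := by rw [hRdef]; linarith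
  have hRR : R₁ < R := by rw [hRdef, hR₁def]; linarith
  have aφ := hb.hol_φ R hR hRρ
  have aq := hb.hol_q hR hRρ
  have aω := hb.hol_w'.mono hRρ.le
  have av := hb.hol_v.mono hRρ.le
  have oφ : ord0 P.φ = P.φ := aφ.ord0_lift hR
  have oq : ord0 P.q = P.q := aq.ord0_lift hR
  have oω : ord0 P.ω = P.ω := aω.ord0_lift hR
  have ov : ord0 (lift₁ v₀) = lift₁ v₀ := av.ord0_lift hR
  have hPok : P.Ok := ⟨⟨R₁, hR₁, aφ.nrm_lift hR₁.le hRR⟩, ⟨R₁, hR₁, aq.nrm_lift hR₁.le hRR⟩,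
    ⟨R₁, hR₁, aω.nrm_lift hR₁.le hRR⟩⟩
  have hentry : ∀ b a, mat Ω χ P (lift₁ v₀) b a = cst (mat Ω χ P (lift₁ v₀) b a 0) := fun b a => by
    refine eq_cst ?_ (ave_mat b a)
    rw [mat, Matrix.of_apply]
    exact ord0_chain Ω χ oφ oq oω (ord0_unitInp oφ ov a) b
  set M₀ : Matrix (Fin 5) (Fin 5) ℂ := Matrix.of fun b a => mat Ω χ P (lift₁ v₀) b a 0 with hM₀
  have hM : mat Ω χ P (lift₁ v₀) = (algebraMap ℂ (Ser n)).mapMatrix M₀ := by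
    ext1 b a
    rw [hentry b a]
    rfl
  rw [hM, ← RingHom.map_det]
  refine IsUnit.map _ (isUnit_iff_ne_zero.2 fun hdet => ?_)
  obtain ⟨X, hX0, hX⟩ := Matrix.exists_mulVec_eq_zero_iff.2 hdet
  refine hX0 ?_
  obtain ⟨j, y, i, g, fj, fy, fi, fg, e1, e2, e3, e4, e5, a2, a3, a4⟩ :=
    exists_chain_of_null (χ := χ) hS hPok ⟨R₁, hR₁, av.nrm_lift hR₁.le hRR⟩ (X := X) fun b => by
      have h1 := congrFun hX b
      have h2 : ∑ a, cst (X a) * mat Ω χ P (lift₁ v₀) b a = (cst ((M₀.mulVec X) b) : Ser n) := by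
        rw [Matrix.mulVec, dotProduct, cst, map_sum]
        refine Finset.sum_congr rfl fun a _ => ?_
        rw [hentry b a, map_mul, mul_comm]
        rfl
      rw [h2, h1, Pi.zero_apply, cst, map_zero]
  obtain ⟨r1, hr1, n1⟩ := fj
  obtain ⟨r2, hr2, n2⟩ := fy
  obtain ⟨r3, hr3, n3⟩ := fi
  obtain ⟨r4, hr4, n4⟩ := fg
  obtain ⟨r, hr, l0, l1, l2, l3, l4⟩ : ∃ r > 0, r ≤ R₁ ∧ r ≤ r1 ∧ r ≤ r2 ∧ r ≤ r3 ∧ r ≤ r4 :=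
    ⟨min R₁ (min (min r1 r2) (min r3 r4)), by positivity, by simp, by simp, by simp, by simp, by simp⟩
  have low : ∀ {r' : ℝ} {f : Ser n}, r ≤ r' → nrm r' f ≠ ∞ → nrm r f ≠ ∞ := fun h hf =>
    ne_top_of_le_ne_top hf (nrm_mono h _)
  have z1 : ‖(0 : ℂ)‖ ≤ 1 := by simp
  have hx : ∀ x, toC x ∈ closedStrip n r := toC_mem hr.le
  have lift : ∀ {F : Fn n}, HolA n R F → ∀ x, HasEv r 0 (toC x) (lift₁ F) (F (toC x)) := fun h x =>
    ⟨low l0 (h.nrm_lift hR₁.le hRR), h.ev_lift hR₁ hRR z1 (toC_mem hR₁.le x)⟩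
  have own : ∀ {f : Ser n}, nrm r f ≠ ∞ → ∀ x, HasEv r 0 (toC x) f (ev 0 (toC x) f) := fun h _ => ⟨h, rfl⟩
  have mul : ∀ {f g : Ser n} {y z : ℂ} {x}, HasEv r 0 (toC x) f y → HasEv r 0 (toC x) g z →
      HasEv r 0 (toC x) (f * g) (y * z) := fun h h' => h.mul hr.le z1 (hx _) h'
  have sub : ∀ {f g : Ser n} {y z : ℂ} {x}, HasEv r 0 (toC x) f y → HasEv r 0 (toC x) g z →
      HasEv r 0 (toC x) (f - g) (y - z) := fun h h' => h.sub z1 (hx _) h'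
  have sh : ∀ {f : Ser n} {F : Fn n} (_ : ∀ x, HasEv r 0 (toC x) f (F (toC x))) (x : Vec n),
      HasEv r 0 (toC x) (shf Ω f) (F (toC (x + Ω))) := fun h x => .shf (by rw [← toC_add]; exact h _)
  have own' : ∀ {f : Ser n}, nrm r f ≠ ∞ → ∀ x, HasEv r 0 (toC x) (shf Ω f) (ev 0 (toC (x + Ω)) f) := fun h =>
    sh (F := fun ψ => ev 0 ψ _) (own h)
  have hφ : ∀ x, HasEv r 0 (toC x) P.φ _ := lift aφ
  have hq : ∀ x, HasEv r 0 (toC x) P.q _ := lift aq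
  have hω : ∀ x, HasEv r 0 (toC x) P.ω _ := lift aω
  have hj := own (low l1 n1)
  have hy := own (low l2 n2)
  have hi := own (low l3 n3)
  have hg := own (low l4 n4)
  have hc : ∀ (c : ℂ) (x : Vec n), HasEv r 0 (toC x) (cst c) c := fun c _ => hasEv_cst c
  have hQ : ∀ {a b : ℂ} (x : Vec n), a = (φ (toC x) * φ (toC x + toC Ω))⁻¹ * b →
      φ (toC x) * φ (toC (x + Ω)) * a = b := fun x h => by
    rw [h, toC_add, mul_inv_cancel_left₀ (mul_ne_zero (hb.φ_ne _) (hb.φ_ne _))]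
  obtain ⟨hs, hD, hJ, hY, hI⟩ := hb.chain_unique hS hT hr (l0.trans_lt (hRR.trans hRρ))
    (J := fun ψ => ev 0 ψ j) (Y := fun ψ => ev 0 ψ y) (I := fun ψ => ev 0 ψ i)
    (G := fun ψ => ev 0 ψ g) (s := X 0) (D := X 1) (holA_ev hr z1 (hy 0).1) (holA_ev hr z1 (hg 0).1)
    (fun x => (e1 ▸ sub (own' (hj x).1 x) (mul (hc _ x) (hj x))).2.symm.trans
      (sh (F := fun ψ => -(φ ψ * (X 0 * v₀ ψ + X 1))) (fun x => (mul (hφ x) ((mul (hc _ x) (lift av x)).add z1 (hx x) (hc _ x))).neg z1 (hx x)) x).2)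
    (fun x => hQ x ((e2 ▸ sub (own' (hy x).1 x) (mul (hc _ x) (hy x))).2.symm.trans (mul (hq x) (hj x)).2))
    (by
      have h1 := ravg_ev z1 (P.φ * y)
      rw [e3, ev_zero] at h1
      exact (congrArg ravg (funext fun x => (mul (hφ x) (hy x)).2.symm)).trans h1)
    (fun x => by
      refine (e4 ▸ sub (own' (hi x).1 x) (mul (hc _ x) (hi x))).2.symm.trans ((mul (hc _ x) (sh (F := fun ψ =>
        -(φ ψ * (X 0 * φ ψ)) - φ ψ ^ 3 * dBeta β (dBeta β U) (hull β η ψ (v₀ ψ)) * ev 0 ψ y) (fun x => sub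
        ((mul (hφ x) (mul (hc _ x) (hφ x))).neg z1 (hx x))
        (mul (mul ((hφ x).pow hr.le z1 (hx x) 3) (hω x)) (hy x))) x)).2.trans ?_)
      ring)
    (fun x => hQ x ((e5 ▸ sub (own' (hg x).1 x) (hg x)).2.symm.trans (mul (hq x) (hi x)).2))
  have hav : ∀ {f : Ser n} {c : ℂ}, ave f = cst c → (∀ x, ev 0 (toC x) f = 0) →
      c = 0 := fun {f c} hf h => by
    have h1 := ravg_ev z1 f
    rw [hf, ev_cst] at h1
    simp only [h] at h1
    rw [← h1]; simp [ravg]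
  have x2 := hav a2 hJ
  have x3 := hav a3 hY
  have x4 := hav a4 hI
  funext k
  fin_cases k
  · exact hs
  · exact hD
  · exact x2
  · exact x3
  · exact x4

end determinant

section taylor

/-- Uniform neighborhoods of the hull in the domain of a family. -/
theorem AnalyticFamily.exists_uniform (hW : AnalyticFamily 𝒟 W) (hv : HolA n ρ v₀) (hD : ∀ ψ ∈ closedStrip n
    ρ, (μ₀, hull β η ψ (v₀ ψ)) ∈ 𝒟) : ∃ δ M : ℝ, 0 < δ ∧ 0 < M ∧ ∀ ψ ∈ closedStrip n ρ, ∀ s t : ℂ, ‖s‖ ≤ δ →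
    ‖t‖ ≤ δ → (μ₀ + s, hull β η ψ (v₀ ψ + t)) ∈ 𝒟 ∧ ‖W (μ₀ + s) (hull β η ψ (v₀ ψ + t))‖ ≤ M := by
  set F : CVec n → ℂ × CVec (n + 1) := fun ψ => (μ₀, hull β η ψ (v₀ ψ)) with hF
  have hFc : ContinuousOn F (stripCell n ρ) :=
    continuousOn_const.prodMk ((continuous_hull β η).comp_continuousOn
      (continuousOn_id.prodMk (hv.continuousOn.mono (stripCell_subset n ρ))))
  have hK : IsCompact (F '' stripCell n ρ) := (isCompact_stripCell n ρ).image_of_continuousOn hFc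
  have hKD : F '' stripCell n ρ ⊆ 𝒟 := by
    rintro _ ⟨ψ, hψ, rfl⟩; exact hD ψ (stripCell_subset n ρ hψ)
  obtain ⟨δ₁, hδ₁, hsub⟩ := hK.exists_cthickening_subset_open hW.isOpen hKD
  obtain ⟨M, hM⟩ := (hK.cthickening (r := δ₁)).exists_bound_of_continuousOn
    (hW.analytic.continuousOn.mono hsub)
  refine ⟨δ₁ / (1 + ‖(toC β : CVec (n + 1))‖), max M 1, by positivity, by positivity,
    fun ψ hψ s t hs ht => ?_⟩
  obtain ⟨m, hm⟩ := exists_translate_mem_stripCell hψ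
  have hpos : 0 < 1 + ‖(toC β : CVec (n + 1))‖ := by positivity
  have hmem : (μ₀ + s, hull β η (ψ + intPt m) (v₀ (ψ + intPt m) + t))
      ∈ Metric.cthickening δ₁ (F '' stripCell n ρ) := by
    refine Metric.mem_cthickening_of_dist_le _ (F (ψ + intPt m)) δ₁ _ ⟨_, hm, rfl⟩ ?_
    rw [hF, Prod.dist_eq, max_le_iff]
    rw [le_div_iff₀ hpos] at hs ht
    constructor
    · rw [dist_eq_norm, add_sub_cancel_left]
      nlinarith [norm_nonneg s, norm_nonneg (toC β : CVec (n + 1))]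
    · rw [hull_add, dist_eq_norm, add_sub_cancel_left, norm_smul]
      nlinarith [norm_nonneg t, norm_nonneg (toC β : CVec (n + 1))]
  have h1 := hsub hmem
  have h2 := hM _ hmem
  have hback : hull β η ψ (v₀ ψ + t) = hull β η (ψ + intPt m) (v₀ (ψ + intPt m) + t)
      + intPt (-(Fin.snoc m 0 : Fin (n + 1) → ℤ)) := by
    rw [hv.periodic ψ hψ, hull_add_intPt, add_assoc]
    ext i; simp [intPt]
  rw [hback]
  have h3 := hW.periodic _ _ h1 (-(Fin.snoc m 0 : Fin (n + 1) → ℤ))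
  exact ⟨h3.1, by rw [h3.2]; exact h2.trans (le_max_left _ _)⟩

/-- Iterated derivatives along a line of an analytic family. -/
theorem AnalyticFamily.iteratedDeriv_line {T : (ℂ → Fn (n + 1)) → (ℂ → Fn (n + 1))} {e : ℂ}
    {y : CVec (n + 1)} (hT : ∀ W, AnalyticFamily 𝒟 W → AnalyticFamily 𝒟 (T W)) (hTe : ∀ W, AnalyticFamily
    𝒟 W → ∀ μ x, (μ, x) ∈ 𝒟 → T W μ x = fderiv ℂ (fun p : ℂ × CVec (n + 1) => W p.1 p.2) (μ, x) (e, y))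
    (hW : AnalyticFamily 𝒟 W) {S : Set ℂ} (hS : IsOpen S) (h : ∀ t ∈ S, (μ + t * e, x + t • y) ∈ 𝒟) (l : ℕ)
    : AnalyticFamily 𝒟 (T^[l] W) ∧ ∀ t ∈ S, iteratedDeriv l (fun t : ℂ => W (μ + t * e) (x + t • y)) t =
    (T^[l] W) (μ + t * e) (x + t • y) := by
  induction l with
  | zero => exact ⟨hW, fun t _ => by simp⟩
  | succ l ih =>
    rw [Function.iterate_succ_apply']
    refine ⟨hT _ ih.1, fun t ht => ?_⟩
    rw [iteratedDeriv_succ, hTe _ ih.1 _ _ (h t ht), ← (ih.1.hasDerivAt_line (h t ht)).deriv]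
    refine Filter.EventuallyEq.deriv_eq ?_
    filter_upwards [hS.mem_nhds ht] with u hu using ih.2 u hu

theorem AnalyticFamily.line_taylor {T : (ℂ → Fn (n + 1)) → (ℂ → Fn (n + 1))} {e : ℂ} {y : CVec (n + 1)}
    (hT : ∀ W, AnalyticFamily 𝒟 W → AnalyticFamily 𝒟 (T W)) (hTe : ∀ W, AnalyticFamily 𝒟 W → ∀ μ x, (μ, x) ∈
    𝒟 → T W μ x = fderiv ℂ (fun p : ℂ × CVec (n + 1) => W p.1 p.2) (μ, x) (e, y))
    (hW : AnalyticFamily 𝒟 W) (hδ : 0 < δ) (h : ∀ t : ℂ, ‖t‖ ≤ δ → (μ + t * e, x + t • y) ∈ 𝒟) (hM : ∀ t :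
    ℂ, ‖t‖ ≤ δ → ‖W (μ + t * e) (x + t • y)‖ ≤ M) : (∀ l : ℕ, ‖((l.factorial : ℂ))⁻¹ * (T^[l] W) μ x‖ ≤ M *
    δ⁻¹ ^ l) ∧ ∀ t : ℂ, ‖t‖ < δ → HasSum (fun l : ℕ => ((l.factorial : ℂ))⁻¹ * (T^[l] W) μ x * t ^ l)
    (W (μ + t * e) (x + t • y)) := by
  have hd : ∀ t : ℂ, ‖t‖ ≤ δ → DifferentiableAt ℂ (fun t : ℂ => W (μ + t * e) (x + t • y)) t :=
    fun t ht => (hW.hasDerivAt_line (h t ht)).differentiableAt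
  have hit : ∀ l, iteratedDeriv l (fun t : ℂ => W (μ + t * e) (x + t • y)) 0 = (T^[l] W) μ x := by
    intro l
    have := (hW.iteratedDeriv_line hT hTe Metric.isOpen_ball
      (fun t ht => h t (mem_ball_zero_iff.1 ht).le) l).2 0 (Metric.mem_ball_self hδ)
    simpa using this
  constructor
  · intro l
    have h1 := Complex.norm_iteratedDeriv_le_of_forall_mem_sphere_norm_le (c := 0) (C := M) l hδ
      (f := fun t : ℂ => W (μ + t * e) (x + t • y)) (by
        refine DifferentiableOn.diffContOnCl ?_
        rw [closure_ball _ hδ.ne']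
        exact fun t ht => (hd t (mem_closedBall_zero_iff.1 ht)).differentiableWithinAt)
      fun t ht => hM t (mem_sphere_zero_iff_norm.1 ht).le
    rw [hit] at h1
    rw [norm_mul, norm_inv, Complex.norm_natCast]
    have hf : (0 : ℝ) < l.factorial := by positivity
    rw [inv_mul_le_iff₀ hf]
    refine h1.trans (le_of_eq ?_)
    rw [inv_pow]; field_simp
  · intro t ht
    have h1 := Complex.hasSum_taylorSeries_on_ball (c := 0) (r := δ)
      (f := fun t : ℂ => W (μ + t * e) (x + t • y)) (z := t)
      (fun t ht => (hd t (mem_ball_zero_iff.1 ht).le).differentiableWithinAt)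
      (mem_ball_zero_iff.2 ht)
    simp only [hit, sub_zero, smul_eq_mul] at h1
    refine h1.congr_fun fun l => ?_
    ring

/-- The derivative in the direction `β`, as an operator on families. -/
def dDir (β : Vec (n + 1)) (W : ℂ → Fn (n + 1)) : ℂ → Fn (n + 1) :=
  fun μ => dBeta β (W μ)

theorem AnalyticFamily.iterate_dDir (hW : AnalyticFamily 𝒟 W) (l : ℕ) : AnalyticFamily 𝒟
    ((dDir β)^[l] W) := by
  induction l with
  | zero => exact hW
  | succ l ih => rw [Function.iterate_succ_apply']; exact ih.dBeta β

theorem AnalyticFamily.iterate_dPar (hW : AnalyticFamily 𝒟 W) (j : ℕ) : AnalyticFamily 𝒟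
    (FKRes.dPar^[j] W) := by
  induction j with
  | zero => exact hW
  | succ l ih => rw [Function.iterate_succ_apply']; exact ih.dPar

/-- The Taylor coefficients of a family along a hull. -/
def tay (β : Vec (n + 1)) (η : ℝ) (W : ℂ → Fn (n + 1)) (μ₀ : ℂ)
    (v₀ : Fn n) (l j : ℕ) (ψ : CVec n) : ℂ :=
  ((j.factorial : ℂ))⁻¹ * (((l.factorial : ℂ))⁻¹ * (dPar^[j] ((dDir β)^[l] W)) μ₀ (hull β η ψ (v₀ ψ)))

/-- The Taylor expansion of a family along a hull is valid on a polydisc of radius `δ`. -/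
structure Taylor (𝒟 : Set (ℂ × CVec (n + 1))) (β : Vec (n + 1)) (η : ℝ)
    (W : ℂ → Fn (n + 1)) (μ₀ : ℂ) (v₀ : Fn n) (ρ δ M : ℝ) : Prop where
  δ_pos : 0 < δ
  M_pos : 0 < M
  mem : ∀ ψ ∈ closedStrip n ρ, ∀ s t : ℂ, ‖s‖ ≤ δ → ‖t‖ ≤ δ → (μ₀ + s, hull β η ψ (v₀ ψ + t)) ∈ 𝒟
  hol : ∀ l j, HolA n ρ (tay β η W μ₀ v₀ l j)
  bound : ∀ l j, ∀ ψ ∈ closedStrip n ρ, ‖tay β η W μ₀ v₀ l j ψ‖ ≤ M * δ⁻¹ ^ l * δ⁻¹ ^ j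
  par : ∀ l, ∀ ψ ∈ closedStrip n ρ, ∀ s : ℂ, ‖s‖ < δ → HasSum (fun j => tay β η W μ₀ v₀ l j ψ * s ^ j)
      (((l.factorial : ℂ))⁻¹ * ((dDir β)^[l] W) (μ₀ + s) (hull β η ψ (v₀ ψ)))
  dir : ∀ ψ ∈ closedStrip n ρ, ∀ s t : ℂ, ‖s‖ ≤ δ → ‖t‖ < δ → HasSum (fun l : ℕ => ((l.factorial : ℂ))⁻¹ *
      ((dDir β)^[l] W) (μ₀ + s) (hull β η ψ (v₀ ψ)) * t ^ l) (W (μ₀ + s) (hull β η ψ (v₀ ψ + t)))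

theorem AnalyticFamily.taylor (hW : AnalyticFamily 𝒟 W) (hv : HolA n ρ v₀) (hD : ∀ ψ ∈ closedStrip n ρ,
    (μ₀, hull β η ψ (v₀ ψ)) ∈ 𝒟) (hδ : 0 < δ) (hM : 0 < M) (hU : ∀ ψ ∈ closedStrip n ρ, ∀ s t : ℂ, ‖s‖ ≤ δ →
    ‖t‖ ≤ δ → (μ₀ + s, hull β η ψ (v₀ ψ + t)) ∈ 𝒟 ∧ ‖W (μ₀ + s) (hull β η ψ (v₀ ψ + t))‖ ≤ M) : Taylor 𝒟 β η
    W μ₀ v₀ ρ δ M := by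
  have hdir : ∀ ψ ∈ closedStrip n ρ, ∀ s : ℂ, ‖s‖ ≤ δ → _ := fun ψ hψ s hs =>
    hW.line_taylor (T := dDir β) (e := 0) (y := toC β) (fun W h => h.dBeta β)
      (fun W h μ x hp => h.dBeta_eq β hp) (μ := μ₀ + s) (x := hull β η ψ (v₀ ψ)) (M := M) hδ
      (fun t ht => by rw [mul_zero, add_zero, ← hull_add]; exact (hU ψ hψ s t hs ht).1)
      (fun t ht => by rw [mul_zero, add_zero, ← hull_add]; exact (hU ψ hψ s t hs ht).2)
  have hpar := fun (l : ℕ) (ψ : CVec n) (hψ : ψ ∈ closedStrip n ρ) =>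
    (hW.iterate_dDir (β := β) l).line_taylor (T := FKRes.dPar) (e := 1) (y := 0) (fun W h => h.dPar)
      (fun W h μ x hp => h.dPar_eq hp) (μ := μ₀) (x := hull β η ψ (v₀ ψ))
      (M := l.factorial * (M * δ⁻¹ ^ l)) hδ
      (fun t ht => by
        have := (hU ψ hψ t 0 ht (by simpa using hδ.le)).1
        simpa using this)
      (fun t ht => by
        have := (hdir ψ hψ t ht).1 l
        rw [norm_mul, norm_inv, Complex.norm_natCast, inv_mul_le_iff₀ (by positivity)] at this
        simpa using this)
  refine ⟨hδ, hM, fun ψ hψ s t hs ht => (hU ψ hψ s t hs ht).1, fun l j => ?_, fun l j ψ hψ => ?_,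
    fun l ψ hψ s hs => ?_, fun ψ hψ s t hs ht => ?_⟩
  · exact ((((hW.iterate_dDir l).iterate_dPar j).holA hv hD).const_mul _).const_mul _
  · have h1 := (hpar l ψ hψ).1 j
    rw [tay, mul_left_comm, norm_mul, norm_inv, Complex.norm_natCast]
    rw [inv_mul_le_iff₀ (by positivity)]
    refine h1.trans (le_of_eq (by ring))
  · have h1 := ((hpar l ψ hψ).2 s hs).mul_left (((l.factorial : ℂ))⁻¹)
    rw [mul_one, smul_zero, add_zero] at h1
    refine h1.congr_fun fun j => ?_
    rw [tay]; ring
  · have h1 := (hdir ψ hψ s hs).2 t ht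
    rw [mul_zero, add_zero, ← hull_add] at h1
    exact h1

/-- Taylor expansions of a family and of its derivative. -/
theorem AnalyticFamily.exists_taylor (hW : AnalyticFamily 𝒟 W) (hv : HolA n ρ v₀) (hD : ∀ ψ ∈ closedStrip n
    ρ, (μ₀, hull β η ψ (v₀ ψ)) ∈ 𝒟) : ∃ δ M, Taylor 𝒟 β η W μ₀ v₀ ρ δ M ∧ Taylor 𝒟 β η (dDir β W) μ₀ v₀ ρ δ
    M ∧ ∀ ψ ∈ closedStrip n ρ, ∀ s t : ℂ, ‖s‖ ≤ δ → ‖t‖ ≤ δ → ‖dDir β W (μ₀ + s) (hull β η ψ (v₀ ψ + t))‖ ≤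
    M ∧ ‖dDir β (dDir β W) (μ₀ + s) (hull β η ψ (v₀ ψ + t))‖ ≤ M := by
  have hW1 : AnalyticFamily 𝒟 (dDir β W) := hW.dBeta β
  have hW2 : AnalyticFamily 𝒟 (dDir β (dDir β W)) := hW1.dBeta β
  obtain ⟨δ₁, M₁, h1, h2, h3⟩ := hW.exists_uniform hv hD
  obtain ⟨δ₂, M₂, k1, k2, k3⟩ := hW1.exists_uniform hv hD
  obtain ⟨δ₃, M₃, l1, l2, l3⟩ := hW2.exists_uniform hv hD
  set δ := min δ₁ (min δ₂ δ₃) with hδ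
  set M := max M₁ (max M₂ M₃) with hM
  have d1 : δ ≤ δ₁ := min_le_left _ _
  have d2 : δ ≤ δ₂ := (min_le_right _ _).trans (min_le_left _ _)
  have d3 : δ ≤ δ₃ := (min_le_right _ _).trans (min_le_right _ _)
  have m1 : M₁ ≤ M := le_max_left _ _
  have m2 : M₂ ≤ M := (le_max_left _ _).trans (le_max_right _ _)
  have m3 : M₃ ≤ M := (le_max_right _ _).trans (le_max_right _ _)
  have hδ0 : 0 < δ := lt_min h1 (lt_min k1 l1)
  have hM0 : 0 < M := h2.trans_le m1
  refine ⟨δ, M, hW.taylor hv hD hδ0 hM0 fun ψ hψ s t hs ht => ?_,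
    hW1.taylor hv hD hδ0 hM0 fun ψ hψ s t hs ht => ?_, fun ψ hψ s t hs ht => ⟨?_, ?_⟩⟩
  · have := h3 ψ hψ s t (hs.trans d1) (ht.trans d1)
    exact ⟨this.1, this.2.trans m1⟩
  · have := k3 ψ hψ s t (hs.trans d2) (ht.trans d2)
    exact ⟨this.1, this.2.trans m2⟩
  · exact (k3 ψ hψ s t (hs.trans d2) (ht.trans d2)).2.trans m2
  · exact (l3 ψ hψ s t (hs.trans d3) (ht.trans d3)).2.trans m3

end taylor

section values

theorem comp_zero (a : ℕ → Ser n) : comp a 0 = a 0 := by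
  rw [comp, tsum_eq_single 0 fun l hl => by rw [zero_pow hl, mul_zero], pow_zero, mul_one]

/-- A series which vanishes at order zero is small if it has a small perturbation. -/
theorem eq_sub_ord0 {A b : Ser n} (hf : Van f) (h : f = A + b) (hb : ord0 b = b) : f = A - ord0 A := by
  have h1 := ord0_eq_zero_iff.2 hf
  rw [h, ord0_add, hb] at h1
  rw [h, ← sub_eq_zero]
  linear_combination h1

end values

section series

/-- The Taylor coefficients in the direction `β` as series in the rescaled parameter. -/
def ser (β : Vec (n + 1)) (η : ℝ) (W : ℂ → Fn (n + 1)) (μ₀ : ℂ)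
    (v₀ : Fn n) (r : ℝ) (l : ℕ) : Ser n :=
  lift fun j ψ => (r : ℂ) ^ j * tay β η W μ₀ v₀ l j ψ

theorem Taylor.geo (hT : Taylor 𝒟 β η W μ₀ v₀ ρ δ M) (hr : 0 < r) (hrδ : 2 * r ≤ δ) (l : ℕ) : Geo ρ
    (M * δ⁻¹ ^ l) fun j ψ => (r : ℂ) ^ j * tay β η W μ₀ v₀ l j ψ := fun j => by
  have hδ := hT.δ_pos
  have hM := hT.M_pos
  refine ⟨(hT.hol l j).const_mul _, fun ψ hψ => ?_⟩
  rw [norm_mul, norm_pow, Complex.norm_real, Real.norm_of_nonneg hr.le]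
  have h1 : r * δ⁻¹ ≤ 2⁻¹ := by rw [← div_eq_mul_inv, div_le_iff₀ hδ]; linarith
  calc r ^ j * ‖tay β η W μ₀ v₀ l j ψ‖ ≤ r ^ j * (M * δ⁻¹ ^ l * δ⁻¹ ^ j) := by
        gcongr; exact hT.bound l j ψ hψ
    _ = M * δ⁻¹ ^ l * (r * δ⁻¹) ^ j := by ring
    _ ≤ _ := by gcongr

theorem Taylor.nrm_ser (hT : Taylor 𝒟 β η W μ₀ v₀ ρ δ M) (hr : 0 < r) (hrδ : 2 * r ≤ δ) (hR : 0 < R)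
    (hRρ : R < ρ) (l : ℕ) : nrm R (ser β η W μ₀ v₀ r l) ≤ ofReal M * liftK n ρ R * ofReal δ⁻¹ ^ l := by
  have hδ := hT.δ_pos
  refine ((hT.geo hr hrδ l).nrm_lift_le hR.le hRρ).trans (le_of_eq ?_)
  rw [ofReal_mul hT.M_pos.le, ENNReal.ofReal_pow (by positivity)]
  ring

theorem Taylor.nrm_ser_sub (hT : Taylor 𝒟 β η W μ₀ v₀ ρ δ M) (hr : 0 < r) (hrδ : 2 * r ≤ δ) (hR : 0 < R)
    (hRρ : R < ρ) (l : ℕ) : nrm R (ser β η W μ₀ v₀ r l - ord0 (ser β η W μ₀ v₀ r l)) ≤ ofReal r *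
    (ofReal (M * δ⁻¹ ^ l * (2 * δ⁻¹)) * liftK n ρ R) := by
  have hδ := hT.δ_pos
  have hM := hT.M_pos
  have hρ := hR.trans hRρ
  have h1 : 2 * r * δ⁻¹ ≤ 1 := by rw [← div_eq_mul_inv, div_le_iff₀ hδ]; linarith
  have hg : Geo ρ (r * (M * δ⁻¹ ^ l * (2 * δ⁻¹)))
      fun j ψ => if j = 0 then 0 else (r : ℂ) ^ j * tay β η W μ₀ v₀ l j ψ := fun j => by
    rcases Nat.eq_zero_or_pos j with rfl | hj
    · simp only [if_true, norm_zero]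
      exact ⟨HolA.const 0, fun _ _ => by positivity⟩
    · simp only [if_neg hj.ne']
      refine ⟨(hT.hol l j).const_mul _, fun ψ hψ => ?_⟩
      rw [norm_mul, norm_pow, Complex.norm_real, Real.norm_of_nonneg hr.le]
      calc r ^ j * ‖tay β η W μ₀ v₀ l j ψ‖ ≤ r ^ j * (M * δ⁻¹ ^ l * δ⁻¹ ^ j) := by
            gcongr; exact hT.bound l j ψ hψ
        _ = M * δ⁻¹ ^ l * (2 * r * δ⁻¹) ^ j * 2⁻¹ ^ j := by
            rw [mul_pow, mul_pow]
            have : (2 : ℝ) ^ j * 2⁻¹ ^ j = 1 := by rw [← mul_pow]; norm_num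
            linear_combination -(M * δ⁻¹ ^ l * r ^ j * δ⁻¹ ^ j) * this
        _ ≤ M * δ⁻¹ ^ l * (2 * r * δ⁻¹) * 2⁻¹ ^ j := by
            gcongr
            exact pow_le_of_le_one (by positivity) h1 hj.ne'
        _ = _ := by ring
  have he : ser β η W μ₀ v₀ r l - ord0 (ser β η W μ₀ v₀ r l)
      = lift fun j ψ => if j = 0 then 0 else (r : ℂ) ^ j * tay β η W μ₀ v₀ l j ψ := by
    ext i
    rw [sub_apply, ord0_apply, hg.lift_apply hρ, ser, (hT.geo hr hrδ l).lift_apply hρ]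
    by_cases h0 : i.2 = 0
    · simp [h0, fc, ravg]
    · simp [h0]
  rw [he, ← mul_assoc, ← ofReal_mul hr.le]
  exact hg.nrm_lift_le hR.le hRρ

theorem Taylor.norm_par_lt (hT : Taylor 𝒟 β η W μ₀ v₀ ρ δ M) (hr : 0 < r) (hrδ : 2 * r ≤ δ) (hζ : ‖ζ‖ ≤ 1) :
    ‖(r : ℂ) * ζ‖ < δ := by
  rw [norm_mul, Complex.norm_real, Real.norm_of_nonneg hr.le]
  have hδ := hT.δ_pos
  nlinarith

theorem Taylor.hasEv_ser (hT : Taylor 𝒟 β η W μ₀ v₀ ρ δ M) (hr : 0 < r) (hrδ : 2 * r ≤ δ) (hR : 0 < R)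
    (hRρ : R < ρ) (hζ : ‖ζ‖ ≤ 1) (hψ : ψ ∈ closedStrip n R) (l : ℕ) : HasEv R ζ ψ (ser β η W μ₀ v₀ r l)
    (((l.factorial : ℂ))⁻¹ * ((dDir β)^[l] W) (μ₀ + r * ζ) (hull β η ψ (v₀ ψ))) := by
  refine ⟨(hT.geo hr hrδ l).nrm_lift_ne_top hR.le hRρ, ?_⟩
  refine ((hT.geo hr hrδ l).ev_lift hR hRρ hζ hψ).unique ?_
  refine (hT.par l ψ (closedStrip_mono hRρ.le hψ) _ (hT.norm_par_lt hr hrδ hζ)).congr_fun fun j => ?_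
  ring

theorem norm_ev_le_of_small (hδ : 0 < δ) (hζ : ‖ζ‖ ≤ 1) (hψ : ψ ∈ closedStrip n R) (hu : nrm R u ≠ ∞)
    (hs : ofReal δ⁻¹ * nrm R u ≤ 8⁻¹) : ‖ev ζ ψ u‖ < δ / 2 := by
  have h1 := (mul_le_mul_right (enorm_ev_le hζ hψ hu) (ofReal δ⁻¹)).trans hs
  rw [← ofReal_norm, ← ofReal_mul (by positivity)] at h1
  have h2 := (ENNReal.ofReal_le_iff_le_toReal (by simp)).1 h1
  rw [inv_mul_le_iff₀ hδ] at h2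
  norm_num at h2
  linarith

theorem Taylor.hasEv_comp (hT : Taylor 𝒟 β η W μ₀ v₀ ρ δ M) (hr : 0 < r) (hrδ : 2 * r ≤ δ) (hR : 0 < R)
    (hRρ : R < ρ) (hζ : ‖ζ‖ ≤ 1) (hψ : ψ ∈ closedStrip n R) {M' B' : ℝ≥0∞} (hM' : M' ≠ ∞) (hB' : B' ≠ ∞)
    (hδB : ofReal δ⁻¹ ≤ B') (ha : ∀ l, nrm R (a l) ≤ M' * B' ^ l) (hev : ∀ l, ev ζ ψ (a l) =
    ((l.factorial : ℂ))⁻¹ * ((dDir β)^[l] W) (μ₀ + r * ζ) (hull β η ψ (v₀ ψ))) (hu : nrm R u ≠ ∞)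
    (hs : B' * nrm R u ≤ 8⁻¹) : HasEv R ζ ψ (comp a u) (W (μ₀ + r * ζ) (hull β η ψ (v₀ ψ + ev ζ ψ u))) := by
  refine ⟨ne_top_of_le_ne_top (by finiteness) (nrm_comp_le hR.le hM' ha hs), ?_⟩
  refine (ev_comp hR.le hM' ha hs hu hB' hζ hψ).unique ?_
  have h2 := norm_ev_le_of_small hT.δ_pos hζ hψ hu ((mul_le_mul_left hδB _).trans hs)
  refine (hT.dir ψ (closedStrip_mono hRρ.le hψ) _ _ (hT.norm_par_lt hr hrδ hζ).le
    (h2.trans (half_lt_self hT.δ_pos))).congr_fun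
    fun l => ?_
  rw [hev]

theorem Taylor.hasEv_der (hT : Taylor 𝒟 β η W μ₀ v₀ ρ δ M) (hr : 0 < r) (hrδ : 2 * r ≤ δ) (hR : 0 < R)
    (hRρ : R < ρ) (hζ : ‖ζ‖ ≤ 1) (hψ : ψ ∈ closedStrip n R) (l : ℕ) : HasEv R ζ ψ
    (der (ser β η W μ₀ v₀ r) l) (((l.factorial : ℂ))⁻¹ * ((dDir β)^[l] (dDir β
    W)) (μ₀ + r * ζ) (hull β η ψ (v₀ ψ))) := by
  have h := (hasEv_natCast (l + 1)).mul hR.le hζ hψ (hT.hasEv_ser hr hrδ hR hRρ hζ hψ (l + 1))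
  refine ⟨h.1, h.2.trans ?_⟩
  rw [Function.iterate_succ_apply, Nat.factorial_succ, ← mul_assoc]
  congr 1
  have h1 : ((l + 1 : ℕ) : ℂ) ≠ 0 := by exact_mod_cast l.succ_ne_zero
  push_cast at h1 ⊢
  rw [mul_inv, mul_inv_cancel_left₀ h1]

end series

theorem HolA.hasEv_lift {f : Fn n} (hf : HolA n ρ f) (h0 : 0 < R) (h1 : R < ρ) (hζ : ‖ζ‖ ≤ 1)
    (hψ : ψ ∈ closedStrip n R) : HasEv R ζ ψ (lift₁ f) (f ψ) := ⟨hf.nrm_lift h0.le h1, hf.ev_lift h0 h1 hζ hψ⟩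

theorem exists_small {K : ℝ≥0∞} (hK : K ≠ ∞) (hε : 0 < ε) (hδ : 0 < δ) : ∃ r : ℝ, 0 < r ∧ 2 * r ≤ δ ∧ ofReal
    r * K ≤ ε := by
  have h1 : K + 1 ≠ ∞ := by finiteness
  have h2 : min ε 1 / (K + 1) ≠ ∞ := (ENNReal.div_lt_top
    (ne_top_of_le_ne_top one_ne_top (min_le_right _ _)) (by simp)).ne
  have h3 : min ε 1 / (K + 1) ≠ 0 := (ENNReal.div_pos (lt_min hε one_pos).ne' h1).ne'
  refine ⟨min (δ / 2) (min ε 1 / (K + 1)).toReal, lt_min (by positivity) (ENNReal.toReal_pos h3 h2),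
    by linarith [min_le_left (δ / 2) (min ε 1 / (K + 1)).toReal], ?_⟩
  calc ofReal (min (δ / 2) (min ε 1 / (K + 1)).toReal) * K ≤ min ε 1 / (K + 1) * (K + 1) := mul_le_mul'
        ((ofReal_le_ofReal (min_le_right _ _)).trans ENNReal.ofReal_toReal_le) le_self_add
    _ = min ε 1 := ENNReal.div_mul_cancel (by simp) h1
    _ ≤ ε := min_le_left _ _

/-- A convergent solution of both equations, as series in the rescaled parameter. -/
structure Sol (Ω : Vec n) (β : Vec (n + 1)) (η : ℝ) (W : ℂ → Fn (n + 1)) (μ₀ : ℂ)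
    (v₀ : Fn n) (σ₀ lam₀ : ℂ) (c₀ : Fn n) (χ : ℝ) (φ : Fn n)
    (R r δ : ℝ) (u σ lam f c : Ser n) : Prop where
  r_pos : 0 < r
  r_le : 2 * r ≤ δ
  fin_u : nrm R u ≠ ∞
  small : ofReal δ⁻¹ * nrm R u ≤ 8⁻¹
  fin_f : nrm R f ≠ ∞
  fin_c : nrm R c ≠ ∞
  ave_u : ave u = 0
  ave_σ : ave σ = σ
  ave_lam : ave lam = lam
  van_u : Van u
  val_σ : ev 0 (0 : CVec n) σ = σ₀
  val_lam : ev 0 (0 : CVec n) lam = lam₀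
  val_f : ∀ x, ev 0 (toC x) f = φ (toC x)
  val_c : ∀ x, ev 0 (toC x) c = c₀ (toC x)
  mul_c : c * f = cst χ * shf (-Ω) f
  equil : ∀ ζ : ℂ, ‖ζ‖ ≤ 1 → ∀ ψ ∈ closedStrip n R,
    equil Ω β η (W (μ₀ + r * ζ)) (fun ψ => v₀ ψ + ev ζ ψ u) (ev ζ 0 σ) (ev ζ 0 lam) ψ = 0
  factor : ∀ ζ : ℂ, ‖ζ‖ ≤ 1 → ∀ ψ ∈ closedStrip n R,
    factorEq Ω β η (W (μ₀ + r * ζ)) (fun ψ => v₀ ψ + ev ζ ψ u) (ev ζ 0 σ) (fun ψ => ev ζ ψ c) ψ = 0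

section existence

variable {φ : Fn n}

theorem hasEv_ave (hX : ave X = X) (R : ℝ) (hζ : ‖ζ‖ ≤ 1) (ψ : CVec n) : HasEv R ζ ψ X (ev ζ 0 X) :=
  ⟨by rw [nrm_of_ave hX]; exact enorm_ne_top, ev_ave hζ hX⟩

theorem ord0_shf (hf : ord0 f = f) (Ω : Vec n) : ord0 (shf Ω f) = shf Ω f := ord0_diag hf _

theorem ord0_two : ord0 (2 : Ser n) = 2 := by
  have := ord0_cst (n := n) 2
  rwa [cst, map_ofNat] at this

theorem der_zero (a : ℕ → Ser n) : der a 0 = a 1 := by rw [der]; simp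

/-- The initial errors are small for a small range of the parameter. -/
theorem Base.initial (hb : Base Ω β η (W μ₀) ρ v₀ σ₀ c₀ χ φ) (hT : Taylor 𝒟 β η W μ₀ v₀ ρ δ M) (hE : ∀ x,
    FKRes.equil Ω β η (W μ₀) v₀ σ₀ lam₀ (toC x) = 0) (hR : 0 < R) (hRρ : R < ρ) (hε : 0 < ε) : ∃ r, 0 < r ∧
    2 * r ≤ δ ∧ ∃ a, a = ser β η W μ₀ v₀ r ∧ nrm R (comp (der (der a)) 0 - (basePt Ω β η (W μ₀) v₀ φ).ω) ≤ ε
    ∧ nrm R (errE Ω a (lift₁ v₀) 0 (cst σ₀) (cst lam₀)) ≤ ε ∧ nrm R (errG Ω χ a 0 (cst σ₀) (lift₁ φ)) ≤ ε ∧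
    Van (errE Ω a (lift₁ v₀) 0 (cst σ₀) (cst lam₀)) ∧ Van (errG Ω χ a 0 (cst σ₀) (lift₁ φ)) := by
  obtain ⟨R₁, hRR, hR₁ρ⟩ := exists_between hRρ
  have hR₁ := hR.trans hRR
  have hρ := hb.pos
  have aφ := hb.hol_φ R₁ hR₁ hR₁ρ
  obtain ⟨Λ, hΛ⟩ : ∃ Λ : ℕ → ℝ≥0∞, ∀ l, Λ l = ofReal (M * δ⁻¹ ^ l * (2 * δ⁻¹)) * liftK n ρ R :=
    ⟨_, fun _ => rfl⟩
  have hΛt : ∀ l, Λ l ≠ ∞ := fun l => by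
    rw [hΛ]; exact mul_ne_top ofReal_ne_top (liftK_ne_top hRρ)
  have nφ : nrm R (lift₁ φ) ≠ ∞ := aφ.nrm_lift hR.le hRR
  obtain ⟨r, hr, hrδ, hrK⟩ := exists_small (K := Λ 0 + Λ 1 * nrm R (lift₁ φ) + 2 * Λ 2) (ε := ε)
    (add_ne_top.2 ⟨add_ne_top.2 ⟨hΛt 0, mul_ne_top (hΛt 1) nφ⟩,
      mul_ne_top (by simp) (hΛt 2)⟩) hε hT.δ_pos
  refine ⟨r, hr, hrδ, ser β η W μ₀ v₀ r, rfl, ?_⟩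
  set a := ser β η W μ₀ v₀ r with ha
  have hsub : ∀ l, nrm R (a l - ord0 (a l)) ≤ ofReal r * Λ l := fun l => by
    rw [hΛ]; exact hT.nrm_ser_sub hr hrδ hR hRρ l
  have z1 : ‖(0 : ℂ)‖ ≤ 1 := by simp
  have hx : ∀ x, toC x ∈ closedStrip n R := toC_mem hR.le
  have hv : ∀ x, HasEv R 0 (toC x) (lift₁ v₀) (v₀ (toC x)) := fun x =>
    hb.hol_v.hasEv_lift hR hRρ z1 (hx x)
  have hφ : ∀ x, HasEv R 0 (toC x) (lift₁ φ) (φ (toC x)) := fun x =>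
    aφ.hasEv_lift hR hRR z1 (hx x)
  have sp : ∀ {f : Ser n} {g : Fn n} (_ : ∀ x,
      HasEv R 0 (toC x) f (g (toC x))) (x : Vec n), HasEv R 0 (toC x) (shf Ω f) (g (toC x + toC Ω)) :=
    fun h x => HasEv.shf (by rw [← toC_add]; exact h _)
  have sm : ∀ {f : Ser n} {g : Fn n} (_ : ∀ x,
      HasEv R 0 (toC x) f (g (toC x))) (x : Vec n),
      HasEv R 0 (toC x) (shf (-Ω) f) (g (toC x - toC Ω)) :=
    fun h x => HasEv.shf_neg (by rw [← toC_sub]; exact h _)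
  have hser : ∀ (l : ℕ) (x : Vec n), HasEv R 0 (toC x) (a l)
      (((l.factorial : ℂ))⁻¹ * ((dDir β)^[l] W) μ₀ (hull β η (toC x) (v₀ (toC x)))) := fun l x => by
    simpa using hT.hasEv_ser hr hrδ hR hRρ z1 (hx x) l
  have ov : ord0 (lift₁ v₀) = lift₁ v₀ := hb.hol_v.ord0_lift hρ
  have oφ : ord0 (lift₁ φ) = lift₁ φ := aφ.ord0_lift hR₁
  have vE : Van (errE Ω a (lift₁ v₀) 0 (cst σ₀) (cst lam₀)) := van_of_ev fun x => by
    rw [errE, add_zero, comp_zero]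
    have := ((((((sp hv x).add z1 (hx x) (sm hv x)).sub z1 (hx x) (hasEv_two.mul hR.le z1 (hx x)
      (hv x))).add z1 (hx x) (hser 0 x)).add z1 (hx x) ((hasEv_cst σ₀).mul hR.le z1 (hx x) (hv x))).add
      z1 (hx x) (hasEv_cst lam₀)).2
    rw [this, ← hE x, FKRes.equil]
    simp [mul_comm]
  have vG : Van (errG Ω χ a 0 (cst σ₀) (lift₁ φ)) := van_of_ev fun x => by
    rw [errG, comp_zero, der_zero]
    have := (((((((hasEv_cst ((χ : ℂ)⁻¹)).mul hR.le z1 (hx x) (sp hφ x)).add z1 (hx x)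
      ((hasEv_cst (χ : ℂ)).mul hR.le z1 (hx x) (sm hφ x))).sub z1 (hx x) (hasEv_two.mul hR.le z1 (hx x)
      (hφ x))).add z1 (hx x) ((hser 1 x).mul hR.le z1 (hx x) (hφ x))).add z1 (hx x)
      ((hasEv_cst σ₀).mul hR.le z1 (hx x) (hφ x)))).2
    have h4 := hb.potential_eq x
    rw [toC_add, toC_sub] at h4
    rw [this]
    simp only [Nat.factorial_one, Nat.cast_one, inv_one, one_mul, Function.iterate_one, dDir]
    linear_combination h4
  refine ⟨?_, ?_, ?_, vE, vG⟩
  · have h0 : Van (2 * a 2 - lift₁ fun ψ => dBeta β (dBeta β (W μ₀)) (hull β η ψ (v₀ ψ))) :=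
      van_of_ev fun x => by
        rw [((hasEv_two.mul hR.le z1 (hx x) (hser 2 x)).sub z1 (hx x)
          (hb.hol_w'.hasEv_lift hR hRρ z1 (hx x))).2]
        simp [dDir]
    rw [comp_zero, der_zero, der, basePt]
    have e := eq_sub_ord0 (b := -lift₁ fun ψ => dBeta β (dBeta β (W μ₀)) (hull β η ψ (v₀ ψ))) h0
      (sub_eq_add_neg _ _) (by rw [ord0_neg, hb.hol_w'.ord0_lift hρ])
    rw [ord0_mul, ord0_two, ← mul_sub] at e
    have e2 : ((1 + 1 : ℕ) : Ser n) = 2 := by norm_num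
    simp only [e2]
    rw [e]
    refine (nrm_mul_le hR.le _ _).trans ?_
    have n2 : nrm R (2 : Ser n) ≤ 2 := by exact_mod_cast (nrm_natCast_le (n := n) R 2).le
    refine (mul_le_mul' n2 (hsub 2)).trans (le_trans ?_ hrK)
    rw [mul_left_comm]
    gcongr
    exact le_add_self
  · rw [eq_sub_ord0 (A := a 0) (b := shf Ω (lift₁ v₀) + shf (-Ω) (lift₁ v₀) - 2 * lift₁ v₀
      + cst σ₀ * lift₁ v₀ + cst lam₀) vE (by rw [errE, add_zero, comp_zero]; ring) (by
        simp only [ord0_add, ord0_sub, ord0_mul, ord0_cst, ord0_two, ord0_shf ov, ov])]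
    refine (hsub 0).trans (le_trans ?_ hrK)
    gcongr
    rw [add_assoc]; exact le_self_add
  · rw [eq_sub_ord0 (A := a 1 * lift₁ φ) (b := cst ((χ : ℂ)⁻¹) * shf Ω (lift₁ φ)
      + cst χ * shf (-Ω) (lift₁ φ) - 2 * lift₁ φ + cst σ₀ * lift₁ φ) vG
      (by rw [errG, comp_zero, der_zero]; ring) (by
        simp only [ord0_add, ord0_sub, ord0_mul, ord0_cst, ord0_two, ord0_shf oφ, oφ]), ord0_mul, oφ,
        ← sub_mul]
    refine (nrm_mul_le hR.le _ _).trans ((mul_le_mul' (hsub 1) le_rfl).trans (le_trans ?_ hrK))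
    rw [mul_assoc]
    gcongr
    exact le_add_self.trans le_self_add

/-- Convergent solutions on smaller strips. -/
theorem Base.exists_sol (hS : SmallDiv Ω C p) (hb : Base Ω β η (W μ₀) ρ v₀ σ₀ c₀ χ φ)
    (hTr : Transversal Ω β η (W μ₀) ρ v₀ σ₀ c₀) (hT : Taylor 𝒟 β η W μ₀ v₀ ρ δ M)
    (hT' : Taylor 𝒟 β η (dDir β W) μ₀ v₀ ρ δ M) (hE : ∀ x, FKRes.equil Ω β η (W μ₀) v₀ σ₀ lam₀ (toC x) = 0)
    (hR' : 0 < R') (hRρ' : R' < ρ) : ∃ r u σ lam f c, Sol Ω β η W μ₀ v₀ σ₀ lam₀ c₀ χ φ R' r δ u σ lam f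
    c := by
  obtain ⟨R, hRR', hRρ⟩ := exists_between hRρ'
  obtain ⟨R₁, hRR, hR₁ρ⟩ := exists_between hRρ
  have hR := hR'.trans hRR'
  have hR₁ := hR.trans hRR
  have hρ := hb.pos
  have aφ := hb.hol_φ R₁ hR₁ hR₁ρ
  have aq := hb.hol_q hR₁ hR₁ρ
  have z1 : ‖(0 : ℂ)‖ ≤ 1 := by simp
  have hx : ∀ x, toC x ∈ closedStrip n R := toC_mem hR.le
  have h₀ : lift₁ φ * shf Ω (lift₁ φ) * (basePt Ω β η (W μ₀) v₀ φ).q = 1 := by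
    have oφ : ord0 (lift₁ φ) = lift₁ φ := aφ.ord0_lift hR₁
    have oq : ord0 (basePt Ω β η (W μ₀) v₀ φ).q = (basePt Ω β η (W μ₀) v₀ φ).q := aq.ord0_lift hR₁
    have h : Van (lift₁ φ * shf Ω (lift₁ φ) * (basePt Ω β η (W μ₀) v₀ φ).q - 1) := van_of_ev fun x => by
      have h1 := aφ.hasEv_lift hR hRR z1 (hx x)
      have h2 : HasEv R 0 (toC x) (shf Ω (lift₁ φ)) (φ (toC x + toC Ω)) := HasEv.shf (by
        rw [← toC_add]; exact aφ.hasEv_lift hR hRR z1 (hx _))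
      have h3 := aq.hasEv_lift hR hRR z1 (hx x)
      have h4 := hasEv_cst (n := n) (R := R) (ζ := 0) (ψ := toC x) 1
      rw [cst_one] at h4
      refine ((((h1.mul hR.le z1 (hx x) h2).mul hR.le z1 (hx x) h3).sub z1 (hx x) h4).2).trans ?_
      rw [mul_inv_cancel₀ (mul_ne_zero (hb.φ_ne _) (hb.φ_ne _)), sub_self]
    have := ord0_eq_zero_iff.2 h
    rw [ord0_sub, ord0_mul, ord0_mul, ord0_shf oφ, oφ, oq, ord0_one] at this
    exact sub_eq_zero.1 this
  have hMt : ofReal M * liftK n ρ R ≠ ∞ :=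
    mul_ne_top ofReal_ne_top (liftK_ne_top hRρ)
  obtain ⟨ε, hε, H⟩ := exists_solution hS hb.χ_ne hR' hRR' (v₀ := lift₁ v₀) (φ₀ := lift₁ φ)
    (q₀ := (basePt Ω β η (W μ₀) v₀ φ).q) (ω₀ := (basePt Ω β η (W μ₀) v₀ φ).ω)
    (hb.hol_v.nrm_lift hR.le hRρ) (aφ.nrm_lift hR.le hRR) (aq.nrm_lift hR.le hRR)
    (hb.hol_w'.nrm_lift hR.le hRρ) h₀ (hb.isUnit_det hS hTr) hMt (B := ofReal δ⁻¹)
    ofReal_ne_top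
  obtain ⟨r, hr, hrδ, a, ha, i1, i2, i3, i4, i5⟩ := hb.initial hT hE hR hRρ hε
  have hna : ∀ l, nrm R (a l) ≤ ofReal M * liftK n ρ R * ofReal δ⁻¹ ^ l := fun l => by
    rw [ha]; exact hT.nrm_ser hr hrδ hR hRρ l
  obtain ⟨u, σ, lam, f, q, e1, e2, hs, nu, nf, nq, hq, hN⟩ := H a (cst σ₀) (cst lam₀) hna i1
    (ave_cst _) (ave_cst _) i2 i3 i4 i5
  have hna' : ∀ l, nrm R' (a l) ≤ ofReal M * liftK n ρ R * ofReal δ⁻¹ ^ l := fun l =>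
    (nrm_mono hRR'.le _).trans (hna l)
  obtain ⟨M', B', eM, eB, ha0, ha1, -⟩ := der_bounds hR'.le hna'
  have hM't : M' ≠ ∞ := by
    rw [eM]
    exact add_ne_top.2 ⟨add_ne_top.2 ⟨hMt, by finiteness⟩, by finiteness⟩
  have hB't : B' ≠ ∞ := by rw [eB]; finiteness
  have hBB : ofReal δ⁻¹ ≤ B' := by rw [eB]; exact le_mul_of_one_le_left zero_le (by norm_num)
  rw [← eB] at hs
  have val0 : ∀ {X : Ser n} {z : ℂ}, ave X = X → Van (X - cst z) → ev 0 (0 : CVec n) X = z :=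
    fun {X z} hX hz => by
      have h1 := ev_zero_ord0 0 (X - cst z)
      rw [ord0_eq_zero_iff.2 hz, ev_zero, ((hasEv_ave hX 0 z1 0).sub z1 (fun j => by simp)
        (hasEv_cst z)).2] at h1
      exact (sub_eq_zero.1 h1.symm)
  have hx' : ∀ x, toC x ∈ closedStrip n R' := toC_mem hR'.le
  have fin_mul : ∀ {f g : Ser n}, nrm R' f ≠ ∞ → nrm R' g ≠ ∞ → nrm R' (f * g) ≠ ∞ :=
    fun hf hg => ne_top_of_le_ne_top (mul_ne_top hf hg) (nrm_mul_le hR'.le _ _)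
  have fin_shf : ∀ {f : Ser n} (Ω : Vec n), nrm R' f ≠ ∞ → nrm R' (shf Ω f) ≠ ∞ :=
    fun Ω hf => by rwa [nrm_shf]
  set c : Ser n := cst χ * shf (-Ω) f * (shf Ω f * q) with hc
  have nc : nrm R' c ≠ ∞ := fin_mul (fin_mul (by rw [nrm_cst]; exact enorm_ne_top) (fin_shf _ nf))
    (fin_mul (fin_shf _ nf) nq)
  have hmul : c * f = cst χ * shf (-Ω) f := by
    rw [hc]; linear_combination (cst χ * shf (-Ω) f) * hq
  have hcf : ∀ ζ : ℂ, ‖ζ‖ ≤ 1 → ∀ ψ ∈ closedStrip n R', ev ζ ψ c * ev ζ ψ f = χ * ev ζ (ψ - toC Ω) f :=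
    fun ζ hζ ψ hψ => by
      have := ((hasEv_cst (χ : ℂ)).mul hR'.le hζ hψ (HasEv.shf_neg (Ω := Ω) ⟨nf, rfl⟩)).2
      rw [← hmul, ev_mul hζ hψ nc nf] at this
      exact this
  have hfne : ∀ ζ : ℂ, ‖ζ‖ ≤ 1 → ∀ ψ ∈ closedStrip n R', ev ζ ψ f ≠ 0 := fun ζ hζ ψ hψ h0 => by
    have := congrArg (ev ζ ψ) hq
    rw [mul_assoc, ev_mul hζ hψ nf (fin_mul (fin_shf _ nf) nq), h0, zero_mul, ev_one] at this
    exact zero_ne_one this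
  have hfx : ∀ x, ev 0 (toC x) f = φ (toC x) := fun x => by
    have h1 := ev_zero_ord0 (toC x) (f - lift₁ φ)
    rw [ord0_eq_zero_iff.2 hN.vφ, ev_zero, (HasEv.sub z1 (hx' x) ⟨nf, rfl⟩
      (aφ.hasEv_lift hR' (hRR'.trans hRR) z1 (hx' x))).2] at h1
    exact (sub_eq_zero.1 h1.symm)
  have hv : ∀ ζ : ℂ, ‖ζ‖ ≤ 1 → ∀ ψ ∈ closedStrip n R', HasEv R' ζ ψ (lift₁ v₀ + u) (v₀ ψ + ev ζ ψ u) :=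
    fun ζ hζ ψ hψ => (hb.hol_v.hasEv_lift hR' hRρ' hζ hψ).add hζ hψ ⟨nu, rfl⟩
  have hδ := hT.δ_pos
  refine ⟨r, u, σ, lam, f, c, hr, hrδ, nu, (mul_le_mul_left hBB _).trans hs, nf, nc, hN.u, hN.σ, hN.lam,
    by simpa using hN.vu, val0 hN.σ hN.vσ, val0 hN.lam hN.vlam, hfx, fun x => ?_, hmul,
    fun ζ hζ ψ hψ => ?_, fun ζ hζ ψ hψ => ?_⟩
  · have h1 := hcf 0 z1 _ (hx' x)
    rw [← toC_sub, hfx, hfx, ← (hb.relations x).1] at h1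
    exact mul_right_cancel₀ (hb.φ_ne _) h1
  · have hp := add_toC_mem_closed hψ Ω
    have hm := sub_toC_mem_closed hψ Ω
    have hcomp := hT.hasEv_comp hr hrδ hR' hRρ' hζ hψ hM't hB't hBB ha0
      (fun l => by rw [ha]; exact (hT.hasEv_ser hr hrδ hR' hRρ' hζ hψ l).2) nu hs
    have := (((((((hv ζ hζ _ hp).shf).add hζ hψ ((hv ζ hζ _ hm).shf_neg)).sub hζ hψ (hasEv_two.mul hR'.le
      hζ hψ (hv ζ hζ ψ hψ))).add hζ hψ hcomp).add hζ hψ ((hasEv_ave hN.σ R' hζ ψ).mul hR'.le hζ hψ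
      (hv ζ hζ ψ hψ))).add hζ hψ (hasEv_ave hN.lam R' hζ ψ)).2
    rw [← errE, e1, ev_zero] at this
    rw [FKRes.equil]
    linear_combination -this
  · have hp := add_toC_mem_closed hψ Ω
    have hm := sub_toC_mem_closed hψ Ω
    have hcomp := hT'.hasEv_comp hr hrδ hR' hRρ' hζ hψ hM't hB't hBB ha1
      (fun l => by rw [ha]; exact (hT.hasEv_der hr hrδ hR' hRρ' hζ hψ l).2) nu hs
    have hf : ∀ ψ, HasEv R' ζ ψ f (ev ζ ψ f) := fun ψ => ⟨nf, rfl⟩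
    have := ((((((hasEv_cst ((χ : ℂ)⁻¹)).mul hR'.le hζ hψ ((hf (ψ + toC Ω)).shf)).add hζ hψ
      ((hasEv_cst (χ : ℂ)).mul hR'.le hζ hψ ((hf (ψ - toC Ω)).shf_neg))).sub hζ hψ (hasEv_two.mul hR'.le
      hζ hψ (hf ψ))).add hζ hψ (hcomp.mul hR'.le hζ hψ (hf ψ))).add hζ hψ ((hasEv_ave hN.σ R' hζ ψ).mul
      hR'.le hζ hψ (hf ψ))).2
    rw [← errG, e2, ev_zero] at this
    have h1 := hcf ζ hζ ψ hψ
    have h2 := hcf ζ hζ _ hp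
    rw [add_sub_cancel_right] at h2
    have hχ : (χ : ℂ) * (χ : ℂ)⁻¹ = 1 := mul_inv_cancel₀ (by exact_mod_cast hb.χ_ne)
    have hne := mul_ne_zero (hfne ζ hζ ψ hψ) (hfne ζ hζ _ hp)
    refine mul_right_cancel₀ hne ?_
    simp only [factorEq, dDir] at this ⊢
    linear_combination (ev ζ (ψ + toC Ω) c * ev ζ (ψ + toC Ω) f) * (this - h1)
      + (χ : ℂ)⁻¹ * ev ζ (ψ + toC Ω) f * h2 + ev ζ ψ f * ev ζ (ψ + toC Ω) f * hχ

end existence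

section limits

variable {N : ℕ}

theorem psum_sub {s s' : ℕ → ℂ} (h : ∀ k < N, s k = s' k) (z : ℂ) : psum s N z - psum s' N z = z ^ N *
    (s N - s' N) := by
  rw [psum, psum, Finset.sum_range_succ, Finset.sum_range_succ,
    Finset.sum_congr rfl fun k hk => by rw [h k (Finset.mem_range.1 hk)]]
  ring

theorem tendsto_psum (s : ℕ → ℂ) (N : ℕ) : Tendsto (psum s N) (𝓝 0) (𝓝 (s 0)) := by
  have hc : Continuous (psum s N) := by unfold psum; fun_prop
  have := hc.tendsto 0
  rwa [show psum s N 0 = s 0 by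
    rw [psum, Finset.sum_range_succ', Finset.sum_eq_zero fun k _ => by simp]; simp] at this

theorem AnalyticFamily.tendsto_slope (hW : AnalyticFamily 𝒟 W) {s₀ B : ℂ} (hp : (μ₀, hull β η ψ s₀) ∈ 𝒟)
    {P P' : ℂ → ℂ} (hP : Tendsto P (𝓝 0) (𝓝 s₀)) (hP' : Tendsto P' (𝓝 0) (𝓝 s₀))
    (h : ∀ z, P z - P' z = z ^ N * B) : Tendsto (fun z => (W (μ₀ + z) (hull β η ψ (P z)) - W (μ₀ + z)
    (hull β η ψ (P' z))) / z ^ N) (𝓝[≠] 0) (𝓝 (FKRes.dBeta β (W μ₀) (hull β η ψ s₀) * B)) := by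
  have hs := ((hW.analytic _ hp).hasStrictFDerivAt).isLittleO
  have hμ : Tendsto (fun z : ℂ => μ₀ + z) (𝓝 0) (𝓝 μ₀) := by
    simpa using (continuous_const_add μ₀).tendsto 0
  have hh : ∀ {P : ℂ → ℂ}, Tendsto P (𝓝 0) (𝓝 s₀) → Tendsto (fun z => (μ₀ + z, hull β η ψ (P z)))
      (𝓝 0) (𝓝 (μ₀, hull β η ψ s₀)) := fun hP =>
    hμ.prodMk_nhds (((continuous_hull β η).tendsto (ψ, s₀)).comp (tendsto_const_nhds.prodMk_nhds hP))
  have h1 := hs.comp_tendsto (((hh hP).prodMk_nhds (hh hP')).mono_left (nhdsWithin_le_nhds (s := {0}ᶜ)))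
  have hd : ∀ z, (μ₀ + z, hull β η ψ (P z)) - (μ₀ + z, hull β η ψ (P' z))
      = (z ^ N * B) • ((0 : ℂ), (toC β : CVec (n + 1))) := fun z => by
    rw [← h, Prod.mk_sub_mk, sub_self, Prod.smul_mk, smul_zero, hull, hull, add_sub_add_left_eq_sub,
      sub_smul]
  simp only [Function.comp_def, hd, map_smul, ← hW.dBeta_eq β hp, smul_eq_mul] at h1
  have h2 : (fun z : ℂ => (z ^ N * B) • ((0 : ℂ), (toC β : CVec (n + 1)))) =O[𝓝[≠] 0]
      fun z : ℂ => z ^ N :=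
    Asymptotics.isBigO_of_le' (c := ‖B‖ * ‖((0 : ℂ), (toC β : CVec (n + 1)))‖) _ fun z => by
      rw [norm_smul, norm_mul]; exact le_of_eq (by ring)
  replace h2 := (h1.trans_isBigO h2).tendsto_div_nhds_zero
  have h3 := h2.add_const (FKRes.dBeta β (W μ₀) (hull β η ψ s₀) * B)
  rw [zero_add] at h3
  refine h3.congr' ?_
  filter_upwards [self_mem_nhdsWithin] with z hz
  have : z ^ N ≠ 0 := pow_ne_zero _ hz
  field_simp
  ring

variable {v v' c c' : ℕ → Fn n} {σ σ' lam lam' : ℕ → ℂ}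

/-- Two expansions have the same coefficients below some order, at real arguments. -/
def Agree (N : ℕ) (f f' : ℕ → Fn n) : Prop :=
  ∀ k < N, ∀ x, f k (toC x) = f' k (toC x)

theorem Agree.fpsum {f f' : ℕ → Fn n} (h : Agree N f f') (z : ℂ) (x : Vec n) : fpsum f N z (toC x) - fpsum
    f' N z (toC x) = z ^ N * (f N (toC x) - f' N (toC x)) := psum_sub (fun k hk => h k hk x) z

theorem tendsto_equil (hW : AnalyticFamily 𝒟 W) (x : Vec n) (hp : (μ₀, hull β η (toC x) (v₀ (toC x))) ∈ 𝒟)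
    (hN : 1 ≤ N) (hv : Agree N v v') (hσ : ∀ k < N, σ k = σ' k) (hl : ∀ k < N, lam k = lam' k)
    (hv0 : ∀ x, v 0 (toC x) = v₀ (toC x)) (hσ0 : σ 0 = σ₀) : Tendsto (fun z => (equil Ω β η (W (μ₀ + z))
    (fpsum v N z) (psum σ N z) (psum lam N z) (toC x) - equil Ω β η (W (μ₀ + z)) (fpsum v' N z)
    (psum σ' N z) (psum lam' N z) (toC x)) / z ^ N) (𝓝[≠] 0) (𝓝 (linEquil Ω β η (W μ₀) v₀ σ₀
    (fun ψ => v N ψ - v' N ψ) (toC x) + (σ N - σ' N) * v₀ (toC x) + (lam N - lam' N))) := by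
  have t0 : Tendsto (fun z => fpsum v N z (toC x)) (𝓝 0) (𝓝 (v₀ (toC x))) := by
    rw [← hv0]; exact tendsto_psum _ N
  have t0' : Tendsto (fun z => fpsum v' N z (toC x)) (𝓝 0) (𝓝 (v₀ (toC x))) := by
    rw [← hv0, hv 0 (by omega)]; exact tendsto_psum _ N
  have tσ : Tendsto (psum σ N) (𝓝 0) (𝓝 σ₀) := by rw [← hσ0]; exact tendsto_psum _ N
  have tw := hW.tendsto_slope hp t0 t0' (fun z => hv.fpsum z x)
  have le : (𝓝[≠] (0 : ℂ)) ≤ 𝓝 0 := nhdsWithin_le_nhds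
  have key := ((tw.const_add (v N (toC x + toC Ω) - v' N (toC x + toC Ω) + (v N (toC x - toC Ω)
    - v' N (toC x - toC Ω)) - 2 * (v N (toC x) - v' N (toC x)))).add
    (((tσ.mono_left le).const_mul (v N (toC x) - v' N (toC x))).add
    ((t0'.mono_left le).const_mul (σ N - σ' N)))).add_const (lam N - lam' N)
  rw [linEquil]
  refine (key.congr' ?_).mono_right (le_of_eq (by congr 1; ring))
  filter_upwards [self_mem_nhdsWithin] with z hz
  have hz' : z ^ N ≠ 0 := pow_ne_zero _ hz
  have e1 := hv.fpsum z x
  have e2 := hv.fpsum z (x + Ω)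
  have e3 := hv.fpsum z (x - Ω)
  have e4 := psum_sub hσ z
  have e5 := psum_sub hl z
  rw [toC_add] at e2
  rw [toC_sub] at e3
  rw [eq_div_iff hz', add_mul, add_mul, add_mul, div_mul_cancel₀ _ hz', equil, equil]
  linear_combination -e2 - e3 + (2 - psum σ N z) * e1 - fpsum v' N z (toC x) * e4 - e5

theorem tendsto_factorEq (hW : AnalyticFamily 𝒟 W) (x : Vec n)
    (hp : (μ₀, hull β η (toC x) (v₀ (toC x))) ∈ 𝒟) (hN : 1 ≤ N) (hv : Agree N v v')
    (hσ : ∀ k < N, σ k = σ' k) (hc : Agree N c c') (hv0 : ∀ x, v 0 (toC x) = v₀ (toC x)) (hσ0 : σ 0 = σ₀)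
    (hc0 : ∀ x, c 0 (toC x) = c₀ (toC x)) : Tendsto (fun z => (factorEq Ω β η (W (μ₀ + z)) (fpsum v N z)
    (psum σ N z) (fpsum c N z) (toC x) - factorEq Ω β η (W (μ₀ + z)) (fpsum v' N z) (psum σ' N z)
    (fpsum c' N z) (toC x)) / z ^ N) (𝓝[≠] 0) (𝓝 (linFactor Ω β η (W μ₀) v₀ σ₀ c₀ (fun ψ => v N ψ - v' N ψ)
    (σ N - σ' N) (fun ψ => c N ψ - c' N ψ) (toC x))) := by
  have t0 : Tendsto (fun z => fpsum v N z (toC x)) (𝓝 0) (𝓝 (v₀ (toC x))) := by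
    rw [← hv0]; exact tendsto_psum _ N
  have t0' : Tendsto (fun z => fpsum v' N z (toC x)) (𝓝 0) (𝓝 (v₀ (toC x))) := by
    rw [← hv0, hv 0 (by omega)]; exact tendsto_psum _ N
  have tc : Tendsto (fun z => fpsum c N z (toC x)) (𝓝 0) (𝓝 (c₀ (toC x))) := by
    rw [← hc0]; exact tendsto_psum _ N
  have tc' : Tendsto (fun z => fpsum c' N z (toC x + toC Ω)) (𝓝 0) (𝓝 (c₀ (toC x + toC Ω))) := by
    rw [← toC_add, ← hc0, hc 0 (by omega)]; exact tendsto_psum _ N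
  have tσ : Tendsto (psum σ N) (𝓝 0) (𝓝 σ₀) := by rw [← hσ0]; exact tendsto_psum _ N
  have hW1 : AnalyticFamily 𝒟 (dDir β W) := hW.dBeta β
  have tw := hW1.tendsto_slope hp t0 t0' (fun z => hv.fpsum z x)
  have tW : Tendsto (fun z => dBeta β (W (μ₀ + z)) (hull β η (toC x) (fpsum v N z (toC x)))) (𝓝 0)
      (𝓝 (dBeta β (W μ₀) (hull β η (toC x) (v₀ (toC x))))) := by
    have h1 := (hW1.analytic _ hp).continuousAt.tendsto
    have hμ : Tendsto (fun z : ℂ => μ₀ + z) (𝓝 0) (𝓝 μ₀) := by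
      simpa using (continuous_const_add μ₀).tendsto 0
    exact h1.comp (hμ.prodMk_nhds (((continuous_hull β η).tendsto (toC x, v₀ (toC x))).comp
      (tendsto_const_nhds.prodMk_nhds t0)))
  have le : (𝓝[≠] (0 : ℂ)) ≤ 𝓝 0 := nhdsWithin_le_nhds
  have key := (((((tc.neg.add_const 2).sub tW).sub tσ).mul_const (c N (toC x + toC Ω)
    - c' N (toC x + toC Ω))).mono_left le).sub ((tc'.mono_left le).mul
    ((tw.const_add (c N (toC x) - c' N (toC x))).add_const (σ N - σ' N)))
  rw [linFactor]
  refine (key.congr' ?_).mono_right (le_of_eq (by congr 1; simp only [dDir]; ring))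
  filter_upwards [self_mem_nhdsWithin] with z hz
  have hz' : z ^ N ≠ 0 := pow_ne_zero _ hz
  have e1 := hc.fpsum z x
  have e2 := hc.fpsum z (x + Ω)
  have e4 := psum_sub hσ z
  rw [toC_add] at e2
  obtain ⟨G, hG⟩ : ∃ G, G = (dDir β W (μ₀ + z) (hull β η (toC x) (fpsum v N z (toC x)))
      - dDir β W (μ₀ + z) (hull β η (toC x) (fpsum v' N z (toC x)))) / z ^ N := ⟨_, rfl⟩
  have hG' := hG
  rw [eq_div_iff hz'] at hG'
  simp only [dDir] at hG'
  rw [eq_div_iff hz', factorEq, factorEq, ← hG]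
  linear_combination (fpsum c N z (toC x) - 2 + dBeta β (W (μ₀ + z)) (hull β η (toC x)
    (fpsum v N z (toC x))) + psum σ N z) * e2 + fpsum c' N z (toC x + toC Ω) * (e1 + e4 - hG')

end limits

section averages

/-- The continuous functions of real arguments. -/
def contSubring (n : ℕ) : Subring (Vec n → ℂ) where
  carrier := {f | Continuous f}
  mul_mem' := Continuous.mul
  one_mem' := continuous_const
  add_mem' := Continuous.add
  zero_mem' := continuous_const
  neg_mem' := Continuous.neg

/-- The real complex numbers. -/
def reSubring : Subring ℂ := Complex.ofRealHom.range

theorem mem_reSubring : z ∈ reSubring ↔ z.im = 0 := by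
  constructor
  · rintro ⟨t, rfl⟩; simp
  · intro h; exact ⟨z.re, Complex.ext (by simp) (by simp [h])⟩

theorem mem_reSubring_conj : z ∈ reSubring ↔ conj z = z := by
  rw [mem_reSubring, Complex.conj_eq_iff_im]

variable {c c' : ℕ → Fn n} {N : ℕ}

theorem continuous_logDerivCoeff (hc : ∀ k, Continuous fun x : Vec n => c k (toC x))
    (h0 : ∀ x, c 0 (toC x) ≠ 0) (k : ℕ) : Continuous fun x : Vec n => logDerivCoeff c k (toC x) :=
  coeff_logDeriv_mem (contSubring n) (c := fun j x => c j (toC x)) hc ((hc 0).inv₀ h0) k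

theorem avg_logDerivCoeff_sub (hc : ∀ k, Continuous fun x : Vec n => c k (toC x))
    (hc' : ∀ k, Continuous fun x : Vec n => c' k (toC x)) (h : Agree (N + 1) c c')
    (h0 : ∀ x, c 0 (toC x) = c₀ (toC x)) (hne : ∀ x, c₀ (toC x) ≠ 0) : avg (logDerivCoeff c N) - avg
    (logDerivCoeff c' N) = (N + 1) * avg fun ψ => (c (N + 1) ψ - c' (N + 1) ψ) / c₀ ψ := by
  have h1 := ravg_sub (continuous_logDerivCoeff hc (fun x => by rw [h0]; exact hne x) N)
    (continuous_logDerivCoeff hc' (fun x => by rw [← h 0 N.succ_pos, h0]; exact hne x) N)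
  refine h1.symm.trans (Eq.trans ?_ (ravg_mul_left _ _))
  congr 1
  funext x
  beta_reduce
  rw [← h0]
  exact coeff_logDeriv_sub (c := fun j => c j (toC x)) (c' := fun j => c' j (toC x))
    (fun k hk => h k hk x) (by rw [h0]; exact hne x)

end averages

section formal

variable {v v' c c' : ℕ → Fn n} {σ σ' lam lam' : ℕ → ℂ} {φ : Fn n}

/-- Formal solutions of the equilibrium equation at real arguments. -/
def ResEquil (Ω : Vec n) (β : Vec (n + 1)) (η : ℝ) (W : ℂ → Fn (n + 1)) (μ₀ : ℂ)
    (v : ℕ → Fn n) (σ lam : ℕ → ℂ) : Prop := ∀ (N : ℕ) (x : Vec n),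
  Tendsto (fun z => equil Ω β η (W (μ₀ + z)) (fpsum v N z) (psum σ N z) (psum lam N z) (toC x) / z ^ N)
    (𝓝[≠] 0) (𝓝 0)

/-- Formal solutions of the factorization equation at real arguments. -/
def ResFactor (Ω : Vec n) (β : Vec (n + 1)) (η : ℝ) (W : ℂ → Fn (n + 1)) (μ₀ : ℂ)
    (v : ℕ → Fn n) (σ : ℕ → ℂ) (c : ℕ → Fn n) : Prop := ∀ (N : ℕ) (x : Vec n),
  Tendsto (fun z => factorEq Ω β η (W (μ₀ + z)) (fpsum v N z) (psum σ N z) (fpsum c N z) (toC x) / z ^ N)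
    (𝓝[≠] 0) (𝓝 0)

theorem tendsto_of_residual {f : ℂ → ℂ} {N : ℕ} (h : ∃ C r : ℝ, 0 < r ∧ ∀ μ : ℂ, ‖μ - μ₀‖ < r → ‖f (μ - μ₀)‖
    ≤ C * ‖μ - μ₀‖ ^ (N + 1)) : Tendsto (fun z => f z / z ^ N) (𝓝[≠] 0) (𝓝 0) := by
  obtain ⟨C, r, hr, h⟩ := h
  have h1 : f =O[𝓝 0] fun z : ℂ => z ^ (N + 1) := by
    refine Asymptotics.IsBigO.of_bound C ?_
    filter_upwards [Metric.ball_mem_nhds (0 : ℂ) hr] with z hz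
    have := h (μ₀ + z) (by simpa using hz)
    rwa [add_sub_cancel_left, ← norm_pow] at this
  exact ((h1.trans_isLittleO (Asymptotics.isLittleO_pow_pow N.lt_succ_self)).mono
    nhdsWithin_le_nhds).tendsto_div_nhds_zero

theorem FormalEquil.res (hρ : 0 < ρ) (h : FormalEquil Ω β η W μ₀ ρ v σ lam) : ResEquil Ω β η W μ₀ v σ lam := fun N x => by
  refine tendsto_of_residual (μ₀ := μ₀) ?_
  obtain ⟨C, r, hr, H⟩ := h N (ρ / 2) (by linarith) (by linarith)
  refine ⟨C, r, hr, fun μ hμ => ?_⟩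
  have := H μ hμ (toC x) (toC_mem (by linarith) x)
  rwa [add_sub_cancel]

theorem FormalFactor.res (hρ : 0 < ρ) (h : FormalFactor Ω β η W μ₀ ρ v σ c) : ResFactor Ω β η W μ₀ v σ c := fun N x => by
  refine tendsto_of_residual (μ₀ := μ₀) ?_
  obtain ⟨C, r, hr, H⟩ := h N (ρ / 2) (by linarith) (by linarith)
  refine ⟨C, r, hr, fun μ hμ => ?_⟩
  have := H μ hμ (toC x) (toC_mem (by linarith) x)
  rwa [add_sub_cancel]

/-- Normalized formal solutions on a strip. -/
structure Formal (Ω : Vec n) (β : Vec (n + 1)) (η : ℝ) (W : ℂ → Fn (n + 1)) (μ₀ : ℂ)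
    (R : ℝ) (v₀ : Fn n) (σ₀ lam₀ : ℂ) (c₀ : Fn n)
    (v : ℕ → Fn n) (σ lam : ℕ → ℂ) (c : ℕ → Fn n) : Prop where
  v_zero : ∀ x, v 0 (toC x) = v₀ (toC x)
  σ_zero : σ 0 = σ₀
  lam_zero : lam 0 = lam₀
  c_zero : ∀ x, c 0 (toC x) = c₀ (toC x)
  v_mem : ∀ k, HolA n R (v k)
  c_mem : ∀ k, HolA n R (c k)
  equil : ResEquil Ω β η W μ₀ v σ lam
  factor : ResFactor Ω β η W μ₀ v σ c
  v_avg : ∀ k, 1 ≤ k → avg (v k) = 0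
  c_avg : ∀ k, avg (logDerivCoeff c k) = 0

theorem NormalizedExpansion.formal {σ₀ lam₀ : ℝ} (h : NormalizedExpansion Ω β η W μ₀ ρ v₀ σ₀ lam₀ c₀ v σ lam
    c) (h0 : 0 < R) (hR : R < ρ) : Formal Ω β η W μ₀ R v₀ σ₀ lam₀ c₀ v σ lam c where
  v_zero x := by rw [h.v_zero]
  σ_zero := h.σ_zero
  lam_zero := h.lam_zero
  c_zero x := by rw [h.c_zero]
  v_mem k := h.v_mem k R h0 hR
  c_mem k := h.c_mem k R h0 hR
  equil := h.equil.res (h0.trans hR)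
  factor := h.factor.res (h0.trans hR)
  v_avg := h.v_avg
  c_avg := h.c_avg

theorem ResEquil.linear (hW : AnalyticFamily 𝒟 W) {N : ℕ} {x : Vec n}
    (hp : (μ₀, hull β η (toC x) (v₀ (toC x))) ∈ 𝒟) (h : ResEquil Ω β η W μ₀ v σ lam)
    (h' : ResEquil Ω β η W μ₀ v' σ' lam') (hN : 1 ≤ N) (hv : Agree N v v') (hσ : ∀ k < N, σ k = σ' k)
    (hl : ∀ k < N, lam k = lam' k) (hv0 : ∀ x, v 0 (toC x) = v₀ (toC x)) (hσ0 : σ 0 = σ₀) : linEquil Ω β η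
    (W μ₀) v₀ σ₀ (fun ψ => v N ψ - v' N ψ) (toC x) + (σ N - σ' N) * v₀ (toC x) + (lam N - lam' N) = 0 := by
  refine tendsto_nhds_unique (tendsto_equil hW x hp hN hv hσ hl hv0 hσ0) ?_
  simpa only [sub_div, sub_zero] using (h N x).sub (h' N x)

/-- Normalized formal solutions are unique. -/
theorem Formal.unique (hS : SmallDiv Ω C p) (hb : Base Ω β η (W μ₀) ρ v₀ σ₀ c₀ χ φ)
    (hT : Transversal Ω β η (W μ₀) ρ v₀ σ₀ c₀) (hW : AnalyticFamily 𝒟 W)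
    (hD : ∀ x, (μ₀, hull β η (toC x) (v₀ (toC x))) ∈ 𝒟) (h0 : 0 < R) (hR : R < ρ)
    (h : Formal Ω β η W μ₀ R v₀ σ₀ lam₀ c₀ v σ lam c) (h' : Formal Ω β η W μ₀ R v₀ σ₀ lam₀ c₀ v' σ' lam' c')
    (k : ℕ) : (∀ x, v k (toC x) = v' k (toC x)) ∧ σ k = σ' k ∧ lam k = lam' k ∧ ∀ x, c k (toC x) = c' k
    (toC x) := by
  induction k using Nat.strong_induction_on with
  | _ k ih =>
    rcases k with _ | N
    · exact ⟨fun x => by rw [h.v_zero, h'.v_zero], by rw [h.σ_zero, h'.σ_zero],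
        by rw [h.lam_zero, h'.lam_zero], fun x => by rw [h.c_zero, h'.c_zero]⟩
    · have av : Agree (N + 1) v v' := fun k hk => (ih k hk).1
      have ac : Agree (N + 1) c c' := fun k hk => (ih k hk).2.2.2
      have aσ : ∀ k < N + 1, σ k = σ' k := fun k hk => (ih k hk).2.1
      have al : ∀ k < N + 1, lam k = lam' k := fun k hk => (ih k hk).2.2.1
      have hN : 1 ≤ N + 1 := N.succ_pos
      have cont : ∀ {f}, HolA n R f → Continuous fun x : Vec n => f (toC x) := fun hf =>
        (hf.per h0.le).cont
      have hne : ∀ x, c₀ (toC x) ≠ 0 := fun x => hb.c_ne _ (toC_mem hb.pos.le x)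
      have hq := avg_logDerivCoeff_sub (fun k => cont (h.c_mem k)) (fun k => cont (h'.c_mem k)) ac
        h.c_zero hne
      rw [h.c_avg, h'.c_avg, sub_zero, eq_comm, mul_eq_zero, or_iff_right (by exact_mod_cast N.succ_ne_zero)]
        at hq
      have hB : avg (fun ψ => v (N + 1) ψ - v' (N + 1) ψ) = 0 :=
        (ravg_sub (cont (h.v_mem _)) (cont (h'.v_mem _))).trans
          ((congrArg₂ (· - ·) (h.v_avg _ hN) (h'.v_avg _ hN)).trans (sub_zero 0))
      obtain ⟨e1, e2, e3, e4⟩ := hb.linear_unique hS hT h0 hR ((h.v_mem (N + 1)).sub (h'.v_mem (N + 1)))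
        ((h.c_mem (N + 1)).sub (h'.c_mem (N + 1))) (s := σ (N + 1) - σ' (N + 1))
        (D := lam (N + 1) - lam' (N + 1))
        (fun x => h.equil.linear hW (hD x) h'.equil hN av aσ al h.v_zero h.σ_zero)
        (fun x => by
          refine tendsto_nhds_unique (tendsto_factorEq hW x (hD x) hN av aσ ac h.v_zero h.σ_zero
            h.c_zero) ?_
          simpa only [sub_div, sub_zero] using (h.factor (N + 1) x).sub (h'.factor (N + 1) x)) hB hq
      exact ⟨fun x => sub_eq_zero.1 (e3 x), sub_eq_zero.1 e1, sub_eq_zero.1 e2, fun x => sub_eq_zero.1 (e4 x)⟩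

/-- Normalized formal solutions without counterterm are unique. -/
theorem ResEquil.unique (hS : SmallDiv Ω C p) (hb : Base Ω β η (W μ₀) ρ v₀ σ₀ c₀ χ φ)
    (hW : AnalyticFamily 𝒟 W) (hD : ∀ x, (μ₀, hull β η (toC x) (v₀ (toC x))) ∈ 𝒟) (h0 : 0 < R)
    (h : ResEquil Ω β η W μ₀ v σ lam) (h' : ResEquil Ω β η W μ₀ v' σ lam') (hv : ∀ k, HolA n R (v k))
    (hv' : ∀ k, HolA n R (v' k)) (hσ0 : σ 0 = σ₀) (hv0 : ∀ x, v 0 (toC x) = v₀ (toC x))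
    (hv0' : ∀ x, v' 0 (toC x) = v₀ (toC x)) (hl : lam 0 = lam' 0) (ha : ∀ k, 1 ≤ k → avg (v k) = 0)
    (ha' : ∀ k, 1 ≤ k → avg (v' k) = 0) (k : ℕ) : (∀ x, v k (toC x) = v' k (toC x)) ∧ lam k = lam' k := by
  induction k using Nat.strong_induction_on with
  | _ k ih =>
    rcases Nat.eq_zero_or_pos k with rfl | hN
    · exact ⟨fun x => by rw [hv0, hv0'], hl⟩
    · have hB : avg (fun ψ => v k ψ - v' k ψ) = 0 :=
        (ravg_sub ((hv k).per h0.le).cont ((hv' k).per h0.le).cont).trans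
          ((congrArg₂ (· - ·) (ha _ hN) (ha' _ hN)).trans (sub_zero 0))
      obtain ⟨e1, e2⟩ := hb.equil_unique hS (((hv k).sub (hv' k)).per h0.le) (D := lam k - lam' k)
        (fun x => by
          have := h.linear hW (hD x) h' hN (fun k hk => (ih k hk).1) (fun _ _ => rfl)
            (fun k hk => (ih k hk).2) hv0 hσ0
          rwa [sub_self, zero_mul, add_zero] at this) hB
      exact ⟨fun x => sub_eq_zero.1 (e2 x), sub_eq_zero.1 e1⟩

end formal

section reality

variable {v c : ℕ → Fn n} {σ lam : ℕ → ℂ} {φ : Fn n}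

/-- Families which are real for real arguments. -/
def RealFam (𝒟 : Set (ℂ × CVec (n + 1))) (W : ℂ → Fn (n + 1)) : Prop :=
  ∀ (t : ℝ) (x : Vec (n + 1)), ((t : ℂ), toC x) ∈ 𝒟 → W t (toC x) ∈ reSubring

theorem RealFam.dDir (hW : AnalyticFamily 𝒟 W) (h : RealFam 𝒟 W) : RealFam 𝒟 (dDir β W) := by
  intro t x hx
  have h1 := hW.hasDerivAt_line (μ := t) (e := 0) (t := ((0 : ℝ) : ℂ)) (x := toC x) (y := toC β)
    (by simpa using hx)
  have h2 := Complex.imCLM.hasFDerivAt.comp_hasDerivAt (0 : ℝ) h1.comp_ofReal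
  simp only [Complex.ofReal_zero, mul_zero, add_zero, zero_smul, ← hW.dBeta_eq β hx] at h2
  rw [mem_reSubring]
  refine h2.unique ((hasDerivAt_const (0 : ℝ) (0 : ℝ)).congr_of_eventuallyEq ?_)
  have hc : Continuous fun s : ℝ => ((t : ℂ), (toC x : CVec (n + 1)) + (s : ℂ) • toC β) := by
    fun_prop
  filter_upwards [hc.continuousAt.eventually (hW.isOpen.mem_nhds (by simpa using hx))] with s hs
  have e : (toC x : CVec (n + 1)) + (s : ℂ) • toC β = toC (x + s • β) := by ext; simp [toC]
  rw [e] at hs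
  have := mem_reSubring.1 (h t _ hs)
  rw [← e] at this
  simpa using this

theorem hull_ofReal (β : Vec (n + 1)) (η : ℝ) (x : Vec n) {s : ℂ} (hs : s ∈ reSubring) : ∃ y : Vec (n + 1),
    hull β η (toC x) s = toC y := by
  obtain ⟨t, rfl⟩ := hs
  refine ⟨(Fin.snoc x η : Vec (n + 1)) + t • β, ?_⟩
  ext i
  refine Fin.lastCases ?_ (fun j => ?_) i <;> simp [hull, toC]

theorem RealFam.mem (h : RealFam 𝒟 W) (hμ : μ ∈ reSubring) {x : Vec n} {s : ℂ} (hs : s ∈ reSubring)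
    (hp : (μ, hull β η (toC x) s) ∈ 𝒟) : W μ (hull β η (toC x) s) ∈ reSubring := by
  obtain ⟨y, hy⟩ := hull_ofReal β η x hs
  obtain ⟨t, rfl⟩ := hμ
  rw [hy] at hp ⊢
  exact h t y hp

theorem psum_mem {s : ℕ → ℂ} {N : ℕ} (h : ∀ k ≤ N, s k ∈ reSubring) (hz : z ∈ reSubring) : psum s N z ∈
    reSubring :=
  reSubring.sum_mem fun k hk => reSubring.mul_mem (reSubring.pow_mem hz k)
    (h k (Nat.lt_succ_iff.1 (Finset.mem_range.1 hk)))

/-- Complex conjugates on the real torus extend to strips. -/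
theorem HolA.exists_conj {f : Fn n} (hf : HolA n ρ f) (h0 : 0 < R) (h1 : R < ρ) : ∃ g, HolA n R g ∧ ∀ x, g
    (toC x) = conj (f (toC x)) := by
  set F := lift₁ f with hF
  let e : Idx n ≃ Idx n := (Equiv.neg _).prodCongr (Equiv.refl _)
  have he : ∀ i, e (e i) = i := fun i => Prod.ext (neg_neg i.1) rfl
  have hs : Summable fun i : Idx n => ‖conj (F (e i))‖ := by
    simpa [Function.comp_def] using e.summable_iff.2 F.summable_norm
  set G : Ser n := Wien.mk (fun i => conj (F (e i))) hs with hG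
  have hn : nrm R G = nrm R F := by
    rw [nrm, nrm, N, N, ← e.tsum_eq]
    refine tsum_congr fun i => ?_
    rw [hG, Wien.mk_apply, he]
    simp [wt, len, e, ← ofReal_norm]
  have hFt : nrm R F ≠ ∞ := hf.nrm_lift h0.le h1
  have z1 : ‖(0 : ℂ)‖ ≤ 1 := by simp
  refine ⟨_, holA_ev h0 z1 (by rwa [hn]), fun x => ?_⟩
  have hx := toC_mem h0.le x
  rw [ev_eq z1 hx (by rwa [hn]), ← hf.ev_lift h0 h1 z1 hx, ev_eq z1 hx hFt, Complex.conj_tsum,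
    ← e.tsum_eq]
  refine tsum_congr fun i => ?_
  rw [hG, Wien.mk_apply, he, map_mul, FKRes.mono, FKRes.mono, map_mul, conj_chr, conj_toC, map_pow, map_zero]
  rfl

/-- The expansions are real for real families. -/
theorem Formal.real (hS : SmallDiv Ω C p) (hb : Base Ω β η (W μ₀) ρ v₀ σ₀ c₀ χ φ)
    (hT : Transversal Ω β η (W μ₀) ρ v₀ σ₀ c₀) (hW : AnalyticFamily 𝒟 W)
    (hD : ∀ x, (μ₀, hull β η (toC x) (v₀ (toC x))) ∈ 𝒟) (h0 : 0 < R) (hR : R < ρ)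
    (h : Formal Ω β η W μ₀ R v₀ σ₀ lam₀ c₀ v σ lam c) (hWr : RealFam 𝒟 W) (hμ : μ₀ ∈ reSubring)
    (hvr : ∀ x, v₀ (toC x) ∈ reSubring) (hcr : ∀ x, c₀ (toC x) ∈ reSubring) (hσr : σ₀ ∈ reSubring)
    (hlr : lam₀ ∈ reSubring) (k : ℕ) : (∀ x, v k (toC x) ∈ reSubring) ∧ σ k ∈ reSubring ∧ lam k ∈ reSubring
    ∧ ∀ x, c k (toC x) ∈ reSubring := by
  induction k using Nat.strong_induction_on with
  | _ k ih =>
    rcases k with _ | N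
    · exact ⟨fun x => by rw [h.v_zero]; exact hvr x, by rwa [h.σ_zero], by rwa [h.lam_zero],
        fun x => by rw [h.c_zero]; exact hcr x⟩
    obtain ⟨v', hv'⟩ : ∃ v' : ℕ → Fn n, ∀ k, v' k = if k < N + 1 then v k else fun _ => 0 :=
      ⟨_, fun _ => rfl⟩
    obtain ⟨c', hc'⟩ : ∃ c' : ℕ → Fn n, ∀ k, c' k = if k < N + 1 then c k else fun _ => 0 :=
      ⟨_, fun _ => rfl⟩
    obtain ⟨σ', hσ'⟩ : ∃ σ' : ℕ → ℂ, ∀ k, σ' k = if k < N + 1 then σ k else 0 := ⟨_, fun _ => rfl⟩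
    obtain ⟨l', hl'⟩ : ∃ l' : ℕ → ℂ, ∀ k, l' k = if k < N + 1 then lam k else 0 := ⟨_, fun _ => rfl⟩
    have av : Agree (N + 1) v v' := fun k hk x => by rw [hv', if_pos hk]
    have ac : Agree (N + 1) c c' := fun k hk x => by rw [hc', if_pos hk]
    have rv : ∀ k x, v' k (toC x) ∈ reSubring := fun k x => by
      rw [hv']; split_ifs with hk
      exacts [(ih k hk).1 x, reSubring.zero_mem]
    have rc : ∀ k x, c' k (toC x) ∈ reSubring := fun k x => by
      rw [hc']; split_ifs with hk
      exacts [(ih k hk).2.2.2 x, reSubring.zero_mem]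
    have rσ : ∀ k, σ' k ∈ reSubring := fun k => by
      rw [hσ']; split_ifs with hk
      exacts [(ih k hk).2.1, reSubring.zero_mem]
    have rl : ∀ k, l' k ∈ reSubring := fun k => by
      rw [hl']; split_ifs with hk
      exacts [(ih k hk).2.2.1, reSubring.zero_mem]
    have v0' : v' (N + 1) = fun _ => 0 := by rw [hv', if_neg (lt_irrefl _)]
    have c0' : c' (N + 1) = fun _ => 0 := by rw [hc', if_neg (lt_irrefl _)]
    have hr0 : Tendsto (fun t : ℝ => (t : ℂ)) (𝓝[≠] 0) (𝓝[≠] 0) := by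
      refine tendsto_nhdsWithin_iff.2 ⟨?_, ?_⟩
      · exact (Complex.continuous_ofReal.tendsto' 0 0 Complex.ofReal_zero).mono_left nhdsWithin_le_nhds
      · filter_upwards [self_mem_nhdsWithin] with t ht
        simpa using ht
    have real_lim : ∀ {E E' : ℂ → ℂ} {K : ℂ}, Tendsto (fun z => E z / z ^ (N + 1)) (𝓝[≠] 0) (𝓝 0) →
        Tendsto (fun z => (E z - E' z) / z ^ (N + 1)) (𝓝[≠] 0) (𝓝 K) →
        (∀ᶠ t : ℝ in 𝓝[≠] 0, E' t ∈ reSubring) → K ∈ reSubring := fun {E E' K} h1 h2 h3 => by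
      have h4 : Tendsto (fun z => -(E' z) / z ^ (N + 1)) (𝓝[≠] 0) (𝓝 K) := by
        have := h2.sub h1
        rw [sub_zero] at this
        exact this.congr fun z => by ring
      refine mem_reSubring.2 (tendsto_nhds_unique ((Complex.continuous_im.tendsto K).comp (h4.comp hr0))
        (tendsto_const_nhds.congr' ?_))
      filter_upwards [h3] with t ht
      obtain ⟨s, hs⟩ := ht
      simp only [Function.comp_apply, ← hs]
      have : -(s : ℂ) / (t : ℂ) ^ (N + 1) = ((-s / t ^ (N + 1) : ℝ) : ℂ) := by push_cast; rfl
      exact (congrArg Complex.im this).symm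
    have hev : ∀ x, ∀ᶠ t : ℝ in 𝓝[≠] 0,
        (μ₀ + (t : ℂ), hull β η (toC x) (fpsum v' (N + 1) t (toC x))) ∈ 𝒟 := fun x => by
      have hμt : Tendsto (fun z : ℂ => μ₀ + z) (𝓝 0) (𝓝 μ₀) := by
        simpa using (continuous_const_add μ₀).tendsto 0
      have ht : Tendsto (fun z => fpsum v' (N + 1) z (toC x)) (𝓝 0) (𝓝 (v₀ (toC x))) := by
        rw [← h.v_zero, av 0 N.succ_pos]; exact tendsto_psum _ _
      exact (((hμt.prodMk_nhds (((continuous_hull β η).tendsto (toC x, v₀ (toC x))).comp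
        (tendsto_const_nhds.prodMk_nhds ht))).mono_left nhdsWithin_le_nhds).comp hr0).eventually
        (hW.isOpen.mem_nhds (hD x))
    have ht : ∀ t : ℝ, (t : ℂ) ∈ reSubring := fun t => ⟨t, rfl⟩
    have two : (2 : ℂ) ∈ reSubring := ⟨2, by simp⟩
    have pv : ∀ (t : ℝ) (x : Vec n), fpsum v' (N + 1) t (toC x) ∈ reSubring := fun t x =>
      psum_mem (fun k _ => rv k x) (ht t)
    have pc : ∀ (t : ℝ) (x : Vec n), fpsum c' (N + 1) t (toC x) ∈ reSubring := fun t x =>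
      psum_mem (fun k _ => rc k x) (ht t)
    have aσ : ∀ k < N + 1, σ k = σ' k := fun k hk => by rw [hσ', if_pos hk]
    have al : ∀ k < N + 1, lam k = l' k := fun k hk => by rw [hl', if_pos hk]
    have K1 : ∀ x, _ ∈ reSubring := fun x =>
      real_lim (h.equil (N + 1) x) (tendsto_equil (Ω := Ω) hW x (hD x) N.succ_pos av aσ al
      h.v_zero h.σ_zero) (by
        filter_upwards [hev x] with t hx
        rw [FKRes.equil, ← toC_add, ← toC_sub]
        exact add_mem (add_mem (add_mem (sub_mem (add_mem (pv t _) (pv t _)) (mul_mem two (pv t _)))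
          (hWr.mem (add_mem hμ (ht t)) (pv t x) hx)) (mul_mem (pv t x)
          (psum_mem (fun k _ => rσ k) (ht t)))) (psum_mem (fun k _ => rl k) (ht t)))
    have K2 : ∀ x, _ ∈ reSubring := fun x =>
      real_lim (h.factor (N + 1) x) (tendsto_factorEq (Ω := Ω) hW x (hD x) N.succ_pos av aσ ac
      h.v_zero h.σ_zero h.c_zero) (by
        filter_upwards [hev x] with t hx
        rw [factorEq, ← toC_add]
        exact sub_mem (mul_mem (sub_mem (sub_mem (add_mem (neg_mem (pc t _)) two)
          ((hWr.dDir hW).mem (add_mem hμ (ht t)) (pv t x) hx)) (psum_mem (fun k _ => rσ k) (ht t)))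
          (pc t _)) (one_mem _))
    simp only [v0', c0', hσ', hl', lt_irrefl, if_false, sub_zero] at K1 K2
    obtain ⟨R', h0', hR'⟩ := exists_between h0
    obtain ⟨g, hg, hgv⟩ := (h.v_mem (N + 1)).exists_conj h0' hR'
    obtain ⟨q, hq, hqc⟩ := (h.c_mem (N + 1)).exists_conj h0' hR'
    have cont : ∀ {f}, HolA n R f → Continuous fun x : Vec n => f (toC x) := fun hf =>
      (hf.per h0.le).cont
    have hne : ∀ x, c₀ (toC x) ≠ 0 := fun x => hb.c_ne _ (toC_mem hb.pos.le x)
    have mc : ∀ x, conj (c₀ (toC x)) = c₀ (toC x) := fun x =>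
      mem_reSubring_conj.1 (hcr x)
    have mv : ∀ x, conj (v₀ (toC x)) = v₀ (toC x) := fun x =>
      mem_reSubring_conj.1 (hvr x)
    have mw : ∀ x, conj (dBeta β (W μ₀) (hull β η (toC x) (v₀ (toC x))))
        = dBeta β (W μ₀) (hull β η (toC x) (v₀ (toC x))) := fun x =>
      mem_reSubring_conj.1 ((hWr.dDir hW).mem hμ (hvr x) (hD x))
    have mw' : ∀ x, conj (dBeta β (dBeta β (W μ₀)) (hull β η (toC x)
        (v₀ (toC x)))) = dBeta β (dBeta β (W μ₀)) (hull β η (toC x) (v₀ (toC x))) := fun x =>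
      mem_reSubring_conj.1 (((hWr.dDir hW).dDir (hW.dBeta β)).mem hμ (hvr x) (hD x))
    have hB : avg (fun ψ => v (N + 1) ψ - g ψ) = 0 := by
      have := ravg_sub (cont (h.v_mem (N + 1))) (hg.per h0'.le).cont
      simp only [hgv, ravg_conj] at this
      refine Eq.trans ?_ (this.trans ?_)
      · exact congrArg ravg (funext fun x => by beta_reduce; rw [hgv])
      · rw [show ravg (fun x : Vec n => v (N + 1) (toC x)) = 0 from h.v_avg _ N.succ_pos]; simp
    have hq0 : avg (fun ψ => (c (N + 1) ψ - q ψ) / c₀ ψ) = 0 := by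
      have h1 := avg_logDerivCoeff_sub (fun k => cont (h.c_mem k)) (fun k => show Continuous _ by
        rw [hc']; split_ifs
        exacts [cont (h.c_mem k), continuous_const]) ac h.c_zero hne
      have h2 : conj (avg (logDerivCoeff c' N)) = avg (logDerivCoeff c' N) := by
        refine (ravg_conj _).symm.trans (congrArg ravg (funext fun x => ?_))
        refine mem_reSubring_conj.1 (Subring.mem_iInf.1 (coeff_logDeriv_mem (⨅ x, reSubring.comap (Pi.evalRingHom _ x))
          (c := fun j x => c' j (toC x)) (fun j => Subring.mem_iInf.2 fun x => rc j x)
          (Subring.mem_iInf.2 fun x => ?_) N) x)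
        obtain ⟨s, hs⟩ := rc 0 x
        exact ⟨s⁻¹, (map_inv₀ Complex.ofRealHom s).trans (congrArg (·⁻¹) hs)⟩
      have h3 : avg (fun ψ => (c (N + 1) ψ - c' (N + 1) ψ) / c₀ ψ)
          = ravg fun x : Vec n => c (N + 1) (toC x) / c₀ (toC x) :=
        congrArg ravg (funext fun x => by simp [c0'])
      have hN0 : ((N : ℂ) + 1) ≠ 0 := by exact_mod_cast N.succ_ne_zero
      rw [h.c_avg, zero_sub, h3] at h1
      have h4 := congrArg conj h1
      rw [map_neg, h2, h1, map_mul, map_add, map_one, Complex.conj_natCast] at h4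
      replace h4 := mul_left_cancel₀ hN0 h4
      have cq : Continuous fun x : Vec n => c (N + 1) (toC x) / c₀ (toC x) := (cont (h.c_mem (N + 1))).div ((hb.hol_c.per hb.pos.le).cont) hne
      have h5 := ravg_sub cq (Complex.continuous_conj.comp cq)
      simp only [Function.comp_def, ravg_conj, ← h4, sub_self] at h5
      refine Eq.trans (congrArg ravg (funext fun x => ?_)) h5
      beta_reduce
      rw [hqc, map_div₀, mc, sub_div]
    obtain ⟨e1, e2, e3, e4⟩ := hb.linear_unique hS hT h0' (hR'.trans hR)
      (((h.v_mem (N + 1)).mono hR'.le).sub hg) (((h.c_mem (N + 1)).mono hR'.le).sub hq)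
      (s := σ (N + 1) - conj (σ (N + 1))) (D := lam (N + 1) - conj (lam (N + 1)))
      (fun x => by
        have h1 := mem_reSubring_conj.1 (K1 x)
        simp only [linEquil, map_add, map_sub, map_mul, ← toC_add, ← toC_sub, ← hgv, mv, mw, map_ofNat,
          mem_reSubring_conj.1 hσr] at h1 ⊢
        linear_combination -h1)
      (fun x => by
        have h1 := mem_reSubring_conj.1 (K2 x)
        simp only [linFactor, map_add, map_sub, map_mul, map_neg, ← toC_add, ← hgv, ← hqc, mc, mw, mw',
          map_ofNat, mem_reSubring_conj.1 hσr] at h1 ⊢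
        linear_combination -h1) hB hq0
    refine ⟨fun x => ?_, ?_, ?_, fun x => ?_⟩ <;> rw [mem_reSubring_conj]
    · rw [← hgv]; exact (sub_eq_zero.1 (e3 x)).symm
    · exact (sub_eq_zero.1 e1).symm
    · exact (sub_eq_zero.1 e2).symm
    · rw [← hqc]; exact (sub_eq_zero.1 (e4 x)).symm

end reality

/-- An equilibrium with factorizing linearization. -/
theorem Factorizes.exists_base (hn : 1 ≤ n) (hS : SmallDiv Ω C p) (hρ : 0 < ρ) {a b c d : Fn n}
    (hW : AnalyticFamily 𝒟 W) (hv : HolA n ρ v₀) (hD : ∀ ψ ∈ closedStrip n ρ, (μ₀, hull β η ψ (v₀ ψ)) ∈ 𝒟)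
    (h : Factorizes Ω β η (W μ₀) ρ v₀ σ₀ a b c d) : InA n ρ (fun ψ => b ψ * c ψ) ∧ ∃ χ φ, Base Ω β η (W μ₀)
    ρ v₀ σ₀ (fun ψ => b ψ * c ψ) χ φ := by
  have hbc : InA n ρ fun ψ => b ψ * c ψ := ⟨h.mem_b.toHolA.mul h.mem_c.toHolA, fun x => by
    rw [Complex.mul_im, h.mem_b.real_of_real, h.mem_c.real_of_real]; ring⟩
  have hne : ∀ ψ ∈ closedStrip n ρ, b ψ * c ψ ≠ 0 := fun ψ hψ h0 => by
    have h1 := (h.relations hn hS hψ).2.1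
    have h2 := (h.relations hn hS (sub_toC_mem_closed hψ Ω)).1
    rw [sub_add_cancel] at h2
    refine one_ne_zero (α := ℂ) ?_
    linear_combination a (ψ - toC Ω) * d ψ * h0 - h2 * (b ψ * d ψ) - h1
  obtain ⟨χ, φ, h1, h2, h3, h4, h5⟩ := exists_coboundary hρ hS hbc hne
  refine ⟨hbc, χ, φ, hρ, h1, hv, (hW.dBeta β).holA hv hD, ((hW.dBeta β).dBeta β).holA hv hD, hbc.toHolA,
    hne, fun ψ hψ => ?_, h2, h3, h4, h5⟩
  obtain ⟨r1, -, r3⟩ := h.relations hn hS hψ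
  have r2 := (h.relations hn hS (add_toC_mem_closed hψ Ω)).2.1
  linear_combination -(b (ψ + toC Ω) * c (ψ + toC Ω)) * r3 + a ψ * c (ψ + toC Ω) * r2 + r1

section powerSeries

theorem norm_psum_sub_le {a : ℕ → ℂ} {S : ℂ} (hζ : ‖ζ‖ ≤ 1) (ha : Summable fun k => ‖a k‖)
    (h : HasSum (fun k => ζ ^ k * a k) S) (N : ℕ) : ‖psum a N ζ - S‖ ≤ ‖ζ‖ ^ (N + 1) * ∑' k, ‖a k‖ := by
  rw [psum, ← h.tsum_eq, ← h.summable.sum_add_tsum_nat_add (N + 1), sub_add_cancel_left, norm_neg]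
  have hs := (summable_nat_add_iff (N + 1)).2 ha
  refine (tsum_of_norm_bounded (hs.mul_left (‖ζ‖ ^ (N + 1))).hasSum fun k => ?_).trans ?_
  · rw [norm_mul, norm_pow, pow_add, mul_comm (‖ζ‖ ^ k)]
    exact mul_le_mul_of_nonneg_right (mul_le_of_le_one_right (by positivity)
      (pow_le_one₀ (norm_nonneg _) hζ)) (norm_nonneg _)
  · rw [tsum_mul_left]
    refine mul_le_mul_of_nonneg_left ?_ (by positivity)
    rw [← ha.sum_add_tsum_nat_add (N + 1)]
    exact le_add_of_nonneg_left (Finset.sum_nonneg fun _ _ => norm_nonneg _)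

theorem eq_zero_of_hasSum_zero {d : ℕ → ℂ} (hd : Summable fun k => ‖d k‖) (h : ∀ ζ : ℂ, ‖ζ‖ ≤ 1 → HasSum
    (fun k => ζ ^ k * d k) 0) (N : ℕ) : d N = 0 := by
  induction N using Nat.strong_induction_on with
  | _ N ih =>
    rw [← norm_le_zero_iff]
    have key : ∀ t : ℝ, 0 < t → t ≤ 1 → ‖d N‖ ≤ t * ∑' k, ‖d k‖ := fun t h0 h1 => by
      have ht : ‖(t : ℂ)‖ = t := by rw [Complex.norm_real, Real.norm_of_nonneg h0.le]
      have h2 := norm_psum_sub_le (by rwa [ht]) hd (h t (by rwa [ht])) N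
      have h3 := psum_sub (s := d) (s' := fun _ => 0) (N := N) ih t
      rw [show psum (fun _ => 0) N t = 0 by simp [psum]] at h3
      rw [h3, sub_zero, norm_mul, norm_pow, ht, pow_succ, mul_assoc] at h2
      exact le_of_mul_le_mul_left h2 (pow_pos h0 N)
    refine ge_of_tendsto (x := 𝓝[>] (0 : ℝ)) (f := fun t => t * ∑' k, ‖d k‖) ?_ ?_
    · exact ((continuous_mul_const _).tendsto' 0 0 (zero_mul _)).mono_left nhdsWithin_le_nhds
    · filter_upwards [Ioc_mem_nhdsGT one_pos] with t ht using key t ht.1 ht.2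

theorem coeff_mk_mul {a b e : ℕ → ℂ} (ha : Summable fun k => ‖a k‖) (hb : Summable fun k => ‖b k‖)
    (he : Summable fun k => ‖e k‖) (h : ∀ ζ : ℂ, ‖ζ‖ ≤ 1 → (∑' k, ζ ^ k * a k) * ∑' k, ζ ^ k * b k = ∑' k, ζ
    ^ k * e k) : PowerSeries.mk a * PowerSeries.mk b = PowerSeries.mk e := by
  have hs : ∀ {a : ℕ → ℂ} (_ : Summable fun k => ‖a k‖) {ζ : ℂ} (_ : ‖ζ‖ ≤ 1),
      Summable fun k => ‖ζ ^ k * a k‖ := fun ha ζ hζ => ha.of_nonneg_of_le (fun _ => norm_nonneg _)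
    fun k => by
      rw [norm_mul, norm_pow]
      exact mul_le_of_le_one_left (norm_nonneg _) (pow_le_one₀ (norm_nonneg _) hζ)
  have hab := summable_norm_sum_mul_antidiagonal_of_summable_norm ha hb
  ext k
  rw [PowerSeries.coeff_mul, PowerSeries.coeff_mk, ← sub_eq_zero]
  simp only [PowerSeries.coeff_mk]
  refine eq_zero_of_hasSum_zero (d := fun k => ∑ p ∈ Finset.HasAntidiagonal.antidiagonal k, a p.1 * b p.2
    - e k) ((hab.add he).of_nonneg_of_le (fun _ => norm_nonneg _) fun k => norm_sub_le _ _)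
    (fun ζ hζ => ?_) k
  have h1 := (hs hab hζ).of_norm.hasSum.sub (hs he hζ).of_norm.hasSum
  have h2 : ∑' k, ζ ^ k * e k
      = ∑' k, ζ ^ k * ∑ p ∈ Finset.HasAntidiagonal.antidiagonal k, a p.1 * b p.2 := by
    rw [← h ζ hζ, tsum_mul_tsum_eq_tsum_sum_antidiagonal_of_summable_norm (hs ha hζ) (hs hb hζ)]
    refine tsum_congr fun k => ?_
    rw [Finset.mul_sum]
    refine Finset.sum_congr rfl fun p hp => ?_
    rw [← Finset.HasAntidiagonal.mem_antidiagonal.1 hp, pow_add]; ring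
  rw [h2, sub_self] at h1
  simpa only [mul_sub] using h1

theorem logDeriv_of_mul {A B M : PowerSeries ℂ} {χ : ℂ} (h : A * B = PowerSeries.C χ * M)
    (hA : PowerSeries.constantCoeff A ≠ 0) (hB : PowerSeries.constantCoeff B ≠ 0)
    (hM : PowerSeries.constantCoeff M ≠ 0) : PowerSeries.derivative ℂ A * A⁻¹ = PowerSeries.derivative ℂ M *
    M⁻¹ - PowerSeries.derivative ℂ B * B⁻¹ := by
  have a := PowerSeries.mul_inv_cancel _ hA
  have b := PowerSeries.mul_inv_cancel _ hB
  have m := PowerSeries.mul_inv_cancel _ hM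
  have d := congrArg (PowerSeries.derivative ℂ) h
  rw [Derivation.leibniz, Derivation.leibniz, PowerSeries.derivative_C] at d
  simp only [smul_eq_mul, mul_zero, add_zero] at d
  linear_combination -(PowerSeries.derivative ℂ A * A⁻¹) * b + A⁻¹ * B⁻¹ * d
    - B⁻¹ * PowerSeries.derivative ℂ B * a + PowerSeries.derivative ℂ M * (-(A⁻¹ * B⁻¹
    * PowerSeries.C χ) * m - M⁻¹ * A⁻¹ * B⁻¹ * h + M⁻¹ * (B * B⁻¹ * a + b))

end powerSeries

theorem HolA.congr {f g : Fn n} (hf : HolA n ρ f) (h : ∀ ψ ∈ closedStrip n ρ, g ψ = f ψ) : HolA n ρ g where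
  analytic ψ hψ := (hf.analytic ψ hψ).congr (by
    filter_upwards [(isOpen_openStrip n ρ).mem_nhds hψ] with ξ hξ
    exact (h ξ (openStrip_subset n ρ hξ)).symm)
  continuousOn := hf.continuousOn.congr h
  periodic ψ hψ m := by
    have : ψ + intPt m ∈ closedStrip n ρ := fun j => by simpa [intPt] using hψ j
    rw [h _ this, h ψ hψ, hf.periodic ψ hψ]

section coefficients

variable {v : ℕ → Fn n}

/-- The Taylor coefficients of a series, in the original parameter. -/
def IsSer (R r : ℝ) (X : Ser n) (v : ℕ → Fn n) : Prop :=
  ∀ k, ∀ ψ ∈ closedStrip n R, v k ψ = (r : ℂ)⁻¹ ^ k * ev 0 ψ (slice k X)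

theorem IsSer.holA (h : IsSer R r X v) (hR : 0 < R) (hX : nrm R X ≠ ∞) (k : ℕ) : HolA n R (v k) :=
  ((holA_ev hR (by simp) (ne_top_of_le_ne_top hX (nrm_slice_le R k X))).const_mul _).congr (h k)

theorem summable_nrm_slice (hX : nrm R X ≠ ∞) : Summable fun k => (nrm R (slice k X)).toReal :=
  ENNReal.summable_toReal (by rwa [tsum_nrm_slice])

theorem norm_ev_le (hζ : ‖ζ‖ ≤ 1) (hψ : ψ ∈ closedStrip n R) (hX : nrm R X ≠ ∞) : ‖ev ζ ψ X‖ ≤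
    (nrm R X).toReal := by
  have := (ENNReal.toReal_le_toReal enorm_ne_top hX).2 (enorm_ev_le hζ hψ hX)
  rwa [toReal_enorm] at this

theorem norm_ev_slice_le (hψ : ψ ∈ closedStrip n R) (hX : nrm R X ≠ ∞) (k : ℕ) : ‖ev 0 ψ (slice k X)‖ ≤
    (nrm R (slice k X)).toReal := norm_ev_le (by simp) hψ (ne_top_of_le_ne_top hX (nrm_slice_le R k X))

theorem summable_ev_slice (hψ : ψ ∈ closedStrip n R) (hX : nrm R X ≠ ∞) : Summable fun k => ‖ev 0 ψ
    (slice k X)‖ :=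
  (summable_nrm_slice hX).of_nonneg_of_le (fun _ => norm_nonneg _) (norm_ev_slice_le hψ hX)

theorem IsSer.norm_le (h : IsSer R r X v) (hr : 0 < r) (hX : nrm R X ≠ ∞) (k : ℕ) (hψ : ψ ∈ closedStrip n R)
    : ‖v k ψ‖ ≤ r⁻¹ ^ k * (nrm R (slice k X)).toReal := by
  rw [h k ψ hψ, norm_mul, norm_pow, norm_inv, Complex.norm_real, Real.norm_of_nonneg hr.le]
  gcongr
  exact norm_ev_slice_le hψ hX k

theorem IsSer.term (h : IsSer R r X v) (hψ : ψ ∈ closedStrip n R) (z : ℂ) (k : ℕ) : z ^ k * v k ψ = (z / r)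
    ^ k * ev 0 ψ (slice k X) := by
  rw [h k ψ hψ, div_eq_mul_inv, mul_pow, mul_assoc]

theorem IsSer.summable (h : IsSer R r X v) (hr : 0 < r) (hX : nrm R X ≠ ∞) : Summable fun k => stripNorm n R
    (v k) * r ^ k := by
  refine (summable_nrm_slice hX).of_nonneg_of_le
    (fun k => mul_nonneg (Real.iSup_nonneg fun _ => norm_nonneg _) (by positivity)) fun k => ?_
  have h1 : stripNorm n R (v k) ≤ r⁻¹ ^ k * (nrm R (slice k X)).toReal :=
    Real.iSup_le (fun ψ => h.norm_le hr hX k ψ.2) (by positivity)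
  refine (mul_le_mul_of_nonneg_right h1 (by positivity)).trans (le_of_eq ?_)
  rw [mul_right_comm, ← mul_pow, inv_mul_cancel₀ hr.ne', one_pow, one_mul]

theorem norm_div_le_one (hr : 0 < r) (hz : ‖z‖ ≤ r) : ‖z / r‖ ≤ 1 := by
  rw [norm_div, Complex.norm_real, Real.norm_of_nonneg hr.le]; exact (div_le_one hr).2 hz

theorem IsSer.hasSum (h : IsSer R r X v) (hr : 0 < r) (hX : nrm R X ≠ ∞) (hz : ‖z‖ ≤ r)
    (hψ : ψ ∈ closedStrip n R) : HasSum (fun k => z ^ k * v k ψ) (ev (z / r) ψ X) := by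
  simp only [h.term hψ]
  exact ev_hasSum_slice (norm_div_le_one hr hz) hψ hX

theorem IsSer.tail (h : IsSer R r X v) (hr : 0 < r) (hX : nrm R X ≠ ∞) (hz : ‖z‖ ≤ r)
    (hψ : ψ ∈ closedStrip n R) (N : ℕ) : ‖fpsum v N z ψ - ev (z / r) ψ X‖ ≤ ‖z / r‖ ^ (N + 1) *
    (nrm R X).toReal := by
  have h1 := norm_psum_sub_le (norm_div_le_one hr hz) (summable_ev_slice hψ hX)
    (ev_hasSum_slice (norm_div_le_one hr hz) hψ hX) N
  have h2 : psum (fun k => ev 0 ψ (slice k X)) N (z / r) = fpsum v N z ψ :=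
    Finset.sum_congr rfl fun k _ => (h.term hψ z k).symm
  rw [h2] at h1
  refine h1.trans (mul_le_mul_of_nonneg_left ?_ (by positivity))
  refine ((summable_ev_slice hψ hX).tsum_le_tsum (norm_ev_slice_le hψ hX) (summable_nrm_slice hX)).trans
    (le_of_eq ?_)
  rw [← ENNReal.tsum_toReal_eq fun k => ne_top_of_le_ne_top hX (nrm_slice_le R k X), tsum_nrm_slice]

theorem IsSer.zero (h : IsSer R r X v) (hX : nrm R X ≠ ∞) (hψ : ψ ∈ closedStrip n R) : v 0 ψ = ev 0 ψ
    X := by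
  have := (ev_hasSum_slice (ζ := 0) (by simp) hψ hX).unique
    (hasSum_single 0 fun k hk => by rw [zero_pow hk, zero_mul])
  rw [h 0 ψ hψ, this]; simp

theorem isSer_ave (hX : ave X = X) : IsSer R r X fun k _ => (r : ℂ)⁻¹ ^ k * ev 0 0 (slice k X) := fun k ψ _ => by
  have : ave (slice k X) = slice k X := ave_eq_self_iff.2 fun i hi => by
    rw [slice_apply, ← hX, ave_apply, if_neg hi, ite_self]
  rw [ev_ave (by simp) this]

end coefficients

section convergence

variable {v c : ℕ → Fn n} {s l : ℕ → ℂ} {φ : Fn n}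

theorem AnalyticFamily.lipschitz (hW : AnalyticFamily 𝒟 W) {w : ℂ}
    (hm : ∀ t : ℂ, ‖t‖ ≤ δ → (μ, hull β η ψ (w + t)) ∈ 𝒟) (hM : ∀ t : ℂ, ‖t‖ ≤ δ → ‖FKRes.dDir β W μ
    (hull β η ψ (w + t))‖ ≤ M) {t t' : ℂ} (ht : ‖t‖ ≤ δ) (ht' : ‖t'‖ ≤ δ) : ‖W μ (hull β η ψ (w + t)) - W μ
    (hull β η ψ (w + t'))‖ ≤ M * ‖t - t'‖ := by
  refine (convex_closedBall (0 : ℂ) δ).norm_image_sub_le_of_norm_hasDerivWithin_le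
    (f := fun t => W μ (hull β η ψ (w + t))) (f' := fun t => FKRes.dDir β W μ (hull β η ψ (w + t)))
    (fun t ht => ?_) (fun t ht => hM t (mem_closedBall_zero_iff.1 ht)) (mem_closedBall_zero_iff.2 ht')
    (mem_closedBall_zero_iff.2 ht)
  have h1 := hm t (mem_closedBall_zero_iff.1 ht)
  rw [FKRes.dDir, hW.dBeta_eq β h1]
  simp only [hull_add] at h1 ⊢
  have := hW.hasDerivAt_line (μ := μ) (e := 0) (x := hull β η ψ w) (y := toC β) (t := t) (by simpa using h1)
  simpa using this.hasDerivWithinAt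

/-- A normalized expansion on a strip, which converges there. -/
structure Loc (Ω : Vec n) (β : Vec (n + 1)) (η : ℝ) (𝒟 : Set (ℂ × CVec (n + 1)))
    (W : ℂ → Fn (n + 1)) (μ₀ : ℂ) (R : ℝ) (v₀ : Fn n) (σ₀ lam₀ : ℂ)
    (c₀ : Fn n) (v : ℕ → Fn n) (s l : ℕ → ℂ) (c : ℕ → Fn n) :
    Prop where
  v_zero : ∀ ψ ∈ closedStrip n R, v 0 ψ = v₀ ψ
  c_zero : ∀ ψ ∈ closedStrip n R, c 0 ψ = c₀ ψ
  σ_zero : s 0 = σ₀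
  lam_zero : l 0 = lam₀
  v_mem : ∀ k, HolA n R (v k)
  c_mem : ∀ k, HolA n R (c k)
  equil : ∀ N, ∃ C r : ℝ, 0 < r ∧ ∀ μ : ℂ, ‖μ - μ₀‖ < r → ∀ ψ ∈ closedStrip n R,
    ‖equil Ω β η (W μ) (fpsum v N (μ - μ₀)) (psum s N (μ - μ₀)) (psum l N (μ - μ₀)) ψ‖
      ≤ C * ‖μ - μ₀‖ ^ (N + 1)
  factor : ∀ N, ∃ C r : ℝ, 0 < r ∧ ∀ μ : ℂ, ‖μ - μ₀‖ < r → ∀ ψ ∈ closedStrip n R,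
    ‖factorEq Ω β η (W μ) (fpsum v N (μ - μ₀)) (psum s N (μ - μ₀)) (fpsum c N (μ - μ₀)) ψ‖
      ≤ C * ‖μ - μ₀‖ ^ (N + 1)
  v_avg : ∀ k, 1 ≤ k → avg (v k) = 0
  c_avg : ∀ k, avg (logDerivCoeff c k) = 0
  conv : ∃ r : ℝ, 0 < r ∧
    Summable (fun k => stripNorm n R (v k) * r ^ k) ∧ Summable (fun k => ‖s k‖ * r ^ k) ∧
    Summable (fun k => ‖l k‖ * r ^ k) ∧ Summable (fun k => stripNorm n R (c k) * r ^ k) ∧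
    ∀ μ : ℂ, ‖μ - μ₀‖ < r → ∀ ψ ∈ closedStrip n R,
      (μ, hull β η ψ (∑' k, (μ - μ₀) ^ k * v k ψ)) ∈ 𝒟 ∧
      FKRes.equil Ω β η (W μ) (fun ζ => ∑' k, (μ - μ₀) ^ k * v k ζ)
        (∑' k, (μ - μ₀) ^ k * s k) (∑' k, (μ - μ₀) ^ k * l k) ψ = 0 ∧
      factorEq Ω β η (W μ) (fun ζ => ∑' k, (μ - μ₀) ^ k * v k ζ)
        (∑' k, (μ - μ₀) ^ k * s k) (fun ζ => ∑' k, (μ - μ₀) ^ k * c k ζ) ψ = 0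

theorem Loc.formal (hR : 0 < R) (h : Loc Ω β η 𝒟 W μ₀ R v₀ σ₀ lam₀ c₀ v s l c) : Formal Ω β η W μ₀ R v₀ σ₀
    lam₀ c₀ v s l c where
  v_zero x := h.v_zero _ (toC_mem hR.le x)
  σ_zero := h.σ_zero
  lam_zero := h.lam_zero
  c_zero x := h.c_zero _ (toC_mem hR.le x)
  v_mem := h.v_mem
  c_mem := h.c_mem
  equil N x := tendsto_of_residual (μ₀ := μ₀) (by
    obtain ⟨C, r, hr, H⟩ := h.equil N
    exact ⟨C, r, hr, fun μ hμ => by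
      rw [add_sub_cancel]; exact H μ hμ _ (toC_mem hR.le x)⟩)
  factor N x := tendsto_of_residual (μ₀ := μ₀) (by
    obtain ⟨C, r, hr, H⟩ := h.factor N
    exact ⟨C, r, hr, fun μ hμ => by
      rw [add_sub_cancel]; exact H μ hμ _ (toC_mem hR.le x)⟩)
  v_avg := h.v_avg
  c_avg := h.c_avg

theorem Sol.avg_logDerivCoeff (h : Sol Ω β η W μ₀ v₀ σ₀ lam₀ c₀ χ φ R r δ u σ lam f g) (hR : 0 < R)
    (hb : Base Ω β η (W μ₀) ρ v₀ σ₀ c₀ χ φ) (hc : IsSer R r g c) (k : ℕ) : avg (logDerivCoeff c k) = 0 := by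
  obtain ⟨F, hF⟩ : ∃ F : ℕ → Fn n, ∀ k ψ, F k ψ = (r : ℂ)⁻¹ ^ k * ev 0 ψ (slice k f) :=
    ⟨_, fun _ _ => rfl⟩
  have hFs : IsSer R r f F := fun k ψ _ => hF k ψ
  have hr := h.r_pos
  have hx : ∀ x, toC x ∈ closedStrip n R := toC_mem hR.le
  have hF0 : ∀ x, F 0 (toC x) ≠ 0 := fun x => by
    rw [hFs.zero h.fin_f (hx x), h.val_f]; exact hb.φ_ne _
  have hFp : ∀ k, Per fun x : Vec n => F k (toC x) := fun k => (hFs.holA hR h.fin_f k).per hR.le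
  have hL : Per fun x : Vec n => logDerivCoeff F k (toC x) :=
    ⟨continuous_logDerivCoeff (fun k => (hFp k).cont) hF0 k, fun x m => by
      simp only [logDerivCoeff, fun j => (hFp j).per x m]⟩
  have h0 : ∀ d : ℕ → ℂ, PowerSeries.constantCoeff (PowerSeries.mk d) = d 0 := fun d => by
    rw [← PowerSeries.coeff_zero_eq_constantCoeff_apply, PowerSeries.coeff_mk]
  have key : ∀ x, logDerivCoeff c k (toC x)
      = logDerivCoeff F k (toC (x - Ω)) - logDerivCoeff F k (toC x) := fun x => by
    rw [logDerivCoeff, logDerivCoeff, logDerivCoeff, ← map_sub]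
    congr 1
    have sc : ∀ {X : Ser n} {y : Vec n} (_ : nrm R X ≠ ∞),
        PowerSeries.rescale (r : ℂ)⁻¹ (PowerSeries.mk fun k => ev 0 (toC y) (slice k X))
          = PowerSeries.mk fun k => (r : ℂ)⁻¹ ^ k * ev 0 (toC y) (slice k X) := fun _ => by
      ext k; simp [PowerSeries.coeff_rescale]
    have hm := coeff_mk_mul (summable_ev_slice (hx x) h.fin_c) (summable_ev_slice (hx x) h.fin_f)
      (e := fun k => χ * ev 0 (toC (x - Ω)) (slice k f)) (by
        simpa only [norm_mul] using (summable_ev_slice (hx (x - Ω)) h.fin_f).mul_left _) fun ζ hζ => by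
        simp only [mul_left_comm _ (χ : ℂ)]
        rw [tsum_mul_left, (ev_hasSum_slice hζ (hx x) h.fin_c).tsum_eq,
          (ev_hasSum_slice hζ (hx x) h.fin_f).tsum_eq, (ev_hasSum_slice hζ (hx (x - Ω)) h.fin_f).tsum_eq,
          ← ev_mul hζ (hx x) h.fin_c h.fin_f, h.mul_c]
        exact ((hasEv_cst (χ : ℂ)).mul hR.le hζ (hx x) (HasEv.shf_neg (Ω := Ω) ⟨h.fin_f,
          by rw [toC_sub]⟩)).2
    refine logDeriv_of_mul (χ := χ) ?_ (by
      rw [h0, hc.zero h.fin_c (hx x), h.val_c]; exact hb.c_ne _ (toC_mem hb.pos.le x)) (by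
      rw [h0]; exact hF0 _) (by rw [h0]; exact hF0 _)
    have hm' := congrArg (PowerSeries.rescale (r : ℂ)⁻¹) hm
    rw [map_mul, sc h.fin_c, sc h.fin_f] at hm'
    simp only [hF, fun k => hc k _ (hx x)]
    rw [hm']
    ext k
    simp only [PowerSeries.coeff_rescale, PowerSeries.coeff_mk, PowerSeries.coeff_C_mul]
    ring
  refine (congrArg ravg (funext key)).trans ?_
  rw [ravg_sub (hL.shift_sub Ω).cont hL.cont, ravg_shift_sub hL Ω, sub_self]

theorem Sol.loc (h : Sol Ω β η W μ₀ v₀ σ₀ lam₀ c₀ χ φ R r δ u σ lam f g) (hR : 0 < R) (hRρ : R < ρ)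
    (hb : Base Ω β η (W μ₀) ρ v₀ σ₀ c₀ χ φ) (hW : AnalyticFamily 𝒟 W) (hT : Taylor 𝒟 β η W μ₀ v₀ ρ δ M)
    (hM : ∀ ψ ∈ closedStrip n ρ, ∀ s t : ℂ, ‖s‖ ≤ δ → ‖t‖ ≤ δ → ‖dDir β W (μ₀ + s) (hull β η ψ (v₀ ψ + t))‖
    ≤ M ∧ ‖dDir β (dDir β W) (μ₀ + s) (hull β η ψ (v₀ ψ + t))‖ ≤ M) (hv : IsSer R r (lift₁ v₀ + u) v)
    (hc : IsSer R r g c) (hs : IsSer R r σ fun k _ => s k) (hl : IsSer R r lam fun k _ => l k) : Loc Ω β η 𝒟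
    W μ₀ R v₀ σ₀ lam₀ c₀ v s l c := by
  have hr := h.r_pos
  have hδ := hT.δ_pos
  have hM0 := hT.M_pos
  have z1 : ‖(0 : ℂ)‖ ≤ 1 := by simp
  have hx : ∀ x, toC x ∈ closedStrip n R := toC_mem hR.le
  have nv : nrm R (lift₁ v₀ + u) ≠ ∞ := ne_top_of_le_ne_top
    (add_ne_top.2 ⟨hb.hol_v.nrm_lift hR.le hRρ, h.fin_u⟩) (N_add_le _ _)
  have nσ : nrm R σ ≠ ∞ := (hasEv_ave h.ave_σ R z1 0).1
  have nl : nrm R lam ≠ ∞ := (hasEv_ave h.ave_lam R z1 0).1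
  have evV : ∀ ζ : ℂ, ‖ζ‖ ≤ 1 → ∀ ψ ∈ closedStrip n R, ev ζ ψ (lift₁ v₀ + u) = v₀ ψ + ev ζ ψ u :=
    fun ζ hζ ψ hψ => ((hb.hol_v.hasEv_lift hR hRρ hζ hψ).add hζ hψ ⟨h.fin_u, rfl⟩).2
  have hu : ∀ ζ : ℂ, ‖ζ‖ ≤ 1 → ∀ ψ ∈ closedStrip n R, ‖ev ζ ψ u‖ < δ / 2 := fun ζ hζ ψ hψ =>
    norm_ev_le_of_small hδ hζ hψ h.fin_u h.small
  have u0 : ∀ ψ, ev 0 ψ u = 0 := fun ψ => by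
    rw [← ev_zero_ord0, ord0_eq_zero_iff.2 h.van_u, ev_zero]
  have hζ : ∀ {z : ℂ}, ‖z‖ < r → ‖z / r‖ ≤ 1 := fun hz => norm_div_le_one hr hz.le
  have hrz : ∀ z : ℂ, (r : ℂ) * (z / r) = z := fun z =>
    mul_div_cancel₀ z (by exact_mod_cast hr.ne')
  have hrδ := h.r_le
  obtain ⟨K, hK0, kv, kc, ks, kl⟩ : ∃ K : ℝ, 0 ≤ K ∧ (nrm R (lift₁ v₀ + u)).toReal ≤ K ∧
      (nrm R g).toReal ≤ K ∧ (nrm R σ).toReal ≤ K ∧ (nrm R lam).toReal ≤ K := by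
    have t := fun x : ℝ≥0∞ => x.toReal_nonneg
    refine ⟨(nrm R (lift₁ v₀ + u)).toReal + (nrm R g).toReal + (nrm R σ).toReal + (nrm R lam).toReal,
      ?_, ?_, ?_, ?_, ?_⟩ <;>
    linarith [t (nrm R (lift₁ v₀ + u)), t (nrm R g), t (nrm R σ), t (nrm R lam)]
  set r₁ : ℝ := min r (r * δ / (2 * (K + 1))) with hr₁
  have hr₁0 : 0 < r₁ := by positivity
  have small : ∀ z : ℂ, ‖z‖ < r₁ → ‖z‖ < r ∧ ‖z / r‖ * K ≤ δ / 2 := fun z hz => by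
    refine ⟨hz.trans_le (min_le_left _ _), ?_⟩
    have h1 := (hz.trans_le (min_le_right _ _)).le
    rw [le_div_iff₀ (by positivity)] at h1
    rw [norm_div, Complex.norm_real, Real.norm_of_nonneg hr.le, div_mul_eq_mul_div, div_le_iff₀ hr]
    nlinarith [norm_nonneg z]
  have tails : ∀ (N : ℕ) (z : ℂ), ‖z‖ < r₁ → ∀ ψ ∈ closedStrip n R, ∃ e : ℝ, e ≤ ‖z / r‖ ∧ 0 ≤ e ∧
      e ≤ 1 ∧ e = r⁻¹ ^ (N + 1) * ‖z‖ ^ (N + 1) ∧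
      (∀ ψ ∈ closedStrip n R, ‖fpsum v N z ψ - (v₀ ψ + ev (z / r) ψ u)‖ ≤ e * K ∧
        ‖v₀ ψ + ev (z / r) ψ u‖ ≤ K ∧ ‖fpsum c N z ψ - ev (z / r) ψ g‖ ≤ e * K ∧ ‖ev (z / r) ψ g‖ ≤ K) ∧
      ‖psum s N z - ev (z / r) 0 σ‖ ≤ e * K ∧ ‖ev (z / r) 0 σ‖ ≤ K ∧ ‖psum l N z - ev (z / r) 0 lam‖ ≤ e * K ∧
      ‖fpsum v N z ψ - v₀ ψ‖ ≤ δ := fun N z hz ψ hψ => by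
    obtain ⟨hz, hz'⟩ := small z hz
    have e1 := hζ hz
    have e0 : ‖z / r‖ ^ (N + 1) ≤ ‖z / r‖ := pow_le_of_le_one (norm_nonneg _) e1 N.succ_ne_zero
    have up : ∀ {x y : ℝ}, x ≤ ‖z / r‖ ^ (N + 1) * y → y ≤ K → x ≤ ‖z / r‖ ^ (N + 1) * K := fun h1 h2 =>
      h1.trans (by gcongr)
    have z0 : (0 : CVec n) ∈ closedStrip n R := fun j => by simpa using hR.le
    have tv : ∀ ψ ∈ closedStrip n R, ‖fpsum v N z ψ - (v₀ ψ + ev (z / r) ψ u)‖ ≤ ‖z / r‖ ^ (N + 1) * K :=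
      fun ψ hψ => by rw [← evV _ e1 ψ hψ]; exact up (hv.tail hr nv hz.le hψ N) kv
    refine ⟨‖z / r‖ ^ (N + 1), e0, by positivity, e0.trans e1, ?_, fun ψ hψ => ⟨tv ψ hψ, ?_,
      up (hc.tail hr h.fin_c hz.le hψ N) kc, (norm_ev_le e1 hψ h.fin_c).trans kc⟩,
      up (hs.tail hr nσ hz.le z0 N) ks, (norm_ev_le e1 z0 nσ).trans ks,
      up (hl.tail hr nl hz.le z0 N) kl, ?_⟩
    · rw [norm_div, Complex.norm_real, Real.norm_of_nonneg hr.le, div_pow, inv_pow, div_eq_inv_mul]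
    · rw [← evV _ e1 ψ hψ]; exact (norm_ev_le e1 hψ nv).trans kv
    · have h1 : fpsum v N z ψ - v₀ ψ = (fpsum v N z ψ - (v₀ ψ + ev (z / r) ψ u)) + ev (z / r) ψ u := by ring
      rw [h1]
      refine (norm_add_le_of_le (tv ψ hψ) (hu _ e1 ψ hψ).le).trans ?_
      nlinarith
  have par : ∀ z : ℂ, ‖z‖ < r₁ → ‖z‖ ≤ δ := fun z hz => by linarith [(small z hz).1]
  have lip : ∀ {V : ℂ → Fn (n + 1)} (_ : AnalyticFamily 𝒟 V) (_ : ∀ ψ ∈ closedStrip n ρ,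
      ∀ s t : ℂ, ‖s‖ ≤ δ → ‖t‖ ≤ δ → ‖dDir β V (μ₀ + s) (hull β η ψ (v₀ ψ + t))‖ ≤ M) (z : ℂ)
      (_ : ‖z‖ < r₁) (ψ) (_ : ψ ∈ closedStrip n R) {x : ℂ} (_ : ‖x - v₀ ψ‖ ≤ δ),
      ‖V (μ₀ + z) (hull β η ψ x) - V (μ₀ + z) (hull β η ψ (v₀ ψ + ev (z / r) ψ u))‖
        ≤ M * ‖x - (v₀ ψ + ev (z / r) ψ u)‖ := fun hV hVM z hz ψ hψ x hx => by
    have hψ' := closedStrip_mono hRρ.le hψ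
    have := hV.lipschitz (fun t ht => hT.mem ψ hψ' z t (par z hz) ht)
      (fun t ht => hVM ψ hψ' z t (par z hz) ht) hx
      ((hu _ (hζ (small z hz).1) ψ hψ).le.trans (half_le_self hδ.le))
    rwa [add_sub_cancel, sub_sub] at this
  have two : ‖(2 : ℂ)‖ ≤ 2 := by simp
  refine ⟨fun ψ hψ => ?_, fun ψ hψ => ?_, ?_, ?_, hv.holA hR nv, hc.holA hR h.fin_c, fun N => ?_,
    fun N => ?_, fun k hk => ?_, h.avg_logDerivCoeff hR hb hc, r, hr, hv.summable hr nv, ?_, ?_,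
    hc.summable hr h.fin_c, fun μ hμ ψ hψ => ?_⟩
  · rw [hv.zero nv hψ, evV 0 z1 ψ hψ, u0, add_zero]
  · exact HolA.eq_on hR (hc.holA hR h.fin_c 0) (hb.hol_c.mono hRρ.le) (fun x => by
      rw [hc.zero h.fin_c (hx x), h.val_c]) hψ
  · rw [hs.zero nσ (hx 0), ev_ave z1 h.ave_σ, h.val_σ]
  · rw [hl.zero nl (hx 0), ev_ave z1 h.ave_lam, h.val_lam]
  · refine ⟨K * (5 + M + 3 * K) * r⁻¹ ^ (N + 1), r₁, hr₁0, fun μ hμ ψ hψ => ?_⟩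
    obtain ⟨z, rfl⟩ : ∃ z, μ = μ₀ + z := ⟨μ - μ₀, by ring⟩
    rw [add_sub_cancel_left] at hμ ⊢
    obtain ⟨e, -, e0, e1, he, hp, p1, p2, p3, p4⟩ := tails N z hμ ψ hψ
    obtain ⟨q1, q2, -, -⟩ := hp ψ hψ
    have qp := (hp _ (add_toC_mem_closed hψ Ω)).1
    have qm := (hp _ (sub_toC_mem_closed hψ Ω)).1
    have hw := (lip hW (fun ψ hψ s t hs ht => (hM ψ hψ s t hs ht).1) z hμ ψ hψ p4).trans
      (mul_le_mul_of_nonneg_left q1 hM0.le)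
    have E0 := h.equil _ (hζ (small z hμ).1) ψ hψ
    rw [hrz, FKRes.equil] at E0
    rw [mul_assoc, ← he, FKRes.equil]
    have ps : ‖psum s N z‖ ≤ e * K + K := by
      have := norm_add_le_of_le p1 p2
      rwa [sub_add_cancel] at this
    have key := norm_add_le_of_le (norm_add_le_of_le (norm_add_le_of_le (norm_sub_le_of_le
      (norm_add_le_of_le qp qm) (norm_mul_le_of_le two q1)) hw) (norm_add_le_of_le
      (norm_mul_le_of_le q1 ps) (norm_mul_le_of_le q2 p1))) p3
    refine le_trans (le_of_eq ?_) (key.trans ?_)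
    · congr 1; linear_combination E0
    · have : 0 ≤ e * K * K * (1 - e) := by
        have := sub_nonneg.2 e1; positivity
      nlinarith
  · refine ⟨K * (4 * K + 2 + M + K * (2 + M)) * r⁻¹ ^ (N + 1), r₁, hr₁0, fun μ hμ ψ hψ => ?_⟩
    obtain ⟨z, rfl⟩ : ∃ z, μ = μ₀ + z := ⟨μ - μ₀, by ring⟩
    rw [add_sub_cancel_left] at hμ ⊢
    obtain ⟨e, -, e0, e1, he, hp, p1, p2, -, p4⟩ := tails N z hμ ψ hψ
    obtain ⟨q1, -, q3, q4⟩ := hp ψ hψ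
    obtain ⟨-, -, qp, qp'⟩ := hp _ (add_toC_mem_closed hψ Ω)
    have hw := (lip (hW.dBeta β) (fun ψ hψ s t hs ht => (hM ψ hψ s t hs ht).2) z hμ ψ hψ p4).trans
      (mul_le_mul_of_nonneg_left q1 hM0.le)
    have hwM := (hM ψ (closedStrip_mono hRρ.le hψ) z _ (par z hμ) p4).1
    rw [add_sub_cancel, dDir] at hwM
    have E0 := h.factor _ (hζ (small z hμ).1) ψ hψ
    rw [hrz, factorEq] at E0
    rw [mul_assoc, ← he, factorEq]
    have ps : ‖psum s N z‖ ≤ e * K + K := by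
      have := norm_add_le_of_le p1 p2
      rwa [sub_add_cancel] at this
    have pc : ‖fpsum c N z ψ‖ ≤ e * K + K := by
      have := norm_add_le_of_le q3 q4
      rwa [sub_add_cancel] at this
    have key := norm_sub_le_of_le (norm_mul_le_of_le (norm_sub_le_of_le (norm_sub_le_of_le
      (norm_sub_le_of_le two pc) hwM) ps) qp) (norm_mul_le_of_le qp'
      (norm_add_le_of_le (norm_add_le_of_le q3 hw) p1))
    refine le_trans (le_of_eq ?_) (key.trans ?_)
    · congr 1; linear_combination E0
    · have : 0 ≤ e * K * K * (1 - e) := by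
        have := sub_nonneg.2 e1; positivity
      nlinarith
  · have hz : ave (slice k (lift₁ v₀ + u)) = 0 := by
      ext i
      rw [ave_apply, slice_apply]
      split_ifs with h1 h2
      · rw [Wien.add_apply, ← hb.hol_v.ord0_lift hb.pos, ord0_apply, if_neg (by simp; omega), h1,
          ave_eq_zero_iff.1 h.ave_u]; simp
      all_goals rfl
    refine (congrArg ravg (funext fun x => hv k _ (hx x))).trans ?_
    rw [ravg_mul_left, ravg_ev z1, hz, ev_zero, mul_zero]
  · refine (hs.summable hr nσ).of_nonneg_of_le (fun k => by positivity) fun k => ?_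
    gcongr
    have : Nonempty (closedStrip n R) := ⟨⟨_, hx 0⟩⟩
    rw [stripNorm, ciSup_const]
  · refine (hl.summable hr nl).of_nonneg_of_le (fun k => by positivity) fun k => ?_
    gcongr
    have : Nonempty (closedStrip n R) := ⟨⟨_, hx 0⟩⟩
    rw [stripNorm, ciSup_const]
  · obtain ⟨z, rfl⟩ : ∃ z, μ = μ₀ + z := ⟨μ - μ₀, by ring⟩
    rw [add_sub_cancel_left] at hμ ⊢
    have e1 : ∀ ψ ∈ closedStrip n R, ∑' k, z ^ k * v k ψ = v₀ ψ + ev (z / r) ψ u := fun ψ hψ => by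
      rw [(hv.hasSum hr nv hμ.le hψ).tsum_eq, evV _ (hζ hμ) ψ hψ]
    have e2 : ∀ ψ ∈ closedStrip n R, ∑' k, z ^ k * c k ψ = ev (z / r) ψ g := fun ψ hψ =>
      (hc.hasSum hr h.fin_c hμ.le hψ).tsum_eq
    have e3 : ∑' k, z ^ k * s k = ev (z / r) 0 σ :=
      (hs.hasSum hr nσ hμ.le (hx 0)).tsum_eq.trans (ev_ave (hζ hμ) h.ave_σ)
    have e4 : ∑' k, z ^ k * l k = ev (z / r) 0 lam :=
      (hl.hasSum hr nl hμ.le (hx 0)).tsum_eq.trans (ev_ave (hζ hμ) h.ave_lam)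
    have E0 := h.equil _ (hζ hμ) ψ hψ
    have F0 := h.factor _ (hζ hμ) ψ hψ
    have hp := add_toC_mem_closed hψ Ω
    have hm := sub_toC_mem_closed hψ Ω
    rw [hrz] at E0 F0
    refine ⟨?_, ?_, ?_⟩
    · rw [e1 ψ hψ]
      exact hT.mem ψ (closedStrip_mono hRρ.le hψ) _ _ (by linarith)
        ((hu _ (hζ hμ) ψ hψ).le.trans (half_le_self hδ.le))
    · rw [FKRes.equil, e1 ψ hψ, e1 _ hp, e1 _ hm, e3, e4]; exact E0
    · rw [factorEq, e1 ψ hψ, e2 ψ hψ, e2 _ hp, e3]; exact F0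

end convergence

section main

variable {φ : Fn n}

theorem exists_glue (F : ∀ R, 0 < R ∧ R < ρ → ℕ → Fn n) (hF : ∀ R₁ h₁ R₂ h₂ k, R₁ ≤ R₂ → Set.EqOn
    (F R₁ h₁ k) (F R₂ h₂ k) (closedStrip n R₁)) (F₀ : Fn n)
    (h0 : ∀ R h, Set.EqOn F₀ (F R h 0) (closedStrip n R)) : ∃ G : ℕ → Fn n, G 0 = F₀ ∧ ∀ R h k, Set.EqOn
    (G k) (F R h k) (closedStrip n R) := by
  classical
  refine ⟨fun k ψ => if k = 0 then F₀ ψ else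
    if h : ∃ R, ∃ _ : 0 < R ∧ R < ρ, ψ ∈ closedStrip n R then F h.choose h.choose_spec.choose k ψ
    else 0, by simp, fun R h k ψ hψ => ?_⟩
  rcases eq_or_ne k 0 with rfl | hk
  · simpa using h0 R h hψ
  · have hex : ∃ R, ∃ _ : 0 < R ∧ R < ρ, ψ ∈ closedStrip n R := ⟨R, h, hψ⟩
    simp only [if_neg hk, dif_pos hex]
    rcases le_total hex.choose R with hle | hle
    · exact hF _ _ _ _ k hle hex.choose_spec.choose_spec
    · exact (hF _ _ _ _ k hle hψ).symm

theorem Formal.mono {v c : ℕ → Fn n} {s l : ℕ → ℂ} (hR : R' ≤ R)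
    (h : Formal Ω β η W μ₀ R v₀ σ₀ lam₀ c₀ v s l c) : Formal Ω β η W μ₀ R' v₀ σ₀ lam₀ c₀ v s l c :=
  { h with v_mem := fun k => (h.v_mem k).mono hR, c_mem := fun k => (h.c_mem k).mono hR }

/-- Convergent normalized expansions exist on each strip. -/
theorem Base.exists_loc (hS : SmallDiv Ω C p) (hb : Base Ω β η (W μ₀) ρ v₀ σ₀ c₀ χ φ)
    (hTr : Transversal Ω β η (W μ₀) ρ v₀ σ₀ c₀) (hW : AnalyticFamily 𝒟 W) (hD : ∀ ψ ∈ closedStrip n ρ,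
    (μ₀, hull β η ψ (v₀ ψ)) ∈ 𝒟) (hE : ∀ x, FKRes.equil Ω β η (W μ₀) v₀ σ₀ lam₀ (toC x) = 0)
    (hR : 0 < R ∧ R < ρ) : ∃ (v : ℕ → Fn n) (s l : ℕ → ℂ) (c : ℕ → Fn n), ∀ v' c',
    (∀ k, Set.EqOn (v' k) (v k) (closedStrip n R)) → (∀ k, Set.EqOn (c' k) (c k) (closedStrip n R)) → Loc Ω
    β η 𝒟 W μ₀ R v₀ σ₀ lam₀ c₀ v' s l c' := by
  obtain ⟨δ, M, hT, hT', hM⟩ := hW.exists_taylor hb.hol_v hD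
  obtain ⟨r, u, σ, lam, f, g, h⟩ := hb.exists_sol hS hTr hT hT' hE hR.1 hR.2
  exact ⟨fun k ψ => (r : ℂ)⁻¹ ^ k * ev 0 ψ (slice k (lift₁ v₀ + u)), _, _,
    fun k ψ => (r : ℂ)⁻¹ ^ k * ev 0 ψ (slice k g), fun v' c' hv hc =>
    h.loc hR.1 hR.2 hb hW hT hM (fun k ψ hψ => hv k hψ) (fun k ψ hψ => hc k hψ) (isSer_ave h.ave_σ)
      (isSer_ave h.ave_lam)⟩

theorem Base.exists_expansion (hS : SmallDiv Ω C p) (hb : Base Ω β η (W μ₀) ρ v₀ σ₀ c₀ χ φ)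
    (hTr : Transversal Ω β η (W μ₀) ρ v₀ σ₀ c₀) (hW : AnalyticFamily 𝒟 W) (hD : ∀ ψ ∈ closedStrip n ρ,
    (μ₀, hull β η ψ (v₀ ψ)) ∈ 𝒟) (hE : ∀ x, FKRes.equil Ω β η (W μ₀) v₀ σ₀ lam₀ (toC x) = 0) : ∃ v s l c, v
    0 = v₀ ∧ c 0 = c₀ ∧ ∀ R, 0 < R → R < ρ → Loc Ω β η 𝒟 W μ₀ R v₀ σ₀ lam₀ c₀ v s l c := by
  choose v s l c H using fun R (h : 0 < R ∧ R < ρ) => hb.exists_loc hS hTr hW hD hE h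
  have L := fun R h => H R h _ _ (fun _ => Set.eqOn_refl _ _) fun _ => Set.eqOn_refl _ _
  have hx := fun x : Vec n => hD _ (toC_mem hb.pos.le x)
  have agree : ∀ R₁ h₁ R₂ h₂, R₁ ≤ R₂ → ∀ k, _ := fun R₁ h₁ R₂ h₂ hle =>
    Formal.unique hS hb hTr hW hx h₁.1 h₁.2 ((L R₁ h₁).formal h₁.1) (((L R₂ h₂).formal h₂.1).mono hle)
  obtain ⟨V, V0, hV⟩ := exists_glue v (fun R₁ h₁ R₂ h₂ k hle => HolA.eq_on h₁.1
    ((L R₁ h₁).v_mem k) (((L R₂ h₂).v_mem k).mono hle) (agree R₁ h₁ R₂ h₂ hle k).1) v₀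
    fun R h ψ hψ => ((L R h).v_zero ψ hψ).symm
  obtain ⟨c', c0, hc⟩ := exists_glue c (fun R₁ h₁ R₂ h₂ k hle => HolA.eq_on h₁.1
    ((L R₁ h₁).c_mem k) (((L R₂ h₂).c_mem k).mono hle) (agree R₁ h₁ R₂ h₂ hle k).2.2.2) c₀
    fun R h ψ hψ => ((L R h).c_zero ψ hψ).symm
  have h2 : 0 < ρ / 2 ∧ ρ / 2 < ρ := ⟨half_pos hb.pos, half_lt_self hb.pos⟩
  refine ⟨V, s _ h2, l _ h2, c', V0, c0, fun R h h' => ?_⟩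
  have e : s R ⟨h, h'⟩ = s _ h2 ∧ l R ⟨h, h'⟩ = l _ h2 := by
    rcases le_total R (ρ / 2) with hle | hle
    · exact ⟨funext fun k => (agree _ ⟨h, h'⟩ _ h2 hle k).2.1,
        funext fun k => (agree _ ⟨h, h'⟩ _ h2 hle k).2.2.1⟩
    · exact ⟨funext fun k => (agree _ h2 _ ⟨h, h'⟩ hle k).2.1.symm,
        funext fun k => (agree _ h2 _ ⟨h, h'⟩ hle k).2.2.1.symm⟩
  rw [← e.1, ← e.2]
  exact H R ⟨h, h'⟩ _ _ (hV R _) (hc R _)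

theorem eqOn_openStrip_of_real (hρ : 0 < ρ) {f g : Fn n} (hf : ∀ R, 0 < R → R < ρ → HolA n R f)
    (hg : ∀ R, 0 < R → R < ρ → HolA n R g) (h : ∀ x, f (toC x) = g (toC x)) : Set.EqOn f g
    (openStrip n ρ) := fun ψ hψ => by
  obtain ⟨R, h0, hR, hm⟩ := exists_margin hρ hψ
  exact HolA.eq_on h0 (hf R h0 hR) (hg R h0 hR) h hm

theorem Base.expansionConverges {σ₀ lam₀ : ℝ} (hS : SmallDiv Ω C p) (hb : Base Ω β η (W μ₀) ρ v₀ σ₀ c₀ χ φ)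
    (hTr : Transversal Ω β η (W μ₀) ρ v₀ σ₀ c₀) (hW : AnalyticFamily 𝒟 W) (hv : InA n ρ v₀)
    (hc : InA n ρ c₀) (hD : ∀ ψ ∈ closedStrip n ρ, (μ₀, hull β η ψ (v₀ ψ)) ∈ 𝒟) (hE : ∀ x, FKRes.equil Ω β η
    (W μ₀) v₀ σ₀ lam₀ (toC x) = 0) : ExpansionConverges Ω β η 𝒟 W μ₀ ρ v₀ σ₀ lam₀ c₀ := by
  obtain ⟨v, s, l, c, v0, c0, L⟩ := hb.exists_expansion hS hTr hW hD hE
  have hρ := hb.pos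
  have h2 : 0 < ρ / 2 ∧ ρ / 2 < ρ := ⟨half_pos hρ, half_lt_self hρ⟩
  have hx := fun x : Vec n => hD _ (toC_mem hρ.le x)
  have L2 := L _ h2.1 h2.2
  have N : NormalizedExpansion Ω β η W μ₀ ρ v₀ σ₀ lam₀ c₀ v s l c :=
    ⟨v0, L2.σ_zero, L2.lam_zero, c0, fun k R h h' => (L R h h').v_mem k,
      fun k R h h' => (L R h h').c_mem k, fun N R h h' => (L R h h').equil N,
      fun N R h h' => (L R h h').factor N, L2.v_avg, L2.c_avg⟩
  refine ⟨v, s, l, c, N, fun v' s' l' c' h k => ?_, fun R h h' => (L R h h').conv,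
    fun ⟨hμ, hr⟩ k => ?_, fun hs => ?_⟩
  · obtain ⟨e1, e2, e3, e4⟩ := Formal.unique hS hb hTr hW hx h2.1 h2.2 (h.formal h2.1 h2.2)
      (L2.formal h2.1) k
    exact ⟨eqOn_openStrip_of_real hρ (h.v_mem k) (N.v_mem k) e1, e2, e3,
      eqOn_openStrip_of_real hρ (h.c_mem k) (N.c_mem k) e4⟩
  · simpa only [mem_reSubring] using Formal.real hS hb hTr hW hx h2.1 h2.2 (L2.formal h2.1) (fun t x h => mem_reSubring.2 (hr t x h))
      (mem_reSubring.2 hμ) (fun x => mem_reSubring.2 (hv.real_of_real x))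
      (fun x => mem_reSubring.2 (hc.real_of_real x)) (mem_reSubring.2 (Complex.ofReal_im _))
      (mem_reSubring.2 (Complex.ofReal_im _)) k
  · obtain rfl : s = fun _ => 0 := funext hs
    refine ⟨⟨v0, N.lam_zero, N.v_mem, N.equil, N.v_avg⟩, fun v' l' h k => ?_⟩
    obtain ⟨e1, e2⟩ := ResEquil.unique hS hb hW hx h2.1 (h.equil.res hρ) (N.equil.res hρ)
      (fun k => h.v_mem k _ h2.1 h2.2) L2.v_mem N.σ_zero (fun x => by rw [h.v_zero])
      (fun x => by rw [v0]) (by rw [h.lam_zero, N.lam_zero]) h.v_avg N.v_avg k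
    exact ⟨eqOn_openStrip_of_real hρ (h.v_mem k) (N.v_mem k) e1, e2⟩

end main

section lindstedt

theorem dBeta_zero : dBeta β (fun _ => 0) = fun _ => 0 := funext fun _ => by simp [dBeta, lineDeriv]

theorem inA_const (ρ x : ℝ) : InA n ρ fun _ => (x : ℂ) where
  toHolA := HolA.const _
  real_of_real _ := Complex.ofReal_im x

theorem factorizes_zero : Factorizes Ω β η (fun _ => 0) ρ (fun _ => 0) 0 (fun _ => (1 : ℝ))
    (fun _ => (1 : ℝ)) (fun _ => (1 : ℝ)) fun _ => (1 : ℝ) where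
  mem_a := inA_const ρ 1
  mem_b := inA_const ρ 1
  mem_c := inA_const ρ 1
  mem_d := inA_const ρ 1
  eq u _ ψ _ := by
    simp only [linEquil, dBeta_zero, opPlus, opMinus, Complex.ofReal_one, add_sub_cancel_right]
    ring

theorem transversal_zero : Transversal Ω β η (fun _ => 0) ρ (fun _ => 0) 0 fun _ => 1 := by
  intro R B q D hR _ _ hq _ _ h
  have hp := hq.per hR.le
  have h1 : (fun x : Vec n => q (toC (x + Ω)) - q (toC x)) = fun _ => 1 := funext fun x => by
    have := h _ (toC_mem hR.le x)
    simp only [linFactor, dBeta_zero] at this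
    rw [toC_add]
    linear_combination this
  have h2 := congrArg ravg h1
  rw [ravg_sub (hp.shift Ω).cont hp.cont, ravg_shift hp Ω, sub_self, ravg_const] at h2
  exact absurd h2 zero_ne_one

end lindstedt

end FKRes

end

theorem theorem5p3 (n : ℕ) (hn : 1 ≤ n) (Ω : Fin n → ℝ) (κ τ : ℝ) (hκ : 0 < κ) (hτ : 0 < τ)
    (hΩ : FKRes.IsDiophantine κ τ Ω) (β : Fin (n + 1) → ℝ) (η : ℝ) (ρ : ℝ) (hρ : 0 < ρ) :
    (∀ (𝒟 : Set (ℂ × (Fin (n + 1) → ℂ))) (W : ℂ → (Fin (n + 1) → ℂ) → ℂ) (μ₀ : ℂ)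
      (v0 : (Fin n → ℂ) → ℂ) (σ0 lam0 : ℝ) (a b c d : (Fin n → ℂ) → ℂ),
      FKRes.AnalyticFamily 𝒟 W →
      FKRes.InA n ρ v0 →
      (∀ ψ ∈ FKRes.closedStrip n ρ, (μ₀, FKRes.hull β η ψ (v0 ψ)) ∈ 𝒟) →
      (∀ ψ ∈ FKRes.closedStrip n ρ, FKRes.equil Ω β η (W μ₀) v0 σ0 lam0 ψ = 0) →
      FKRes.Factorizes Ω β η (W μ₀) ρ v0 σ0 a b c d →
      FKRes.Transversal Ω β η (W μ₀) ρ v0 σ0 (fun ψ => b ψ * c ψ) →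
      FKRes.ExpansionConverges Ω β η 𝒟 W μ₀ ρ v0 σ0 lam0 (fun ψ => b ψ * c ψ)) ∧
    (∀ (𝒰 : Set (Fin (n + 1) → ℂ)) (U : (Fin (n + 1) → ℂ) → ℂ),
      IsOpen 𝒰 → AnalyticOnNhd ℂ U 𝒰 →
      (∀ x ∈ 𝒰, ∀ m : Fin (n + 1) → ℤ,
        x + FKRes.intPt m ∈ 𝒰 ∧ U (x + FKRes.intPt m) = U x) →
      (∀ ψ ∈ FKRes.closedStrip n ρ, FKRes.hull β η ψ 0 ∈ 𝒰) →
      FKRes.ExpansionConverges Ω β η (Set.univ ×ˢ 𝒰) (fun μ x => μ * U x) 0 ρ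
        (fun _ => 0) 0 0 (fun _ => 1)) := by
  obtain ⟨C, p, -, hS⟩ := FKRes.IsDiophantine.smallDiv hκ hΩ
  have main : ∀ (𝒟 : Set (ℂ × (Fin (n + 1) → ℂ))) (W : ℂ → (Fin (n + 1) → ℂ) → ℂ) (μ₀ : ℂ)
      (v0 : (Fin n → ℂ) → ℂ) (σ0 lam0 : ℝ) (a b c d : (Fin n → ℂ) → ℂ),
      FKRes.AnalyticFamily 𝒟 W →
      FKRes.InA n ρ v0 →
      (∀ ψ ∈ FKRes.closedStrip n ρ, (μ₀, FKRes.hull β η ψ (v0 ψ)) ∈ 𝒟) →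
      (∀ ψ ∈ FKRes.closedStrip n ρ, FKRes.equil Ω β η (W μ₀) v0 σ0 lam0 ψ = 0) →
      FKRes.Factorizes Ω β η (W μ₀) ρ v0 σ0 a b c d →
      FKRes.Transversal Ω β η (W μ₀) ρ v0 σ0 (fun ψ => b ψ * c ψ) →
      FKRes.ExpansionConverges Ω β η 𝒟 W μ₀ ρ v0 σ0 lam0 (fun ψ => b ψ * c ψ) :=
    fun 𝒟 W μ₀ v0 σ0 lam0 a b c d hW hv hD hE hF hT => by
    obtain ⟨hc, χ, φ, hb⟩ := hF.exists_base hn hS hρ hW hv.toHolA hD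
    exact hb.expansionConverges hS hT hW hv hc hD fun x => hE _ (FKRes.toC_mem hρ.le x)
  refine ⟨main, fun 𝒰 U hO hU hP h𝒰 => ?_⟩
  have h0 : (fun x => 0 * U x) = fun _ => 0 := funext fun x => zero_mul _
  have h1 : (fun _ : Fin n → ℂ => ((1 : ℝ) : ℂ) * ((1 : ℝ) : ℂ)) = fun _ => 1 := by simp
  rw [← h1]
  refine main _ _ 0 (fun _ => 0) 0 0 (fun _ => (1 : ℝ)) _ _ (fun _ => (1 : ℝ)) ⟨isOpen_univ.prod hO,
    analyticOnNhd_fst.mul ((hU.comp analyticOnNhd_snd fun p hp => hp.2)), fun μ x hx m =>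
    ⟨⟨trivial, (hP x hx.2 m).1⟩, congrArg (μ * ·) (hP x hx.2 m).2⟩⟩ ?_ (fun ψ hψ => ⟨trivial, h𝒰 ψ hψ⟩)
    ?_ ?_ ?_
  · simpa using FKRes.inA_const (n := n) ρ 0
  · intro ψ _
    simp [FKRes.equil]
  · simpa only [h0, Complex.ofReal_zero] using FKRes.factorizes_zero (n := n)
  · simpa only [h0, h1, Complex.ofReal_zero] using FKRes.transversal_zero (n := n)
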